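/- Let $k$ be a field of characteristic $0$. Let $A$ be a finite-dimensional $\mathbb Z/2$-graded associative $k$-algebra (not necessarily unital) with an odd differentiation $d$, $d^2=0$, and an odd scalar product $\beta$ (nondegenerate, symmetric in the super sense) with $\beta(da,b)+(-1)^{\bar a}\beta(a,db)=0$, such that the three-tensor $m(\pi a,\pi b,\pi c)=(-1)^{\bar b}\beta(ab,c)$ on $\Pi A$ is cyclically invariant. Let $H$ be an odd selfadjoint operator on $A$, $\beta(Ha,b)=(-1)^{\bar a}\beta(a,Hb)$, such that $P=\mathrm{Id}-[d,H]$, with $[d,H]=dH+Hd$, is idempotent. For a trivalent ribbon graph $\Gamma$ with labelled legs, let $W_\Gamma$ be the contraction of the tensors $m$ at the vertices with the propagators $\beta_H^\vee=-\sum_{i,j}\beta^{\vee}_{ij}\,\pi He_i\otimes\pi e_j$ on the edges and with elements of $\Pi(\operatorname{im}P)$ on the legs, with Koszul signs; here $(\beta^\vee_{ij})$ is the inverse of the Gram matrix of $\beta$ in a homogeneous basis $(e_i)$. These contractions are well defined because $\dim A<\infty$. Let $B$ be a $\mathbb Z/2$-graded cyclic $A_\infty$-algebra with odd scalar product, with odd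 operations $b_n:(\Pi B)^{\otimes n}\to\Pi B$, $n\ge1$, and cyclic tensors $\omega(b_n(x_0,\dots,x_{n-1}),x_n)$, where $\omega(\pi a,\pi c)=(-1)^{\bar c+1}\beta(a,c)$. Suppose that $B$ is obtained from $A$ and $H$ via the summation over trees: $B$ with its scalar product is identified with $\operatorname{im}P$, $b_1$ is the restriction of $d$, and for $n\ge2$ the cyclic tensor of $b_n$ is the sum of $W_\Gamma$ over isomorphism classes of trivalent ribbon trees $\Gamma$ with $n+1$ legs labelled compatibly with the cyclic order. Let $S_{0,2}=\omega(b_1\,\cdot,\cdot)$ be the quadratic term of the differential, and put $$S=S_{0,2}+\sum_{\Gamma}\hbar^{1-\chi(\Sigma_\Gamma)}W_\Gamma ,$$ the sum being over isomorphism classes of connected trivalent ribbon graphs such that every boundary component of the surface $\Sigma_\Gamma$ carries at least one leg. Then $S=\sum_{i\ge1,\,g\ge0}\hbar^{2g+i-1}S_{i,g}$ with $S_{i,g}$ even elements of the dual of $Symm^i\bigl(\bigoplus_{j\ge1}((\Pi B)^{\otimes j})^{\mathbb Z/j}\bigr)$; the component $S_{1,0}$ is the tensor of the cyclic $A_\infty$-algebra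 $B$; and $S$ is a solution of the noncommutative Batalin–Vilkovisky equation $$\hbar\Delta S+\tfrac12\{S,S\}=0 .$$ Here $\Delta$ contracts with $\beta^\vee$ each unordered pair of letters in a product of cyclic words: for functionals on cyclic words, two letters $f,f'$ in one word $(f\,u\,f'\,v)$ with $u,v$ nonempty are contracted, giving the value on the product $(u)(v)$, and two letters in different words $(f\,u)(f'\,v)$ with $uv$ nonempty are contracted, giving the value on $(u\,v)$; the bracket $\{\cdot,\cdot\}$ is given by the contractions of the second kind between letters of its two arguments. -/

import Mathlib

noncomputable section

namespace NCBV

/-! ## Signs and super vector spaces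

A `ℤ/2`-graded vector space is a module with a grading `𝒜 : ZMod 2 → Submodule k A`.  The parity
change `Π A` is the same module; an element of `𝒜 p` has parity `p + 1` in `Π A`. -/

/-- `(-1)^p`. -/
def sgn (k : Type*) [Ring k] (p : ZMod 2) : k := if p = 0 then 1 else -1

/-- The Koszul sign of reordering a tensor product of homogeneous factors of parities `q`, indexed
by the finite set `F`, from the order given by the injective rank `r` to the order given by the
injective rank `s`: a factor `-1` for every pair of odd factors that gets interchanged. -/
def koszulSign (k : Type*) [CommRing k] {F : Type*} [Fintype F] (r s : F → ℕ) (q : F → ZMod 2) : k :=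
  ∏ x : F × F, if r x.1 < r x.2 ∧ s x.2 < s x.1 then sgn k (q x.1 * q x.2) else 1

section Super

variable {k A : Type*} [Field k] [AddCommGroup A] [Module k A] (𝒜 : ZMod 2 → Submodule k A)

/-- Index set of a homogeneous basis; `i.1` is the parity of the basis vector `i`. -/
abbrev HomIdx : Type := Σ i : ZMod 2, Fin (Module.finrank k (𝒜 i))

/-- A homogeneous basis of a finite-dimensional super vector space. -/
def homBasis [DirectSum.Decomposition 𝒜] [FiniteDimensional k A] :
    Module.Basis (HomIdx 𝒜) k A :=
  (DirectSum.Decomposition.isInternal 𝒜).collectedBasis fun i => Module.finBasis k (𝒜 i)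

theorem homBasis_mem [DirectSum.Decomposition 𝒜] [FiniteDimensional k A] (i : HomIdx 𝒜) :
    homBasis 𝒜 i ∈ 𝒜 i.1 :=
  (DirectSum.Decomposition.isInternal 𝒜).collectedBasis_mem _ i

/-- An odd scalar product: a nondegenerate bilinear form that pairs even with odd vectors and is
symmetric in the super sense. -/
structure IsOddScalarProduct (β : LinearMap.BilinForm k A) : Prop where
  odd : ∀ i a b, a ∈ 𝒜 i → b ∈ 𝒜 i → β a b = 0
  symm : ∀ i j a b, a ∈ 𝒜 i → b ∈ 𝒜 j → β a b = sgn k (i * j) * β b a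
  nondegenerate : β.Nondegenerate

/-- The coefficients of the inverse tensor `β^∨ = ∑ β^∨_{ij} (π e_i) ⊗ (π e_j)` of a scalar product
in the homogeneous basis. -/
def inverseTensor [DirectSum.Decomposition 𝒜] [FiniteDimensional k A]
    (β : LinearMap.BilinForm k A) : Matrix (HomIdx 𝒜) (HomIdx 𝒜) k :=
  (Matrix.of fun i j => β (homBasis 𝒜 i) (homBasis 𝒜 j))⁻¹

end Super

/-! ## Cyclic `A∞`-algebras -/

section AInfinity

variable {k B : Type*} [Field k] [AddCommGroup B] [Module k B]

/-- The cyclic tensor `m(π x_0, …, π x_n) = ω(b_n(π x_0, …, π x_{n-1}), π x_n)` of an operation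
`b_n : (Π B)^{⊗ n} → Π B`, with `ω(π a, π c) = (-1)^{c + 1} β(a, c)`, on homogeneous arguments
`x_i` of parities `p i` in `B`. -/
def cyclicTensor (β : LinearMap.BilinForm k B) {n : ℕ} (op : MultilinearMap k (fun _ : Fin n => B) B)
    (p : Fin (n + 1) → ZMod 2) (x : Fin (n + 1) → B) : k :=
  sgn k (p (Fin.last n) + 1) * β (op fun i => x i.castSucc) (x (Fin.last n))

/-- A `ℤ/2`-graded cyclic `A∞`-algebra with odd scalar product.  The operations
`op n : (Π B)^{⊗ n} → Π B` are odd, vanish for `n = 0`, satisfy the Stasheff identities, and give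
cyclically invariant tensors on `Π B`. -/
structure CyclicAInfinity (ℬ : ZMod 2 → Submodule k B) where
  op : ∀ n : ℕ, MultilinearMap k (fun _ : Fin n => B) B
  form : LinearMap.BilinForm k B
  op_zero : op 0 = 0
  op_mem : ∀ (n : ℕ) (p : Fin n → ZMod 2) (x : Fin n → B), (∀ i, x i ∈ ℬ (p i)) →
    op n x ∈ ℬ (∑ i, (p i + 1))
  stasheff : ∀ (n : ℕ) (p : ℕ → ZMod 2) (x : ℕ → B), (∀ i, x i ∈ ℬ (p i)) →
    ∑ s ∈ Finset.Icc 1 n, ∑ r ∈ Finset.range (n - s + 1),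
      sgn k (∑ i ∈ Finset.range r, (p i + 1)) •
        op (n - s + 1) (fun i => if (i : ℕ) < r then x i
          else if (i : ℕ) = r then op s (fun j => x (r + j)) else x (i + s - 1)) = 0
  form_odd : IsOddScalarProduct ℬ form
  cyclic : ∀ (n : ℕ) (p : Fin (n + 1) → ZMod 2) (x : Fin (n + 1) → B), (∀ i, x i ∈ ℬ (p i)) →
    cyclicTensor form (op n) p x =
      sgn k ((p (Fin.last n) + 1) * ∑ i : Fin n, (p i.castSucc + 1)) *
        cyclicTensor form (op n) (p ∘ (finRotate (n + 1)).symm) (x ∘ (finRotate (n + 1)).symm)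

end AInfinity

/-! ## Ribbon graphs -/

/-- Given a permutation `φ` of a finite set (thought of as walking along the boundary circles of a
surface) and marked points `leg l` in it, `IsBoundary φ leg σ` says that every cycle of `φ` contains
a marked point and that `σ` is the first-return permutation: `leg (σ l)` is the first marked point
reached after `leg l`.  So `σ` records the boundary circles, all of them carrying
marked points, and the cyclic orders of the marked points on them. -/
def IsBoundary {F : Type*} {n : ℕ} (φ : Equiv.Perm F) (leg : Fin n → F)
    (σ : Equiv.Perm (Fin n)) : Prop :=
  (∀ l, ∃ t : ℕ, (φ ^ (t + 1)) (leg l) = leg (σ l) ∧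
    ∀ s < t, ∀ l', (φ ^ (s + 1)) (leg l) ≠ leg l') ∧
  ∀ f, ∃ (t : ℕ) (l : Fin n), (φ ^ t) f = leg l

/-- A trivalent ribbon graph with `n` labelled legs.  The flags are the pairs (vertex, position),
the cyclic order at a vertex is `0 → 1 → 2 → 0`, and every flag is either one of the two halves of
an edge or a leg. Graphs are considered up to the equivalence `RibbonGraph.Iso` below. -/
structure RibbonGraph (n : ℕ) where
  numVert : ℕ
  numEdge : ℕ
  flagEquiv : (Fin numEdge × Fin 2) ⊕ Fin n ≃ Fin numVert × Fin 3

namespace RibbonGraph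

variable {n : ℕ} (Γ : RibbonGraph n)

abbrev Flag : Type := Fin Γ.numVert × Fin 3

def leg (l : Fin n) : Γ.Flag := Γ.flagEquiv (Sum.inr l)

/-- The cyclic orders at the vertices. -/
def rot : Equiv.Perm Γ.Flag := Equiv.prodCongr (Equiv.refl _) (finRotate 3)

/-- The involution interchanging the two flags of every edge and fixing the legs. -/
def inv : Equiv.Perm Γ.Flag :=
  (Γ.flagEquiv.symm.trans
    (Equiv.sumCongr (Equiv.prodCongr (Equiv.refl _) (Equiv.swap 0 1)) (Equiv.refl _))).trans
    Γ.flagEquiv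

/-- The permutation of flags whose cycles are the boundary components of the surface `Σ_Γ`. -/
def face : Equiv.Perm Γ.Flag := Γ.rot * Γ.inv

/-- The graph is nonempty and connected. -/
def Connected : Prop :=
  Nonempty Γ.Flag ∧
    ∀ f g : Γ.Flag, ∃ w ∈ Subgroup.closure ({Γ.rot, Γ.inv} : Set (Equiv.Perm Γ.Flag)), w f = g

/-- The Euler characteristic `χ(Σ_Γ) = |Vert Γ| - |Edge Γ|`. -/
def chi : ℤ := (Γ.numVert : ℤ) - Γ.numEdge

def IsTree : Prop := Γ.Connected ∧ Γ.numVert = Γ.numEdge + 1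

/-- `σ` describes the distribution of the legs on the boundary components of `Σ_Γ`, and every
boundary component carries a leg. -/
def HasBoundary (σ : Equiv.Perm (Fin n)) : Prop := IsBoundary Γ.face Γ.leg σ

/-- Isomorphism of ribbon graphs with labelled legs. -/
def Iso (Γ Γ' : RibbonGraph n) : Prop :=
  ∃ τ : Γ.Flag ≃ Γ'.Flag, (∀ f, τ (Γ.rot f) = Γ'.rot (τ f)) ∧ (∀ f, τ (Γ.inv f) = Γ'.inv (τ f)) ∧
    ∀ l, τ (Γ.leg l) = Γ'.leg l

instance isoSetoid (n : ℕ) : Setoid (RibbonGraph n) where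
  r := Iso
  iseqv :=
    { refl := fun _ => ⟨Equiv.refl _, fun _ => rfl, fun _ => rfl, fun _ => rfl⟩
      symm := by
        rintro Γ Γ' ⟨τ, h1, h2, h3⟩
        refine ⟨τ.symm, fun f => ?_, fun f => ?_, fun l => ?_⟩
        · rw [Equiv.symm_apply_eq, h1, Equiv.apply_symm_apply]
        · rw [Equiv.symm_apply_eq, h2, Equiv.apply_symm_apply]
        · rw [Equiv.symm_apply_eq, h3]
      trans := by
        rintro Γ Γ' Γ'' ⟨τ, h1, h2, h3⟩ ⟨τ', h1', h2', h3'⟩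
        refine ⟨τ.trans τ', fun f => ?_, fun f => ?_, fun l => ?_⟩
        · simp [h1, h1']
        · simp [h2, h2']
        · simp [h3, h3'] }

/-- The order of the flags in `⊗_v (Π A)^{⊗ Flag(v)}`. -/
def vertRank (f : Γ.Flag) : ℕ := 3 * f.1 + f.2

/-- The order of the flags in `⊗_e (Π A)^{⊗ e} ⊗ ⊗_l Π A`. -/
def edgeRank (f : Γ.Flag) : ℕ :=
  match Γ.flagEquiv.symm f with
  | Sum.inl (e, s) => 2 * e + s
  | Sum.inr l => 2 * Γ.numEdge + l

end RibbonGraph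

/-- Isomorphism classes of trivalent ribbon graphs with `n` labelled legs. -/
abbrev RibbonClass (n : ℕ) : Type := Quotient (RibbonGraph.isoSetoid n)

/-! ## Cyclic dg associative algebras, homotopies, and contractions over ribbon graphs -/

section Contraction

variable {k A : Type*} [Field k] [NonUnitalRing A] [Module k A]

/-- The (even) three-tensor `m(π a, π b, π c) = (-1)^b β(ab, c)`, where `b` has parity `j`. -/
def threeTensor (β : LinearMap.BilinForm k A) (j : ZMod 2) (a b c : A) : k :=
  sgn k j * β (a * b) c

/-- A cyclic `d(ℤ/2)g` associative algebra with odd scalar product: the multiplication is even and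
associative, `d` is an odd differentiation of square zero, the three-tensor is cyclically invariant
and the scalar product is preserved by `d`. -/
structure CyclicDGAlgebra (𝒜 : ZMod 2 → Submodule k A) where
  d : A →ₗ[k] A
  form : LinearMap.BilinForm k A
  mul_mem : ∀ i j a b, a ∈ 𝒜 i → b ∈ 𝒜 j → a * b ∈ 𝒜 (i + j)
  d_mem : ∀ i a, a ∈ 𝒜 i → d a ∈ 𝒜 (i + 1)
  leibniz : ∀ i a b, a ∈ 𝒜 i → d (a * b) = d a * b + sgn k i • (a * d b)
  d_sq : ∀ a, d (d a) = 0
  form_odd : IsOddScalarProduct 𝒜 form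
  cyclic : ∀ i j l a b c, a ∈ 𝒜 i → b ∈ 𝒜 j → c ∈ 𝒜 l →
    threeTensor form j a b c = sgn k ((l + 1) * (i + j)) * threeTensor form i c a b
  form_d : ∀ i a b, a ∈ 𝒜 i → form (d a) b + sgn k i * form a (d b) = 0

variable {𝒜 : ZMod 2 → Submodule k A}

/-- An odd selfadjoint operator `H` such that `P = Id - [d, H]` is idempotent, `[d, H]` being the
supercommutator `d H + H d` of odd operators. -/
structure Homotopy (M : CyclicDGAlgebra 𝒜) where
  H : A →ₗ[k] A
  P : A →ₗ[k] A
  H_mem : ∀ i a, a ∈ 𝒜 i → H a ∈ 𝒜 (i + 1)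
  H_selfadjoint : ∀ i a b, a ∈ 𝒜 i → M.form (H a) b = sgn k i * M.form a (H b)
  P_eq : ∀ a, P a = a - (M.d (H a) + H (M.d a))
  P_idem : ∀ a, P (P a) = P a

variable [DirectSum.Decomposition 𝒜] [FiniteDimensional k A]

/-- The coefficients of the (even, symmetric in the super sense) propagator
`β_H^∨ = -∑_{i,j} β^∨_{ij} (π H e_i) ⊗ (π e_j)`. -/
def propagator {M : CyclicDGAlgebra 𝒜} (h : Homotopy M) : Matrix (HomIdx 𝒜) (HomIdx 𝒜) k :=
  -(LinearMap.toMatrix (homBasis 𝒜) (homBasis 𝒜) h.H * inverseTensor 𝒜 M.form)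

/-- The contraction `⟨⊗_v m^v, (⊗_e β_H^{∨,e}) ⊗ ⊗_l a_l⟩`, as a multilinear function of the
elements `a_l` attached to the legs.  The sum is over all labellings of the flags by basis vectors;
the sign is the Koszul sign between the order of the flags by vertices and the order by edges and
legs. -/
def contraction {M : CyclicDGAlgebra 𝒜} (h : Homotopy M) {n : ℕ} (Γ : RibbonGraph n) :
    MultilinearMap k (fun _ : Fin n => A) k :=
  ∑ φ : Γ.Flag → HomIdx 𝒜,
    (koszulSign k Γ.vertRank Γ.edgeRank (fun f => (φ f).1 + 1) *
      (∏ v : Fin Γ.numVert, threeTensor M.form (φ (v, 1)).1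
        (homBasis 𝒜 (φ (v, 0))) (homBasis 𝒜 (φ (v, 1))) (homBasis 𝒜 (φ (v, 2)))) *
      ∏ e : Fin Γ.numEdge, propagator h
        (φ (Γ.flagEquiv (Sum.inl (e, 0)))) (φ (Γ.flagEquiv (Sum.inl (e, 1))))) •
    (MultilinearMap.mkPiAlgebra k (Fin n) k).compLinearMap
      fun l => (homBasis 𝒜).coord (φ (Γ.leg l))

/-- The sum of the contractions over the isomorphism classes of trivalent ribbon trees whose legs
are placed on the boundary circle in the way described by `σ`. -/
def treeSum {M : CyclicDGAlgebra 𝒜} (h : Homotopy M) (n : ℕ) (σ : Equiv.Perm (Fin n)) :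
    MultilinearMap k (fun _ : Fin n => A) k :=
  ∑ᶠ (c : RibbonClass n) (_ : c.out.IsTree ∧ c.out.HasBoundary σ), contraction h c.out

/-- The sum of the contractions over the isomorphism classes of connected trivalent ribbon graphs
with a leg on every boundary component, with `1 - χ(Σ_Γ) = b`, and with legs distributed over the
boundary components as described by `σ`. -/
def ribbonSum {M : CyclicDGAlgebra 𝒜} (h : Homotopy M) (n : ℕ) (σ : Equiv.Perm (Fin n)) (b : ℕ) :
    MultilinearMap k (fun _ : Fin n => A) k :=
  ∑ᶠ (c : RibbonClass n) (_ : c.out.Connected ∧ c.out.HasBoundary σ ∧ 1 - c.out.chi = b),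
    contraction h c.out

end Contraction

/-! ## The noncommutative Batalin-Vilkovisky equation -/

section BV

variable {k B : Type*} [Field k] [AddCommGroup B] [Module k B]

variable (k B) in
/-- Formal series in `ħ` with values in symmetric products of cyclic words.  The value of `T` at
`n`, `σ`, `b` is the coefficient of `ħ^b`, evaluated on the following product of cyclic words in
`n` letters `x_0, …, x_{n-1}` of `Π B`: one cyclic word for each cycle of `σ` (fixed points
included), formed by the letters `x_l, x_{σ l}, x_{σ (σ l)}, …`.  An element of the dual of
`Symm(⊕_{j ≥ 1} ((Π B)^{⊗ j})^{ℤ/j})` is the same as such a family, for fixed `b`, that is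
compatible with relabelling the letters, see `IsSymmetric`. -/
abbrev Series : Type _ :=
  ∀ n : ℕ, Equiv.Perm (Fin n) → ℕ → MultilinearMap k (fun _ : Fin n => B) k

/-- Invariance under relabelling the letters, with the Koszul sign.  In particular the functionals
are invariant under cyclic permutations in every word and symmetric in the words. -/
def IsSymmetric (ℬ : ZMod 2 → Submodule k B) (T : Series k B) : Prop :=
  ∀ (n : ℕ) (σ τ : Equiv.Perm (Fin n)) (b : ℕ) (p : Fin n → ZMod 2) (x : Fin n → B),
    (∀ i, x i ∈ ℬ (p i)) →
    T n (τ * σ * τ⁻¹) b (x ∘ ⇑τ⁻¹) =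
      koszulSign k (fun i : Fin n => (i : ℕ)) (fun i => (τ i : ℕ)) (fun i => p i + 1) * T n σ b x

/-- The functionals are even on `Π B`. -/
def IsEven (ℬ : ZMod 2 → Submodule k B) (T : Series k B) : Prop :=
  ∀ (n : ℕ) (σ : Equiv.Perm (Fin n)) (b : ℕ) (p : Fin n → ZMod 2) (x : Fin n → B),
    (∀ i, x i ∈ ℬ (p i)) → ∑ i, (p i + 1) ≠ 0 → T n σ b x = 0

/-- The number of cycles of `σ`, fixed points included. -/
def numCycles {n : ℕ} (σ : Equiv.Perm (Fin n)) : ℕ :=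
  Nat.card (Quotient (Equiv.Perm.SameCycle.setoid σ))

/-- `T = ∑_{i ≥ 1, g ≥ 0} ħ^{2g+i-1} T_{i,g}` with `T_{i,g}` a functional on products of `i` cyclic
words. -/
def HasGenusExpansion (T : Series k B) : Prop :=
  ∀ (n : ℕ) (σ : Equiv.Perm (Fin n)) (b : ℕ), T n σ b ≠ 0 →
    0 < n ∧ ∃ g : ℕ, b + 1 = 2 * g + numCycles σ

/-- Multiplication by `ħ`. -/
def hbarMul (T : Series k B) : Series k B := fun n σ b =>
  match b with
  | 0 => 0
  | b + 1 => T n σ b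

/-- `Glues σ' σ`: take `n + 2` points `f = 0`, `f' = 1`, `2, …, n + 1` lying on circles as described
by `σ'`, and glue a strip joining `f` to `f'`.  Then each circle of the resulting boundary contains
at least one of the `n` remaining points, which lie on it as described by `σ`.  In cyclic words:
`(f u f' v)` becomes `(u)(v)`, where `u`, `v` must be nonempty, that is, `f` and `f'` are not
neighbours; and `(f u)(f' v)` becomes `(u v)`, where `u v` must be nonempty. -/
def Glues {n : ℕ} (σ' : Equiv.Perm (Fin (n + 2))) (σ : Equiv.Perm (Fin n)) : Prop :=
  IsBoundary (σ' * Equiv.swap 0 1) (fun l : Fin n => l.succ.succ) σ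

section Operators

variable (ℬ : ZMod 2 → Submodule k B) [DirectSum.Decomposition ℬ] [FiniteDimensional k B]
  (β : LinearMap.BilinForm k B)

open Classical in
/-- The noncommutative Batalin-Vilkovisky operator: two letters, in the same or in different words,
are contracted with `β^∨` and the words are dissected and glued.  Each unordered pair of letters is
counted twice, which accounts for the factor `1/2`. -/
def bvLaplacian (T : Series k B) : Series k B := fun n σ b =>
  (1 / 2 : k) • ∑ i : HomIdx ℬ, ∑ j : HomIdx ℬ, inverseTensor ℬ β i j •
    ∑ σ' : Equiv.Perm (Fin (n + 2)),
      if Glues σ' σ then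
        ((T (n + 2) σ' b).curryLeft (homBasis ℬ i)).curryLeft (homBasis ℬ j)
      else 0

/-- The restriction of a permutation of `Fin N` to a stable subset `I`, whose elements are numbered
in increasing order. -/
def restrictPerm {N : ℕ} (σ : Equiv.Perm (Fin N)) (I : Finset (Fin N)) (hI : ∀ a, σ a ∈ I ↔ a ∈ I) :
    Equiv.Perm (Fin I.card) :=
  (I.orderIsoOfFin rfl).toEquiv.symm.permCongr (σ.subtypePerm hI)

/-- The restriction of a word of `N` letters to the positions in `I`. -/
def restrictWord {N : ℕ} {X : Type*} (y : Fin N → X) (I : Finset (Fin N)) : Fin I.card → X :=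
  fun a => y (I.orderEmbOfFin rfl a)

open Classical in
/-- The odd bracket `{T, T'}` of even series, on homogeneous letters `x_i` of parities `p i` in `B`:
a letter of `T` and a letter of `T'` are contracted with `β^∨` and the two words containing them are
glued.  Here `f = 0` and `f' = 1` are the contracted letters, `I ∋ f` is the set of letters of the
words to which `T` is applied and the complement of `I` the set of letters of those to which `T'` is
applied; the sign is the Koszul sign of moving the letters in `I` in front of the others. -/
def bvBracket (T T' : Series k B) (n : ℕ) (σ : Equiv.Perm (Fin n)) (b : ℕ)
    (p : Fin n → ZMod 2) (x : Fin n → B) : k :=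
  ∑ i : HomIdx ℬ, ∑ j : HomIdx ℬ, inverseTensor ℬ β i j *
    ∑ σ' : Equiv.Perm (Fin (n + 2)), if Glues σ' σ then
      ∑ I : Finset (Fin (n + 2)),
        if h : (∀ a, σ' a ∈ I ↔ a ∈ I) ∧ (∀ a, σ' a ∈ Iᶜ ↔ a ∈ Iᶜ) ∧ 0 ∈ I ∧ 1 ∉ I then
          koszulSign k (fun a : Fin (n + 2) => (a : ℕ))
            (fun a => if a ∈ I then (a : ℕ) else a + (n + 2))
            (Fin.cons (i.1 + 1) (Fin.cons (j.1 + 1) fun l => p l + 1)) *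
          ∑ c ∈ Finset.range (b + 1),
            T _ (restrictPerm σ' I h.1) c
              (restrictWord (Fin.cons (homBasis ℬ i) (Fin.cons (homBasis ℬ j) x)) I) *
            T' _ (restrictPerm σ' Iᶜ h.2.1) (b - c)
              (restrictWord (Fin.cons (homBasis ℬ i) (Fin.cons (homBasis ℬ j) x)) Iᶜ)
        else 0
      else 0

/-- `S` is a solution `∑ ħ^{2g+i-1} S_{i,g}`, with `S_{i,g}` even elements of the dual of
`Symm^i(⊕_{j ≥ 1} ((Π B)^{⊗ j})^{ℤ/j})`, of the noncommutative Batalin-Vilkovisky equation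
`ħ Δ S + ½ {S, S} = 0`. -/
structure IsBVSolution (S : Series k B) : Prop where
  symmetric : IsSymmetric ℬ S
  even : IsEven ℬ S
  genus : HasGenusExpansion S
  equation : ∀ (n : ℕ) (σ : Equiv.Perm (Fin n)) (b : ℕ) (p : Fin n → ZMod 2) (x : Fin n → B),
    (∀ i, x i ∈ ℬ (p i)) →
    hbarMul (bvLaplacian ℬ β S) n σ b x + (1 / 2 : k) * bvBracket ℬ β S S n σ b p x = 0

end Operators

/-- The component `S_{1,0}` of `S` is the tensor of the cyclic `A∞`-algebra. -/
def Extends {ℬ : ZMod 2 → Submodule k B} (S : Series k B) (R : CyclicAInfinity ℬ) : Prop :=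
  ∀ (n : ℕ) (p : Fin (n + 1) → ZMod 2) (x : Fin (n + 1) → B), (∀ i, x i ∈ ℬ (p i)) →
    S (n + 1) (finRotate (n + 1)) 0 x = cyclicTensor R.form (R.op n) p x

end BV

/-! ## Models and the sum over all ribbon graphs -/

section Model

variable {k A B : Type*} [Field k] [NonUnitalRing A] [Module k A] [AddCommGroup B] [Module k B]
  {𝒜 : ZMod 2 → Submodule k A} {ℬ : ZMod 2 → Submodule k B}
  [DirectSum.Decomposition 𝒜] [FiniteDimensional k A]

/-- The cyclic `A∞`-algebra `R` on `B` is obtained via the summation over trees from the cyclic dg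
associative algebra `M` on `A` and the homotopy `h`: `incl` identifies `B`, with its scalar product,
with the image of `P`; the unary operation is the restriction of the differential; and the cyclic
tensors of the operations with at least two arguments are the sums over ribbon trees. -/
structure IsTreeModel (R : CyclicAInfinity ℬ) {M : CyclicDGAlgebra 𝒜} (h : Homotopy M)
    (incl : B →ₗ[k] A) : Prop where
  incl_mem : ∀ i x, x ∈ ℬ i → incl x ∈ 𝒜 i
  incl_injective : Function.Injective incl
  range_incl : LinearMap.range incl = LinearMap.range h.P
  form_incl : ∀ x y, R.form x y = M.form (incl x) (incl y)
  op_one : ∀ x : Fin 1 → B, incl (R.op 1 x) = M.d (incl (x 0))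
  op_eq_treeSum : ∀ (n : ℕ), 2 ≤ n → ∀ (p : Fin (n + 1) → ZMod 2) (x : Fin (n + 1) → B),
    (∀ i, x i ∈ ℬ (p i)) →
    cyclicTensor R.form (R.op n) p x = treeSum h (n + 1) (finRotate (n + 1)) (fun i => incl (x i))

variable [DirectSum.Decomposition ℬ] [FiniteDimensional k B]

/-- The quadratic term of the differential of `R`: the bilinear functional
`(x_0, x_1) ↦ ω(b_1(x_0), x_1)` on cyclic words of length two, in degree zero in `ħ`. -/
def quadraticTerm (R : CyclicAInfinity ℬ) : Series k B
  | 2, σ, 0 => if σ = finRotate 2 then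
      ∑ i : HomIdx ℬ, ∑ j : HomIdx ℬ,
        cyclicTensor R.form (R.op 1) ![i.1, j.1] ![homBasis ℬ i, homBasis ℬ j] •
          (MultilinearMap.mkPiAlgebra k (Fin 2) k).compLinearMap
            ![(homBasis ℬ).coord i, (homBasis ℬ).coord j]
      else 0
  | _, _, _ => 0

/-- `S = S_{0,2} + ∑_Γ ħ^{1 - χ(Σ_Γ)} W_Γ`: the quadratic term plus the sum over all connected
trivalent ribbon graphs with nonempty sets of legs on every boundary component, with elements of
`Π B` attached to the legs. -/
def ribbonAction (R : CyclicAInfinity ℬ) {M : CyclicDGAlgebra 𝒜} (h : Homotopy M)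
    (incl : B →ₗ[k] A) : Series k B := fun n σ b =>
  quadraticTerm R n σ b + (ribbonSum h n σ b).compLinearMap fun _ => incl

end Model

end NCBV

end

/-! Let W be the sum over ribbon graphs and let D apply `b_1` to one letter at a time, with Koszul
signs. The brackets of S_{0,2} with W, in either order, equal D W. The bracket of S_{0,2} with
itself vanishes by d² = 0, and Δ S_{0,2} vanishes because contracting both letters of a word leaves
no letter. Hence the equation amounts to 2ħΔW + {W,W} = -2 D W (`ribbonSeries_equation`), a
statement about graphs.

The differential annihilates the product of the three-tensors, by the Leibniz rule and the
invariance of β. Therefore D W_Γ is minus the effect of d on the propagators. As dH + Hd = Id - P,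
the differential of the propagator is β^∨ - (P ⊗ 1)β^∨ up to sign, and D W_Γ becomes the sum over
the edges of Γ of the contractions with this tensor at one edge (`sum_propagator_d`,
`sum_contraction_d`).

The terms with β^∨ at an edge cancel. Such an edge can be shrunk to a four-valent vertex, and the
two trivalent resolutions of that vertex are the two bracketings of a product of three elements. By
associativity they agree up to the sign -1, which comes from the oddness of β^∨
(`sum_threeTensor_twist`, `gluedContraction_twist`). Passing to the other resolution keeps the graph
connected and keeps the legs on the boundary, and it is injective on a finite set of isomorphism
classes, so the sum equals its own negative. An edge from a vertex to itself has no second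
resolution, but it would join neighbouring flags and create a boundary component without legs; the
condition on the legs excludes it.

In the terms with (P ⊗ 1)β^∨ the edge is cut, because this tensor is the image of the inverse tensor
of B. The cut graph has two new legs carrying the contracted letters. If it is connected it
contributes to Δ W; otherwise it has two components, its contraction is a product, and it
contributes to {W,W} (`sum_gluesAdmissible`, `sum_isSplit`, `contraction_union`). The boundary
components match because joining two legs multiplies the boundary permutation by a transposition,
and first returns can be computed in two stages (`isBoundary_mul_swap_iff`). Each edge is cut twice,
once for each order of its halves; all these cuts are distinct because a connected graph with a leg
has no nontrivial automorphism fixing it (`Connected.rigid`, `sum_graphTensor_update`).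

The exponents of ħ come from Euler's formula, proved by inserting edges one at a time
(`euler_inequality`). Exponent 0 with one boundary circle gives the trees, hence the `A∞`-tensors.
Signs are compared as Koszul signs between orders of finite sets (`koszulSign_trans`,
`koszulSign_block`, `koszulSign_update`). -/

noncomputable section

namespace NCBV

/-! ### Calculus of Koszul signs. -/

section Signs

variable {k : Type*} [CommRing k] {F F' : Type*} [Fintype F] [Fintype F']

theorem zmod_two_cases (a : ZMod 2) : a = 0 ∨ a = 1 := by revert a; decide

theorem sgn_zero : sgn k 0 = 1 := by simp [sgn]

theorem sgn_one : sgn k 1 = -1 := by simp [sgn]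

theorem sgn_add (a b : ZMod 2) : sgn k (a + b) = sgn k a * sgn k b := by
  have h : (1 : ZMod 2) + 1 = 0 := by decide
  rcases zmod_two_cases a with rfl | rfl <;> rcases zmod_two_cases b with rfl | rfl <;>
    simp [sgn_zero, sgn_one, h]

theorem sgn_mul_self (a : ZMod 2) : sgn k a * sgn k a = 1 := by
  rcases zmod_two_cases a with rfl | rfl <;> simp [sgn_zero, sgn_one]

theorem sgn_add_one (a : ZMod 2) : sgn k (a + 1) = -sgn k a := by
  simp [sgn_add, sgn_one]

theorem sgn_sum {ι : Type*} (s : Finset ι) (f : ι → ZMod 2) :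
    sgn k (∑ i ∈ s, f i) = ∏ i ∈ s, sgn k (f i) := by
  classical
  induction s using Finset.induction_on with
  | empty => simp [sgn_zero]
  | insert a s ha ih => rw [Finset.sum_insert ha, Finset.prod_insert ha, sgn_add, ih]

/-- Each unordered pair of distinct elements is listed once, in the order of `r`. Two signs with
different reference orders can then be compared pair by pair. -/
theorem prod_pairs_eq {r : F → ℕ} (hr : Function.Injective r) (g : F × F → k)
    (hg : ∀ x, g (x, x) = 1) :
    ∏ z, g z = ∏ z : F × F, if r z.1 < r z.2 then g z * g z.swap else 1 := by
  have h1 : ∏ z : F × F, (if r z.1 < r z.2 then g z.swap else 1) =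
      ∏ z : F × F, if r z.2 < r z.1 then g z else 1 :=
    Fintype.prod_equiv (Equiv.prodComm F F) _ _ (fun z => by rfl)
  have h2 : ∀ z : F × F, (if r z.1 < r z.2 then g z * g z.swap else 1) =
      (if r z.1 < r z.2 then g z else 1) * (if r z.1 < r z.2 then g z.swap else 1) := by
    intro z; split_ifs <;> simp
  rw [Finset.prod_congr rfl fun z _ => h2 z, Finset.prod_mul_distrib, h1,
    ← Finset.prod_mul_distrib]
  refine Finset.prod_congr rfl fun z _ => ?_
  rcases lt_trichotomy (r z.1) (r z.2) with h | h | h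
  · simp [h, h.not_gt]
  · obtain ⟨x, y⟩ := z
    obtain rfl : x = y := hr h
    simp [hg]
  · simp [h, h.not_gt]

theorem koszulSign_equiv (e : F ≃ F') (r s : F' → ℕ) (q : F' → ZMod 2) :
    koszulSign k (r ∘ e) (s ∘ e) (q ∘ e) = koszulSign k r s q :=
  Fintype.prod_equiv (Equiv.prodCongr e e) _ _ (fun z => by simp)

theorem koszulSign_congr {r s r' s' : F → ℕ} {q q' : F → ZMod 2}
    (h : ∀ x y, (r x < r y ∧ s y < s x) ↔ (r' x < r' y ∧ s' y < s' x))
    (hq : ∀ x y, r x < r y → s y < s x → q x * q y = q' x * q' y) :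
    koszulSign k r s q = koszulSign k r' s' q' := by
  unfold koszulSign
  refine Finset.prod_congr rfl fun z _ => ?_
  by_cases hz : r z.1 < r z.2 ∧ s z.2 < s z.1
  · rw [if_pos hz, if_pos ((h _ _).1 hz), hq _ _ hz.1 hz.2]
  · rw [if_neg hz, if_neg fun h' => hz ((h _ _).2 h')]

theorem koszulSign_eq_one {r s : F → ℕ} {q : F → ZMod 2}
    (h : ∀ x y, r x < r y → s y < s x → q x * q y = 0) : koszulSign k r s q = 1 := by
  unfold koszulSign
  refine Finset.prod_eq_one fun z _ => ?_
  split_ifs with hz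
  · rw [h _ _ hz.1 hz.2, sgn_zero]
  · rfl

theorem koszulSign_self (r : F → ℕ) (q : F → ZMod 2) : koszulSign k r r q = 1 :=
  koszulSign_eq_one fun _ _ h h' => absurd h h'.not_gt

/-- A pair is interchanged between `r` and `t` exactly when one and only one of the two intermediate
steps interchanges it; if both do, its signs cancel. -/
theorem koszulSign_trans {r s t : F → ℕ} (hr : Function.Injective r) (hs : Function.Injective s)
    (ht : Function.Injective t) (q : F → ZMod 2) :
    koszulSign k r s q * koszulSign k s t q = koszulSign k r t q := by
  unfold koszulSign
  rw [← Finset.prod_mul_distrib, prod_pairs_eq hr, prod_pairs_eq hr (fun z : F × F => if r z.1 < r z.2 ∧ t z.2 < t z.1 then sgn k (q z.1 * q z.2) else 1)]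
  · refine Finset.prod_congr rfl fun z _ => ?_
    obtain ⟨x, y⟩ := z
    by_cases h : r x < r y
    · have hxy : x ≠ y := by rintro rfl; exact lt_irrefl _ h
      have h1 := sgn_mul_self (k := k) (q x * q y)
      simp only [Prod.swap, mul_comm (q y) (q x)]
      rcases lt_or_gt_of_ne (hs.ne hxy) with h2 | h2 <;>
        rcases lt_or_gt_of_ne (ht.ne hxy) with h3 | h3 <;>
        simp [h, h.not_gt, h2, h2.not_gt, h3, h3.not_gt, h1]
    · simp [h]
  · simp
  · simp

theorem koszulSign_mul_self (r s : F → ℕ) (q : F → ZMod 2) :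
    koszulSign k r s q * koszulSign k r s q = 1 := by
  unfold koszulSign
  rw [← Finset.prod_mul_distrib]
  refine Finset.prod_eq_one fun z _ => ?_
  split_ifs
  · exact sgn_mul_self _
  · simp

theorem koszulSign_comm {r s : F → ℕ} (hr : Function.Injective r) (hs : Function.Injective s)
    (q : F → ZMod 2) : koszulSign k r s q = koszulSign k s r q := by
  have h := koszulSign_trans (k := k) hr hs hr q
  rw [koszulSign_self] at h
  calc koszulSign k r s q = koszulSign k r s q * (koszulSign k s r q * koszulSign k s r q) := by
        rw [koszulSign_mul_self, mul_one]
    _ = koszulSign k s r q := by rw [← mul_assoc, h, one_mul]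

/-- Blocks that are interchanged as a whole do not contribute when one of them is even. -/
theorem koszulSign_block {ι : Type*} [Fintype ι] [DecidableEq ι] (blk : F → ι)
    {r s : F → ℕ} {q : F → ZMod 2}
    (h : ∀ x y x' y', blk x ≠ blk y → blk x' = blk x → blk y' = blk y →
      r x < r y → s y < s x → r x' < r y' ∧ s y' < s x')
    (hq : ∀ x y, blk x ≠ blk y → r x < r y → s y < s x →
      ∑ z with blk z = blk x, q z = 0 ∨ ∑ z with blk z = blk y, q z = 0) :
    koszulSign k r s q = ∏ z : F × F,
      if blk z.1 = blk z.2 ∧ r z.1 < r z.2 ∧ s z.2 < s z.1 then sgn k (q z.1 * q z.2) else 1 := by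
  -- Pairs from two different blocks are grouped by the ordered pair of blocks. If one pair in a
  -- group is inverted, all are, and the group contributes `sgn` of the product of the two block
  -- parities, one of which is 0.
  have key : ∏ z : F × F, (if blk z.1 ≠ blk z.2 ∧ r z.1 < r z.2 ∧ s z.2 < s z.1 then
      sgn k (q z.1 * q z.2) else 1) = 1 := by
    rw [← Finset.prod_fiberwise (g := fun z : F × F => (blk z.1, blk z.2))]
    refine Finset.prod_eq_one fun b _ => ?_
    by_cases hb : ∃ z : F × F, (blk z.1, blk z.2) = b ∧ blk z.1 ≠ blk z.2 ∧
        r z.1 < r z.2 ∧ s z.2 < s z.1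
    · obtain ⟨⟨x, y⟩, rfl, hne, h1, h2⟩ := hb
      have hfil : (Finset.univ.filter fun z : F × F => (blk z.1, blk z.2) = (blk x, blk y)) =
          (Finset.univ.filter fun z => blk z = blk x) ×ˢ
            (Finset.univ.filter fun z => blk z = blk y) := by
        ext z; simp
      simp only at hne h1 h2 ⊢
      rw [hfil]
      have hc : ∀ z ∈ (Finset.univ.filter fun z => blk z = blk x) ×ˢ
            (Finset.univ.filter fun z => blk z = blk y),
          (if blk z.1 ≠ blk z.2 ∧ r z.1 < r z.2 ∧ s z.2 < s z.1 then
            sgn k (q z.1 * q z.2) else 1) = sgn k (q z.1 * q z.2) := by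
        intro z hz
        simp only [Finset.mem_product, Finset.mem_filter, Finset.mem_univ, true_and] at hz
        rw [if_pos ⟨by rw [hz.1, hz.2]; exact hne, h _ _ _ _ hne hz.1 hz.2 h1 h2⟩]
      rw [Finset.prod_congr rfl hc, ← sgn_sum, Finset.sum_product, ← Finset.sum_mul_sum]
      rcases hq x y hne h1 h2 with h0 | h0 <;> rw [h0] <;> simp [sgn_zero]
    · refine Finset.prod_eq_one fun z hz => ?_
      rw [if_neg]
      rintro ⟨h1, h2⟩
      exact hb ⟨z, (Finset.mem_filter.1 hz).2, h1, h2⟩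
  have hsplit : koszulSign k r s q = (∏ z : F × F,
      if blk z.1 = blk z.2 ∧ r z.1 < r z.2 ∧ s z.2 < s z.1 then sgn k (q z.1 * q z.2) else 1) *
      ∏ z : F × F, (if blk z.1 ≠ blk z.2 ∧ r z.1 < r z.2 ∧ s z.2 < s z.1 then
      sgn k (q z.1 * q z.2) else 1) := by
    unfold koszulSign
    rw [← Finset.prod_mul_distrib]
    refine Finset.prod_congr rfl fun z _ => ?_
    by_cases hb : blk z.1 = blk z.2 <;> simp [hb]
  rw [hsplit, key, mul_one]

/-- The effect of a change of the parity of one factor. -/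
theorem koszulSign_update [DecidableEq F] {r s : F → ℕ} (hr : Function.Injective r)
    (hs : Function.Injective s) (q : F → ZMod 2) (f : F) :
    koszulSign k r s (Function.update q f (q f + 1)) =
      koszulSign k r s q * sgn k (∑ g with r g < r f, q g) * sgn k (∑ g with s g < s f, q g) := by
  -- Only the inverted pairs containing `f` change, and each of them acquires the sign of its other
  -- member.
  have h1 : koszulSign k r s (Function.update q f (q f + 1)) = koszulSign k r s q *
      ∏ z : F × F, ((if z.1 = f then (if r f < r z.2 ∧ s z.2 < s f then sgn k (q z.2) else 1)
        else 1) *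
        (if z.2 = f then (if r z.1 < r f ∧ s f < s z.1 then sgn k (q z.1) else 1) else 1)) := by
    unfold koszulSign
    rw [← Finset.prod_mul_distrib]
    refine Finset.prod_congr rfl fun z _ => ?_
    obtain ⟨x, y⟩ := z
    by_cases hx : x = f
    · subst hx
      by_cases hy : y = x
      · subst hy; simp
      · simp only [Function.update_self, Function.update_of_ne hy, hy, if_true, if_false]
        split_ifs
        · rw [add_mul, one_mul, sgn_add, mul_one]
        · simp
    · by_cases hy : y = f
      · subst hy
        simp only [Function.update_self, Function.update_of_ne hx, hx, if_true, if_false]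
        split_ifs
        · rw [mul_add, mul_one, sgn_add, one_mul]
        · simp
      · simp [Function.update_of_ne hx, Function.update_of_ne hy, hx, hy]
  rw [h1, mul_assoc, Finset.prod_mul_distrib, Fintype.prod_prod_type, Fintype.prod_prod_type_right]
  congr 1
  rw [sgn_sum, sgn_sum, Finset.prod_filter, Finset.prod_filter]
  have h3 : ∀ g : F → k, ∏ x, ∏ y, (if x = f then g y else 1) = ∏ y, g y := by
    intro g
    rw [Finset.prod_comm]
    simp
  dsimp only
  rw [h3 (fun y => if r f < r y ∧ s y < s f then sgn k (q y) else 1),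
    h3 (fun x => if r x < r f ∧ s f < s x then sgn k (q x) else 1), ← Finset.prod_mul_distrib, ← Finset.prod_mul_distrib]
  -- The pair of `g` and `f` is inverted exactly when one of the two orders, but not both, places
  -- `g` before `f`.
  refine Finset.prod_congr rfl fun g _ => ?_
  by_cases hg : g = f
  · subst hg; simp
  · have := sgn_mul_self (k := k) (q g)
    rcases lt_or_gt_of_ne (hr.ne hg) with h2 | h2 <;>
        rcases lt_or_gt_of_ne (hs.ne hg) with h3 | h3 <;>
        simp [h2, h2.not_gt, h3, h3.not_gt, this]

end Signs

/-! ### First-return permutations and their certificates. -/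

section Boundary

variable {F F' : Type*} {n : ℕ}

/-- A certificate for `IsBoundary`: `c f` is the first marked point reached from `f`, and `t`
decreases along the way. -/
structure BoundaryCert (φ : Equiv.Perm F) (leg : Fin n → F) (σ : Equiv.Perm (Fin n))
    (c : F → Fin n) (t : F → ℕ) : Prop where
  color_leg : ∀ l, c (leg l) = l
  color : ∀ f, (∀ l, f ≠ leg l) → c (φ f) = c f
  lt : ∀ f, (∀ l, f ≠ leg l) → t (φ f) < t f
  next : ∀ l, c (φ (leg l)) = σ l

theorem exists_pow_eq_leg {φ : Equiv.Perm F} {leg : Fin n → F} {t : F → ℕ}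
    (ht : ∀ f, (∀ l, f ≠ leg l) → t (φ f) < t f) (f : F) :
    ∃ (s : ℕ) (l : Fin n), (φ ^ s) f = leg l ∧ ∀ u < s, ∀ l', (φ ^ u) f ≠ leg l' := by
  induction hN : t f using Nat.strong_induction_on generalizing f with
  | _ N ih =>
    by_cases hf : ∃ l, f = leg l
    · obtain ⟨l, hl⟩ := hf
      exact ⟨0, l, by simpa using hl, by simp⟩
    · push Not at hf
      obtain ⟨s, l, h1, h2⟩ := ih _ (hN ▸ ht f hf) (φ f) rfl
      refine ⟨s + 1, l, by rw [pow_succ, Equiv.Perm.mul_apply, h1], fun u hu l' => ?_⟩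
      cases u with
      | zero => simpa using hf l'
      | succ u =>
        rw [pow_succ, Equiv.Perm.mul_apply]
        exact h2 u (by omega) l'

/-- The walk ends at a leg because `t` decreases, and the colour is constant up to that point. The
colour read just after a leg therefore names the next leg. -/
theorem BoundaryCert.isBoundary {φ : Equiv.Perm F} {leg : Fin n → F} {σ : Equiv.Perm (Fin n)}
    {c : F → Fin n} {t : F → ℕ} (h : BoundaryCert φ leg σ c t) : IsBoundary φ leg σ := by
  have key : ∀ (s : ℕ) (f : F), (∀ u < s, ∀ l', (φ ^ u) f ≠ leg l') → c ((φ ^ s) f) = c f := by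
    intro s
    induction s with
    | zero => simp
    | succ s ih =>
      intro f hf
      rw [pow_succ, Equiv.Perm.mul_apply, ih, h.color f (by simpa using hf 0 (by omega))]
      intro u hu l'
      have := hf (u + 1) (by omega) l'
      rwa [pow_succ, Equiv.Perm.mul_apply] at this
  refine ⟨fun l => ?_, fun f => ?_⟩
  · obtain ⟨s, l', h1, h2⟩ := exists_pow_eq_leg h.lt (φ (leg l))
    have h3 := key s _ h2
    rw [h1, h.color_leg, h.next] at h3
    refine ⟨s, by rw [pow_succ, Equiv.Perm.mul_apply, h1, h3], fun u hu l' => ?_⟩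
    rw [pow_succ, Equiv.Perm.mul_apply]
    exact h2 u hu l'
  · obtain ⟨s, l', h1, h2⟩ := exists_pow_eq_leg h.lt f
    exact ⟨s, l', h1⟩

/-- The canonical certificate takes for `t` the number of steps to the first leg and for `c` that
leg. -/
theorem IsBoundary.exists_cert {φ : Equiv.Perm F} {leg : Fin n → F} {σ : Equiv.Perm (Fin n)}
    (hleg : Function.Injective leg) (h : IsBoundary φ leg σ) :
    ∃ c t, BoundaryCert φ leg σ c t := by
  classical
  obtain ⟨h1, h2⟩ := h
  let t : F → ℕ := fun f => Nat.find (h2 f)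
  have ht : ∀ f, ∃ l, (φ ^ t f) f = leg l := fun f => Nat.find_spec (h2 f)
  have hmin : ∀ f s l, (φ ^ s) f = leg l → t f ≤ s := fun f s l hs => Nat.find_min' (h2 f) ⟨l, hs⟩
  choose c hc using ht
  have hstep : ∀ f, (∀ l, f ≠ leg l) → t f = t (φ f) + 1 := by
    intro f hf
    apply le_antisymm
    · refine hmin f _ (c (φ f)) ?_
      rw [pow_succ, Equiv.Perm.mul_apply, hc]
    · have h0 : t f ≠ 0 := fun h0 => hf (c f) (by have := hc f; rwa [h0] at this)
      obtain ⟨u, hu⟩ := Nat.exists_eq_succ_of_ne_zero h0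
      have := hc f
      rw [hu, Nat.succ_eq_add_one, pow_succ, Equiv.Perm.mul_apply] at this
      have := hmin _ _ _ this
      omega
  refine ⟨c, t, fun l => ?_, fun f hf => ?_, fun f hf => ?_, fun l => ?_⟩
  · have h0 : t (leg l) = 0 := Nat.le_zero.1 (hmin _ 0 l (by simp))
    have := hc (leg l)
    rw [h0] at this
    exact (hleg (by simpa using this)).symm
  · have := hc f
    rw [hstep f hf, pow_succ, Equiv.Perm.mul_apply, hc] at this
    exact hleg this
  · rw [hstep f hf]; omega
  · obtain ⟨s, hs, hs'⟩ := h1 l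
    rw [pow_succ, Equiv.Perm.mul_apply] at hs
    have h3 : t (φ (leg l)) = s := by
      refine le_antisymm (hmin _ _ _ hs) ?_
      by_contra hlt
      refine hs' (t (φ (leg l))) (by omega) (c (φ (leg l))) ?_
      rw [pow_succ, Equiv.Perm.mul_apply, hc]
    have := hc (φ (leg l))
    rw [h3, hs] at this
    exact (hleg this).symm

theorem IsBoundary.unique {φ : Equiv.Perm F} {leg : Fin n → F} {σ σ' : Equiv.Perm (Fin n)}
    (hleg : Function.Injective leg) (h : IsBoundary φ leg σ) (h' : IsBoundary φ leg σ') :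
    σ = σ' := by
  ext l
  obtain ⟨s, hs, hmin⟩ := h.1 l
  obtain ⟨s', hs', hmin'⟩ := h'.1 l
  rcases lt_trichotomy s s' with hlt | rfl | hlt
  · exact absurd hs (hmin' s hlt _)
  · rw [hleg (hs.symm.trans hs')]
  · exact absurd hs' (hmin s' hlt _)

/-- The first-return map is injective: if two walks end at the same leg, running both backwards
shows that the longer one passed through the starting leg of the shorter one, against its being a
first return. -/
theorem exists_isBoundary {φ : Equiv.Perm F} {leg : Fin n → F} (hleg : Function.Injective leg)
    {t : F → ℕ} (ht : ∀ f, (∀ l, f ≠ leg l) → t (φ f) < t f) : ∃ σ, IsBoundary φ leg σ := by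
  have h := fun l => exists_pow_eq_leg ht (φ (leg l))
  choose s g h1 h2 using h
  have hle : ∀ l l', g l = g l' → s l ≤ s l' → l = l' := by
    intro l l' hg hs
    obtain ⟨d, hd⟩ := Nat.exists_eq_add_of_le hs
    have h3 := h1 l'
    rw [← hg, ← h1 l, hd, pow_add, Equiv.Perm.mul_apply] at h3
    have h4 := (φ ^ s l).injective h3
    cases d with
    | zero => exact (hleg (φ.injective (by simpa using h4))).symm
    | succ d =>
      rw [pow_succ', Equiv.Perm.mul_apply] at h4
      exact absurd (φ.injective h4) (h2 l' d (by omega) l)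
  have hinj : Function.Injective g := fun l l' hg => by
    rcases le_total (s l) (s l') with hs | hs
    · exact hle l l' hg hs
    · exact (hle l' l hg.symm hs).symm
  refine ⟨Equiv.ofBijective g (Finite.injective_iff_bijective.1 hinj), fun l => ⟨s l, ?_, ?_⟩,
    fun f => ?_⟩
  · rw [pow_succ, Equiv.Perm.mul_apply, h1]; rfl
  · intro u hu l'
    rw [pow_succ, Equiv.Perm.mul_apply]
    exact h2 l u hu l'
  · obtain ⟨s, l, hs, -⟩ := exists_pow_eq_leg ht f
    exact ⟨s, l, hs⟩

theorem IsBoundary.conj {φ : Equiv.Perm F} {leg : Fin n → F} {σ : Equiv.Perm (Fin n)}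
    (h : IsBoundary φ leg σ) {φ' : Equiv.Perm F'} {leg' : Fin n → F'} (π : Equiv.Perm (Fin n))
    (τ : F ≃ F') (hφ : ∀ f, τ (φ f) = φ' (τ f)) (hl : ∀ l, τ (leg l) = leg' (π l)) :
    IsBoundary φ' leg' (π * σ * π⁻¹) := by
  have hpow : ∀ (s : ℕ) f, τ ((φ ^ s) f) = (φ' ^ s) (τ f) := by
    intro s
    induction s with
    | zero => simp
    | succ s ih => intro f; simp [pow_succ, ih, hφ]
  have hl' : ∀ l, leg' l = τ (leg (π⁻¹ l)) := fun l => by rw [hl]; simp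
  refine ⟨fun l => ?_, fun f => ?_⟩
  · obtain ⟨s, hs, hmin⟩ := h.1 (π⁻¹ l)
    refine ⟨s, ?_, fun u hu l' => ?_⟩
    · rw [hl', hl', ← hpow, hs]; simp
    · rw [hl', hl', ← hpow]
      exact fun h' => hmin u hu _ (τ.injective h')
  · obtain ⟨s, l, hs⟩ := h.2 (τ.symm f)
    exact ⟨s, π l, by rw [← hl, ← hs, hpow]; simp⟩

/-- First returns can be taken in two stages: first to all `n + 2` legs, which gives `σ'`, then
among these, with `0` and `1` interchanged, to the `n` remaining ones. This is how gluing two legs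
of a graph corresponds to the gluing of cyclic words. -/
theorem isBoundary_mul_swap_iff [DecidableEq F] {φ : Equiv.Perm F} {leg : Fin (n + 2) → F}
    [Finite F]
    (hleg : Function.Injective leg) (σ : Equiv.Perm (Fin n)) :
    IsBoundary (φ * Equiv.swap (leg 0) (leg 1)) (fun l : Fin n => leg l.succ.succ) σ ↔
      ∃ σ', IsBoundary φ leg σ' ∧ Glues σ' σ := by
  have hleg' : Function.Injective (fun l : Fin n => leg l.succ.succ) := fun a b hab => by
    simpa using hleg hab
  have hsw : ∀ l, φ (leg (Equiv.swap 0 1 l)) = (φ * Equiv.swap (leg 0) (leg 1)) (leg l) := by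
    intro l
    rw [Equiv.Perm.mul_apply]
    congr 1
    exact (hleg.swap_apply 0 1 l).symm
  have hcases : ∀ l : Fin (n + 2), l = 0 ∨ l = 1 ∨ ∃ m : Fin n, l = m.succ.succ := by
    intro l
    refine Fin.cases (Or.inl rfl) (fun l => ?_) l
    refine Fin.cases (Or.inr (Or.inl rfl)) (fun l => Or.inr (Or.inr ⟨l, rfl⟩)) l
  have hsw2 : ∀ f, (∀ l, f ≠ leg l) → (φ * Equiv.swap (leg 0) (leg 1)) f = φ f := by
    intro f hf
    rw [Equiv.Perm.mul_apply, Equiv.swap_apply_of_ne_of_ne (hf 0) (hf 1)]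
  constructor
  · intro h
    obtain ⟨c, t, hc⟩ := h.exists_cert hleg'
    have hnon : ∀ f, (∀ l, f ≠ leg l) → ∀ l : Fin n, f ≠ leg l.succ.succ := fun f hf l => hf _
    -- Away from the legs `φ` and the glued permutation agree, so the height function of the latter
    -- also serves for `φ`.
    obtain ⟨σ', hσ'⟩ := exists_isBoundary hleg (φ := φ) (t := t) (fun f hf => by
      rw [← hsw2 f hf]
      exact hc.lt f (hnon f hf))
    refine ⟨σ', hσ', ?_⟩
    -- Between two consecutive legs the colour stays constant and the height cannot grow, so the
    -- certificate restricts to the set of legs.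
    have hret : ∀ l, c (leg (σ' l)) = c (φ (leg l)) ∧ t (leg (σ' l)) ≤ t (φ (leg l)) := by
      intro l
      obtain ⟨s, hs, hmin⟩ := hσ'.1 l
      have : ∀ u ≤ s, c ((φ ^ (u + 1)) (leg l)) = c (φ (leg l)) ∧
          t ((φ ^ (u + 1)) (leg l)) ≤ t (φ (leg l)) := by
        intro u
        induction u with
        | zero => simp
        | succ u ih =>
          intro hu
          obtain ⟨h1, h2⟩ := ih (by omega)
          have hf := hmin u (by omega)
          have h3 := hc.color _ (hnon _ hf)
          have h4 := hc.lt _ (hnon _ hf)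
          rw [hsw2 _ hf, ← Equiv.Perm.mul_apply, ← pow_succ'] at h3 h4
          exact ⟨h3.trans h1, by omega⟩
      rw [← hs]
      exact this s le_rfl
    have hne : ∀ l : Fin (n + 2), (∀ m : Fin n, l ≠ m.succ.succ) →
        ∀ m : Fin n, leg l ≠ leg m.succ.succ := fun l hl m h' => hl m (hleg h')
    refine BoundaryCert.isBoundary (c := c ∘ leg) (t := t ∘ leg) ⟨hc.color_leg, fun l hl => ?_,
      fun l hl => ?_, fun l => ?_⟩
    · have := (hret (Equiv.swap 0 1 l)).1
      simp only [Function.comp, Equiv.Perm.mul_apply]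
      rw [this, hsw]
      exact hc.color _ (hne l hl)
    · have := (hret (Equiv.swap 0 1 l)).2
      simp only [Function.comp, Equiv.Perm.mul_apply]
      refine this.trans_lt ?_
      rw [hsw]
      exact hc.lt _ (hne l hl)
    · have := (hret (Equiv.swap 0 1 l.succ.succ)).1
      simp only [Function.comp, Equiv.Perm.mul_apply]
      rw [this, hsw]
      exact hc.next l
  · rintro ⟨σ', h1, h2⟩
    obtain ⟨c₁, t₁, hc₁⟩ := h1.exists_cert hleg
    obtain ⟨c₂, t₂, hc₂⟩ := IsBoundary.exists_cert (fun a b hab => by simpa using hab) h2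
    -- With a bound `N` for `t₁`, the number `t₂ (c₁ f) * N + t₁ f` encodes the lexicographic order:
    -- `t₁` falls between legs, and `t₂` falls at each passage through leg `0` or `1`.
    obtain ⟨N, hN⟩ : ∃ N, ∀ f, t₁ f < N := by
      obtain ⟨N, hN⟩ := (Set.finite_range t₁).bddAbove
      exact ⟨N + 1, fun f => Nat.lt_succ_of_le (hN ⟨f, rfl⟩)⟩
    have hlex : ∀ a b x y : ℕ, a < b → x < N → a * N + x < b * N + y := by
      intro a b x y hab hx
      have := Nat.mul_le_mul_right N (Nat.succ_le_of_lt hab)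
      rw [Nat.succ_mul] at this
      omega
    have hnext : ∀ l, c₁ ((φ * Equiv.swap (leg 0) (leg 1)) (leg l)) =
        (σ' * Equiv.swap (0 : Fin (n + 2)) 1 : Equiv.Perm (Fin (n + 2))) l := by
      intro l
      rw [← hsw, hc₁.next, Equiv.Perm.mul_apply]
    have hcase : ∀ f, (∀ l : Fin n, f ≠ leg l.succ.succ) → (∀ l, f ≠ leg l) ∨
        ∃ l, f = leg l ∧ ∀ m : Fin n, l ≠ m.succ.succ := by
      intro f hf
      by_cases h : ∃ l, f = leg l
      · obtain ⟨l, rfl⟩ := h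
        exact Or.inr ⟨l, rfl, fun m hm => hf m (by rw [hm])⟩
      · push Not at h
        exact Or.inl h
    refine BoundaryCert.isBoundary (c := fun f => c₂ (c₁ f))
      (t := fun f => t₂ (c₁ f) * N + t₁ f) ⟨fun l => ?_, fun f hf => ?_, fun f hf => ?_,
      fun l => ?_⟩
    · simp only [hc₁.color_leg, hc₂.color_leg]
    · rcases hcase f hf with hf | ⟨l, rfl, hl⟩
      · simp only [hsw2 f hf, hc₁.color f hf]
      · simp only [hnext, hc₁.color_leg]
        exact hc₂.color l hl
    · rcases hcase f hf with hf | ⟨l, rfl, hl⟩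
      · simp only [hsw2 f hf, hc₁.color f hf]
        have := hc₁.lt f hf
        omega
      · simp only [hnext, hc₁.color_leg]
        exact hlex _ _ _ _ (hc₂.lt l hl) (hN _)
    · simp only [hnext]
      exact hc₂.next l

/-- The boundary permutation of a union of components. -/
theorem IsBoundary.restrict {m : ℕ} {φ : Equiv.Perm F} {leg : Fin n → F} {σ : Equiv.Perm (Fin n)}
    (h : IsBoundary φ leg σ) {φ' : Equiv.Perm F'} {leg' : Fin m → F'} {σ' : Equiv.Perm (Fin m)}
    (τ : F' → F) (hτ : Function.Injective τ) (hφ : ∀ f, τ (φ' f) = φ (τ f))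
    (j : Fin m → Fin n) (hl : ∀ l, τ (leg' l) = leg (j l)) (hσ : ∀ l, j (σ' l) = σ (j l))
    (hj : ∀ l f, leg l = τ f → ∃ a, l = j a) : IsBoundary φ' leg' σ' := by
  have hpow : ∀ (s : ℕ) f, τ ((φ' ^ s) f) = (φ ^ s) (τ f) := by
    intro s
    induction s with
    | zero => simp
    | succ s ih => intro f; simp [pow_succ, ih, hφ]
  refine ⟨fun l => ?_, fun f => ?_⟩
  · obtain ⟨s, hs, hmin⟩ := h.1 (j l)
    refine ⟨s, hτ ?_, fun u hu l' h' => hmin u hu (j l') ?_⟩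
    · rw [hpow, hl, hs, hl, hσ]
    · rw [← hl, ← hl, ← hpow, h']
  · obtain ⟨s, l, hs⟩ := h.2 (τ f)
    rw [← hpow] at hs
    obtain ⟨a, rfl⟩ := hj l _ hs.symm
    exact ⟨s, a, hτ (by rw [hs, hl])⟩

theorem IsBoundary.union {F₁ F₂ : Type*} {n₁ n₂ : ℕ} {φ : Equiv.Perm F} {leg : Fin n → F}
    {σ : Equiv.Perm (Fin n)}
    {φ₁ : Equiv.Perm F₁} {leg₁ : Fin n₁ → F₁} {σ₁ : Equiv.Perm (Fin n₁)}
    {φ₂ : Equiv.Perm F₂} {leg₂ : Fin n₂ → F₂} {σ₂ : Equiv.Perm (Fin n₂)}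
    (h₁ : IsBoundary φ₁ leg₁ σ₁) (h₂ : IsBoundary φ₂ leg₂ σ₂)
    (τ : F₁ ⊕ F₂ ≃ F)
    (hφ₁ : ∀ f, τ (Sum.inl (φ₁ f)) = φ (τ (Sum.inl f)))
    (hφ₂ : ∀ f, τ (Sum.inr (φ₂ f)) = φ (τ (Sum.inr f)))
    (j : Fin n₁ ⊕ Fin n₂ ≃ Fin n)
    (hl₁ : ∀ l, τ (Sum.inl (leg₁ l)) = leg (j (Sum.inl l)))
    (hl₂ : ∀ l, τ (Sum.inr (leg₂ l)) = leg (j (Sum.inr l)))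
    (hσ₁ : ∀ l, j (Sum.inl (σ₁ l)) = σ (j (Sum.inl l)))
    (hσ₂ : ∀ l, j (Sum.inr (σ₂ l)) = σ (j (Sum.inr l))) : IsBoundary φ leg σ := by

  have hpow₁ : ∀ (s : ℕ) f, (φ ^ s) (τ (Sum.inl f)) = τ (Sum.inl ((φ₁ ^ s) f)) := by
    intro s
    induction s with
    | zero => simp
    | succ s ih => intro f; simp [pow_succ, ← ih, hφ₁]
  have hpow₂ : ∀ (s : ℕ) f, (φ ^ s) (τ (Sum.inr f)) = τ (Sum.inr ((φ₂ ^ s) f)) := by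
    intro s
    induction s with
    | zero => simp
    | succ s ih => intro f; simp [pow_succ, ← ih, hφ₂]
  refine ⟨fun l => ?_, fun f => ?_⟩
  · obtain ⟨l, rfl⟩ := j.surjective l
    rcases l with l | l
    · obtain ⟨s, hs, hmin⟩ := h₁.1 l
      refine ⟨s, by rw [← hl₁, hpow₁, hs, hl₁, hσ₁], fun u hu l' => ?_⟩
      obtain ⟨l', rfl⟩ := j.surjective l'
      rcases l' with l' | l'
      · rw [← hl₁, ← hl₁, hpow₁]
        exact fun h' => hmin u hu l' (Sum.inl_injective (τ.injective h'))
      · rw [← hl₁, ← hl₂, hpow₁]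
        exact fun h' => Sum.inl_ne_inr (τ.injective h')
    · obtain ⟨s, hs, hmin⟩ := h₂.1 l
      refine ⟨s, by rw [← hl₂, hpow₂, hs, hl₂, hσ₂], fun u hu l' => ?_⟩
      obtain ⟨l', rfl⟩ := j.surjective l'
      rcases l' with l' | l'
      · rw [← hl₁, ← hl₂, hpow₂]
        exact fun h' => Sum.inr_ne_inl (τ.injective h')
      · rw [← hl₂, ← hl₂, hpow₂]
        exact fun h' => hmin u hu l' (Sum.inr_injective (τ.injective h'))
  · obtain ⟨f, rfl⟩ := τ.surjective f
    rcases f with f | f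
    · obtain ⟨s, l, hs⟩ := h₁.2 f
      exact ⟨s, j (Sum.inl l), by rw [hpow₁, hs, hl₁]⟩
    · obtain ⟨s, l, hs⟩ := h₂.2 f
      exact ⟨s, j (Sum.inr l), by rw [hpow₂, hs, hl₂]⟩

end Boundary

/-! ### The number of cycles after multiplication by a transposition. -/

section CycleCount

variable {F : Type*}

/-- The number of cycles of a permutation, fixed points included. -/
def cycleCount (φ : Equiv.Perm F) : ℕ := Nat.card (Quotient (Equiv.Perm.SameCycle.setoid φ))

/-- The setoid obtained from `r` by joining the classes of `x` and `y`. -/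
def joinSetoid (r : Setoid F) (x y : F) : Setoid F :=
  open Classical in
  Setoid.ker fun a => if r a y then (Quotient.mk r x) else Quotient.mk r a

variable {r : Setoid F} {x y : F}

theorem le_joinSetoid (r : Setoid F) (x y : F) : r ≤ joinSetoid r x y := by
  classical
  intro a b hab
  change (if r a y then _ else _) = (if r b y then _ else _)
  by_cases h : r a y
  · rw [if_pos h, if_pos (r.trans' (r.symm' hab) h)]
  · rw [if_neg h, if_neg fun h' => h (r.trans' hab h')]
    exact Quotient.sound hab

theorem joinSetoid_rel (r : Setoid F) (x y : F) : joinSetoid r x y x y := by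
  classical
  change (if r x y then _ else _) = (if r y y then _ else _)
  rw [if_pos (r.refl' y)]
  split_ifs <;> rfl

theorem joinSetoid_le {s : Setoid F} (h : r ≤ s) (hxy : s x y) : joinSetoid r x y ≤ s := by
  classical
  intro a b hab
  change (if r a y then _ else _) = (if r b y then _ else _) at hab
  split_ifs at hab with h1 h2 h2
  · exact s.trans' (h h1) (s.symm' (h h2))
  · exact s.trans' (h h1) (s.trans' (s.symm' hxy) (h (Quotient.exact hab)))
  · exact s.trans' (h (Quotient.exact hab)) (s.trans' hxy (s.symm' (h h2)))
  · exact h (Quotient.exact hab)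

theorem joinSetoid_eq_self (h : r x y) : joinSetoid r x y = r :=
  le_antisymm (joinSetoid_le le_rfl h) (le_joinSetoid _ _ _)

/-- Every class keeps its name except that of `y`, which takes the name of `x`; the names in use are
thus all classes but that of `y`. -/
theorem card_joinSetoid [Finite F] (h : ¬ r x y) :
    Nat.card (Quotient (joinSetoid r x y)) + 1 = Nat.card (Quotient r) := by
  classical
  have hr : Set.range (fun a => if r a y then (Quotient.mk r x) else Quotient.mk r a) =
      {Quotient.mk r y}ᶜ := by
    ext q
    constructor
    · rintro ⟨a, rfl⟩ ha
      simp only [Set.mem_singleton_iff] at ha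
      split_ifs at ha with h1
      · exact h (Quotient.exact ha)
      · exact h1 (Quotient.exact ha)
    · intro hq
      induction q using Quotient.inductionOn with
      | _ a =>
        refine ⟨a, if_neg fun h' => hq (Quotient.sound h')⟩
  have h1 : Nat.card (Quotient (joinSetoid r x y)) = ({Quotient.mk r y}ᶜ : Set (Quotient r)).ncard := by
    rw [← hr]
    exact Nat.card_congr (Setoid.quotientKerEquivRange _)
  rw [h1, Set.ncard_compl, Set.ncard_singleton]
  have : 0 < Nat.card (Quotient r) := Nat.card_pos_iff.2 ⟨⟨Quotient.mk r y⟩, inferInstance⟩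
  omega

theorem sameCycle_le [Finite F] {φ : Equiv.Perm F} {s : Setoid F} (h : ∀ a, s a (φ a)) :
    Equiv.Perm.SameCycle.setoid φ ≤ s := by
  intro a b hab
  obtain ⟨i, -, hi⟩ := Equiv.Perm.SameCycle.exists_pow_eq' (f := φ) hab
  rw [← hi]
  clear hi
  induction i with
  | zero => exact s.refl' _
  | succ i ih => rw [pow_succ', Equiv.Perm.mul_apply]; exact s.trans' ih (h _)

/-- From `x` the new permutation follows the old orbit of `y`, which avoids `x`, all the way round
to `y`. -/
theorem sameCycle_mul_swap [Finite F] [DecidableEq F] {φ : Equiv.Perm F} (hxy : x ≠ y)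
    (h : ¬ φ.SameCycle x y) : (φ * Equiv.swap x y).SameCycle x y := by
  obtain ⟨b, hb, hby⟩ : ∃ b, 0 < b ∧ (φ ^ b) y = y :=
    ⟨orderOf φ, orderOf_pos φ, by rw [pow_orderOf_eq_one]; rfl⟩
  have hex : ∃ b, 0 < b ∧ (φ ^ b) y = y := ⟨b, hb, hby⟩
  have hs := Nat.find_spec hex
  have hm := fun {m} => Nat.find_min (H := hex) (m := m)
  set c := Nat.find hex
  have key : ∀ i, i + 1 ≤ c → ((φ * Equiv.swap x y) ^ (i + 1)) x = (φ ^ (i + 1)) y := by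
    intro i
    induction i with
    | zero => intro _; simp
    | succ i ih =>
      intro hi
      rw [pow_succ', Equiv.Perm.mul_apply, ih (by omega), Equiv.Perm.mul_apply,
        Equiv.swap_apply_of_ne_of_ne, pow_succ' φ (i + 1), Equiv.Perm.mul_apply]
      · intro h'
        exact h (Equiv.Perm.SameCycle.symm ⟨((i + 1 : ℕ) : ℤ), by rw [zpow_natCast]; exact h'⟩)
      · intro h'
        exact hm (by omega : i + 1 < c) ⟨by omega, h'⟩
  refine ⟨(c : ℕ), ?_⟩
  have := key (c - 1) (by omega)
  rw [Nat.sub_add_cancel hs.1] at this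
  rw [zpow_natCast, this, hs.2]

/-- From `x` the new permutation only visits `φ y, φ² y, …, x`, the arc of the old cycle leading
from `y` to `x`, and never `y` itself. -/
theorem not_sameCycle_mul_swap [Finite F] [DecidableEq F] {φ : Equiv.Perm F} (hxy : x ≠ y)
    (h : φ.SameCycle x y) : ¬ (φ * Equiv.swap x y).SameCycle x y := by
  have hex : ∃ b, (φ ^ b) y = x := by
    obtain ⟨i, -, hi⟩ := h.symm.exists_pow_eq'
    exact ⟨i, hi⟩
  have hs := Nat.find_spec hex
  have hm := fun {m} => Nat.find_min (H := hex) (m := m)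
  set b := Nat.find hex
  have hb : b ≠ 0 := by
    intro h0
    rw [h0] at hs
    exact hxy (by simpa using hs.symm)
  have hy : ∀ i, 0 < i → i ≤ b → (φ ^ i) y ≠ y := by
    intro i h0 hi h'
    refine hm (by omega : b - i < b) ?_
    rw [← hs]
    conv_rhs => rw [← Nat.sub_add_cancel hi, pow_add, Equiv.Perm.mul_apply, h']
  have key : ∀ i : ℕ, ∃ m, 0 < m ∧ m ≤ b ∧ ((φ * Equiv.swap x y) ^ i) x = (φ ^ m) y := by
    intro i
    induction i with
    | zero => exact ⟨b, by omega, le_rfl, by simpa using hs.symm⟩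
    | succ i ih =>
      obtain ⟨m, h0, h1, h2⟩ := ih
      rw [pow_succ', Equiv.Perm.mul_apply, h2, Equiv.Perm.mul_apply]
      rcases h1.lt_or_eq with h3 | h3
      · refine ⟨m + 1, by omega, h3, ?_⟩
        rw [Equiv.swap_apply_of_ne_of_ne (hm h3) (hy m h0 h1), pow_succ', Equiv.Perm.mul_apply]
      · refine ⟨1, one_pos, by omega, ?_⟩
        rw [h3, hs, Equiv.swap_apply_left, pow_one]
  intro h'
  obtain ⟨i, -, hi⟩ := h'.exists_pow_eq'
  obtain ⟨m, h0, h1, h2⟩ := key i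
  exact hy m h0 h1 (h2.symm.trans hi)

theorem joinSetoid_sameCycle [Finite F] [DecidableEq F] (φ : Equiv.Perm F) (x y : F) :
    joinSetoid (Equiv.Perm.SameCycle.setoid (φ * Equiv.swap x y)) x y ≤
      joinSetoid (Equiv.Perm.SameCycle.setoid φ) x y := by
  refine joinSetoid_le (sameCycle_le fun a => ?_) (joinSetoid_rel _ _ _)
  set R := joinSetoid (Equiv.Perm.SameCycle.setoid φ) x y
  have h1 : R a (Equiv.swap x y a) := by
    rcases eq_or_ne a x with rfl | hx
    · rw [Equiv.swap_apply_left]; exact joinSetoid_rel _ _ _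
    · rcases eq_or_ne a y with rfl | hy
      · rw [Equiv.swap_apply_right]; exact R.symm' (joinSetoid_rel _ _ _)
      · rw [Equiv.swap_apply_of_ne_of_ne hx hy]
  exact R.trans' h1 (le_joinSetoid _ _ _ (⟨1, by simp⟩ : φ.SameCycle _ _))

/-- Once `x` and `y` are joined, both permutations have the same orbits. Exactly one of the two had
`x` and `y` on one cycle beforehand, so the cycle numbers differ by one. -/
theorem cycleCount_mul_swap [Finite F] [DecidableEq F] (φ : Equiv.Perm F) (hxy : x ≠ y) :
    (φ.SameCycle x y ∧ cycleCount (φ * Equiv.swap x y) = cycleCount φ + 1) ∨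
      (¬ φ.SameCycle x y ∧ cycleCount (φ * Equiv.swap x y) + 1 = cycleCount φ) := by
  have hR : joinSetoid (Equiv.Perm.SameCycle.setoid (φ * Equiv.swap x y)) x y =
      joinSetoid (Equiv.Perm.SameCycle.setoid φ) x y := by
    refine le_antisymm (joinSetoid_sameCycle _ _ _) ?_
    have := joinSetoid_sameCycle (φ * Equiv.swap x y) x y
    rwa [mul_assoc, Equiv.swap_mul_self, mul_one] at this
  by_cases h : φ.SameCycle x y
  · refine Or.inl ⟨h, ?_⟩
    have h1 := card_joinSetoid (r := Equiv.Perm.SameCycle.setoid (φ * Equiv.swap x y))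
      (not_sameCycle_mul_swap hxy h)
    rw [hR, joinSetoid_eq_self (r := Equiv.Perm.SameCycle.setoid φ) h] at h1
    exact h1.symm
  · refine Or.inr ⟨h, ?_⟩
    have h1 := card_joinSetoid (r := Equiv.Perm.SameCycle.setoid φ) h
    rw [← hR, joinSetoid_eq_self (r := Equiv.Perm.SameCycle.setoid (φ * Equiv.swap x y))
      (sameCycle_mul_swap hxy h)] at h1
    exact h1

/-- Every cycle of `φ` carries a leg. The maps `leg` and `c` respect cycles and, since `c ∘ leg` is
the identity, induce a bijection between the cycles of `σ` and those of `φ`. -/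
theorem IsBoundary.numCycles_eq [Finite F] {n : ℕ} {φ : Equiv.Perm F} {leg : Fin n → F}
    {σ : Equiv.Perm (Fin n)} (hleg : Function.Injective leg) (h : IsBoundary φ leg σ) :
    numCycles σ = cycleCount φ := by
  obtain ⟨c, t, hc⟩ := h.exists_cert hleg
  have h1 : Equiv.Perm.SameCycle.setoid σ ≤
      Setoid.comap leg (Equiv.Perm.SameCycle.setoid φ) := by
    refine sameCycle_le fun l => ?_
    obtain ⟨s, hs, -⟩ := h.1 l
    exact ⟨(s + 1 : ℕ), by rw [zpow_natCast, hs]⟩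
  have h2 : Equiv.Perm.SameCycle.setoid φ ≤
      Setoid.comap c (Equiv.Perm.SameCycle.setoid σ) := by
    refine sameCycle_le fun f => ?_
    by_cases hf : ∀ l, f ≠ leg l
    · change σ.SameCycle _ _
      rw [hc.color f hf]
    · push Not at hf
      obtain ⟨l, rfl⟩ := hf
      change σ.SameCycle _ _
      rw [hc.color_leg, hc.next]
      exact ⟨1, by simp⟩
  refine Nat.card_congr (Equiv.ofBijective (Quotient.map' leg fun a b hab => h1 hab) ⟨?_, ?_⟩)
  · intro a b
    induction a using Quotient.inductionOn with | _ a => ?_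
    induction b using Quotient.inductionOn with | _ b => ?_
    intro hab
    have hab' : φ.SameCycle (leg a) (leg b) := Quotient.exact hab
    have : σ.SameCycle (c (leg a)) (c (leg b)) := h2 hab'
    rw [hc.color_leg, hc.color_leg] at this
    exact Quotient.sound this
  · intro q
    induction q using Quotient.inductionOn with | _ f => ?_
    obtain ⟨s, l, hs⟩ := h.2 f
    refine ⟨Quotient.mk _ l, Quotient.sound ?_⟩
    exact Equiv.Perm.SameCycle.symm ⟨(s : ℕ), by rw [zpow_natCast, hs]⟩

end CycleCount

/-! ### Connectedness, gluing of legs, and Euler's formula for ribbon graphs. -/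

namespace RibbonGraph

variable {n : ℕ}

theorem leg_injective (Γ : RibbonGraph n) : Function.Injective Γ.leg :=
  Γ.flagEquiv.injective.comp Sum.inr_injective

theorem inv_leg (Γ : RibbonGraph n) (l : Fin n) : Γ.inv (Γ.leg l) = Γ.leg l := by
  simp [inv, leg]

theorem inv_inl (Γ : RibbonGraph n) (e : Fin Γ.numEdge) (s : Fin 2) :
    Γ.inv (Γ.flagEquiv (Sum.inl (e, s))) = Γ.flagEquiv (Sum.inl (e, Equiv.swap 0 1 s)) := by
  simp [inv]

theorem inv_inv (Γ : RibbonGraph n) (f : Γ.Flag) : Γ.inv (Γ.inv f) = f := by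
  obtain ⟨x, rfl⟩ := Γ.flagEquiv.surjective f
  rcases x with ⟨e, s⟩ | l
  · rw [inv_inl, inv_inl, Equiv.swap_apply_self]
  · change Γ.inv (Γ.inv (Γ.leg l)) = Γ.leg l
    rw [inv_leg, inv_leg]

theorem rot_apply (Γ : RibbonGraph n) (v : Fin Γ.numVert) (i : Fin 3) :
    Γ.rot (v, i) = (v, i + 1) := by
  simp [rot, finRotate_apply]

theorem face_apply (Γ : RibbonGraph n) (f : Γ.Flag) : Γ.face f = Γ.rot (Γ.inv f) := rfl

/-- Flags in the same connected component. -/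
def conn (Γ : RibbonGraph n) : Setoid Γ.Flag :=
  MulAction.orbitRel (Subgroup.closure ({Γ.rot, Γ.inv} : Set (Equiv.Perm Γ.Flag))) Γ.Flag

theorem conn_iff (Γ : RibbonGraph n) (f g : Γ.Flag) : Γ.conn f g ↔
    ∃ w ∈ Subgroup.closure ({Γ.rot, Γ.inv} : Set (Equiv.Perm Γ.Flag)), w f = g := by
  rw [← Setoid.comm']
  constructor
  · rintro ⟨⟨w, hw⟩, h⟩
    exact ⟨w, hw, h⟩
  · rintro ⟨w, hw, h⟩
    exact ⟨⟨w, hw⟩, h⟩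

theorem conn_rot (Γ : RibbonGraph n) (f : Γ.Flag) : Γ.conn f (Γ.rot f) :=
  (conn_iff _ _ _).2 ⟨_, Subgroup.subset_closure (by simp), rfl⟩

theorem conn_inv (Γ : RibbonGraph n) (f : Γ.Flag) : Γ.conn f (Γ.inv f) :=
  (conn_iff _ _ _).2 ⟨_, Subgroup.subset_closure (by simp), rfl⟩

/-- `conn` is the least equivalence relation compatible with `rot` and `inv`; statements about
components are proved by testing these two generators. -/
theorem conn_le (Γ : RibbonGraph n) {s : Setoid Γ.Flag} (h1 : ∀ f, s f (Γ.rot f))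
    (h2 : ∀ f, s f (Γ.inv f)) : Γ.conn ≤ s := by
  have key : ∀ w ∈ Subgroup.closure ({Γ.rot, Γ.inv} : Set (Equiv.Perm Γ.Flag)), ∀ f, s f (w f) := by
    intro w hw
    induction hw using Subgroup.closure_induction with
    | mem w hw =>
      rcases hw with rfl | hw
      · exact h1
      · rw [Set.mem_singleton_iff.1 hw]; exact h2
    | one => exact fun f => s.refl' _
    | mul v w _ _ hv hw => exact fun f => s.trans' (hw f) (hv (w f))
    | inv w _ hw =>
      intro f
      have := hw (w⁻¹ f)
      rw [← Equiv.Perm.mul_apply, mul_inv_cancel, Equiv.Perm.one_apply] at this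
      exact s.symm' this
  intro f g hfg
  obtain ⟨w, hw, rfl⟩ := (conn_iff _ _ _).1 hfg
  exact key w hw f

theorem connected_iff (Γ : RibbonGraph n) :
    Γ.Connected ↔ Nonempty Γ.Flag ∧ ∀ f g, Γ.conn f g := by
  simp only [conn_iff, Connected]

/-- Detaching the last edge produces two new legs. -/
def glueEquiv (E n : ℕ) : (Fin (E + 1) × Fin 2) ⊕ Fin n ≃ (Fin E × Fin 2) ⊕ Fin (n + 2) where
  toFun := Sum.elim
    (fun p => Fin.lastCases (motive := fun _ => (Fin E × Fin 2) ⊕ Fin (n + 2))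
      (Sum.inr (Fin.castLE (by omega) p.2)) (fun e => Sum.inl (e, p.2)) p.1)
    (fun l => Sum.inr l.succ.succ)
  invFun := Sum.elim (fun p => Sum.inl (p.1.castSucc, p.2))
    (Fin.cases (Sum.inl (Fin.last E, 0)) (Fin.cases (Sum.inl (Fin.last E, 1)) Sum.inr))
  left_inv := by
    rintro (⟨e, s⟩ | l)
    · induction e using Fin.lastCases with
      | last => fin_cases s <;> simp <;> rfl
      | cast e => simp
    · simp
  right_inv := by
    rintro (⟨e, s⟩ | l)
    · simp
    · induction l using Fin.cases with
      | zero => simp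
      | succ l =>
        induction l using Fin.cases with
        | zero =>
          change Sum.elim _ _ (Sum.inl (Fin.last E, 1)) = _
          simp
          rfl
        | succ l => simp

/-- The graph in which the first two legs are joined to form a new last edge. -/
abbrev glue (Γ : RibbonGraph (n + 2)) : RibbonGraph n where
  numVert := Γ.numVert
  numEdge := Γ.numEdge + 1
  flagEquiv := (glueEquiv Γ.numEdge n).trans Γ.flagEquiv

theorem glue_rot (Γ : RibbonGraph (n + 2)) : Γ.glue.rot = Γ.rot := rfl

theorem glue_flagEquiv_cast (Γ : RibbonGraph (n + 2)) (e : Fin Γ.numEdge) (s : Fin 2) :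
    Γ.glue.flagEquiv (Sum.inl (e.castSucc, s)) = Γ.flagEquiv (Sum.inl (e, s)) := by
  change Γ.flagEquiv (glueEquiv _ _ _) = _
  congr 1
  simp [glueEquiv]

theorem glue_flagEquiv_last_zero (Γ : RibbonGraph (n + 2)) :
    Γ.glue.flagEquiv (Sum.inl (Fin.last _, 0)) = Γ.leg 0 := by
  change Γ.flagEquiv (glueEquiv _ _ _) = Γ.flagEquiv _
  congr 1
  simp [glueEquiv]

theorem glue_flagEquiv_last_one (Γ : RibbonGraph (n + 2)) :
    Γ.glue.flagEquiv (Sum.inl (Fin.last _, 1)) = Γ.leg 1 := by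
  change Γ.flagEquiv (glueEquiv _ _ _) = Γ.flagEquiv _
  congr 1
  simp [glueEquiv]
  rfl

theorem glue_inv_leg_zero (Γ : RibbonGraph (n + 2)) : Γ.glue.inv (Γ.leg 0) = Γ.leg 1 := by
  have := Γ.glue.inv_inl (Fin.last _) 0
  rwa [glue_flagEquiv_last_zero, Equiv.swap_apply_left, glue_flagEquiv_last_one] at this

theorem glue_inv_leg_one (Γ : RibbonGraph (n + 2)) : Γ.glue.inv (Γ.leg 1) = Γ.leg 0 := by
  rw [← glue_inv_leg_zero]; exact inv_inv _ _

theorem glue_inv_of_ne (Γ : RibbonGraph (n + 2)) (f : Γ.Flag) (h0 : f ≠ Γ.leg 0)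
    (h1 : f ≠ Γ.leg 1) : Γ.glue.inv f = Γ.inv f := by
  obtain ⟨x, rfl⟩ := Γ.flagEquiv.surjective f
  rcases x with ⟨e, s⟩ | l
  · have := Γ.glue.inv_inl e.castSucc s
    rwa [glue_flagEquiv_cast, glue_flagEquiv_cast, ← inv_inl] at this
  · induction l using Fin.cases with
    | zero => exact absurd rfl h0
    | succ l =>
      induction l using Fin.cases with
      | zero => exact absurd rfl h1
      | succ l => exact (Γ.glue.inv_leg l).trans (Γ.inv_leg _).symm

theorem glue_inv (Γ : RibbonGraph (n + 2)) :
    Γ.glue.inv = Γ.inv * Equiv.swap (Γ.leg 0) (Γ.leg 1) := by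
  refine Equiv.ext fun (f : Γ.Flag) => ?_
  rw [Equiv.Perm.mul_apply]
  by_cases h0 : f = Γ.leg 0
  · subst h0
    rw [Equiv.swap_apply_left, inv_leg]
    exact glue_inv_leg_zero Γ
  · by_cases h1 : f = Γ.leg 1
    · subst h1
      rw [Equiv.swap_apply_right, inv_leg]
      exact glue_inv_leg_one Γ
    · rw [Equiv.swap_apply_of_ne_of_ne h0 h1]
      exact glue_inv_of_ne Γ f h0 h1

/-- The bridge to permutations: with it `isBoundary_mul_swap_iff` and `cycleCount_mul_swap` apply to
the boundary of a glued graph. -/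
theorem glue_face (Γ : RibbonGraph (n + 2)) :
    Γ.glue.face = Γ.face * Equiv.swap (Γ.leg 0) (Γ.leg 1) := by
  rw [face, face, glue_inv, glue_rot]; rfl

/-- Reassembles any graph with an edge from one with an edge fewer; the basis of inductions on the
number of edges. -/
theorem exists_glue_eq (Γ : RibbonGraph n) {E : ℕ} (h : Γ.numEdge = E + 1) :
    ∃ Γ' : RibbonGraph (n + 2), Γ'.glue = Γ ∧ Γ'.numEdge = E := by
  obtain ⟨V, E', g⟩ := Γ
  simp only at h
  subst h
  refine ⟨⟨V, E, (glueEquiv E n).symm.trans g⟩, ?_, rfl⟩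
  simp [glue, ← Equiv.trans_assoc]

theorem glue_conn (Γ : RibbonGraph (n + 2)) :
    Γ.glue.conn = joinSetoid Γ.conn (Γ.leg 0) (Γ.leg 1) := by
  apply le_antisymm
  · refine conn_le _ (fun f => le_joinSetoid _ _ _ (Γ.conn_rot f)) fun f => ?_
    change joinSetoid Γ.conn (Γ.leg 0) (Γ.leg 1) f (Γ.glue.inv f)
    by_cases h0 : f = Γ.leg 0
    · subst h0
      rw [glue_inv_leg_zero]; exact joinSetoid_rel _ _ _
    · by_cases h1 : f = Γ.leg 1
      · subst h1
        rw [glue_inv_leg_one]; exact Setoid.symm' _ (joinSetoid_rel _ _ _)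
      · rw [glue_inv_of_ne Γ f h0 h1]
        exact le_joinSetoid _ _ _ (Γ.conn_inv f)
  · have h01 : Γ.glue.conn (Γ.leg 0) (Γ.leg 1) := by
      have := Γ.glue.conn_inv (Γ.leg 0)
      rwa [glue_inv_leg_zero] at this
    refine joinSetoid_le (conn_le _ (fun f => Γ.glue.conn_rot f) fun f => ?_) h01
    by_cases h0 : f = Γ.leg 0
    · subst h0; rw [inv_leg]
    · by_cases h1 : f = Γ.leg 1
      · subst h1; rw [inv_leg]
      · rw [← glue_inv_of_ne Γ f h0 h1]; exact Γ.glue.conn_inv f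

theorem cycleCount_rot (Γ : RibbonGraph n) : cycleCount Γ.rot = Γ.numVert := by
  have h1 : Equiv.Perm.SameCycle.setoid Γ.rot ≤ Setoid.ker Prod.fst :=
    sameCycle_le fun f => by obtain ⟨v, i⟩ := f; simp [Setoid.ker, Function.onFun, rot_apply]
  have : Nat.card (Quotient (Equiv.Perm.SameCycle.setoid Γ.rot)) = Nat.card (Fin Γ.numVert) := by
    refine Nat.card_congr (Equiv.ofBijective (Quotient.lift Prod.fst fun a b hab => h1 hab) ⟨?_, ?_⟩)
    · intro a b
      induction a using Quotient.inductionOn with | _ a => ?_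
      induction b using Quotient.inductionOn with | _ b => ?_
      obtain ⟨v, i⟩ := a
      obtain ⟨w, j⟩ := b
      rintro (rfl : v = w)
      refine Quotient.sound ?_
      change Γ.rot.SameCycle _ _
      have hij : ∀ i j : Fin 3, j = i ∨ j = i + 1 ∨ j = i + 1 + 1 := by decide
      rcases hij i j with rfl | rfl | rfl
      · exact Equiv.Perm.SameCycle.refl _ _
      · exact ⟨((1 : ℕ) : ℤ), by rw [zpow_natCast, pow_one, rot_apply]⟩
      · exact ⟨((2 : ℕ) : ℤ), by
          rw [zpow_natCast, pow_two, Equiv.Perm.mul_apply, rot_apply, rot_apply]⟩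
    · exact fun v => ⟨Quotient.mk _ (v, 0), rfl⟩
  simpa [cycleCount] using this

theorem sameCycle_face_le (Γ : RibbonGraph n) : Equiv.Perm.SameCycle.setoid Γ.face ≤ Γ.conn :=
  sameCycle_le fun f => Setoid.trans' _ (Γ.conn_inv f) (Γ.conn_rot _)

/-- Faces, vertices and components agree in number when there are no edges, and every insertion of
an edge preserves the balance. -/
theorem euler_inequality (E : ℕ) : ∀ {n : ℕ} (Γ : RibbonGraph n), Γ.numEdge = E →
    ∃ g, cycleCount Γ.face + Γ.numVert + 2 * g = 2 * Nat.card (Quotient Γ.conn) + E := by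
  induction E with
  | zero =>
    intro n Γ hE
    have hinv : ∀ f, Γ.inv f = f := by
      intro f
      obtain ⟨x, rfl⟩ := Γ.flagEquiv.surjective f
      rcases x with ⟨e, s⟩ | l
      · exact absurd e.2 (by omega)
      · exact Γ.inv_leg l
    have hface : Γ.face = Γ.rot := Equiv.ext fun f => by rw [face_apply, hinv]
    have hconn : Γ.conn = Equiv.Perm.SameCycle.setoid Γ.rot := by
      refine le_antisymm (conn_le _ (fun f => ⟨1, by simp⟩) fun f => ?_)
        (sameCycle_le Γ.conn_rot)
      rw [hinv]
    refine ⟨0, ?_⟩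
    have := cycleCount_rot Γ
    rw [hface, hconn]
    rw [cycleCount] at *
    omega
  | succ E ih =>
    intro n Γ hE
    obtain ⟨Γ', rfl, hE'⟩ := Γ.exists_glue_eq hE
    obtain ⟨g, hg⟩ := ih Γ' hE'
    have hne : Γ'.leg 0 ≠ Γ'.leg 1 := Γ'.leg_injective.ne (by simp)
    have key : ∃ g, cycleCount (Γ'.face * Equiv.swap (Γ'.leg 0) (Γ'.leg 1)) + Γ'.numVert + 2 * g =
        2 * Nat.card (Quotient (joinSetoid Γ'.conn (Γ'.leg 0) (Γ'.leg 1))) + (E + 1) := by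
      -- Within a component the new edge either splits a face, with the same `g`, or merges two
      -- faces, which raises `g` by one. Between two components it merges two faces and lowers the
      -- number of components.
      by_cases hc : Γ'.conn (Γ'.leg 0) (Γ'.leg 1)
      · rw [joinSetoid_eq_self hc]
        rcases cycleCount_mul_swap Γ'.face hne with ⟨-, h⟩ | ⟨-, h⟩
        · exact ⟨g, by omega⟩
        · exact ⟨g + 1, by omega⟩
      · have h1 := card_joinSetoid hc
        rcases cycleCount_mul_swap Γ'.face hne with ⟨h, -⟩ | ⟨-, h⟩
        · exact absurd (Γ'.sameCycle_face_le h) hc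
        · exact ⟨g, by omega⟩
    rw [glue_face, glue_conn]
    exact key

theorem genus_formula (Γ : RibbonGraph n) (hΓ : Γ.Connected) :
    ∃ g, Γ.numVert + cycleCount Γ.face + 2 * g = 2 + Γ.numEdge := by
  obtain ⟨g, hg⟩ := euler_inequality _ Γ rfl
  obtain ⟨⟨f⟩, h⟩ := (connected_iff Γ).1 hΓ
  have : Nat.card (Quotient Γ.conn) = 1 := by
    rw [Nat.card_eq_one_iff_exists]
    refine ⟨Quotient.mk _ f, fun q => ?_⟩
    induction q using Quotient.inductionOn with | _ a => exact Quotient.sound (h _ _)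
  exact ⟨g, by omega⟩

end RibbonGraph

/-! ### The inverse tensor of an odd scalar product. -/

section InverseTensor

variable {k A : Type*} [Field k] [AddCommGroup A] [Module k A] {𝒜 : ZMod 2 → Submodule k A}
  {β : LinearMap.BilinForm k A}

variable [DirectSum.Decomposition 𝒜] [FiniteDimensional k A]

/-- The sign of super symmetry is -1 only for two odd vectors, and on these an odd form vanishes. -/
theorem IsOddScalarProduct.comm (hβ : IsOddScalarProduct 𝒜 β) (a b : A) : β a b = β b a := by
  have h : β = β.flip := by
    refine (homBasis 𝒜).ext fun i => (homBasis 𝒜).ext fun j => ?_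
    change _ = β (homBasis 𝒜 j) (homBasis 𝒜 i)
    rcases zmod_two_cases (i.1 * j.1) with h | h
    · rw [hβ.symm _ _ _ _ (homBasis_mem 𝒜 i) (homBasis_mem 𝒜 j), h, sgn_zero, one_mul]
    · have hij : i.1 = j.1 := by
        revert h; generalize i.1 = a; generalize j.1 = b; revert a b; decide
      have hj := homBasis_mem 𝒜 j
      rw [← hij] at hj
      rw [hβ.odd _ _ _ (homBasis_mem 𝒜 i) hj, hβ.odd _ _ _ hj (homBasis_mem 𝒜 i)]
  exact congrFun (congrArg DFunLike.coe (congrFun (congrArg DFunLike.coe h) a)) b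

theorem inverseTensor_mul (hβ : IsOddScalarProduct 𝒜 β) :
    inverseTensor 𝒜 β * Matrix.of (fun i j => β (homBasis 𝒜 i) (homBasis 𝒜 j)) = 1 := by
  refine Matrix.nonsing_inv_mul _ ?_
  have h := hβ.nondegenerate.toMatrix (homBasis 𝒜)
  rw [Matrix.nondegenerate_iff_det_ne_zero] at h
  rw [isUnit_iff_ne_zero]
  convert h using 2
  ext i j
  simp [LinearMap.BilinForm.toMatrix_apply]

theorem inverseTensor_symm (hβ : IsOddScalarProduct 𝒜 β) (i j : HomIdx 𝒜) :
    inverseTensor 𝒜 β i j = inverseTensor 𝒜 β j i := by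
  have h : (Matrix.of fun i j => β (homBasis 𝒜 i) (homBasis 𝒜 j)).transpose =
      Matrix.of fun i j => β (homBasis 𝒜 i) (homBasis 𝒜 j) := by
    ext i j; simp [hβ.comm (homBasis 𝒜 i)]
  have h2 : (inverseTensor 𝒜 β).transpose = inverseTensor 𝒜 β := by
    rw [inverseTensor, Matrix.transpose_nonsing_inv, h]
  exact congrFun (congrFun h2 j) i

/-- The expansion of a vector by means of the scalar product. -/
theorem inverseTensor_expand (hβ : IsOddScalarProduct 𝒜 β) {N : Type*} [AddCommGroup N]
    [Module k N] (T : A →ₗ[k] N) (a : A) :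
    ∑ i, ∑ j, (inverseTensor 𝒜 β i j * β (homBasis 𝒜 i) a) • T (homBasis 𝒜 j) = T a := by
  have key : ∀ l, ∑ i, ∑ j, (inverseTensor 𝒜 β i j * β (homBasis 𝒜 i) (homBasis 𝒜 l)) •
      T (homBasis 𝒜 j) = T (homBasis 𝒜 l) := by
    intro l
    rw [Finset.sum_comm]
    have h : ∀ j, ∑ i, (inverseTensor 𝒜 β i j * β (homBasis 𝒜 i) (homBasis 𝒜 l)) =
        if j = l then 1 else 0 := by
      intro j
      have := congrFun (congrFun (inverseTensor_mul hβ) j) l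
      rw [Matrix.mul_apply, Matrix.one_apply] at this
      rw [← this]
      exact Finset.sum_congr rfl fun i _ => by rw [inverseTensor_symm hβ i j]; rfl
    simp only [← Finset.sum_smul, h]
    simp
  have h : ∑ i, ∑ j, inverseTensor 𝒜 β i j • (β (homBasis 𝒜 i)).smulRight (T (homBasis 𝒜 j)) = T := by
    refine (homBasis 𝒜).ext fun l => ?_
    rw [← key l]
    simp [LinearMap.sum_apply, smul_smul]
  conv_rhs => rw [← h]
  simp [LinearMap.sum_apply, smul_smul]

/-- Conjugation by the parity matrix `s` negates the Gram matrix, hence also its inverse. Entries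
between vectors of equal parity then equal their own negatives. -/
theorem inverseTensor_parity [CharZero k] (hβ : IsOddScalarProduct 𝒜 β) {i j : HomIdx 𝒜}
    (hij : i.1 = j.1) : inverseTensor 𝒜 β i j = 0 := by
  set G := Matrix.of (fun i j => β (homBasis 𝒜 i) (homBasis 𝒜 j))
  set s : Matrix (HomIdx 𝒜) (HomIdx 𝒜) k := Matrix.diagonal fun i => sgn k i.1
  have hs : s * s = 1 := by
    rw [Matrix.diagonal_mul_diagonal]
    simp only [sgn_mul_self, Matrix.diagonal_one]
  have hG : s * G * s = -G := by
    ext a b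
    rw [Matrix.mul_diagonal, Matrix.diagonal_mul, Matrix.neg_apply]
    change sgn k a.1 * β _ _ * sgn k b.1 = - β _ _
    rcases eq_or_ne a.1 b.1 with h | h
    · have hb := homBasis_mem 𝒜 b
      rw [← h] at hb
      rw [hβ.odd _ _ _ (homBasis_mem 𝒜 a) hb]; simp
    · have : sgn k a.1 * sgn k b.1 = -1 := by
        rw [← sgn_add, ← sgn_one]; congr 1
        revert h; generalize a.1 = a; generalize b.1 = b; revert a b; decide
      linear_combination (β (homBasis 𝒜 a) (homBasis 𝒜 b)) * this
  have h1 : inverseTensor 𝒜 β * G = 1 := inverseTensor_mul hβ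
  have h2 : s * inverseTensor 𝒜 β * s = -inverseTensor 𝒜 β := by
    have h3 : G * inverseTensor 𝒜 β = 1 := mul_eq_one_comm.1 h1
    calc s * inverseTensor 𝒜 β * s = s * inverseTensor 𝒜 β * s * (G * inverseTensor 𝒜 β) := by
          rw [h3, mul_one]
      _ = s * inverseTensor 𝒜 β * (s * G * s) * s * inverseTensor 𝒜 β := by
          simp only [mul_assoc]; rw [← mul_assoc s s, hs, one_mul]
      _ = -(s * (inverseTensor 𝒜 β * G) * s * inverseTensor 𝒜 β) := by
          rw [hG]; simp [mul_assoc]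
      _ = -inverseTensor 𝒜 β := by rw [h1, mul_one, hs, one_mul]
  have h4 := congrFun (congrFun h2 i) j
  rw [Matrix.mul_diagonal, Matrix.diagonal_mul, Matrix.neg_apply, ← hij] at h4
  have h5 : inverseTensor 𝒜 β i j = - inverseTensor 𝒜 β i j := by
    linear_combination h4 - inverseTensor 𝒜 β i j * sgn_mul_self (k := k) i.1
  simpa [eq_neg_iff_add_eq_zero, ← two_mul] using h5

/-- Moving an operator from the first to the second factor of the inverse tensor. -/
theorem inverseTensor_adjoint (hβ : IsOddScalarProduct 𝒜 β) {L L' : A →ₗ[k] A}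
    (h : ∀ a b, β (L a) b = β a (L' b)) (T : A →ₗ[k] A →ₗ[k] k) :
    ∑ i, ∑ j, inverseTensor 𝒜 β i j * T (L (homBasis 𝒜 i)) (homBasis 𝒜 j) =
      ∑ i, ∑ j, inverseTensor 𝒜 β i j * T (homBasis 𝒜 i) (L' (homBasis 𝒜 j)) := by
  have h1 : ∀ i j, T (L (homBasis 𝒜 i)) (homBasis 𝒜 j) = ∑ u, ∑ v, inverseTensor 𝒜 β u v *
      β (homBasis 𝒜 i) (L' (homBasis 𝒜 u)) * T (homBasis 𝒜 v) (homBasis 𝒜 j) := by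
    intro i j
    have := inverseTensor_expand hβ (T.flip (homBasis 𝒜 j)) (L (homBasis 𝒜 i))
    simp only [LinearMap.flip_apply, smul_eq_mul] at this
    rw [← this]
    refine Finset.sum_congr rfl fun u _ => Finset.sum_congr rfl fun v _ => ?_
    rw [hβ.comm, h]
  have h2 : ∀ u v, T (homBasis 𝒜 v) (L' (homBasis 𝒜 u)) = ∑ i, ∑ j, inverseTensor 𝒜 β i j *
      β (homBasis 𝒜 i) (L' (homBasis 𝒜 u)) * T (homBasis 𝒜 v) (homBasis 𝒜 j) := by
    intro u v
    exact (inverseTensor_expand hβ (T (homBasis 𝒜 v)) (L' (homBasis 𝒜 u))).symm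
  simp only [h1]
  rw [Finset.sum_comm (f := fun i j => inverseTensor 𝒜 β i j * T (homBasis 𝒜 i) _)]
  simp only [h2, Finset.mul_sum]
  rw [Finset.sum_comm]
  have h3 : ∀ f : HomIdx 𝒜 → HomIdx 𝒜 → HomIdx 𝒜 → HomIdx 𝒜 → k,
      ∑ j, ∑ i, ∑ u, ∑ v, f j i u v = ∑ u, ∑ v, ∑ i, ∑ j, f j i u v := by
    intro f
    rw [Finset.sum_comm]
    simp only [← Fintype.sum_prod_type']
    exact Fintype.sum_equiv ⟨fun x => ⟨x.2.2.1, x.2.2.2, x.1, x.2.1⟩,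
      fun x => ⟨x.2.2.1, x.2.2.2, x.1, x.2.1⟩, fun x => rfl, fun x => rfl⟩ _ _ (fun x => rfl)
  rw [h3]
  refine Finset.sum_congr rfl fun u _ => Finset.sum_congr rfl fun v _ =>
    Finset.sum_congr rfl fun i _ => Finset.sum_congr rfl fun j _ => ?_
  rw [inverseTensor_symm hβ v u]
  ring

variable (𝒜) in
/-- The parity operator. -/
def parityOp : A →ₗ[k] A := (homBasis 𝒜).constr k fun i => sgn k i.1 • homBasis 𝒜 i

theorem parityOp_basis (i : HomIdx 𝒜) :
    parityOp 𝒜 (homBasis 𝒜 i) = sgn k i.1 • homBasis 𝒜 i := by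
  simp [parityOp]

theorem homBasis_repr_of_mem {p : ZMod 2} {a : A} (ha : a ∈ 𝒜 p) {i : HomIdx 𝒜}
    (hi : i.1 ≠ p) : (homBasis 𝒜).repr a i = 0 := by
  rw [homBasis, DirectSum.IsInternal.collectedBasis_repr_of_mem_ne _ _ hi.symm ha]

theorem parityOp_of_mem {p : ZMod 2} {a : A} (ha : a ∈ 𝒜 p) : parityOp 𝒜 a = sgn k p • a := by
  conv_lhs => rw [← (homBasis 𝒜).sum_repr a, map_sum]
  conv_rhs => rw [← (homBasis 𝒜).sum_repr a, Finset.smul_sum]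
  refine Finset.sum_congr rfl fun i _ => ?_
  rw [map_smul, parityOp_basis, smul_comm]
  by_cases hi : i.1 = p
  · rw [hi]
  · rw [homBasis_repr_of_mem ha hi]; simp

/-- Bilinear identities can be checked on homogeneous vectors. -/
theorem bilin_ext {T T' : A →ₗ[k] A →ₗ[k] k}
    (h : ∀ i j a b, a ∈ 𝒜 i → b ∈ 𝒜 j → T a b = T' a b) (a b : A) : T a b = T' a b := by
  have : T = T' := (homBasis 𝒜).ext fun i => (homBasis 𝒜).ext fun j =>
    h _ _ _ _ (homBasis_mem 𝒜 i) (homBasis_mem 𝒜 j)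
  rw [this]

end InverseTensor

/-! ### Symmetry and differential of the propagator. -/

section Propagator

variable {k A : Type*} [Field k] [NonUnitalRing A] [Module k A]
  {𝒜 : ZMod 2 → Submodule k A} [DirectSum.Decomposition 𝒜] [FiniteDimensional k A]
  {M : CyclicDGAlgebra 𝒜} (h : Homotopy M)

theorem propagator_apply (i j : HomIdx 𝒜) : propagator h i j =
    -∑ l, (homBasis 𝒜).repr (h.H (homBasis 𝒜 l)) i * inverseTensor 𝒜 M.form l j := by
  rw [propagator, Matrix.neg_apply, Matrix.mul_apply]
  simp [LinearMap.toMatrix_apply]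

theorem sum_propagator (T : A →ₗ[k] A →ₗ[k] k) :
    ∑ i, ∑ j, propagator h i j * T (homBasis 𝒜 i) (homBasis 𝒜 j) =
      -∑ i, ∑ j, inverseTensor 𝒜 M.form i j * T (h.H (homBasis 𝒜 i)) (homBasis 𝒜 j) := by
  have h1 : ∀ l j, T (h.H (homBasis 𝒜 l)) (homBasis 𝒜 j) = ∑ i,
      (homBasis 𝒜).repr (h.H (homBasis 𝒜 l)) i * T (homBasis 𝒜 i) (homBasis 𝒜 j) := by
    intro l j
    conv_lhs => rw [← (homBasis 𝒜).sum_repr (h.H (homBasis 𝒜 l))]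
    simp only [map_sum, map_smul, LinearMap.sum_apply, LinearMap.smul_apply, smul_eq_mul]
  simp only [propagator_apply, h1, Finset.mul_sum, Finset.sum_mul, neg_mul, Finset.sum_neg_distrib]
  congr 1
  have h3 : ∀ f : HomIdx 𝒜 → HomIdx 𝒜 → HomIdx 𝒜 → k,
      ∑ i, ∑ j, ∑ l, f i j l = ∑ l, ∑ j, ∑ i, f i j l := by
    intro f
    simp only [← Fintype.sum_prod_type']
    exact Fintype.sum_equiv ⟨fun x => ⟨x.2.2, x.2.1, x.1⟩,
      fun x => ⟨x.2.2, x.2.1, x.1⟩, fun x => rfl, fun x => rfl⟩ _ _ (fun x => rfl)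
  rw [h3]
  refine Finset.sum_congr rfl fun u _ => Finset.sum_congr rfl fun v _ =>
    Finset.sum_congr rfl fun i _ => ?_
  ring

theorem propagator_parity [CharZero k] {i j : HomIdx 𝒜} (hij : i.1 ≠ j.1) :
    propagator h i j = 0 := by
  rw [propagator_apply, Finset.sum_eq_zero, neg_zero]
  intro l _
  by_cases hl : l.1 = j.1
  · rw [inverseTensor_parity M.form_odd hl, mul_zero]
  · rw [homBasis_repr_of_mem (h.H_mem _ _ (homBasis_mem 𝒜 l)), zero_mul]
    revert hij hl; generalize i.1 = a; generalize j.1 = b; generalize l.1 = c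
    revert a b c; decide

/-- Selfadjointness says that the adjoint of `H` for the form is `H` composed with the parity
operator. Moving `H` across `β^∨` exchanges the two tensor factors and leaves the sign of super
symmetry. -/
theorem propagator_symm [CharZero k] (i j : HomIdx 𝒜) :
    propagator h i j = sgn k ((i.1 + 1) * (j.1 + 1)) * propagator h j i := by
  by_cases hij : i.1 = j.1
  swap
  · rw [propagator_parity h hij, propagator_parity h (Ne.symm hij), mul_zero]
  have hadj : ∀ a b, M.form (h.H a) b = M.form a ((h.H ∘ₗ parityOp 𝒜) b) := by
    refine bilin_ext (𝒜 := 𝒜) (T := M.form ∘ₗ h.H) (T' := M.form.compl₂ (h.H ∘ₗ parityOp 𝒜)) ?_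
    intro p q a b ha hb
    simp only [LinearMap.comp_apply, LinearMap.compl₂_apply]
    rw [h.H_selfadjoint p a b ha, parityOp_of_mem hb, map_smul, map_smul, smul_eq_mul]
    -- The sign attached to `a` is replaced by the one attached to `b`; this is harmless because the
    -- form of `a` and `H b` vanishes unless `a` and `b` have equal parity.
    by_cases hpq : p = q
    · rw [hpq]
    · have hq : q + 1 = p := by
        have : ∀ p q : ZMod 2, p ≠ q → q + 1 = p := by decide
        exact this p q hpq
      have h3 : M.form a (h.H b) = 0 := M.form_odd.odd p a _ ha (hq ▸ h.H_mem q b hb)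
      rw [h3, mul_zero, mul_zero]
  have h1 := inverseTensor_adjoint M.form_odd hadj
    (((homBasis 𝒜).coord i).smulRight ((homBasis 𝒜).coord j))
  have h2 : ∀ a b, (((homBasis 𝒜).coord i).smulRight ((homBasis 𝒜).coord j)) a b =
      (homBasis 𝒜).repr a i * (homBasis 𝒜).repr b j := fun a b => by simp
  simp only [h2, Module.Basis.repr_self, LinearMap.comp_apply, parityOp_basis, map_smul,
    Finsupp.smul_apply, smul_eq_mul, Finsupp.single_apply, mul_ite, ite_mul, mul_one, mul_zero,
    one_mul, zero_mul, Finset.sum_ite_eq', Finset.mem_univ, if_true] at h1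
  rw [Finset.sum_comm (γ := HomIdx 𝒜)] at h1
  simp only [Finset.sum_ite_eq', Finset.sum_ite_eq, Finset.mem_univ, if_true] at h1
  rw [propagator_apply, propagator_apply, mul_neg, Finset.mul_sum]
  congr 1
  trans ∑ x, inverseTensor 𝒜 M.form x j * (homBasis 𝒜).repr (h.H (homBasis 𝒜 x)) i
  · exact Finset.sum_congr rfl fun l _ => mul_comm _ _
  · rw [h1]
    refine Finset.sum_congr rfl fun l _ => ?_
    by_cases hl : l.1 = i.1
    · rw [inverseTensor_parity M.form_odd hl, inverseTensor_parity M.form_odd hl.symm]; simp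
    · have : (i.1 + 1) * (j.1 + 1) = l.1 := by
        revert hij hl; generalize i.1 = a; generalize j.1 = b; generalize l.1 = c
        revert a b c; decide
      rw [this, inverseTensor_symm M.form_odd i l]
      ring

/-- Acting on the first factor, `d` produces `d H`. Acting on the second it can be moved by the
invariance of the form to the first, where it produces `H d`. Together they give `d H + H d = Id -
P`. -/
theorem sum_propagator_d [CharZero k] (T : A →ₗ[k] A →ₗ[k] k) :
    ∑ i, ∑ j, propagator h i j * (T (M.d (homBasis 𝒜 i)) (homBasis 𝒜 j) +
        sgn k (i.1 + 1) * T (homBasis 𝒜 i) (M.d (homBasis 𝒜 j))) =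
      -∑ i, ∑ j, inverseTensor 𝒜 M.form i j * (T (homBasis 𝒜 i) (homBasis 𝒜 j) -
        T (h.P (homBasis 𝒜 i)) (homBasis 𝒜 j)) := by
  have h1 := sum_propagator h (T ∘ₗ M.d)
  have h2 := sum_propagator h ((T ∘ₗ parityOp 𝒜).compl₂ M.d)
  -- Invariance of the form, read as: `d` is the adjoint of minus `d` composed with the parity
  -- operator.
  have hadj : ∀ a b, M.form ((-(M.d ∘ₗ parityOp 𝒜)) a) b = M.form a (M.d b) := by
    refine bilin_ext (𝒜 := 𝒜) (T := M.form ∘ₗ (-(M.d ∘ₗ parityOp 𝒜))) (T' := M.form.compl₂ M.d) ?_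
    intro p q a b ha hb
    simp only [LinearMap.comp_apply, LinearMap.compl₂_apply, LinearMap.neg_apply, map_neg,
      parityOp_of_mem ha, map_smul, LinearMap.smul_apply, smul_eq_mul]
    have h3 := M.form_d p a b ha
    have h4 := sgn_mul_self (k := k) p
    linear_combination (-sgn k p) * h3 + (M.form a (M.d b)) * h4
  have h3 := inverseTensor_adjoint M.form_odd hadj (T ∘ₗ parityOp 𝒜 ∘ₗ h.H)
  simp only [LinearMap.comp_apply, LinearMap.compl₂_apply] at h1 h2 h3
  rw [← h3] at h2
  have h4 : ∀ i, parityOp 𝒜 (h.H ((-(M.d ∘ₗ parityOp 𝒜)) (homBasis 𝒜 i))) =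
      -h.H (M.d (homBasis 𝒜 i)) := by
    intro i
    have hi := homBasis_mem 𝒜 i
    rw [LinearMap.neg_apply, LinearMap.comp_apply, parityOp_of_mem hi, map_smul, map_neg, map_smul,
      map_neg, map_smul, parityOp_of_mem (h.H_mem _ _ (M.d_mem _ _ hi)), smul_smul]
    have : i.1 + 1 + 1 = i.1 := by generalize i.1 = a; revert a; decide
    rw [this, sgn_mul_self, one_smul]
  simp only [h4] at h2
  simp only [parityOp_basis, map_smul, map_neg, LinearMap.smul_apply, LinearMap.neg_apply,
    smul_eq_mul, mul_neg, Finset.sum_neg_distrib, neg_neg] at h2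
  simp only [mul_add, Finset.sum_add_distrib, h1, sgn_add_one, neg_mul, mul_neg,
    Finset.sum_neg_distrib, h2]
  rw [← neg_add, ← Finset.sum_add_distrib]
  congr 1
  refine Finset.sum_congr rfl fun i _ => ?_
  rw [← Finset.sum_add_distrib]
  refine Finset.sum_congr rfl fun j _ => ?_
  rw [h.P_eq, map_sub, map_add, LinearMap.sub_apply, LinearMap.add_apply]
  ring

/-- The signs from moving `d` and `H` across the form cancel in `d H + H d`, the two summands being
exchanged. -/
theorem P_selfadjoint (a b : A) : M.form (h.P a) b = M.form a (h.P b) := by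
  refine bilin_ext (𝒜 := 𝒜) (T := M.form ∘ₗ h.P) (T' := M.form.compl₂ h.P) ?_ a b
  intro p q a b ha hb
  simp only [LinearMap.comp_apply, LinearMap.compl₂_apply, h.P_eq, map_sub, map_add,
    LinearMap.sub_apply, LinearMap.add_apply]
  have h1 := M.form_d (p + 1) (h.H a) b (h.H_mem _ _ ha)
  have h2 := h.H_selfadjoint p a (M.d b) ha
  have h3 := h.H_selfadjoint (p + 1) (M.d a) b (M.d_mem _ _ ha)
  have h4 := M.form_d p a (h.H b) ha
  have h5 := sgn_mul_self (k := k) p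
  rw [sgn_add_one] at h1 h3
  rw [h2] at h1
  linear_combination -h1 - h3 + sgn k p * h4 - (M.form a (M.d (h.H b)) + M.form a (h.H (M.d b))) * h5

variable {B : Type*} [AddCommGroup B] [Module k B] {ℬ : ZMod 2 → Submodule k B}
  [DirectSum.Decomposition ℬ] [FiniteDimensional k B]

/-- Both tensors represent the projection `P`. Expanding `P a` in the basis of `B` involves the form
with vectors fixed by the selfadjoint `P`, so `P` drops out of the coefficients. -/
theorem sum_inverseTensor_incl {R : CyclicAInfinity ℬ} {incl : B →ₗ[k] A}
    (hm : IsTreeModel R h incl) (T : A →ₗ[k] A →ₗ[k] k) :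
    ∑ i, ∑ j, inverseTensor ℬ R.form i j * T (incl (homBasis ℬ i)) (incl (homBasis ℬ j)) =
      ∑ i, ∑ j, inverseTensor 𝒜 M.form i j * T (h.P (homBasis 𝒜 i)) (homBasis 𝒜 j) := by
  have hP : ∀ b, h.P (incl b) = incl b := by
    intro b
    have : incl b ∈ LinearMap.range h.P := by rw [← hm.range_incl]; exact ⟨b, rfl⟩
    obtain ⟨a, ha⟩ := this
    rw [← ha, h.P_idem]
  have h1 : ∀ a (T : A →ₗ[k] k), T (h.P a) = ∑ i, ∑ j, inverseTensor ℬ R.form i j *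
      M.form (incl (homBasis ℬ i)) a * T (incl (homBasis ℬ j)) := by
    intro a T
    have : h.P a ∈ LinearMap.range incl := by rw [hm.range_incl]; exact ⟨a, rfl⟩
    obtain ⟨b, hb⟩ := this
    have h2 := inverseTensor_expand R.form_odd (T ∘ₗ incl) b
    rw [LinearMap.comp_apply, hb] at h2
    rw [← h2]
    refine Finset.sum_congr rfl fun i _ => Finset.sum_congr rfl fun j _ => ?_
    rw [LinearMap.comp_apply, smul_eq_mul, hm.form_incl, hb, ← P_selfadjoint, hP]
  have h2 : ∀ i j, T (incl (homBasis ℬ i)) (incl (homBasis ℬ j)) = ∑ u, ∑ v,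
      inverseTensor 𝒜 M.form u v * M.form (homBasis 𝒜 u) (incl (homBasis ℬ j)) *
        T (incl (homBasis ℬ i)) (homBasis 𝒜 v) := fun i j =>
    (inverseTensor_expand M.form_odd (T (incl (homBasis ℬ i))) (incl (homBasis ℬ j))).symm
  have h3 : ∀ u v, T (h.P (homBasis 𝒜 u)) (homBasis 𝒜 v) = _ :=
    fun u v => h1 (homBasis 𝒜 u) (T.flip (homBasis 𝒜 v))
  simp only [h2, h3, Finset.mul_sum, LinearMap.flip_apply]
  simp only [← Fintype.sum_prod_type']
  refine Fintype.sum_equiv ⟨fun x => ⟨x.2.2.1, x.2.2.2, x.2.1, x.1⟩,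
      fun x => ⟨x.2.2.2, x.2.2.1, x.1, x.2.1⟩, fun x => rfl, fun x => rfl⟩ _ _ (fun x => ?_)
  obtain ⟨i, j, u, v⟩ := x
  simp only [Equiv.coe_fn_mk]
  rw [inverseTensor_symm R.form_odd j i, M.form_odd.comm (incl _) (homBasis 𝒜 u)]
  ring

end Propagator

/-! ### The order of flags by vertices and Koszul signs of juxtaposed blocks. -/

/-- The order of the flags by vertices. -/
def flagRank {V : ℕ} (f : Fin V × Fin 3) : ℕ := 3 * f.1 + f.2

theorem flagRank_injective {V : ℕ} : Function.Injective (flagRank (V := V)) := by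
  rintro ⟨v, i⟩ ⟨w, j⟩ h
  simp only [flagRank] at h
  ext <;> simp <;> omega

theorem koszulSign_sum {k : Type*} [CommRing k] {X Y : Type*} [Fintype X] [Fintype Y]
    {r s : X ⊕ Y → ℕ} {q : X ⊕ Y → ZMod 2}
    (h1 : ∀ x y, r (Sum.inl x) < r (Sum.inr y)) (h2 : ∀ x y, s (Sum.inl x) < s (Sum.inr y)) :
    koszulSign k r s q = koszulSign k (r ∘ Sum.inl) (s ∘ Sum.inl) (q ∘ Sum.inl) *
      koszulSign k (r ∘ Sum.inr) (s ∘ Sum.inr) (q ∘ Sum.inr) := by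
  unfold koszulSign
  simp only [Fintype.prod_prod_type, Fintype.prod_sum_type, Function.comp]
  have h3 : ∀ x y, ¬ (r (Sum.inl x) < r (Sum.inr y) ∧ s (Sum.inr y) < s (Sum.inl x)) :=
    fun x y h => absurd h.2 (h2 x y).not_gt
  have h4 : ∀ x y, ¬ (r (Sum.inr y) < r (Sum.inl x) ∧ s (Sum.inl x) < s (Sum.inr y)) :=
    fun x y h => absurd h.1 (h1 x y).not_gt
  simp only [h3, h4, if_false, Finset.prod_const_one, mul_one, one_mul]

/-! ### The product of the three-tensors at the vertices. -/

section Vertices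

variable {k A : Type*} [Field k] [NonUnitalRing A] [Module k A]
  {𝒜 : ZMod 2 → Submodule k A} (M : CyclicDGAlgebra 𝒜)

theorem threeTensor_eq_zero {i j l : ZMod 2} {a b c : A} (ha : a ∈ 𝒜 i) (hb : b ∈ 𝒜 j)
    (hc : c ∈ 𝒜 l) (h : (i + 1) + (j + 1) + (l + 1) ≠ 0) : threeTensor M.form j a b c = 0 := by
  have h1 : l = i + j := by
    have : ∀ i j l : ZMod 2, (i + 1) + (j + 1) + (l + 1) ≠ 0 → l = i + j := by decide
    exact this i j l h
  subst h1
  rw [threeTensor, M.form_odd.odd _ _ _ (M.mul_mem _ _ _ _ ha hb) hc, mul_zero]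

/-- The product of the three-tensors at the vertices. -/
def vertexWeight {V : ℕ} (p : Fin V × Fin 3 → ZMod 2) (y : Fin V × Fin 3 → A) : k :=
  ∏ v, threeTensor M.form (p (v, 1)) (y (v, 0)) (y (v, 1)) (y (v, 2))

theorem vertexWeight_eq_zero {V : ℕ} {p : Fin V × Fin 3 → ZMod 2} {y : Fin V × Fin 3 → A}
    (hy : ∀ f, y f ∈ 𝒜 (p f)) (v : Fin V) (hv : ∑ i, (p (v, i) + 1) ≠ 0) :
    vertexWeight M p y = 0 := by
  refine Finset.prod_eq_zero (Finset.mem_univ v) ?_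
  rw [Fin.sum_univ_three] at hv
  exact threeTensor_eq_zero M (hy _) (hy _) (hy _) hv

/-- The double product is the Koszul sign of rotating three letters by `o`; the cyclicity axiom,
used once for each of two positions, supplies the rotations by 1 and 2. -/
theorem threeTensor_rotate {p : Fin 3 → ZMod 2} {y : Fin 3 → A} (hy : ∀ i, y i ∈ 𝒜 (p i))
    (o : Fin 3) :
    (∏ i : Fin 3, ∏ j : Fin 3, if (i : ℕ) < j ∧ ((j + o : Fin 3) : ℕ) < ((i + o : Fin 3) : ℕ) then
      sgn k ((p i + 1) * (p j + 1)) else 1) * threeTensor M.form (p 1) (y 0) (y 1) (y 2) =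
    threeTensor M.form (p (1 - o)) (y (0 - o)) (y (1 - o)) (y (2 - o)) := by
  have h1 := M.cyclic _ _ _ _ _ _ (hy 0) (hy 1) (hy 2)
  have h2 := M.cyclic _ _ _ _ _ _ (hy 1) (hy 2) (hy 0)
  have hs := fun a => sgn_mul_self (k := k) a
  fin_cases o
  · simp [Fin.prod_univ_three]
  · simp only [Fin.prod_univ_three]
    have e1 : (1 : Fin 3) - 1 = 0 := rfl
    have e2 : (0 : Fin 3) - 1 = 2 := rfl
    have e3 : (2 : Fin 3) - 1 = 1 := rfl
    simp [e2, e3]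
    rw [h1, ← mul_assoc, ← sgn_add]
    have : (p 0 + 1) * (p 2 + 1) + (p 1 + 1) * (p 2 + 1) = (p 2 + 1) * (p 0 + p 1) := by
      generalize p 0 = a; generalize p 1 = b; generalize p 2 = c; revert a b c; decide
    rw [this, hs, one_mul]
  · simp only [Fin.prod_univ_three]
    have e1 : (1 : Fin 3) - 2 = 2 := rfl
    have e2 : (0 : Fin 3) - 2 = 1 := rfl
    have e3 : (2 : Fin 3) - 2 = 0 := rfl
    have e4 : (1 : Fin 3) + 2 = 0 := rfl
    have e5 : (2 : Fin 3) + 2 = 1 := rfl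
    simp [e1, e2, e4, e5]
    rw [h2, ← sgn_add]
    congr 2
    generalize p 0 = a; generalize p 1 = b; generalize p 2 = c; revert a b c; decide

/-- Invariance of the product of the three-tensors under permutations of the vertices and rotations
at the vertices. -/
theorem vertexWeight_equiv {V V' : ℕ} (τ : Fin V × Fin 3 ≃ Fin V' × Fin 3)
    (hτ : ∀ v i, τ (v, i + 1) = ((τ (v, i)).1, (τ (v, i)).2 + 1))
    {p : Fin V' × Fin 3 → ZMod 2} {y : Fin V' × Fin 3 → A} (hy : ∀ f, y f ∈ 𝒜 (p f)) :
    koszulSign k flagRank (flagRank ∘ τ) (fun f => p (τ f) + 1) * vertexWeight M (p ∘ τ) (y ∘ τ) =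
      vertexWeight M p y := by
  -- Commuting with rotation forces `τ` to be a permutation `π` of the vertices together with a
  -- shift `o v` at every vertex.
  have h0 : ∀ v i, τ (v, i) = ((τ (v, 0)).1, i + (τ (v, 0)).2) := by
    intro v
    have h1 := hτ v 0
    have h2 := hτ v 1
    rw [zero_add] at h1
    rw [h1] at h2
    intro i
    fin_cases i
    · simp
    · simp [h1, add_comm]
    · simp only [Fin.reduceFinMk]
      have h3 : ∀ x : Fin 3, x + 1 + 1 = 2 + x := by decide
      exact h2.trans (Prod.ext rfl (h3 _))
  have hinj : Function.Injective fun v => (τ (v, 0)).1 := by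
    intro v w hvw
    have : τ (v, (τ (w, 0)).2 - (τ (v, 0)).2) = τ (w, 0) := by
      rw [h0, sub_add_cancel]
      exact Prod.ext hvw rfl
    exact congrArg Prod.fst (τ.injective this)
  have hsurj : Function.Surjective fun v => (τ (v, 0)).1 := by
    intro v'
    obtain ⟨⟨v, i⟩, hvi⟩ := τ.surjective (v', 0)
    exact ⟨v, by rw [h0] at hvi; exact congrArg Prod.fst hvi⟩
  set π : Fin V ≃ Fin V' := Equiv.ofBijective _ ⟨hinj, hsurj⟩ with hπ
  have hπ' : ∀ v, π v = (τ (v, 0)).1 := fun v => rfl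
  set o : Fin V → Fin 3 := fun v => (τ (v, 0)).2
  have h0' : ∀ v i, τ (v, i) = (π v, i + o v) := h0
  -- The three-tensor is even, so both sides vanish if the letters at some vertex have odd total
  -- parity. Otherwise the vertices are even blocks, and permuting them costs no sign.
  by_cases hev : ∀ v, ∑ i, (p (τ (v, i)) + 1) = 0
  swap
  · push Not at hev
    obtain ⟨v, hv⟩ := hev
    have hv' : ∑ i, (p (π v, i) + 1) ≠ 0 := by
      rw [← Equiv.sum_comp (Equiv.addRight (o v))]
      simpa [h0'] using hv
    rw [vertexWeight_eq_zero M hy _ hv', vertexWeight_eq_zero M (p := p ∘ τ) (y := y ∘ τ)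
      (fun f => hy (τ f)) v hv, mul_zero]
  have hπne : ∀ {v w}, v ≠ w → (π v : ℕ) ≠ π w := fun h h' => h (π.injective (Fin.ext h'))
  have hblk : koszulSign k flagRank (flagRank ∘ τ) (fun f => p (τ f) + 1) =
      ∏ z : (Fin V × Fin 3) × (Fin V × Fin 3), if z.1.1 = z.2.1 ∧ flagRank z.1 < flagRank z.2 ∧
        (flagRank ∘ τ) z.2 < (flagRank ∘ τ) z.1 then
        sgn k ((p (τ z.1) + 1) * (p (τ z.2) + 1)) else 1 := by
    refine koszulSign_block (fun f : Fin V × Fin 3 => f.1) ?_ ?_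
    · rintro ⟨v, i⟩ ⟨w, j⟩ ⟨v', i'⟩ ⟨w', j'⟩ hne hv hw h1 h2
      dsimp only at hv hw hne
      subst hv hw
      have h3 := hπne hne
      have h4 : (v' : ℕ) ≠ w' := fun h => hne (Fin.ext h)
      simp only [flagRank, Function.comp, h0'] at *
      omega
    · rintro ⟨v, i⟩ ⟨w, j⟩ hne h1 h2
      left
      have : (Finset.univ.filter fun z : Fin V × Fin 3 => z.1 = v) =
          Finset.univ.map ⟨fun i => (v, i), fun a b h => by simpa using h⟩ := by
        ext ⟨w, i⟩
        simp only [Finset.mem_filter, Finset.mem_univ, true_and, Finset.mem_map,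
          Function.Embedding.coeFn_mk, Prod.mk.injEq]
        constructor
        · rintro rfl
          exact ⟨i, rfl⟩
        · rintro ⟨a, rfl, -⟩
          rfl
      simp only
      rw [this, Finset.sum_map]
      exact hev v
  have hloc : koszulSign k flagRank (flagRank ∘ τ) (fun f => p (τ f) + 1) =
      ∏ v, ∏ i : Fin 3, ∏ j : Fin 3, if (i : ℕ) < j ∧ ((j + o v : Fin 3) : ℕ) <
        ((i + o v : Fin 3) : ℕ) then sgn k ((p (τ (v, i)) + 1) * (p (τ (v, j)) + 1)) else 1 := by
    rw [hblk, Fintype.prod_prod_type, Fintype.prod_prod_type]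
    refine Finset.prod_congr rfl fun v _ => Finset.prod_congr rfl fun i _ => ?_
    rw [Fintype.prod_prod_type, Finset.prod_comm]
    refine Finset.prod_congr rfl fun j _ => ?_
    rw [Finset.prod_eq_single v]
    · simp [flagRank, h0']
    · intro w _ hw
      simp [hw.symm]
    · simp
  rw [hloc]
  unfold vertexWeight
  rw [← Finset.prod_mul_distrib, ← Equiv.prod_comp π]
  refine Finset.prod_congr rfl fun v _ => ?_
  have := threeTensor_rotate M (p := fun i => p (τ (v, i))) (y := fun i => y (τ (v, i)))
    (fun i => hy _) (o v)
  simp only [Function.comp]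
  rw [this]
  simp only [h0', sub_add_cancel]

/-- The Leibniz rule together with the invariance of the form, applied to the product of the first
two letters. -/
theorem threeTensor_d {p : Fin 3 → ZMod 2} {y : Fin 3 → A} (hy : ∀ i, y i ∈ 𝒜 (p i)) :
    threeTensor M.form (p 1) (M.d (y 0)) (y 1) (y 2) +
      sgn k (p 0 + 1) * threeTensor M.form (p 1 + 1) (y 0) (M.d (y 1)) (y 2) +
      sgn k (p 0 + 1 + (p 1 + 1)) * threeTensor M.form (p 1) (y 0) (y 1) (M.d (y 2)) = 0 := by
  have h1 := M.form_d _ _ (y 2) (M.mul_mem _ _ _ _ (hy 0) (hy 1))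
  rw [M.leibniz _ _ _ (hy 0), map_add, map_smul, LinearMap.add_apply, LinearMap.smul_apply,
    smul_eq_mul] at h1
  simp only [threeTensor, sgn_add, sgn_one] at *
  linear_combination (sgn k (p 1)) * h1

/-- The differential annihilates the product of the three-tensors. -/
theorem sum_vertexWeight_d {V : ℕ} {p : Fin V × Fin 3 → ZMod 2} {y : Fin V × Fin 3 → A}
    (hy : ∀ f, y f ∈ 𝒜 (p f)) :
    ∑ f, sgn k (∑ g with flagRank g < flagRank f, (p g + 1)) *
      vertexWeight M (Function.update p f (p f + 1)) (Function.update y f (M.d (y f))) = 0 := by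
  rw [Fintype.sum_prod_type]
  -- The sum vanishes vertex by vertex: the sign of the flags before `v` and the tensors at the
  -- other vertices are common factors of the three terms at `v`.
  refine Finset.sum_eq_zero fun v _ => ?_
  have hins : ∀ i j : Fin 3, (j : ℕ) = i + 1 → ∑ g : Fin V × Fin 3 with flagRank g < flagRank (v, j), (p g + 1) =
      ∑ g : Fin V × Fin 3 with flagRank g < flagRank (v, i), (p g + 1) + (p (v, i) + 1) := by
    intro i j hij
    have : (Finset.univ.filter fun g : Fin V × Fin 3 => flagRank g < flagRank (v, j)) =
        insert (v, i) (Finset.univ.filter fun g : Fin V × Fin 3 => flagRank g < flagRank (v, i)) := by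
      ext ⟨w, l⟩
      rw [Finset.mem_insert, Finset.mem_filter, Finset.mem_filter, Prod.ext_iff, Fin.ext_iff,
        Fin.ext_iff]
      simp only [flagRank, Finset.mem_univ, true_and]
      have := l.2
      have := i.2
      have := j.2
      omega
    rw [this, Finset.sum_insert (by simp), add_comm]
  have hw : ∀ i, vertexWeight M (Function.update p (v, i) (p (v, i) + 1))
      (Function.update y (v, i) (M.d (y (v, i)))) =
      (threeTensor M.form (Function.update p (v, i) (p (v, i) + 1) (v, 1))
        (Function.update y (v, i) (M.d (y (v, i))) (v, 0))
        (Function.update y (v, i) (M.d (y (v, i))) (v, 1))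
        (Function.update y (v, i) (M.d (y (v, i))) (v, 2))) *
      ∏ w ∈ Finset.univ.erase v, threeTensor M.form (p (w, 1)) (y (w, 0)) (y (w, 1)) (y (w, 2)) := by
    intro i
    unfold vertexWeight
    rw [← Finset.mul_prod_erase _ _ (Finset.mem_univ v)]
    congr 1
    refine Finset.prod_congr rfl fun w hw => ?_
    have hwv : w ≠ v := Finset.ne_of_mem_erase hw
    simp [Function.update_of_ne, hwv]
  have h01 := hins 0 1 rfl
  have h12 := hins 1 2 rfl
  have h3 := threeTensor_d M (p := fun i => p (v, i)) (y := fun i => y (v, i)) (fun i => hy _)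
  rw [Fin.sum_univ_three]
  simp only [hw, h01, h12]
  simp [Function.update_apply]
  simp only [sgn_add] at *
  linear_combination (sgn k (∑ g : Fin V × Fin 3 with flagRank g < flagRank (v, 0), (p g + 1)) *
    ∏ w ∈ Finset.univ.erase v, threeTensor M.form (p (w, 1)) (y (w, 0)) (y (w, 1)) (y (w, 2))) * h3

variable [IsScalarTower k A A] [SMulCommClass k A A]

/-- The multiplication and the scalar product as a multilinear map. -/
def trilinear : MultilinearMap k (fun _ : Fin 3 => A) k where
  toFun y := M.form (y 0 * y 1) (y 2)
  map_update_add' := by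
    intro inst y i a b
    obtain rfl : inst = instDecidableEqFin 3 := Subsingleton.elim _ _
    fin_cases i <;> simp [Function.update_apply, add_mul, mul_add]
  map_update_smul' := by
    intro inst y i c a
    obtain rfl : inst = instDecidableEqFin 3 := Subsingleton.elim _ _
    fin_cases i <;> simp [Function.update_apply, smul_mul_assoc, mul_smul_comm]

variable {X : Type*} {V : ℕ} (g : X ≃ Fin V × Fin 3)

theorem update_comp_symm [DecidableEq X] {Y : Type*} (y : X → Y) (x : X) (a : Y) (v : Fin V) :
    (fun i => Function.update y x a (g.symm (v, i))) =
      if (g x).1 = v then Function.update (fun i => y (g.symm (v, i))) (g x).2 a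
      else fun i => y (g.symm (v, i)) := by
  funext i
  split_ifs with h
  · by_cases hi : i = (g x).2
    · have : g.symm (v, i) = x := by rw [hi, ← h]; simp
      rw [this, hi]; simp
    · have : g.symm (v, i) ≠ x := by rintro rfl; simp at hi
      simp [Function.update_of_ne, this, hi]
  · have : g.symm (v, i) ≠ x := by rintro rfl; simp at h
    simp [Function.update_of_ne, this]

theorem prod_trilinear_update [DecidableEq X] (y : X → A) (x : X) (a : A) :
    ∏ v, trilinear M (fun i => Function.update y x a (g.symm (v, i))) =
      trilinear M (Function.update (fun i => y (g.symm ((g x).1, i))) (g x).2 a) *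
        ∏ v ∈ Finset.univ.erase (g x).1, trilinear M (fun i => y (g.symm (v, i))) := by
  rw [← Finset.mul_prod_erase _ _ (Finset.mem_univ (g x).1)]
  simp only [update_comp_symm, if_true]
  congr 1
  refine Finset.prod_congr rfl fun v hv => ?_
  rw [if_neg (Finset.ne_of_mem_erase hv).symm]

/-- The product of the trilinear forms over the vertices, as a multilinear map. -/
def prodTrilinear : MultilinearMap k (fun _ : X => A) k where
  toFun y := ∏ v, trilinear M (fun i => y (g.symm (v, i)))
  map_update_add' y x a b := by
    simp only [prod_trilinear_update, MultilinearMap.map_update_add, add_mul]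
  map_update_smul' y x c a := by
    simp only [prod_trilinear_update, MultilinearMap.map_update_smul, smul_eq_mul, mul_assoc]

variable [DirectSum.Decomposition 𝒜] [Fintype X]

variable (𝒜) in
/-- The projection to the vectors of parity `p`. -/
def parityProj (p : ZMod 2) : A →ₗ[k] A :=
  (𝒜 p).subtype ∘ₗ DirectSum.component k (ZMod 2) (fun i => 𝒜 i) p ∘ₗ
    (DirectSum.decomposeLinearEquiv 𝒜).toLinearMap

theorem parityProj_of_mem {p q : ZMod 2} {a : A} (ha : a ∈ 𝒜 p) :
    parityProj 𝒜 q a = if q = p then a else 0 := by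
  change ((DirectSum.decompose 𝒜 a q : 𝒜 q) : A) = _
  split_ifs with h
  · rw [h, DirectSum.decompose_of_mem_same _ ha]
  · rw [DirectSum.decompose_of_mem_ne _ ha (Ne.symm h)]

/-- The tensor `⊗_v m^v` evaluated on letters attached to the flags, which are indexed by `X` and
ordered by `r`. -/
def vertexTensor (r : X → ℕ) : MultilinearMap k (fun _ : X => A) k :=
  open Classical in
  ∑ p : X → ZMod 2, (koszulSign k (flagRank ∘ g) r (fun x => p x + 1) *
    ∏ v, sgn k (p (g.symm (v, 1)))) • (prodTrilinear M g).compLinearMap fun x => parityProj 𝒜 (p x)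

/-- On homogeneous letters one assignment of parities survives the projections. Projecting is what
makes an expression with parity-dependent signs multilinear on all of `A`. -/
theorem vertexTensor_apply (r : X → ℕ) {p : X → ZMod 2} {y : X → A} (hy : ∀ x, y x ∈ 𝒜 (p x)) :
    vertexTensor M g r y = koszulSign k (flagRank ∘ g) r (fun x => p x + 1) *
      vertexWeight M (p ∘ g.symm) (y ∘ g.symm) := by
  classical
  rw [vertexTensor, sum_apply, Finset.sum_eq_single p]
  · rw [smul_apply, MultilinearMap.compLinearMap_apply]
    simp only [parityProj_of_mem (hy _), if_true]
    rw [smul_eq_mul, mul_assoc]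
    congr 1
    change _ * ∏ v : Fin V, M.form (y (g.symm (v, 0)) * y (g.symm (v, 1))) (y (g.symm (v, 2))) = _
    rw [← Finset.prod_mul_distrib]
    rfl
  · intro p' _ hp
    obtain ⟨x, hx⟩ := Function.ne_iff.1 hp
    rw [smul_apply, MultilinearMap.compLinearMap_apply,
      MultilinearMap.map_coord_zero _ x, smul_zero]
    rw [parityProj_of_mem (hy x), if_neg hx]
  · simp

theorem vertexTensor_rank {r r' : X → ℕ} (hr : Function.Injective r) (hr' : Function.Injective r')
    {p : X → ZMod 2} {y : X → A} (hy : ∀ x, y x ∈ 𝒜 (p x)) :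
    vertexTensor M g r' y = koszulSign k r r' (fun x => p x + 1) * vertexTensor M g r y := by
  rw [vertexTensor_apply M g r hy, vertexTensor_apply M g r' hy, ← mul_assoc]
  congr 1
  have hg : Function.Injective (flagRank ∘ g) := flagRank_injective.comp g.injective
  rw [mul_comm, koszulSign_trans hg hr hr']

/-- Only the cyclic order that `g` induces on the indices at each vertex matters, so vertices may be
renumbered and rotated freely. -/
theorem vertexTensor_rotate {V' : ℕ} (g' : X ≃ Fin V' × Fin 3) {r : X → ℕ}
    (hr : Function.Injective r)
    (hg : ∀ x, g'.symm ((g' x).1, (g' x).2 + 1) = g.symm ((g x).1, (g x).2 + 1))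
    {p : X → ZMod 2} {y : X → A} (hy : ∀ x, y x ∈ 𝒜 (p x)) :
    vertexTensor M g' r y = vertexTensor M g r y := by
  have hg' := flagRank_injective.comp g'.injective
  have hgi := flagRank_injective.comp g.injective
  rw [vertexTensor_apply M g r hy, vertexTensor_apply M g' r hy,
    ← koszulSign_trans hgi hg' hr, mul_comm (koszulSign k (flagRank ∘ g) _ _), mul_assoc]
  congr 1
  have := vertexWeight_equiv M (g.symm.trans g') (p := p ∘ g'.symm) (y := y ∘ g'.symm) ?_
    (fun f => hy _)
  · rw [← this, ← koszulSign_equiv g]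
    congr 2
    · funext x; simp
    · funext x; simp
    · funext x; simp
    · funext x; simp
  · intro v i
    have := hg (g.symm (v, i))
    simp only [Equiv.apply_symm_apply] at this
    simp only [Equiv.trans_apply]
    rw [← this, Equiv.apply_symm_apply]

theorem update_mem [DecidableEq X] {p : X → ZMod 2} {y : X → A} (hy : ∀ x, y x ∈ 𝒜 (p x)) {x : X}
    {i : ZMod 2} {a : A} (ha : a ∈ 𝒜 i) (z : X) :
    Function.update y x a z ∈ 𝒜 (Function.update p x i z) := by
  by_cases h : z = x
  · subst h; simpa
  · simpa [Function.update_of_ne h] using hy z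

theorem update_comp_equiv_symm [DecidableEq X] {X' Y : Type*} [DecidableEq X'] (g : X ≃ X')
    (y : X → Y) (x : X) (a : Y) :
    Function.update y x a ∘ g.symm = Function.update (y ∘ g.symm) (g x) a := by
  funext f
  by_cases h : f = g x
  · subst h; simp
  · have : g.symm f ≠ x := fun h' => h (by rw [← h']; simp)
    simp [Function.update_of_ne h, Function.update_of_ne this]

/-- By `koszulSign_update`, changing the parity of one letter turns the sign of the letters before
it in the order `r` into that for the order by vertices, where `sum_vertexWeight_d` applies. -/
theorem sum_vertexTensor_d [DecidableEq X] {r : X → ℕ} (hr : Function.Injective r)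
    {p : X → ZMod 2} {y : X → A} (hy : ∀ x, y x ∈ 𝒜 (p x)) :
    ∑ x, sgn k (∑ z with r z < r x, (p z + 1)) *
      vertexTensor M g r (Function.update y x (M.d (y x))) = 0 := by
  have hgi := flagRank_injective.comp g.injective
  have h1 : ∀ x, sgn k (∑ z with r z < r x, (p z + 1)) *
      vertexTensor M g r (Function.update y x (M.d (y x))) =
      koszulSign k (flagRank ∘ g) r (fun x => p x + 1) *
        (sgn k (∑ f with flagRank f < flagRank (g x), ((p ∘ g.symm) f + 1)) *
        vertexWeight M (Function.update (p ∘ g.symm) (g x) ((p ∘ g.symm) (g x) + 1))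
          (Function.update (y ∘ g.symm) (g x) (M.d ((y ∘ g.symm) (g x))))) := by
    intro x
    rw [vertexTensor_apply M g r (update_mem hy (M.d_mem _ _ (hy x)))]
    have h2 : (fun z => Function.update p x (p x + 1) z + 1) =
        Function.update (fun z => p z + 1) x ((p x + 1) + 1) := by
      funext z
      by_cases h : z = x
      · subst h; simp
      · simp [Function.update_of_ne h]
    rw [h2, koszulSign_update hgi hr]
    have h3 : ∑ f with flagRank f < flagRank (g x), ((p ∘ g.symm) f + 1) =
        ∑ z with (flagRank ∘ g) z < (flagRank ∘ g) x, (p z + 1) := by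
      refine Finset.sum_equiv g.symm ?_ ?_ <;> simp
    rw [h3, update_comp_equiv_symm, update_comp_equiv_symm]
    simp only [Function.comp_apply, Equiv.symm_apply_apply]
    linear_combination (koszulSign k (flagRank ∘ g) r (fun x => p x + 1) *
      sgn k (∑ z with flagRank (g z) < flagRank (g x), (p z + 1)) *
      vertexWeight M (Function.update (p ∘ g.symm) (g x) (p x + 1))
        (Function.update (y ∘ g.symm) (g x) (M.d (y x)))) *
      sgn_mul_self (k := k) (∑ z with r z < r x, (p z + 1))
  simp only [h1]
  rw [← Finset.mul_sum]
  have := sum_vertexWeight_d M (p := p ∘ g.symm) (y := y ∘ g.symm) (fun f => hy _)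
  rw [← Equiv.sum_comp g] at this
  rw [this, mul_zero]

theorem vertexTensor_even {r : X → ℕ} {p : X → ZMod 2} {y : X → A} (hy : ∀ x, y x ∈ 𝒜 (p x))
    (h : ∑ x, (p x + 1) ≠ 0) : vertexTensor M g r y = 0 := by
  rw [vertexTensor_apply M g r hy]
  rw [← Equiv.sum_comp g.symm, Fintype.sum_prod_type] at h
  obtain ⟨v, -, hv⟩ := Finset.exists_ne_zero_of_sum_ne_zero h
  rw [vertexWeight_eq_zero M (p := p ∘ g.symm) (y := y ∘ g.symm) (fun f => hy _) v hv, mul_zero]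

theorem vertexTensor_reindex {X' : Type*} [Fintype X'] (e : X' ≃ X) (r : X → ℕ)
    {p : X → ZMod 2} {y : X → A} (hy : ∀ x, y x ∈ 𝒜 (p x)) :
    vertexTensor M (e.trans g) (r ∘ e) (y ∘ e) = vertexTensor M g r y := by
  rw [vertexTensor_apply M g r hy, vertexTensor_apply M _ _ (p := p ∘ e) (y := y ∘ e) (fun x => hy _)]
  congr 1
  · exact koszulSign_equiv (k := k) e (flagRank ∘ g) r (fun x => p x + 1)
  · congr 1 <;> funext f <;> simp

/-- Both orders list the first block before the second, so no letters of different blocks are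
interchanged and the tensor factors without a sign. -/
theorem vertexTensor_sum {X₁ X₂ : Type*} [Fintype X₁] [Fintype X₂] {V₁ V₂ : ℕ}
    (g₁ : X₁ ≃ Fin V₁ × Fin 3) (g₂ : X₂ ≃ Fin V₂ × Fin 3)
    (g : X₁ ⊕ X₂ ≃ Fin (V₁ + V₂) × Fin 3)
    (hg₁ : ∀ x, g (Sum.inl x) = (Fin.castAdd V₂ (g₁ x).1, (g₁ x).2))
    (hg₂ : ∀ x, g (Sum.inr x) = (Fin.natAdd V₁ (g₂ x).1, (g₂ x).2))
    {r : X₁ ⊕ X₂ → ℕ} (hr : ∀ x y, r (Sum.inl x) < r (Sum.inr y))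
    {p : X₁ ⊕ X₂ → ZMod 2} {y : X₁ ⊕ X₂ → A} (hy : ∀ x, y x ∈ 𝒜 (p x)) :
    vertexTensor M g r y = vertexTensor M g₁ (r ∘ Sum.inl) (y ∘ Sum.inl) *
      vertexTensor M g₂ (r ∘ Sum.inr) (y ∘ Sum.inr) := by
  have hs₁ : ∀ v i, g.symm (Fin.castAdd V₂ v, i) = Sum.inl (g₁.symm (v, i)) := fun v i => by
    rw [Equiv.symm_apply_eq, hg₁]; simp
  have hs₂ : ∀ v i, g.symm (Fin.natAdd V₁ v, i) = Sum.inr (g₂.symm (v, i)) := fun v i => by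
    rw [Equiv.symm_apply_eq, hg₂]; simp
  rw [vertexTensor_apply M g r hy, vertexTensor_apply M g₁ _ (p := p ∘ Sum.inl) (y := y ∘ Sum.inl) (fun x => hy _),
    vertexTensor_apply M g₂ _ (p := p ∘ Sum.inr) (y := y ∘ Sum.inr) (fun x => hy _), koszulSign_sum _ hr]
  · have h1 : (flagRank ∘ g) ∘ Sum.inl = flagRank ∘ g₁ := by
      funext x; simp [hg₁, flagRank]
    have h2 : koszulSign k ((flagRank ∘ g) ∘ Sum.inr) (r ∘ Sum.inr)
        ((fun x => p x + 1) ∘ Sum.inr) =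
        koszulSign k (flagRank ∘ g₂) (r ∘ Sum.inr) (fun x => (p ∘ Sum.inr) x + 1) := by
      refine koszulSign_congr (fun x y => ?_) (fun _ _ _ _ => rfl)
      simp [hg₂, flagRank]
      intro _
      omega
    have h3 : (fun x => p x + 1) ∘ Sum.inl = fun x => (p ∘ Sum.inl) x + 1 := rfl
    rw [h1, h2, h3]
    unfold vertexWeight
    rw [Fin.prod_univ_add]
    simp only [Function.comp, hs₁, hs₂]
    ring
  · intro x y
    simp only [Function.comp, flagRank, hg₁, hg₂, Fin.val_castAdd, Fin.val_natAdd]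
    omega

end Vertices

/-! ### Contractions with arbitrary tensors at the edges. -/

section Graphs

variable {k A : Type*} [Field k] [NonUnitalRing A] [Module k A]
  {𝒜 : ZMod 2 → Submodule k A} (M : CyclicDGAlgebra 𝒜)
  [IsScalarTower k A A] [SMulCommClass k A A] [DirectSum.Decomposition 𝒜] [FiniteDimensional k A]
  {V E n : ℕ}

/-- The order of the half-edges and legs by edges, followed by the legs. -/
def edgeLegRank {E n : ℕ} : (Fin E × Fin 2) ⊕ Fin n → ℕ :=
  Sum.elim (fun z => 2 * z.1 + z.2) (fun l => 2 * E + l)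

theorem edgeLegRank_inl (e : Fin E) (s : Fin 2) :
    edgeLegRank (n := n) (Sum.inl (e, s)) = 2 * e + s := rfl

theorem edgeLegRank_inr (l : Fin n) : edgeLegRank (E := E) (Sum.inr l) = 2 * E + l := rfl

theorem edgeLegRank_lt (z : Fin E × Fin 2) (l : Fin n) :
    edgeLegRank (n := n) (Sum.inl z) < edgeLegRank (E := E) (Sum.inr l) := by
  obtain ⟨e, s⟩ := z
  rw [edgeLegRank_inl, edgeLegRank_inr]
  omega

theorem edgeLegRank_injective : Function.Injective (edgeLegRank (E := E) (n := n)) := by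
  rintro (⟨e, s⟩ | l) (⟨e', s'⟩ | l') h
  · simp only [edgeLegRank_inl] at h
    rw [Sum.inl.injEq, Prod.ext_iff, Fin.ext_iff, Fin.ext_iff]
    dsimp only
    omega
  · exact absurd h (edgeLegRank_lt _ _).ne
  · exact absurd h (edgeLegRank_lt _ _).ne'
  · simp only [edgeLegRank_inr] at h
    rw [Sum.inr.injEq, Fin.ext_iff]
    omega

variable (𝒜) in
/-- Basis vectors attached to the half-edges, and given vectors attached to the legs. -/
def letters {Et Lt : Type*} (ψ : Et → HomIdx 𝒜) (x : Lt → A) : Et ⊕ Lt → A :=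
  Sum.elim (fun z => homBasis 𝒜 (ψ z)) x

variable (𝒜) in
/-- The parities of the letters. -/
def letterParity {Et Lt : Type*} (ψ : Et → HomIdx 𝒜) (p : Lt → ZMod 2) : Et ⊕ Lt → ZMod 2 :=
  Sum.elim (fun z => (ψ z).1) p

theorem letters_mem {Et Lt : Type*} (ψ : Et → HomIdx 𝒜) {p : Lt → ZMod 2} {x : Lt → A}
    (hx : ∀ l, x l ∈ 𝒜 (p l)) (z : Et ⊕ Lt) : letters 𝒜 ψ x z ∈ 𝒜 (letterParity 𝒜 ψ p z) := by
  cases z with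
  | inl z => exact homBasis_mem 𝒜 _
  | inr l => exact hx l

/-- The contraction of the three-tensors at the vertices with tensors `K e` at the edges. -/
def graphTensor (g : (Fin E × Fin 2) ⊕ Fin n ≃ Fin V × Fin 3)
    (K : Fin E → Matrix (HomIdx 𝒜) (HomIdx 𝒜) k) : MultilinearMap k (fun _ : Fin n => A) k :=
  ∑ ψ : Fin E × Fin 2 → HomIdx 𝒜, (∏ e, K e (ψ (e, 0)) (ψ (e, 1))) •
    (vertexTensor M g edgeLegRank).currySum fun z => homBasis 𝒜 (ψ z)

theorem graphTensor_apply (g : (Fin E × Fin 2) ⊕ Fin n ≃ Fin V × Fin 3)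
    (K : Fin E → Matrix (HomIdx 𝒜) (HomIdx 𝒜) k) (x : Fin n → A) :
    graphTensor M g K x = ∑ ψ : Fin E × Fin 2 → HomIdx 𝒜, (∏ e, K e (ψ (e, 0)) (ψ (e, 1))) *
      vertexTensor M g edgeLegRank (letters 𝒜 ψ x) := by
  rw [graphTensor, sum_apply]
  rfl

/-- On basis vectors, a labelling of the flags survives the coordinate functions only if it
prescribes the given vectors at the legs; what remains is a sum over labels of half-edges. In this
form the tensor at a single edge can be exchanged. -/
theorem contraction_eq_graphTensor (h : Homotopy M) (Γ : RibbonGraph n) :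
    contraction h Γ = graphTensor M Γ.flagEquiv fun _ => propagator h := by
  refine Module.Basis.ext_multilinear (fun _ => homBasis 𝒜) fun ψ => ?_
  rw [graphTensor_apply, contraction, sum_apply]
  symm
  refine Fintype.sum_of_injective
    (fun (χ : Fin Γ.numEdge × Fin 2 → HomIdx 𝒜) f => Sum.elim χ ψ (Γ.flagEquiv.symm f)) ?_ _ _ ?_ ?_
  · intro χ χ' hχ
    funext z
    simpa using congrFun hχ (Γ.flagEquiv (Sum.inl z))
  · intro φ hφ
    have : ∃ l, φ (Γ.leg l) ≠ ψ l := by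
      by_contra! hl
      refine hφ ⟨fun z => φ (Γ.flagEquiv (Sum.inl z)), ?_⟩
      funext f
      obtain ⟨z, rfl⟩ := Γ.flagEquiv.surjective f
      cases z with
      | inl z => simp
      | inr l => simpa [RibbonGraph.leg] using (hl l).symm
    obtain ⟨l, hl⟩ := this
    simp only [smul_apply, MultilinearMap.compLinearMap_apply,
      MultilinearMap.mkPiAlgebra_apply]
    rw [Finset.prod_eq_zero (Finset.mem_univ l), smul_zero]
    rw [Module.Basis.coord_apply, Module.Basis.repr_self, Finsupp.single_apply, if_neg hl.symm]
  · intro χ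
    rw [vertexTensor_apply M _ _ (letters_mem χ (p := fun l => (ψ l).1) fun l => homBasis_mem 𝒜 _)]
    simp only [smul_apply, MultilinearMap.compLinearMap_apply,
      MultilinearMap.mkPiAlgebra_apply, RibbonGraph.leg, Equiv.symm_apply_apply, Sum.elim_inr,
      Sum.elim_inl, Module.Basis.coord_apply, Module.Basis.repr_self, Finsupp.single_eq_same,
      Finset.prod_const_one, smul_eq_mul, mul_one]
    rw [mul_comm]
    congr 1
    congr 1
    · rw [← koszulSign_equiv Γ.flagEquiv]
      congr 1
      · funext z
        cases z <;> simp [RibbonGraph.edgeRank, edgeLegRank]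
      · funext z
        cases z <;> simp [letterParity]
    · refine Finset.prod_congr rfl fun v _ => ?_
      have h1 : ∀ z : (Fin Γ.numEdge × Fin 2) ⊕ Fin n,
          homBasis 𝒜 (Sum.elim χ ψ z) = letters 𝒜 χ (fun i => homBasis 𝒜 (ψ i)) z := by
        rintro (z | l) <;> rfl
      have h2 : ∀ z : (Fin Γ.numEdge × Fin 2) ⊕ Fin n,
          (Sum.elim χ ψ z).1 = letterParity 𝒜 χ (fun i => (ψ i).1) z := by
        rintro (z | l) <;> rfl
      simp only [h1, h2, Function.comp]

/-- A tensor of parity `ε` that is symmetric in the super sense. -/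
structure IsEdgeTensor (ε : ZMod 2) (K : Matrix (HomIdx 𝒜) (HomIdx 𝒜) k) : Prop where
  parity : ∀ {i j}, K i j ≠ 0 → i.1 + 1 + (j.1 + 1) = ε
  symm : ∀ i j, K i j = sgn k ((i.1 + 1) * (j.1 + 1)) * K j i

variable {M} in
theorem graphTensor_eq_zero {g : (Fin E × Fin 2) ⊕ Fin n ≃ Fin V × Fin 3}
    {K : Fin E → Matrix (HomIdx 𝒜) (HomIdx 𝒜) k} {ε : Fin E → ZMod 2}
    (hK : ∀ e, IsEdgeTensor (ε e) (K e)) {p : Fin n → ZMod 2} {x : Fin n → A}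
    (hx : ∀ l, x l ∈ 𝒜 (p l)) (h : ∑ e, ε e + ∑ l, (p l + 1) ≠ 0) :
    graphTensor M g K x = 0 := by
  rw [graphTensor_apply]
  refine Finset.sum_eq_zero fun ψ _ => ?_
  by_cases h0 : ∏ e, K e (ψ (e, 0)) (ψ (e, 1)) = 0
  · rw [h0, zero_mul]
  · rw [vertexTensor_even M g (letters_mem ψ hx), mul_zero]
    rw [Fintype.sum_sum_type, Fintype.sum_prod_type]
    convert h using 2
    swap
    · rfl
    refine Finset.sum_congr rfl fun e _ => ?_
    rw [Fin.sum_univ_two]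
    exact (hK e).parity (Finset.prod_ne_zero_iff.1 h0 e (Finset.mem_univ e))

/-- The two halves of an edge form a block. When no two edges are both odd, permuting the edges
costs nothing, and only edges whose halves are exchanged contribute. -/
theorem koszulSign_edges {E' : ℕ} (ε : Fin E ≃ Fin E') (δ : Fin E → Equiv.Perm (Fin 2))
    {q : Fin E × Fin 2 → ZMod 2}
    (hq : ∀ e e', e ≠ e' → q (e, 0) + q (e, 1) = 0 ∨ q (e', 0) + q (e', 1) = 0) :
    koszulSign k (fun z : Fin E × Fin 2 => 2 * (z.1 : ℕ) + z.2)
      (fun z => 2 * (ε z.1 : ℕ) + δ z.1 z.2) q =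
      ∏ e, if δ e = 1 then 1 else sgn k (q (e, 0) * q (e, 1)) := by
  rw [koszulSign_block (fun z => z.1)]
  · rw [Fintype.prod_prod_type, Fintype.prod_prod_type]
    refine Finset.prod_congr rfl fun e _ => ?_
    simp only [Fintype.prod_prod_type]
    have : ∀ s : Fin 2, ∏ e', ∏ s' : Fin 2, (if e = e' ∧ 2 * (e : ℕ) + s < 2 * (e' : ℕ) + s' ∧
        2 * (ε e' : ℕ) + (δ e' s' : Fin 2) < 2 * (ε e : ℕ) + (δ e s : Fin 2) then
          sgn k (q (e, s) * q (e', s')) else 1) =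
        ∏ s' : Fin 2, if s < s' ∧ δ e s' < δ e s then sgn k (q (e, s) * q (e, s')) else 1 := by
      intro s
      rw [Finset.prod_eq_single e]
      · simp
      · intro e' _ he'
        simp [he'.symm]
      · simp
    simp only [this]
    simp only [Fin.prod_univ_two]
    have hδ : δ e = 1 ∨ δ e = Equiv.swap 0 1 := by
      generalize δ e = d; revert d; decide
    rcases hδ with hδ | hδ
    · rw [hδ]; simp
    · have hne : Equiv.swap (0 : Fin 2) 1 ≠ 1 := by decide
      rw [hδ]; simp [hne]
  · rintro ⟨e, s⟩ ⟨e', s'⟩ ⟨e'', t⟩ ⟨e''', t'⟩ hne h1 h2 h3 h4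
    dsimp only at *
    subst h1 h2
    have h5 : (ε e'' : ℕ) ≠ ε e''' := fun h => hne (ε.injective (Fin.ext h))
    have h6 : (e'' : ℕ) ≠ e''' := fun h => hne (Fin.ext h)
    have := (δ e'' s).2
    have := (δ e''' s').2
    have := (δ e'' t).2
    have := (δ e''' t').2
    omega
  · rintro ⟨e, s⟩ ⟨e', s'⟩ hne - -
    have : ∀ e : Fin E, ∑ z : Fin E × Fin 2 with z.1 = e, q z = q (e, 0) + q (e, 1) := by
      intro e
      rw [Finset.sum_filter, Fintype.sum_prod_type, Finset.sum_eq_single e]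
      · simp
      · intro e' _ he'; simp [he']
      · simp
    simp only [this]
    exact hq e e' hne

/-- Exchanging the halves of an edge costs a Koszul sign that the super symmetry of its tensor
restores; only the relabelling of the legs leaves a sign. One odd edge is allowed, since `β^∨` will
be placed at one edge. -/
theorem graphTensor_iso {V' E' : ℕ} {g : (Fin E × Fin 2) ⊕ Fin n ≃ Fin V × Fin 3}
    {g' : (Fin E' × Fin 2) ⊕ Fin n ≃ Fin V' × Fin 3} (ε : Fin E ≃ Fin E')
    (δ : Fin E → Equiv.Perm (Fin 2)) (π : Equiv.Perm (Fin n))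
    (hg : ∀ z, ((Equiv.sumCongr (Equiv.prodShear ε δ) π).trans g').symm
      ((((Equiv.sumCongr (Equiv.prodShear ε δ) π).trans g') z).1,
        (((Equiv.sumCongr (Equiv.prodShear ε δ) π).trans g') z).2 + 1) =
      g.symm ((g z).1, (g z).2 + 1))
    {K : Fin E → Matrix (HomIdx 𝒜) (HomIdx 𝒜) k} {K' : Fin E' → Matrix (HomIdx 𝒜) (HomIdx 𝒜) k}
    (hK' : ∀ e, K' (ε e) = K e) {o : Fin E → ZMod 2} (hK : ∀ e, IsEdgeTensor (o e) (K e))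
    (ho : ∀ e e', e ≠ e' → o e = 0 ∨ o e' = 0)
    {p : Fin n → ZMod 2} {x : Fin n → A} (hx : ∀ l, x l ∈ 𝒜 (p l)) :
    graphTensor M g' K' (x ∘ π.symm) =
      koszulSign k (fun l : Fin n => (l : ℕ)) (fun l => (π l : ℕ)) (fun l => p l + 1) *
        graphTensor M g K x := by
  rw [graphTensor_apply, graphTensor_apply, Finset.mul_sum,
    ← Equiv.sum_comp (Equiv.arrowCongr (Equiv.prodShear ε δ) (Equiv.refl _))]
  refine Finset.sum_congr rfl fun ψ _ => ?_
  set η := Equiv.sumCongr (Equiv.prodShear ε δ) π with hη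
  have hlet : letters 𝒜 (Equiv.arrowCongr (Equiv.prodShear ε δ) (Equiv.refl _) ψ) (x ∘ π.symm) ∘ η
      = letters 𝒜 ψ x := by
    funext z
    cases z with
    | inl z => simp [letters, hη, Equiv.arrowCongr]
    | inr l => simp [letters, hη]
  have hprod : ∏ e', K' e' (Equiv.arrowCongr (Equiv.prodShear ε δ) (Equiv.refl _) ψ (e', 0))
      (Equiv.arrowCongr (Equiv.prodShear ε δ) (Equiv.refl _) ψ (e', 1)) =
      (∏ e, if δ e = 1 then 1 else sgn k (((ψ (e, 0)).1 + 1) * ((ψ (e, 1)).1 + 1))) *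
        ∏ e, K e (ψ (e, 0)) (ψ (e, 1)) := by
    rw [← Finset.prod_mul_distrib, ← Equiv.prod_comp ε]
    refine Finset.prod_congr rfl fun e _ => ?_
    have h1 : ∀ s, Equiv.arrowCongr (Equiv.prodShear ε δ) (Equiv.refl _) ψ (ε e, s) =
        ψ (e, (δ e).symm s) := by
      intro s
      simp [Equiv.arrowCongr, Equiv.prodShear]
    rw [h1, h1, hK']
    have hδ : δ e = 1 ∨ δ e = Equiv.swap 0 1 := by
      generalize δ e = d; revert d; decide
    rcases hδ with hδ | hδ
    · rw [hδ, if_pos rfl, one_mul]; rfl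
    · have hne : Equiv.swap (0 : Fin 2) 1 ≠ 1 := by decide
      rw [hδ, if_neg hne, (hK e).symm]
      simp [mul_comm]
  have hT : vertexTensor M g' edgeLegRank
      (letters 𝒜 (Equiv.arrowCongr (Equiv.prodShear ε δ) (Equiv.refl _) ψ) (x ∘ π.symm)) =
      koszulSign k edgeLegRank (edgeLegRank ∘ η) (fun z => letterParity 𝒜 ψ p z + 1) *
        vertexTensor M g edgeLegRank (letters 𝒜 ψ x) := by
    have hy := letters_mem (𝒜 := 𝒜) (Equiv.arrowCongr (Equiv.prodShear ε δ) (Equiv.refl _) ψ)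
      (p := p ∘ π.symm) (x := x ∘ π.symm) fun l => hx _
    rw [← vertexTensor_reindex M g' η edgeLegRank hy, hlet,
      vertexTensor_rotate M g (η.trans g') (edgeLegRank_injective.comp η.injective) hg
        (letters_mem ψ hx),
      vertexTensor_rank M g edgeLegRank_injective (edgeLegRank_injective.comp η.injective)
        (letters_mem ψ hx)]
  rw [hprod, hT]
  by_cases h0 : ∏ e, K e (ψ (e, 0)) (ψ (e, 1)) = 0
  · rw [h0]; ring
  -- Half-edges precede legs before and after, so the sign splits into an edge part and a leg part.
  -- The edge part is the same product as in `hprod`, and the two square to 1.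
  have hs : koszulSign k edgeLegRank (edgeLegRank ∘ η) (fun z => letterParity 𝒜 ψ p z + 1) =
      (∏ e, if δ e = 1 then 1 else sgn k (((ψ (e, 0)).1 + 1) * ((ψ (e, 1)).1 + 1))) *
      koszulSign k (fun l : Fin n => (l : ℕ)) (fun l => (π l : ℕ)) (fun l => p l + 1) := by
    rw [koszulSign_sum (s := edgeLegRank ∘ η) edgeLegRank_lt (fun x y => edgeLegRank_lt _ _)]
    congr 1
    · refine Eq.trans ?_ (koszulSign_edges ε δ (q := fun z => (ψ z).1 + 1) ?_)
      · rfl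
      · intro e e' hne
        have := fun e => (hK e).parity (Finset.prod_ne_zero_iff.1 h0 e (Finset.mem_univ e))
        rw [this, this]
        exact ho e e' hne
    · refine koszulSign_congr (fun a b => ?_) fun _ _ _ _ => rfl
      simp [edgeLegRank, hη]
  rw [hs]
  have h1 : ∀ e : Fin E, ((if δ e = 1 then 1 else
      sgn k (((ψ (e, 0)).1 + 1) * ((ψ (e, 1)).1 + 1))) : k) * (if δ e = 1 then 1 else
      sgn k (((ψ (e, 0)).1 + 1) * ((ψ (e, 1)).1 + 1))) = 1 := by
    intro e
    split_ifs
    · rw [mul_one]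
    · exact sgn_mul_self _
  have h2 : (∏ e, if δ e = 1 then 1 else sgn k (((ψ (e, 0)).1 + 1) * ((ψ (e, 1)).1 + 1))) *
      (∏ e, if δ e = 1 then 1 else sgn k (((ψ (e, 0)).1 + 1) * ((ψ (e, 1)).1 + 1))) = (1 : k) := by
    rw [← Finset.prod_mul_distrib]
    exact Finset.prod_eq_one fun e _ => h1 e
  linear_combination (koszulSign k (fun l : Fin n => (l : ℕ)) (fun l => (π l : ℕ))
    (fun l => p l + 1) * (∏ e, K e (ψ (e, 0)) (ψ (e, 1))) *
    vertexTensor M g edgeLegRank (letters 𝒜 ψ x)) * h2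

end Graphs

theorem RibbonGraph.exists_edge_equiv {n : ℕ} {Γ Γ' : RibbonGraph n} (τ : Γ.Flag ≃ Γ'.Flag)
    (π : Equiv.Perm (Fin n)) (hinv : ∀ f, τ (Γ.inv f) = Γ'.inv (τ f))
    (hleg : ∀ l, τ (Γ.leg l) = Γ'.leg (π l)) :
    ∃ (ε : Fin Γ.numEdge ≃ Fin Γ'.numEdge) (δ : Fin Γ.numEdge → Equiv.Perm (Fin 2)),
      ∀ e s, τ (Γ.flagEquiv (Sum.inl (e, s))) = Γ'.flagEquiv (Sum.inl (ε e, δ e s)) := by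
  have h1 : ∀ z, ∃ z', τ (Γ.flagEquiv (Sum.inl z)) = Γ'.flagEquiv (Sum.inl z') := by
    intro z
    obtain ⟨z' | l, hz⟩ := Γ'.flagEquiv.surjective (τ (Γ.flagEquiv (Sum.inl z)))
    · exact ⟨z', hz.symm⟩
    · exfalso
      have := hleg (π.symm l)
      rw [Equiv.apply_symm_apply, RibbonGraph.leg, RibbonGraph.leg, hz] at this
      simpa using τ.injective this
  choose f hf using h1
  have hf1 : ∀ e s, f (e, Equiv.swap 0 1 s) = ((f (e, s)).1, Equiv.swap 0 1 (f (e, s)).2) := by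
    intro e s
    have := hinv (Γ.flagEquiv (Sum.inl (e, s)))
    rw [Γ.inv_inl, hf, hf, ← Prod.mk.eta (p := f (e, s)), Γ'.inv_inl] at this
    simpa using this
  have hfi : Function.Injective f := by
    intro z z' h
    have := congrArg (fun z => Γ'.flagEquiv (Sum.inl z)) h
    simp only [← hf] at this
    simpa using this
  have hfs : Function.Surjective f := by
    intro z'
    obtain ⟨z | l, hz⟩ := (Γ.flagEquiv.trans τ).surjective (Γ'.flagEquiv (Sum.inl z'))
    · refine ⟨z, ?_⟩
      rw [Equiv.trans_apply, hf] at hz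
      simpa using hz
    · exfalso
      rw [Equiv.trans_apply] at hz
      have := (hleg l).symm.trans hz
      simp [RibbonGraph.leg] at this
  have hsw : ∀ s : Fin 2, s = 0 ∨ s = 1 := by decide
  have hf2 : ∀ e, f (e, 1) = ((f (e, 0)).1, Equiv.swap 0 1 (f (e, 0)).2) := fun e => hf1 e 0
  have hε : Function.Bijective fun e => (f (e, 0)).1 := by
    constructor
    · intro e e' h
      dsimp only at h
      rcases hsw (f (e, 0)).2 with h0 | h0 <;> rcases hsw (f (e', 0)).2 with h0' | h0'
      · exact congrArg Prod.fst (hfi (Prod.ext h (h0.trans h0'.symm)))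
      · refine congrArg Prod.fst (hfi (a₁ := (e, 0)) (a₂ := (e', 1)) ?_)
        rw [hf2]
        exact Prod.ext h (by rw [h0, h0']; rfl)
      · refine congrArg Prod.fst (hfi (a₁ := (e, 0)) (a₂ := (e', 1)) ?_)
        rw [hf2]
        exact Prod.ext h (by rw [h0, h0']; rfl)
      · exact congrArg Prod.fst (hfi (Prod.ext h (h0.trans h0'.symm)))
    · intro e'
      obtain ⟨⟨e, s⟩, hz⟩ := hfs (e', 0)
      rcases hsw s with rfl | rfl
      · exact ⟨e, congrArg Prod.fst hz⟩
      · rw [hf2] at hz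
        exact ⟨e, congrArg Prod.fst hz⟩
  refine ⟨Equiv.ofBijective _ hε, fun e => if (f (e, 0)).2 = 0 then 1 else Equiv.swap 0 1, ?_⟩
  intro e s
  rw [hf]
  congr 2
  rcases hsw s with rfl | rfl
  · refine Prod.ext rfl ?_
    dsimp only
    split_ifs with h
    · simp [h]
    · rcases hsw (f (e, 0)).2 with h0 | h0
      · exact absurd h0 h
      · simp [h0]
  · rw [hf2]
    refine Prod.ext rfl ?_
    dsimp only
    split_ifs with h
    · simp [h]
    · rcases hsw (f (e, 0)).2 with h0 | h0
      · exact absurd h0 h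
      · simp [h0]

/-! ### Invariance under isomorphisms, gluing of legs, and the differential at one edge. -/

section Graphs

variable {k A : Type*} [Field k] [NonUnitalRing A] [Module k A]
  {𝒜 : ZMod 2 → Submodule k A} {M : CyclicDGAlgebra 𝒜}
  [IsScalarTower k A A] [SMulCommClass k A A] [DirectSum.Decomposition 𝒜] [FiniteDimensional k A]
  {V E n : ℕ}

theorem graphTensor_of_iso {Γ Γ' : RibbonGraph n} (τ : Γ.Flag ≃ Γ'.Flag) (π : Equiv.Perm (Fin n))
    (hrot : ∀ f, τ (Γ.rot f) = Γ'.rot (τ f)) (hinv : ∀ f, τ (Γ.inv f) = Γ'.inv (τ f))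
    (hleg : ∀ l, τ (Γ.leg l) = Γ'.leg (π l))
    {K : Fin Γ.numEdge → Matrix (HomIdx 𝒜) (HomIdx 𝒜) k}
    {K' : Fin Γ'.numEdge → Matrix (HomIdx 𝒜) (HomIdx 𝒜) k}
    (hK' : ∀ e s e' s', τ (Γ.flagEquiv (Sum.inl (e, s))) = Γ'.flagEquiv (Sum.inl (e', s')) →
      K' e' = K e)
    {o : Fin Γ.numEdge → ZMod 2} (hK : ∀ e, IsEdgeTensor (o e) (K e))
    (ho : ∀ e e', e ≠ e' → o e = 0 ∨ o e' = 0)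
    {p : Fin n → ZMod 2} {x : Fin n → A} (hx : ∀ l, x l ∈ 𝒜 (p l)) :
    graphTensor M Γ'.flagEquiv K' (x ∘ π.symm) =
      koszulSign k (fun l : Fin n => (l : ℕ)) (fun l => (π l : ℕ)) (fun l => p l + 1) *
        graphTensor M Γ.flagEquiv K x := by
  obtain ⟨ε, δ, hεδ⟩ := RibbonGraph.exists_edge_equiv τ π hinv hleg
  refine graphTensor_iso M ε δ π ?_ (fun e => hK' e 0 _ _ (hεδ e 0)) hK ho hx
  have h1 : ∀ z, ((Equiv.sumCongr (Equiv.prodShear ε δ) π).trans Γ'.flagEquiv) z =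
      τ (Γ.flagEquiv z) := by
    rintro (⟨e, s⟩ | l)
    · rw [hεδ]; rfl
    · exact (hleg l).symm
  intro z
  rw [Equiv.symm_apply_eq, h1, h1]
  have h2 := hrot (Γ.flagEquiv z)
  rw [← Prod.mk.eta (p := Γ.flagEquiv z), Γ.rot_apply,
    ← Prod.mk.eta (p := τ ((Γ.flagEquiv z).1, (Γ.flagEquiv z).2)), Γ'.rot_apply] at h2
  rw [Equiv.apply_symm_apply, ← h2]

variable (h : Homotopy M)

theorem isEdgeTensor_propagator [CharZero k] : IsEdgeTensor 0 (propagator h) where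
  parity {i j} hij := by
    have : i.1 = j.1 := by
      by_contra hne
      exact hij (propagator_parity h hne)
    rw [this]
    have : ∀ a : ZMod 2, a + 1 + (a + 1) = 0 := by decide
    exact this _
  symm := propagator_symm h

theorem contraction_of_iso [CharZero k] {Γ Γ' : RibbonGraph n} (τ : Γ.Flag ≃ Γ'.Flag)
    (π : Equiv.Perm (Fin n))
    (hrot : ∀ f, τ (Γ.rot f) = Γ'.rot (τ f)) (hinv : ∀ f, τ (Γ.inv f) = Γ'.inv (τ f))
    (hleg : ∀ l, τ (Γ.leg l) = Γ'.leg (π l))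
    {p : Fin n → ZMod 2} {x : Fin n → A} (hx : ∀ l, x l ∈ 𝒜 (p l)) :
    contraction h Γ' (x ∘ π.symm) =
      koszulSign k (fun l : Fin n => (l : ℕ)) (fun l => (π l : ℕ)) (fun l => p l + 1) *
        contraction h Γ x := by
  rw [contraction_eq_graphTensor, contraction_eq_graphTensor]
  exact graphTensor_of_iso τ π hrot hinv hleg (fun _ _ _ _ _ => rfl)
    (fun _ => isEdgeTensor_propagator h) (fun _ _ _ => Or.inl rfl) hx

theorem contraction_eq_zero [CharZero k] (Γ : RibbonGraph n) {p : Fin n → ZMod 2} {x : Fin n → A}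
    (hx : ∀ l, x l ∈ 𝒜 (p l)) (h0 : ∑ l, (p l + 1) ≠ 0) : contraction h Γ x = 0 := by
  rw [contraction_eq_graphTensor]
  exact graphTensor_eq_zero (fun _ => isEdgeTensor_propagator h) hx (by simpa using h0)

/-- The labels of the last edge and of the other edges. -/
def lastEdgeEquiv (I : Type*) (E : ℕ) :
    (I × I) × (Fin E × Fin 2 → I) ≃ (Fin (E + 1) × Fin 2 → I) where
  toFun a z := Fin.lastCases (motive := fun _ => I) (if z.2 = 0 then a.1.1 else a.1.2)
    (fun e => a.2 (e, z.2)) z.1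
  invFun ψ := ((ψ (Fin.last E, 0), ψ (Fin.last E, 1)), fun z => ψ (z.1.castSucc, z.2))
  left_inv a := by simp
  right_inv ψ := by
    funext ⟨e, s⟩
    have hs : s = 0 ∨ s = 1 := by revert s; decide
    refine Fin.lastCases ?_ (fun e => ?_) e
    · rcases hs with rfl | rfl <;> simp
    · simp

theorem lastEdgeEquiv_last_zero {I : Type*} (a : (I × I) × (Fin E × Fin 2 → I)) :
    lastEdgeEquiv I E a (Fin.last E, 0) = a.1.1 := by simp [lastEdgeEquiv]

theorem lastEdgeEquiv_last_one {I : Type*} (a : (I × I) × (Fin E × Fin 2 → I)) :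
    lastEdgeEquiv I E a (Fin.last E, 1) = a.1.2 := by simp [lastEdgeEquiv]

theorem lastEdgeEquiv_castSucc {I : Type*} (a : (I × I) × (Fin E × Fin 2 → I)) (e : Fin E)
    (s : Fin 2) : lastEdgeEquiv I E a (e.castSucc, s) = a.2 (e, s) := by simp [lastEdgeEquiv]

variable (M) in
-- Legs `0` and `1` become the halves of the last edge, which stand exactly where these legs stood
-- in the order by edges and legs. Gluing thus needs no sign.
theorem graphTensor_glue (Γ : RibbonGraph (n + 2))
    (K : Fin Γ.numEdge → Matrix (HomIdx 𝒜) (HomIdx 𝒜) k) (t : Matrix (HomIdx 𝒜) (HomIdx 𝒜) k)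
    {p : Fin n → ZMod 2} {x : Fin n → A} (hx : ∀ l, x l ∈ 𝒜 (p l)) :
    graphTensor M Γ.glue.flagEquiv (Fin.snoc (α := fun _ => Matrix (HomIdx 𝒜) (HomIdx 𝒜) k) K t) x =
      ∑ i, ∑ j, t i j * graphTensor M Γ.flagEquiv K
        (Fin.cons (homBasis 𝒜 i) (Fin.cons (homBasis 𝒜 j) x)) := by
  rw [graphTensor_apply, ← Equiv.sum_comp (lastEdgeEquiv (HomIdx 𝒜) Γ.numEdge),
    Fintype.sum_prod_type, Fintype.sum_prod_type]
  refine Finset.sum_congr rfl fun i _ => Finset.sum_congr rfl fun j _ => ?_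
  rw [graphTensor_apply, Finset.mul_sum]
  refine Finset.sum_congr rfl fun ψ _ => ?_
  rw [Fin.prod_univ_castSucc]
  simp only [Fin.snoc_castSucc, Fin.snoc_last, lastEdgeEquiv_last_zero, lastEdgeEquiv_last_one,
    lastEdgeEquiv_castSucc]
  have hx' : ∀ l, (Fin.cons (homBasis 𝒜 i) (Fin.cons (homBasis 𝒜 j) x) : Fin (n + 2) → A) l ∈
      𝒜 ((Fin.cons i.1 (Fin.cons j.1 p) : Fin (n + 2) → ZMod 2) l) := by
    intro l
    refine Fin.cases (homBasis_mem 𝒜 i) (fun l => ?_) l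
    refine Fin.cases (homBasis_mem 𝒜 j) (fun l => ?_) l
    exact hx l
  have h1 := vertexTensor_reindex M Γ.flagEquiv (RibbonGraph.glueEquiv Γ.numEdge n) edgeLegRank
    (letters_mem ψ hx')
  -- The two orders coincide literally: the new half-edges have ranks `2 * E` and `2 * E + 1`,
  -- formerly those of the first two legs.
  have h2 : edgeLegRank ∘ RibbonGraph.glueEquiv Γ.numEdge n = edgeLegRank := by
    funext z
    rcases z with ⟨e, s⟩ | l
    · refine Fin.lastCases ?_ (fun e => ?_) e
      · simp [RibbonGraph.glueEquiv, edgeLegRank]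
      · simp [RibbonGraph.glueEquiv, edgeLegRank]
    · simp [RibbonGraph.glueEquiv, edgeLegRank]
      omega
  have h3 : letters 𝒜 ψ (Fin.cons (homBasis 𝒜 i) (Fin.cons (homBasis 𝒜 j) x)) ∘
      RibbonGraph.glueEquiv Γ.numEdge n =
      letters 𝒜 (lastEdgeEquiv (HomIdx 𝒜) Γ.numEdge ((i, j), ψ)) x := by
    funext z
    have hs : ∀ s : Fin 2, s = 0 ∨ s = 1 := by decide
    rcases z with ⟨e, s⟩ | l
    · refine Fin.lastCases ?_ (fun e => ?_) e
      · rcases hs s with rfl | rfl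
        · simp [RibbonGraph.glueEquiv, letters, lastEdgeEquiv_last_zero]
        · have : (Fin.castLE (by omega) (1 : Fin 2) : Fin (n + 2)) = 1 := rfl
          simp [RibbonGraph.glueEquiv, letters, lastEdgeEquiv_last_one, this]
      · simp [RibbonGraph.glueEquiv, letters, lastEdgeEquiv_castSucc]
    · simp [RibbonGraph.glueEquiv, letters]
  rw [h2, h3] at h1
  rw [← h1]
  ring

/-- The labels of the edge `e` and of the other edges. -/
def edgeSplitEquiv (I : Type*) (e : Fin E) :
    ({z : Fin E × Fin 2 // z.1 ≠ e} → I) × (I × I) ≃ (Fin E × Fin 2 → I) where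
  toFun a z := if hz : z.1 = e then (if z.2 = 0 then a.2.1 else a.2.2) else a.1 ⟨z, hz⟩
  invFun ψ := (fun z => ψ z.1, (ψ (e, 0), ψ (e, 1)))
  left_inv a := by
    refine Prod.ext ?_ (Prod.ext ?_ ?_)
    · funext z; simp [z.2]
    · simp
    · simp
  right_inv ψ := by
    funext ⟨e', s⟩
    have hs : s = 0 ∨ s = 1 := by revert s; decide
    by_cases h : e' = e
    · subst h
      rcases hs with rfl | rfl <;> simp
    · simp [h]

/-- A multilinear map as a function of two of its arguments. -/
def bilinearAt {X : Type*} [DecidableEq X] (T : MultilinearMap k (fun _ : X => A) k) (y : X → A)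
    {a b : X} (hab : a ≠ b) : A →ₗ[k] A →ₗ[k] k :=
  LinearMap.mk₂ k (fun u v => T (Function.update (Function.update y a u) b v))
    (fun u u' v => by
      simp only [Function.update_comm hab, MultilinearMap.map_update_add])
    (fun c u v => by
      simp only [Function.update_comm hab, MultilinearMap.map_update_smul])
    (fun u v v' => by simp only [MultilinearMap.map_update_add])
    (fun c u v => by simp only [MultilinearMap.map_update_smul])

theorem bilinearAt_apply {X : Type*} [DecidableEq X] (T : MultilinearMap k (fun _ : X => A) k)
    (y : X → A) {a b : X} (hab : a ≠ b) (u v : A) :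
    bilinearAt T y hab u v = T (Function.update (Function.update y a u) b v) := rfl

/-- The part of `β^∨` in the image of `P`. -/
def imageTensor : Matrix (HomIdx 𝒜) (HomIdx 𝒜) k :=
  LinearMap.toMatrix (homBasis 𝒜) (homBasis 𝒜) h.P * inverseTensor 𝒜 M.form

theorem sum_imageTensor (T : A →ₗ[k] A →ₗ[k] k) :
    ∑ i, ∑ j, imageTensor h i j * T (homBasis 𝒜 i) (homBasis 𝒜 j) =
      ∑ i, ∑ j, inverseTensor 𝒜 M.form i j * T (h.P (homBasis 𝒜 i)) (homBasis 𝒜 j) := by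
  have h1 : ∀ i j, T (h.P (homBasis 𝒜 i)) (homBasis 𝒜 j) =
      ∑ l, (homBasis 𝒜).repr (h.P (homBasis 𝒜 i)) l * T (homBasis 𝒜 l) (homBasis 𝒜 j) := by
    intro i j
    conv_lhs => rw [← (homBasis 𝒜).sum_repr (h.P (homBasis 𝒜 i))]
    simp only [map_sum, map_smul, LinearMap.sum_apply, LinearMap.smul_apply, smul_eq_mul]
  simp only [imageTensor, Matrix.mul_apply, h1, Finset.sum_mul, Finset.mul_sum,
    LinearMap.toMatrix_apply]
  have h2 : ∀ F : HomIdx 𝒜 → HomIdx 𝒜 → HomIdx 𝒜 → k,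
      ∑ i, ∑ j, ∑ l, F i j l = ∑ l, ∑ j, ∑ i, F i j l := by
    intro F
    rw [Finset.sum_comm, Finset.sum_congr rfl fun j _ => Finset.sum_comm, Finset.sum_comm]
  rw [h2]
  exact Finset.sum_congr rfl fun i _ => Finset.sum_congr rfl fun j _ =>
    Finset.sum_congr rfl fun l _ => by ring

/-- With the labels of all other edges fixed, the vertex tensor is a bilinear function of the two
letters at `e`, and `sum_propagator_d` applies to it. -/
theorem sum_contraction_edge_d [CharZero k] (g : (Fin E × Fin 2) ⊕ Fin n ≃ Fin V × Fin 3) (e : Fin E)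
    (x : Fin n → A) :
    ∑ ψ : Fin E × Fin 2 → HomIdx 𝒜, (∏ e, propagator h (ψ (e, 0)) (ψ (e, 1))) *
      (vertexTensor M g edgeLegRank (Function.update (letters 𝒜 ψ x) (Sum.inl (e, 0))
        (M.d (homBasis 𝒜 (ψ (e, 0))))) +
      sgn k ((ψ (e, 0)).1 + 1) * vertexTensor M g edgeLegRank
        (Function.update (letters 𝒜 ψ x) (Sum.inl (e, 1)) (M.d (homBasis 𝒜 (ψ (e, 1)))))) =
    -graphTensor M g (Function.update (fun _ => propagator h) e
      (inverseTensor 𝒜 M.form - imageTensor h)) x := by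
  rw [graphTensor_apply, ← Equiv.sum_comp (edgeSplitEquiv (HomIdx 𝒜) e),
    ← Equiv.sum_comp (edgeSplitEquiv (HomIdx 𝒜) e), Fintype.sum_prod_type, Fintype.sum_prod_type,
    ← Finset.sum_neg_distrib]
  refine Finset.sum_congr rfl fun χ _ => ?_
  rw [Fintype.sum_prod_type, Fintype.sum_prod_type]
  have h0 : ∀ a : HomIdx 𝒜 × HomIdx 𝒜, edgeSplitEquiv (HomIdx 𝒜) e (χ, a) (e, 0) = a.1 :=
    fun a => by simp [edgeSplitEquiv]
  have h1 : ∀ a : HomIdx 𝒜 × HomIdx 𝒜, edgeSplitEquiv (HomIdx 𝒜) e (χ, a) (e, 1) = a.2 :=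
    fun a => by simp [edgeSplitEquiv]
  have h2 : ∀ (a : HomIdx 𝒜 × HomIdx 𝒜) e' (he : e' ≠ e) s,
      edgeSplitEquiv (HomIdx 𝒜) e (χ, a) (e', s) = χ ⟨(e', s), he⟩ :=
    fun a e' he s => by simp [edgeSplitEquiv, he]
  set R : k := ∏ e' : {e' // e' ≠ e}, propagator h (χ ⟨(e'.1, 0), e'.2⟩) (χ ⟨(e'.1, 1), e'.2⟩)
  have h3 : ∀ (K : Fin E → Matrix (HomIdx 𝒜) (HomIdx 𝒜) k) (_ : ∀ e', e' ≠ e → K e' = propagator h)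
      (a : HomIdx 𝒜 × HomIdx 𝒜),
      ∏ e', K e' (edgeSplitEquiv (HomIdx 𝒜) e (χ, a) (e', 0))
        (edgeSplitEquiv (HomIdx 𝒜) e (χ, a) (e', 1)) = K e a.1 a.2 * R := by
    intro K hK a
    rw [← Finset.mul_prod_erase _ _ (Finset.mem_univ e), h0, h1]
    congr 1
    rw [Finset.prod_subtype (p := fun e' => e' ≠ e) _ (by simp)]
    refine Finset.prod_congr rfl fun e' _ => ?_
    rw [h2 _ _ e'.2, h2 _ _ e'.2, hK _ e'.2]
  set y : (Fin E × Fin 2) ⊕ Fin n → A :=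
    Sum.elim (fun z => if hz : z.1 = e then 0 else homBasis 𝒜 (χ ⟨z, hz⟩)) x with hy
  have hne : (Sum.inl (e, 0) : (Fin E × Fin 2) ⊕ Fin n) ≠ Sum.inl (e, 1) := by simp
  have h4 : ∀ a : HomIdx 𝒜 × HomIdx 𝒜, letters 𝒜 (edgeSplitEquiv (HomIdx 𝒜) e (χ, a)) x =
      Function.update (Function.update y (Sum.inl (e, 0)) (homBasis 𝒜 a.1)) (Sum.inl (e, 1))
        (homBasis 𝒜 a.2) := by
    intro a
    funext z
    rcases z with ⟨e', s⟩ | l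
    · by_cases he : e' = e
      · subst he
        have hs : s = 0 ∨ s = 1 := by revert s; decide
        rcases hs with rfl | rfl
        · rw [Function.update_of_ne hne, Function.update_self]
          exact congrArg (homBasis 𝒜) (h0 a)
        · rw [Function.update_self]
          exact congrArg (homBasis 𝒜) (h1 a)
      · rw [Function.update_of_ne (by simp [he]), Function.update_of_ne (by simp [he])]
        rw [letters, hy, Sum.elim_inl, Sum.elim_inl, dif_neg he, h2 a e' he]
    · rw [Function.update_of_ne (by simp), Function.update_of_ne (by simp)]
      rfl
  set T := bilinearAt (vertexTensor M g edgeLegRank) y hne with hT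
  have hlhs := sum_propagator_d h T
  rw [Finset.sum_congr rfl fun i _ => Finset.sum_congr rfl fun j _ => by
    rw [h3 _ (fun _ _ => rfl) (i, j), h0, h1, h4, Function.update_idem,
      Function.update_comm hne.symm, Function.update_idem]]
  have hP := sum_imageTensor h T
  have hl : ∀ i j : HomIdx 𝒜, vertexTensor M g edgeLegRank
      (letters 𝒜 (edgeSplitEquiv (HomIdx 𝒜) e (χ, (i, j))) x) =
      T (homBasis 𝒜 i) (homBasis 𝒜 j) := fun i j => by rw [h4]; rfl
  have hr : ∑ i, ∑ j, (∏ e', Function.update (fun _ => propagator h) e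
      (inverseTensor 𝒜 M.form - imageTensor h) e'
        (edgeSplitEquiv (HomIdx 𝒜) e (χ, (i, j)) (e', 0))
        (edgeSplitEquiv (HomIdx 𝒜) e (χ, (i, j)) (e', 1))) *
        vertexTensor M g edgeLegRank (letters 𝒜 (edgeSplitEquiv (HomIdx 𝒜) e (χ, (i, j))) x) =
      R * (∑ i, ∑ j, inverseTensor 𝒜 M.form i j * T (homBasis 𝒜 i) (homBasis 𝒜 j) -
        ∑ i, ∑ j, imageTensor h i j * T (homBasis 𝒜 i) (homBasis 𝒜 j)) := by
    rw [← Finset.sum_sub_distrib, Finset.mul_sum]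
    refine Finset.sum_congr rfl fun i _ => ?_
    rw [← Finset.sum_sub_distrib, Finset.mul_sum]
    refine Finset.sum_congr rfl fun j _ => ?_
    rw [h3 _ (fun e' he => Function.update_of_ne he _ _), Function.update_self, hl,
      Matrix.sub_apply]
    ring
  rw [hr, hP]
  have hlhs' : ∑ i, ∑ j, inverseTensor 𝒜 M.form i j * (T (homBasis 𝒜 i) (homBasis 𝒜 j) -
        T (h.P (homBasis 𝒜 i)) (homBasis 𝒜 j)) =
      ∑ i, ∑ j, inverseTensor 𝒜 M.form i j * T (homBasis 𝒜 i) (homBasis 𝒜 j) -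
      ∑ i, ∑ j, inverseTensor 𝒜 M.form i j * T (h.P (homBasis 𝒜 i)) (homBasis 𝒜 j) := by
    simp only [mul_sub, Finset.sum_sub_distrib]
  rw [← hlhs', ← mul_neg, ← hlhs, Finset.mul_sum]
  refine Finset.sum_congr rfl fun i _ => ?_
  rw [Finset.mul_sum]
  refine Finset.sum_congr rfl fun j _ => ?_
  rw [hT, bilinearAt_apply, bilinearAt_apply]
  ring

end Graphs

/-- Every half-edge of a graph can be cut. -/
theorem RibbonGraph.exists_cut {n : ℕ} (Γ : RibbonGraph n) (e : Fin Γ.numEdge) (s : Fin 2) :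
    ∃ (Γ' : RibbonGraph (n + 2)) (τ : Γ'.glue.Flag ≃ Γ.Flag),
      (∀ f, τ (Γ'.glue.rot f) = Γ.rot (τ f)) ∧ (∀ f, τ (Γ'.glue.inv f) = Γ.inv (τ f)) ∧
      (∀ l, τ (Γ'.glue.leg l) = Γ.leg l) ∧ τ (Γ'.leg 0) = Γ.flagEquiv (Sum.inl (e, s)) := by
  obtain ⟨V, E, g⟩ := Γ
  cases E with
  | zero => exact e.elim0
  | succ E =>
    -- The edge `e` is moved to the last place and flipped if necessary, so that the chosen half
    -- becomes the new leg `0`.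
    set δ : Equiv.Perm (Fin 2) := if s = 0 then 1 else Equiv.swap 0 1 with hδ
    set ρ : (Fin (E + 1) × Fin 2) ⊕ Fin n ≃ (Fin (E + 1) × Fin 2) ⊕ Fin n :=
      Equiv.sumCongr (Equiv.prodShear (Equiv.swap e (Fin.last E)) fun _ => δ) (Equiv.refl _) with hρ
    have hδs : δ 0 = s ∧ ∀ t, δ (Equiv.swap 0 1 t) = Equiv.swap 0 1 (δ t) := by
      have : ∀ s : Fin 2, (if s = 0 then (1 : Equiv.Perm (Fin 2)) else Equiv.swap 0 1) 0 = s ∧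
          ∀ t, (if s = 0 then (1 : Equiv.Perm (Fin 2)) else Equiv.swap 0 1) (Equiv.swap 0 1 t) =
          Equiv.swap 0 1 ((if s = 0 then (1 : Equiv.Perm (Fin 2)) else Equiv.swap 0 1) t) := by
        decide
      exact this s
    set Γ' : RibbonGraph (n + 2) := ⟨V, E, (glueEquiv E n).symm.trans (ρ.trans g)⟩ with hΓ'
    have hg : ∀ z, Γ'.glue.flagEquiv z = g (ρ z) := by
      intro z
      change g (ρ ((glueEquiv E n).symm (glueEquiv E n z))) = _
      rw [Equiv.symm_apply_apply]
    refine ⟨Γ', Equiv.refl _, fun f => rfl, fun f => ?_, fun l => hg (Sum.inr l), ?_⟩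
    · obtain ⟨⟨e', t⟩ | l, rfl⟩ := Γ'.glue.flagEquiv.surjective f
      · have h1 : ∀ t, g (ρ (Sum.inl (e', t))) = (⟨V, E + 1, g⟩ : RibbonGraph n).flagEquiv
            (Sum.inl (Equiv.swap e (Fin.last E) e', δ t)) := fun t => rfl
        rw [inv_inl, hg, hg, h1, h1, Equiv.refl_apply, Equiv.refl_apply, inv_inl, hδs.2]
      · have h1 : Γ'.glue.flagEquiv (Sum.inr l) = (⟨V, E + 1, g⟩ : RibbonGraph n).leg l :=
          hg (Sum.inr l)
        exact (inv_leg Γ'.glue l).trans (h1.trans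
          ((inv_leg (⟨V, E + 1, g⟩ : RibbonGraph n) l).symm.trans
            (congrArg _ h1.symm)))
    · have h2 := Γ'.glue_flagEquiv_last_zero
      rw [Equiv.refl_apply, ← h2]
      refine (hg _).trans ?_
      change g (Sum.inl (Equiv.swap e (Fin.last E) (Fin.last E), δ 0)) = _
      rw [hδs.1, Equiv.swap_apply_right]

/-! ### The differential of a contraction as a sum over edges. -/

section Differential

variable {k A : Type*} [Field k] [NonUnitalRing A] [Module k A]
  {𝒜 : ZMod 2 → Submodule k A} {M : CyclicDGAlgebra 𝒜}
  [IsScalarTower k A A] [SMulCommClass k A A] [DirectSum.Decomposition 𝒜] [FiniteDimensional k A]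
  {V E n : ℕ} (h : Homotopy M)

variable {B : Type*} [AddCommGroup B] [Module k B] {ℬ : ZMod 2 → Submodule k B}
  [DirectSum.Decomposition ℬ] [FiniteDimensional k B]

theorem sum_imageTensor_eq {R : CyclicAInfinity ℬ} {incl : B →ₗ[k] A}
    (hm : IsTreeModel R h incl) (T : A →ₗ[k] A →ₗ[k] k) :
    ∑ i, ∑ j, imageTensor h i j * T (homBasis 𝒜 i) (homBasis 𝒜 j) =
    ∑ i, ∑ j, inverseTensor ℬ R.form i j * T (incl (homBasis ℬ i)) (incl (homBasis ℬ j)) := by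
  rw [sum_imageTensor, sum_inverseTensor_incl h hm]

/-- Displays the tensor as the image of the inverse tensor of `B`, from which it inherits symmetry
and parity. -/
theorem imageTensor_apply {R : CyclicAInfinity ℬ} {incl : B →ₗ[k] A}
    (hm : IsTreeModel R h incl) (i j : HomIdx 𝒜) :
    imageTensor h i j = ∑ a, ∑ b, inverseTensor ℬ R.form a b *
      ((homBasis 𝒜).repr (incl (homBasis ℬ a)) i * (homBasis 𝒜).repr (incl (homBasis ℬ b)) j) := by
  have h1 := sum_imageTensor_eq h hm
    ((LinearMap.mul k k).compl₁₂ ((homBasis 𝒜).coord i) ((homBasis 𝒜).coord j))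
  simp only [LinearMap.compl₁₂_apply, LinearMap.mul_apply', Module.Basis.coord_apply,
    Module.Basis.repr_self, Finsupp.single_apply] at h1
  rw [← h1]
  simp

theorem imageTensor_symm {R : CyclicAInfinity ℬ} {incl : B →ₗ[k] A}
    (hm : IsTreeModel R h incl) (i j : HomIdx 𝒜) : imageTensor h i j = imageTensor h j i := by
  rw [imageTensor_apply h hm i j, imageTensor_apply h hm j i, Finset.sum_comm]
  refine Finset.sum_congr rfl fun a _ => Finset.sum_congr rfl fun b _ => ?_
  rw [inverseTensor_symm R.form_odd b a]
  ring

theorem imageTensor_parity [CharZero k] {R : CyclicAInfinity ℬ} {incl : B →ₗ[k] A}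
    (hm : IsTreeModel R h incl) {i j : HomIdx 𝒜} (hij : i.1 = j.1) : imageTensor h i j = 0 := by
  rw [imageTensor_apply h hm i j]
  refine Finset.sum_eq_zero fun a _ => Finset.sum_eq_zero fun b _ => ?_
  by_cases h1 : i.1 = a.1
  · by_cases h2 : j.1 = b.1
    · rw [inverseTensor_parity R.form_odd (h1.symm.trans (hij.trans h2)), zero_mul]
    · rw [homBasis_repr_of_mem (hm.incl_mem _ _ (homBasis_mem ℬ b)) h2, mul_zero, mul_zero]
  · rw [homBasis_repr_of_mem (hm.incl_mem _ _ (homBasis_mem ℬ a)) h1, zero_mul, mul_zero]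

theorem isEdgeTensor_one {K : Matrix (HomIdx 𝒜) (HomIdx 𝒜) k}
    (h0 : ∀ i j : HomIdx 𝒜, i.1 = j.1 → K i j = 0) (h1 : ∀ i j, K i j = K j i) :
    IsEdgeTensor 1 K where
  parity {i j} hij := by
    have h2 : ∀ a b : ZMod 2, a ≠ b → a + 1 + (b + 1) = 1 := by decide
    exact h2 _ _ fun h => hij (h0 _ _ h)
  symm i j := by
    by_cases hij : i.1 = j.1
    · rw [h0 i j hij, h0 j i hij.symm, mul_zero]
    · have h2 : ∀ a b : ZMod 2, a ≠ b → (a + 1) * (b + 1) = 0 := by decide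
      rw [h2 _ _ hij, sgn_zero, one_mul, h1 i j]

theorem isEdgeTensor_inverseTensor [CharZero k] {β : LinearMap.BilinForm k A}
    (hβ : IsOddScalarProduct 𝒜 β) : IsEdgeTensor 1 (inverseTensor 𝒜 β) :=
  isEdgeTensor_one (fun _ _ => inverseTensor_parity hβ) (inverseTensor_symm hβ)

theorem isEdgeTensor_imageTensor [CharZero k] {R : CyclicAInfinity ℬ} {incl : B →ₗ[k] A}
    (hm : IsTreeModel R h incl) : IsEdgeTensor 1 (imageTensor h) :=
  isEdgeTensor_one (fun _ _ => imageTensor_parity h hm) (imageTensor_symm h hm)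

/-- Earlier edges are even in total, so the sign of applying `d` at a half-edge depends at most on
the other half of the same edge. -/
theorem sum_edgeLegRank_lt (e : Fin E) (s : Fin 2) {q : (Fin E × Fin 2) ⊕ Fin n → ZMod 2}
    (hq : ∀ e, q (Sum.inl (e, 0)) + q (Sum.inl (e, 1)) = 0) :
    ∑ z with edgeLegRank z < edgeLegRank (n := n) (Sum.inl (e, s)), q z =
      if s = 0 then 0 else q (Sum.inl (e, 0)) := by
  rw [Finset.sum_filter, Fintype.sum_sum_type, Fintype.sum_prod_type]
  have h0 : ∀ l : Fin n, ¬ edgeLegRank (E := E) (Sum.inr l) < edgeLegRank (n := n) (Sum.inl (e, s)) :=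
    fun l => (edgeLegRank_lt _ _).not_gt
  simp only [h0, if_false, Finset.sum_const_zero, add_zero, Fin.sum_univ_two]
  rw [Finset.sum_eq_single e]
  · have hs : ∀ s : Fin 2, s = 0 ∨ s = 1 := by decide
    rcases hs s with rfl | rfl <;> simp [edgeLegRank_inl]
  · intro e' _ he'
    have : (e' : ℕ) ≠ e := fun h => he' (Fin.ext h)
    have h2 := s.2
    by_cases hlt : (e' : ℕ) < e
    · have h3 : edgeLegRank (n := n) (Sum.inl (e', (0 : Fin 2))) <
          edgeLegRank (n := n) (Sum.inl (e, s)) := by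
        rw [edgeLegRank_inl, edgeLegRank_inl]; simp; omega
      have h4 : edgeLegRank (n := n) (Sum.inl (e', (1 : Fin 2))) <
          edgeLegRank (n := n) (Sum.inl (e, s)) := by
        rw [edgeLegRank_inl, edgeLegRank_inl]; simp; omega
      rw [if_pos h3, if_pos h4, hq]
    · have h3 : ¬ edgeLegRank (n := n) (Sum.inl (e', (0 : Fin 2))) <
          edgeLegRank (n := n) (Sum.inl (e, s)) := by
        rw [edgeLegRank_inl, edgeLegRank_inl]; simp; omega
      have h4 : ¬ edgeLegRank (n := n) (Sum.inl (e', (1 : Fin 2))) <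
          edgeLegRank (n := n) (Sum.inl (e, s)) := by
        rw [edgeLegRank_inl, edgeLegRank_inl]; simp; omega
      rw [if_neg h3, if_neg h4, add_zero]
  · simp

theorem sum_edgeLegRank_lt_inr (l : Fin n) {q : (Fin E × Fin 2) ⊕ Fin n → ZMod 2}
    (hq : ∀ e, q (Sum.inl (e, 0)) + q (Sum.inl (e, 1)) = 0) :
    ∑ z with edgeLegRank z < edgeLegRank (E := E) (Sum.inr l), q z =
      ∑ m with m < l, q (Sum.inr m) := by
  rw [Finset.sum_filter, Fintype.sum_sum_type, Fintype.sum_prod_type, Finset.sum_filter]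
  have h0 : ∀ z : Fin E × Fin 2, edgeLegRank (n := n) (Sum.inl z) <
      edgeLegRank (E := E) (Sum.inr l) := fun z => edgeLegRank_lt _ _
  simp only [h0, if_true, Fin.sum_univ_two, hq, Finset.sum_const_zero, zero_add]
  refine Finset.sum_congr rfl fun m _ => ?_
  simp [edgeLegRank_inr]

/-- The differential of a contraction is the sum over the edges of the contractions in which the
propagator is replaced by its differential. -/
theorem sum_contraction_d [CharZero k] (Γ : RibbonGraph n) {p : Fin n → ZMod 2} {x : Fin n → A}
    (hx : ∀ l, x l ∈ 𝒜 (p l)) :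
    ∑ l, sgn k (∑ m with m < l, (p m + 1)) *
        contraction h Γ (Function.update x l (M.d (x l))) =
      ∑ e, graphTensor M Γ.flagEquiv (Function.update (fun _ => propagator h) e
        (inverseTensor 𝒜 M.form - imageTensor h)) x := by
  -- For fixed labels of the half-edges, `sum_vertexTensor_d` is split into the terms with `d` on
  -- half-edges and those with `d` on legs.
  have hz : ∀ ψ : Fin Γ.numEdge × Fin 2 → HomIdx 𝒜,
      (∏ e, propagator h (ψ (e, 0)) (ψ (e, 1))) *
      (∑ e, (vertexTensor M Γ.flagEquiv edgeLegRank (Function.update (letters 𝒜 ψ x)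
        (Sum.inl (e, 0)) (M.d (homBasis 𝒜 (ψ (e, 0))))) +
      sgn k ((ψ (e, 0)).1 + 1) * vertexTensor M Γ.flagEquiv edgeLegRank
        (Function.update (letters 𝒜 ψ x) (Sum.inl (e, 1)) (M.d (homBasis 𝒜 (ψ (e, 1)))))) +
      ∑ l, sgn k (∑ m with m < l, (p m + 1)) * vertexTensor M Γ.flagEquiv edgeLegRank
        (letters 𝒜 ψ (Function.update x l (M.d (x l))))) = 0 := by
    intro ψ
    by_cases h0 : ∏ e, propagator h (ψ (e, 0)) (ψ (e, 1)) = 0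
    · rw [h0, zero_mul]
    have hq : ∀ e, (letterParity 𝒜 ψ p (Sum.inl (e, 0)) + 1) +
        (letterParity 𝒜 ψ p (Sum.inl (e, 1)) + 1) = 0 := fun e =>
      (isEdgeTensor_propagator h).parity (Finset.prod_ne_zero_iff.1 h0 e (Finset.mem_univ e))
    have h1 := sum_vertexTensor_d M Γ.flagEquiv edgeLegRank_injective (letters_mem ψ hx)
    rw [Fintype.sum_sum_type, Fintype.sum_prod_type] at h1
    simp only [Fin.sum_univ_two,
      sum_edgeLegRank_lt _ _ (q := fun z => letterParity 𝒜 ψ p z + 1) hq,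
      sum_edgeLegRank_lt_inr _ (q := fun z => letterParity 𝒜 ψ p z + 1) hq] at h1
    have h2 : ∀ l, Function.update (letters 𝒜 ψ x) (Sum.inr l) (M.d (letters 𝒜 ψ x (Sum.inr l))) =
        letters 𝒜 ψ (Function.update x l (M.d (x l))) := by
      intro l
      exact (Sum.elim_update_right _ _ _ _).symm
    simp only [h2, if_true, sgn_zero, one_mul, one_ne_zero, if_false] at h1
    rw [mul_eq_zero]
    exact Or.inr h1
  have h1 : ∀ l, sgn k (∑ m with m < l, (p m + 1)) *
      contraction h Γ (Function.update x l (M.d (x l))) =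
      ∑ ψ : Fin Γ.numEdge × Fin 2 → HomIdx 𝒜, (∏ e, propagator h (ψ (e, 0)) (ψ (e, 1))) *
        (sgn k (∑ m with m < l, (p m + 1)) * vertexTensor M Γ.flagEquiv edgeLegRank
          (letters 𝒜 ψ (Function.update x l (M.d (x l))))) := by
    intro l
    rw [contraction_eq_graphTensor, graphTensor_apply, Finset.mul_sum]
    exact Finset.sum_congr rfl fun ψ _ => by ring
  have h2 : ∀ e, graphTensor M Γ.flagEquiv (Function.update (fun _ => propagator h) e
        (inverseTensor 𝒜 M.form - imageTensor h)) x = _ := fun e =>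
    neg_eq_iff_eq_neg.1 (sum_contraction_edge_d h Γ.flagEquiv e x).symm
  simp only [h1, h2]
  rw [Finset.sum_neg_distrib, eq_neg_iff_add_eq_zero, Finset.sum_comm, add_comm, Finset.sum_comm,
    ← Finset.sum_add_distrib]
  refine Finset.sum_eq_zero fun ψ _ => ?_
  rw [← Finset.mul_sum, ← Finset.mul_sum, ← mul_add]
  exact hz ψ

/-- The contraction over the graph obtained by gluing the first two legs, with the tensor `t` at the
new edge. -/
def gluedContraction (t : Matrix (HomIdx 𝒜) (HomIdx 𝒜) k) (Γ : RibbonGraph (n + 2)) (x : Fin n → A) :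
    k :=
  ∑ i, ∑ j, t i j * contraction h Γ (Fin.cons (homBasis 𝒜 i) (Fin.cons (homBasis 𝒜 j) x))

theorem gluedContraction_sub (t t' : Matrix (HomIdx 𝒜) (HomIdx 𝒜) k) (Γ : RibbonGraph (n + 2))
    (x : Fin n → A) : gluedContraction h (t - t') Γ x =
      gluedContraction h t Γ x - gluedContraction h t' Γ x := by
  simp only [gluedContraction, Matrix.sub_apply, sub_mul, Finset.sum_sub_distrib]

theorem gluedContraction_eq (t : Matrix (HomIdx 𝒜) (HomIdx 𝒜) k) (Γ : RibbonGraph (n + 2))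
    {p : Fin n → ZMod 2} {x : Fin n → A} (hx : ∀ l, x l ∈ 𝒜 (p l)) :
    gluedContraction h t Γ x = graphTensor M Γ.glue.flagEquiv
      (Fin.snoc (α := fun _ => Matrix (HomIdx 𝒜) (HomIdx 𝒜) k) (fun _ => propagator h) t) x := by
  rw [graphTensor_glue M Γ _ t hx]
  simp only [gluedContraction, contraction_eq_graphTensor]

/-- Replacing the propagator at an edge amounts to cutting the edge. -/
theorem graphTensor_update_eq [CharZero k] {o : ZMod 2} {t : Matrix (HomIdx 𝒜) (HomIdx 𝒜) k}
    (ht : IsEdgeTensor o t) {Γ : RibbonGraph n} {Γ' : RibbonGraph (n + 2)}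
    (τ : Γ'.glue.Flag ≃ Γ.Flag)
    (hrot : ∀ f, τ (Γ'.glue.rot f) = Γ.rot (τ f)) (hinv : ∀ f, τ (Γ'.glue.inv f) = Γ.inv (τ f))
    (hleg : ∀ l, τ (Γ'.glue.leg l) = Γ.leg l) {e : Fin Γ.numEdge} {s : Fin 2}
    (hτ : τ (Γ'.leg 0) = Γ.flagEquiv (Sum.inl (e, s)))
    {p : Fin n → ZMod 2} {x : Fin n → A} (hx : ∀ l, x l ∈ 𝒜 (p l)) :
    graphTensor M Γ.flagEquiv (Function.update (fun _ => propagator h) e t) x =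
      gluedContraction h t Γ' x := by
  rw [gluedContraction_eq h t Γ' hx]
  have hτ1 : τ (Γ'.leg 1) = Γ.flagEquiv (Sum.inl (e, Equiv.swap 0 1 s)) := by
    rw [← Γ'.glue_inv_leg_zero, hinv, hτ, Γ.inv_inl]
  have := graphTensor_of_iso (M := M) τ 1 hrot hinv hleg
    (K := Fin.snoc (α := fun _ => Matrix (HomIdx 𝒜) (HomIdx 𝒜) k) (fun _ => propagator h) t)
    (K' := Function.update (fun _ => propagator h) e t)
    (o := Fin.snoc (α := fun _ => ZMod 2) (fun _ => 0) o) ?_ ?_ ?_ hx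
  · have h1 : koszulSign k (fun l : Fin n => (l : ℕ))
        (fun l => ((1 : Equiv.Perm (Fin n)) l : ℕ)) (fun l => p l + 1) = 1 := koszulSign_self _ _
    rw [h1, one_mul] at this
    exact this
  -- The last edge of the glued graph is matched with `e`, which carries `t`; every other edge is
  -- matched with an edge different from `e` and carries the propagator.
  · intro e₁ s₁ e' s' h1
    have hs : ∀ s : Fin 2, s = 0 ∨ s = 1 := by decide
    revert h1
    refine Fin.lastCases ?_ (fun e₁ => ?_) e₁
    · intro h1
      have : e' = e := by
        rcases hs s₁ with rfl | rfl
        · rw [Γ'.glue_flagEquiv_last_zero, hτ] at h1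
          simp only [EmbeddingLike.apply_eq_iff_eq, Sum.inl.injEq, Prod.mk.injEq] at h1
          exact h1.1.symm
        · rw [Γ'.glue_flagEquiv_last_one, hτ1] at h1
          simp only [EmbeddingLike.apply_eq_iff_eq, Sum.inl.injEq, Prod.mk.injEq] at h1
          exact h1.1.symm
      subst this
      rw [Function.update_self, Fin.snoc_last]
    · intro h1
      have : e' ≠ e := by
        rintro rfl
        have h2 : Γ'.glue.flagEquiv (Sum.inl (e₁.castSucc, s₁)) = Γ'.leg 0 ∨
            Γ'.glue.flagEquiv (Sum.inl (e₁.castSucc, s₁)) = Γ'.leg 1 := by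
          by_cases h3 : s' = s
          · subst h3
            left
            exact τ.injective (h1.trans hτ.symm)
          · right
            have : ∀ s s' : Fin 2, s' ≠ s → Equiv.swap 0 1 s = s' := by decide
            rw [this _ _ h3] at hτ1
            exact τ.injective (h1.trans hτ1.symm)
        rw [Γ'.glue_flagEquiv_cast, RibbonGraph.leg, RibbonGraph.leg] at h2
        simp at h2
      rw [Function.update_of_ne this, Fin.snoc_castSucc]
  · intro e₁
    refine Fin.lastCases ?_ (fun e₁ => ?_) e₁
    · simpa only [Fin.snoc_last] using ht
    · simpa only [Fin.snoc_castSucc] using isEdgeTensor_propagator h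
  · intro e₁ e₂
    refine Fin.lastCases ?_ (fun e₁ => ?_) e₁
    · refine Fin.lastCases ?_ (fun e₂ => ?_) e₂
      · intro h1; exact absurd rfl h1
      · intro _; right; simp only [Fin.snoc_castSucc]
    · intro _; left; simp only [Fin.snoc_castSucc]

end Differential

/-! ### The exchange of the two resolutions of a four-valent vertex. -/

section TwistPerm

variable {F F' : Type*} [DecidableEq F] [DecidableEq F']

/-- The cyclic permutation of the four neighbours of two flags `f`, `f'` at distinct trivalent
vertices with cyclic orders `(f, a, b)` and `(f', c, d)` after which the vertices carry `(f, b, c)`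
and `(f', d, a)`. -/
def twistPerm (ρ : Equiv.Perm F) (f f' : F) : Equiv.Perm F :=
  Equiv.swap (ρ f') (ρ (ρ f')) * Equiv.swap (ρ (ρ f)) (ρ f') * Equiv.swap (ρ f) (ρ (ρ f))

theorem twistPerm_map {ρ : Equiv.Perm F} {ρ' : Equiv.Perm F'} {e : F → F'}
    (he : Function.Injective e) (hρ : ∀ x, e (ρ x) = ρ' (e x)) (f f' x : F) :
    e (twistPerm ρ f f' x) = twistPerm ρ' (e f) (e f') (e x) := by
  simp only [twistPerm, Equiv.Perm.mul_apply, ← hρ, he.swap_apply]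

end TwistPerm

/-- The cyclic permutation at every vertex. -/
def vertexRot (V : ℕ) : Equiv.Perm (Fin V × Fin 3) := Equiv.prodCongr (Equiv.refl _) (finRotate 3)

theorem vertexRot_apply {V : ℕ} (v : Fin V) (i : Fin 3) : vertexRot V (v, i) = (v, i + 1) := by
  simp [vertexRot]

/-- Exchanging the parities of two factors that are adjacent in both orders. -/
theorem koszulSign_adjacent {k F : Type*} [CommRing k] [Fintype F] [DecidableEq F] {r s : F → ℕ}
    (hr : Function.Injective r) (hs : Function.Injective s) {a b : F} (hab : r a < r b)
    (hab' : s a < s b) (hra : ∀ z, z ≠ a → z ≠ b → (r z < r a ↔ r z < r b))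
    (hsa : ∀ z, z ≠ a → z ≠ b → (s z < s a ↔ s z < s b)) {q q' : F → ZMod 2}
    (hq : ∀ z, z ≠ a → z ≠ b → q z = q' z) (h1 : q a + q b = 1) (h2 : q' a + q' b = 1) :
    koszulSign k r s q = koszulSign k r s q' := by
  have hne : a ≠ b := fun h => by rw [h] at hab; exact hab.false
  by_cases hqa : q a = q' a
  · congr 1
    funext z
    by_cases hza : z = a
    · rw [hza, hqa]
    · by_cases hzb : z = b
      · subst hzb
        rw [hqa, ← h2] at h1
        exact add_left_cancel h1
      · exact hq z hza hzb
  · have h3 : ∀ x y x' y' : ZMod 2, x + y = 1 → x' + y' = 1 → x ≠ x' → x' = x + 1 ∧ y' = y + 1 := by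
      decide
    obtain ⟨h4, h5⟩ := h3 _ _ _ _ h1 h2 hqa
    -- If the parities differ at all, they differ at both places. Since `a` and `b` are adjacent in
    -- both orders, the correction signs of the two changes occur twice and cancel.
    have h6 : q' = Function.update (Function.update q a (q a + 1)) b
        (Function.update q a (q a + 1) b + 1) := by
      funext z
      by_cases hzb : z = b
      · subst hzb
        rw [Function.update_self, Function.update_of_ne hne.symm, h5]
      · rw [Function.update_of_ne hzb]
        by_cases hza : z = a
        · subst hza; rw [Function.update_self, h4]
        · rw [Function.update_of_ne hza, hq z hza hzb]
    have hbef : ∀ {t : F → ℕ} (_ : Function.Injective t) (_ : t a < t b)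
        (_ : ∀ z, z ≠ a → z ≠ b → (t z < t a ↔ t z < t b)),
        ∑ g with t g < t b, Function.update q a (q a + 1) g =
          ∑ g with t g < t a, q g + (q a + 1) := by
      intro t ht htab hta
      have : (Finset.univ.filter fun g => t g < t b) =
          insert a (Finset.univ.filter fun g => t g < t a) := by
        ext z
        simp only [Finset.mem_filter, Finset.mem_univ, true_and, Finset.mem_insert]
        by_cases hza : z = a
        · subst hza; simp [htab]
        · by_cases hzb : z = b
          · subst hzb; simp [hza, htab.not_gt]
          · simp [hza, hta z hza hzb]
      rw [this, Finset.sum_insert (by simp), Function.update_self, add_comm]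
      congr 1
      refine Finset.sum_congr rfl fun g hg => ?_
      rw [Function.update_of_ne]
      rintro rfl
      simp at hg
    rw [h6, koszulSign_update hr hs, koszulSign_update hr hs, hbef hr hab hra, hbef hs hab' hsa,
      sgn_add (∑ g with r g < r a, q g), sgn_add (∑ g with s g < s a, q g)]
    have e1 := sgn_mul_self (k := k) (∑ g with r g < r a, q g)
    have e2 := sgn_mul_self (k := k) (∑ g with s g < s a, q g)
    have e3 := sgn_mul_self (k := k) (q a + 1)
    generalize sgn k (∑ g with r g < r a, q g) = u at *
    generalize sgn k (∑ g with s g < s a, q g) = v at *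
    generalize sgn k (q a + 1) = w at *
    calc koszulSign k r s q = koszulSign k r s q * (u * u) * (v * v) * (w * w) := by
          rw [e1, e2, e3]; ring
      _ = _ := by ring

/-! ### Associativity as a relation between two trivalent vertices. -/

section Associativity

variable {k A : Type*} [Field k] [NonUnitalRing A] [Module k A]
  {𝒜 : ZMod 2 → Submodule k A} (M : CyclicDGAlgebra 𝒜)

/-- Invariance of the scalar product. -/
theorem CyclicDGAlgebra.form_mul {i j l : ZMod 2} {a b c : A} (ha : a ∈ 𝒜 i) (hb : b ∈ 𝒜 j)
    (hc : c ∈ 𝒜 l) : M.form (a * b) c = M.form (b * c) a := by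
  -- An odd form is nonzero only when the total parity is odd; in that case the sign of the
  -- cyclicity axiom cancels against those in the definition of the three-tensor.
  by_cases h : i + j + l = 1
  · have h1 := M.cyclic j l i b c a hb hc ha
    have h2 : (i + 1) * (j + l) = j + l := by
      have : ∀ i j l : ZMod 2, i + j + l = 1 → (i + 1) * (j + l) = j + l := by decide
      exact this i j l h
    rw [threeTensor, threeTensor, h2, sgn_add] at h1
    have e1 := sgn_mul_self (k := k) l
    have e2 := sgn_mul_self (k := k) j
    calc M.form (a * b) c = (sgn k l * sgn k l) * (sgn k j * sgn k j) * M.form (a * b) c := by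
          rw [e1, e2]; ring
      _ = sgn k l * (sgn k j * sgn k l * (sgn k j * M.form (a * b) c)) := by ring
      _ = (sgn k l * sgn k l) * M.form (b * c) a := by rw [← h1]; ring
      _ = _ := by rw [e1, one_mul]
  · have h1 : i + j = l := by
      have : ∀ i j l : ZMod 2, i + j + l ≠ 1 → i + j = l := by decide
      exact this i j l h
    have h2 : j + l = i := by
      have : ∀ i j l : ZMod 2, i + j = l → j + l = i := by decide
      exact this i j l h1
    rw [M.form_odd.odd l _ _ (h1 ▸ M.mul_mem i j a b ha hb) hc,
      M.form_odd.odd i _ _ (h2 ▸ M.mul_mem j l b c hb hc) ha]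

variable [IsScalarTower k A A] [SMulCommClass k A A] [DirectSum.Decomposition 𝒜]
  [FiniteDimensional k A]

/-- Contracting with `β^∨` expands the product `a * b` and inserts it as the first factor at the
other vertex. -/
theorem sum_threeTensor_mul {p q r : ZMod 2} {a b c d : A} (ha : a ∈ 𝒜 p) (hb : b ∈ 𝒜 q)
    (hc : c ∈ 𝒜 r) :
    ∑ i, ∑ j, inverseTensor 𝒜 M.form i j * (threeTensor M.form p (homBasis 𝒜 i) a b *
      threeTensor M.form r (homBasis 𝒜 j) c d) = sgn k (p + r) * M.form (a * b * c) d := by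
  have h1 := inverseTensor_expand M.form_odd
    ((LinearMap.flip M.form d).comp (LinearMap.mulRight k c)) (a * b)
  simp only [LinearMap.comp_apply, LinearMap.mulRight_apply, LinearMap.flip_apply,
    smul_eq_mul] at h1
  rw [← h1, Finset.mul_sum]
  refine Finset.sum_congr rfl fun i _ => ?_
  rw [Finset.mul_sum]
  refine Finset.sum_congr rfl fun j _ => ?_
  rw [threeTensor, threeTensor, M.form_mul (homBasis_mem 𝒜 i) ha hb, sgn_add,
    M.form_odd.comm (a * b)]
  ring

/-- Associativity in terms of the three-tensor. -/
theorem sum_threeTensor_twist {p q r s : ZMod 2} {a b c d : A} (ha : a ∈ 𝒜 p) (hb : b ∈ 𝒜 q)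
    (hc : c ∈ 𝒜 r) (hd : d ∈ 𝒜 s) :
    ∑ i, ∑ j, inverseTensor 𝒜 M.form i j * (threeTensor M.form q (homBasis 𝒜 i) b c *
      threeTensor M.form s (homBasis 𝒜 j) d a) =
    -∑ i, ∑ j, inverseTensor 𝒜 M.form i j * (threeTensor M.form p (homBasis 𝒜 i) a b *
      threeTensor M.form r (homBasis 𝒜 j) c d) := by
  rw [sum_threeTensor_mul M hb hc hd, sum_threeTensor_mul M ha hb hc, mul_assoc a b c,
    M.form_mul ha (M.mul_mem _ _ _ _ hb hc) hd]
  -- Either the parities force the common value to vanish, or `q + s` and `p + r` have opposite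
  -- parity, which is the source of the minus sign.
  by_cases h : q + r + s = p
  · rw [M.form_odd.odd p _ _ (h ▸ M.mul_mem _ _ _ _ (M.mul_mem _ _ _ _ hb hc) hd) ha]
    simp
  · have : ∀ p q r s : ZMod 2, q + r + s ≠ p → q + s = p + r + 1 := by decide
    rw [this p q r s h, sgn_add_one]
    ring

/-- The order of the flags at two vertices in which the flags at position `0` come first. -/
def pairRank (f : Fin 2 × Fin 3) : ℕ := ![![0, 2, 3], ![1, 4, 5]] f.1 f.2

theorem pairRank_injective : Function.Injective pairRank := by
  intro a b h
  have : ∀ a b : Fin 2 × Fin 3, pairRank a = pairRank b → a = b := by decide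
  exact this a b h

/-- Reordering moves the letter `(1, 0)` past two letters whose total parity is that of `(0, 0)`. As
the contracted letters have opposite parities, the sign is trivial. -/
theorem vertexTensor_pair {p : Fin 2 × Fin 3 → ZMod 2} {y : Fin 2 × Fin 3 → A}
    (hy : ∀ x, y x ∈ 𝒜 (p x)) (h0 : p (0, 0) + p (1, 0) = 1) :
    vertexTensor M (Equiv.refl _) pairRank y =
      threeTensor M.form (p (0, 1)) (y (0, 0)) (y (0, 1)) (y (0, 2)) *
      threeTensor M.form (p (1, 1)) (y (1, 0)) (y (1, 1)) (y (1, 2)) := by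
  rw [vertexTensor_apply M _ _ hy]
  have hw : vertexWeight M (p ∘ (Equiv.refl (Fin 2 × Fin 3)).symm) (y ∘ (Equiv.refl _).symm) =
      threeTensor M.form (p (0, 1)) (y (0, 0)) (y (0, 1)) (y (0, 2)) *
      threeTensor M.form (p (1, 1)) (y (1, 0)) (y (1, 1)) (y (1, 2)) := by
    rw [vertexWeight, Fin.prod_univ_two]
    rfl
  rw [hw]
  by_cases h1 : (p (0, 0) + 1) + (p (0, 1) + 1) + (p (0, 2) + 1) = 0
  swap
  · rw [threeTensor_eq_zero M (hy _) (hy _) (hy _) h1, zero_mul, mul_zero]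
  have hk : koszulSign k (flagRank ∘ Equiv.refl (Fin 2 × Fin 3)) pairRank (fun x => p x + 1) =
      sgn k ((p (0, 1) + 1) * (p (1, 0) + 1)) * sgn k ((p (0, 2) + 1) * (p (1, 0) + 1)) := by
    simp [koszulSign, Fintype.prod_prod_type, Fin.prod_univ_succ, flagRank, pairRank]
  rw [hk, ← sgn_add]
  have : (p (0, 1) + 1) * (p (1, 0) + 1) + (p (0, 2) + 1) * (p (1, 0) + 1) = 0 := by
    have : ∀ a b c d : ZMod 2, a + d = 1 → (a + 1) + (b + 1) + (c + 1) = 0 →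
      (b + 1) * (d + 1) + (c + 1) * (d + 1) = 0 := by decide
    exact this _ _ _ _ h0 h1
  rw [this, sgn_zero, one_mul]

theorem twistPerm_pair : ∀ x : Fin 2 × Fin 3,
    (twistPerm (vertexRot 2) (0, 0) (1, 0)).symm x =
      ![![(0, 0), (0, 2), (1, 1)], ![(1, 0), (1, 2), (0, 1)]] x.1 x.2 := by
  decide

theorem flagRank_twistPerm_pair : ∀ x : Fin 2 × Fin 3,
    flagRank (twistPerm (vertexRot 2) (0, 0) (1, 0) x) =
      ![![0, 5, 1], ![3, 2, 4]] x.1 x.2 := by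
  decide

/-- After the twist more pairs are inverted, but the evenness of both vertices and the opposite
parities of the contracted letters again make the sign trivial. -/
theorem vertexTensor_pair_twist {p : Fin 2 × Fin 3 → ZMod 2} {y : Fin 2 × Fin 3 → A}
    (hy : ∀ x, y x ∈ 𝒜 (p x)) (h0 : p (0, 0) + p (1, 0) = 1) :
    vertexTensor M (twistPerm (vertexRot 2) (0, 0) (1, 0)) pairRank y =
      threeTensor M.form (p (0, 2)) (y (0, 0)) (y (0, 2)) (y (1, 1)) *
      threeTensor M.form (p (1, 2)) (y (1, 0)) (y (1, 2)) (y (0, 1)) := by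
  rw [vertexTensor_apply M _ _ hy]
  have hw : vertexWeight M (p ∘ (twistPerm (vertexRot 2) (0, 0) (1, 0)).symm)
      (y ∘ (twistPerm (vertexRot 2) (0, 0) (1, 0)).symm) =
      threeTensor M.form (p (0, 2)) (y (0, 0)) (y (0, 2)) (y (1, 1)) *
      threeTensor M.form (p (1, 2)) (y (1, 0)) (y (1, 2)) (y (0, 1)) := by
    rw [vertexWeight, Fin.prod_univ_two]
    simp only [Function.comp, twistPerm_pair]
    rfl
  rw [hw]
  by_cases h1 : (p (0, 0) + 1) + (p (0, 2) + 1) + (p (1, 1) + 1) = 0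
  swap
  · rw [threeTensor_eq_zero M (hy _) (hy _) (hy _) h1, zero_mul, mul_zero]
  by_cases h2 : (p (1, 0) + 1) + (p (1, 2) + 1) + (p (0, 1) + 1) = 0
  swap
  · rw [threeTensor_eq_zero M (hy (1, 0)) (hy (1, 2)) (hy (0, 1)) h2, mul_zero, mul_zero]
  have hk : koszulSign k (flagRank ∘ twistPerm (vertexRot 2) (0, 0) (1, 0)) pairRank
      (fun x => p x + 1) =
      sgn k ((p (0, 2) + 1) * (p (1, 0) + 1) + (p (1, 1) + 1) * (p (1, 0) + 1) +
        (p (0, 2) + 1) * (p (0, 1) + 1) + (p (1, 1) + 1) * (p (0, 1) + 1) +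
        (p (1, 2) + 1) * (p (0, 1) + 1)) := by
    simp only [sgn_add, koszulSign, Function.comp_apply, flagRank_twistPerm_pair]
    simp [Fintype.prod_prod_type, Fin.prod_univ_succ, pairRank]
    ring
  rw [hk]
  have : ∀ a b c d e f : ZMod 2, a + d = 1 → (a + 1) + (c + 1) + (e + 1) = 0 →
      (d + 1) + (f + 1) + (b + 1) = 0 → (c + 1) * (d + 1) + (e + 1) * (d + 1) +
        (c + 1) * (b + 1) + (e + 1) * (b + 1) + (f + 1) * (b + 1) = 0 := by decide
  rw [this _ _ _ _ _ _ h0 h1 h2, sgn_zero, one_mul]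

end Associativity

/-- Two vertices with chosen positions can be made the first two vertices with position `0`. -/
theorem exists_normalization {V : ℕ} {a b : Fin V × Fin 3} (hab : a.1 ≠ b.1) :
    ∃ (V' : ℕ) (ρ : Fin V × Fin 3 ≃ Fin (2 + V') × Fin 3),
      (∀ f, ρ (vertexRot V f) = vertexRot _ (ρ f)) ∧ ρ a = (Fin.castAdd V' 0, 0) ∧
      ρ b = (Fin.castAdd V' 1, 0) := by
  have h2 : 2 ≤ V := by
    have h1 : (a.1 : ℕ) ≠ b.1 := fun h => hab (Fin.ext h)
    omega
  obtain ⟨V', rfl⟩ := Nat.exists_eq_add_of_le h2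
  set π₁ : Equiv.Perm (Fin (2 + V')) := Equiv.swap a.1 (Fin.castAdd V' 0)
  set π : Equiv.Perm (Fin (2 + V')) := Equiv.swap (π₁ b.1) (Fin.castAdd V' 1) * π₁ with hπ
  have hπa : π a.1 = Fin.castAdd V' 0 := by
    have h1 : π₁ a.1 = Fin.castAdd V' 0 := Equiv.swap_apply_left _ _
    rw [hπ, Equiv.Perm.mul_apply, h1, Equiv.swap_apply_of_ne_of_ne]
    · rw [← h1]; exact π₁.injective.ne hab
    · rw [Ne, Fin.ext_iff]; simp
  have hπb : π b.1 = Fin.castAdd V' 1 := by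
    rw [hπ, Equiv.Perm.mul_apply, Equiv.swap_apply_left]
  set o : Fin (2 + V') → Fin 3 := fun v => if v = a.1 then a.2 else if v = b.1 then b.2 else 0
    with ho
  refine ⟨V', Equiv.prodShear π fun v => Equiv.subRight (o v), ?_, ?_, ?_⟩
  · rintro ⟨v, i⟩
    rw [vertexRot_apply]
    simp only [Equiv.prodShear_apply, Equiv.subRight_apply, vertexRot_apply]
    rw [add_sub_right_comm]
  · simp [hπa, ho]
  · simp [hπb, ho, hab.symm]

/-! ### The sign -1 of the exchange inside an arbitrary graph. -/

section Twist

variable {k A : Type*} [Field k] [NonUnitalRing A] [Module k A]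
  {𝒜 : ZMod 2 → Submodule k A} (M : CyclicDGAlgebra 𝒜)
  [IsScalarTower k A A] [SMulCommClass k A A] [DirectSum.Decomposition 𝒜] [FiniteDimensional k A]

theorem sum_vertexTensor_pair_twist [CharZero k] {p : Fin 2 × Fin 3 → ZMod 2}
    {y : Fin 2 × Fin 3 → A} (hy : ∀ x, y x ∈ 𝒜 (p x)) :
    ∑ i, ∑ j, inverseTensor 𝒜 M.form i j *
      vertexTensor M (twistPerm (vertexRot 2) (0, 0) (1, 0)) pairRank
        (Function.update (Function.update y (0, 0) (homBasis 𝒜 i)) (1, 0) (homBasis 𝒜 j)) =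
    -∑ i, ∑ j, inverseTensor 𝒜 M.form i j * vertexTensor M (Equiv.refl _) pairRank
        (Function.update (Function.update y (0, 0) (homBasis 𝒜 i)) (1, 0) (homBasis 𝒜 j)) := by
  have key := sum_threeTensor_twist M (hy (0, 1)) (hy (0, 2)) (hy (1, 1)) (hy (1, 2))
  have hup : ∀ i j : HomIdx 𝒜, ∀ x,
      Function.update (Function.update y (0, 0) (homBasis 𝒜 i)) (1, 0) (homBasis 𝒜 j) x ∈
      𝒜 (Function.update (Function.update p (0, 0) i.1) (1, 0) j.1 x) := fun i j =>
    update_mem (update_mem hy (homBasis_mem 𝒜 i)) (homBasis_mem 𝒜 j)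
  have h1 : ∀ i j, inverseTensor 𝒜 M.form i j *
      vertexTensor M (twistPerm (vertexRot 2) (0, 0) (1, 0)) pairRank
        (Function.update (Function.update y (0, 0) (homBasis 𝒜 i)) (1, 0) (homBasis 𝒜 j)) =
      inverseTensor 𝒜 M.form i j * (threeTensor M.form (p (0, 2)) (homBasis 𝒜 i) (y (0, 2))
        (y (1, 1)) * threeTensor M.form (p (1, 2)) (homBasis 𝒜 j) (y (1, 2)) (y (0, 1))) := by
    intro i j
    by_cases hij : i.1 = j.1
    · rw [inverseTensor_parity M.form_odd hij, zero_mul, zero_mul]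
    · rw [vertexTensor_pair_twist M (hup i j)]
      · simp [Function.update_apply]
      · have : ∀ a b : ZMod 2, a ≠ b → a + b = 1 := by decide
        simpa [Function.update_apply] using this _ _ hij
  have h2 : ∀ i j, inverseTensor 𝒜 M.form i j *
      vertexTensor M (Equiv.refl _) pairRank
        (Function.update (Function.update y (0, 0) (homBasis 𝒜 i)) (1, 0) (homBasis 𝒜 j)) =
      inverseTensor 𝒜 M.form i j * (threeTensor M.form (p (0, 1)) (homBasis 𝒜 i) (y (0, 1))
        (y (0, 2)) * threeTensor M.form (p (1, 1)) (homBasis 𝒜 j) (y (1, 1)) (y (1, 2))) := by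
    intro i j
    by_cases hij : i.1 = j.1
    · rw [inverseTensor_parity M.form_odd hij, zero_mul, zero_mul]
    · rw [vertexTensor_pair M (hup i j)]
      · simp [Function.update_apply]
      · have : ∀ a b : ZMod 2, a ≠ b → a + b = 1 := by decide
        simpa [Function.update_apply] using this _ _ hij
  simp only [h1, h2]
  exact key

/-- The flags of the first two vertices and of the others. -/
def flagSumEquiv (V₁ V₂ : ℕ) :
    (Fin V₁ × Fin 3) ⊕ (Fin V₂ × Fin 3) ≃ Fin (V₁ + V₂) × Fin 3 :=
  (Equiv.sumProdDistrib _ _ _).symm.trans (Equiv.prodCongr finSumFinEquiv (Equiv.refl _))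

theorem flagSumEquiv_inl {V₁ V₂ : ℕ} (f : Fin V₁ × Fin 3) :
    flagSumEquiv V₁ V₂ (Sum.inl f) = (Fin.castAdd V₂ f.1, f.2) := by
  simp [flagSumEquiv]

theorem flagSumEquiv_inr {V₁ V₂ : ℕ} (f : Fin V₂ × Fin 3) :
    flagSumEquiv V₁ V₂ (Sum.inr f) = (Fin.natAdd V₁ f.1, f.2) := by
  simp [flagSumEquiv]

theorem flagSumEquiv_rot_inl {V₁ V₂ : ℕ} (f : Fin V₁ × Fin 3) :
    flagSumEquiv V₁ V₂ (Sum.inl (vertexRot _ f)) = vertexRot _ (flagSumEquiv V₁ V₂ (Sum.inl f)) := by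
  rw [flagSumEquiv_inl, flagSumEquiv_inl, vertexRot_apply]
  obtain ⟨v, i⟩ := f
  rw [vertexRot_apply]

theorem flagSumEquiv_rot_inr {V₁ V₂ : ℕ} (f : Fin V₂ × Fin 3) :
    flagSumEquiv V₁ V₂ (Sum.inr (vertexRot _ f)) = vertexRot _ (flagSumEquiv V₁ V₂ (Sum.inr f)) := by
  rw [flagSumEquiv_inr, flagSumEquiv_inr, vertexRot_apply]
  obtain ⟨v, i⟩ := f
  rw [vertexRot_apply]

variable {X : Type*} [Fintype X] [DecidableEq X] {V : ℕ}

theorem vertexTensor_normalize {V' : ℕ} (g : X ≃ Fin V × Fin 3)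
    (ρ : Fin V × Fin 3 ≃ Fin V' × Fin 3) (hρ : ∀ f, ρ (vertexRot V f) = vertexRot _ (ρ f))
    {X' : Type*} [Fintype X'] (e : X' ≃ X) {r : X → ℕ} (hr : Function.Injective r)
    {p : X → ZMod 2} {y : X → A} (hy : ∀ x, y x ∈ 𝒜 (p x)) {s : X' → ℕ}
    (hs : Function.Injective s) :
    vertexTensor M g r y = koszulSign k s (r ∘ e) (fun x => (p ∘ e) x + 1) *
      vertexTensor M (e.trans (g.trans ρ)) s (y ∘ e) := by
  rw [← vertexTensor_rank M _ hs (hr.comp e.injective) (p := p ∘ e) (y := y ∘ e) (fun x => hy _),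
    vertexTensor_reindex M (g.trans ρ) e r hy, vertexTensor_rotate M g (g.trans ρ) hr ?_ hy]
  intro x
  have h1 := hρ (g x)
  rw [← Prod.mk.eta (p := g x), vertexRot_apply, ← Prod.mk.eta (p := ρ ((g x).1, (g x).2)),
    vertexRot_apply] at h1
  rw [Equiv.symm_apply_eq, Equiv.trans_apply, Equiv.trans_apply, Equiv.apply_symm_apply, h1]

theorem update_comp_equiv {X' Y : Type*} [DecidableEq X'] (e : X' ≃ X) (y : X → Y) (x : X') (a : Y) :
    Function.update y (e x) a ∘ e = Function.update (y ∘ e) x a := by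
  have := update_comp_equiv_symm e.symm y (e x) a
  simpa using this

/-- The two vertices are brought to the front with the contracted flags in position `0`. The
remaining vertices then split off as a common factor, and the identity for two vertices decides the
sign. -/
theorem sum_vertexTensor_twist [CharZero k] (g : X ≃ Fin V × Fin 3) {z₀ z₁ : X}
    (hz : (g z₀).1 ≠ (g z₁).1) {r : X → ℕ} (hr : Function.Injective r) (h01 : r z₀ < r z₁)
    (hadj : ∀ z, z ≠ z₀ → z ≠ z₁ → (r z < r z₀ ↔ r z < r z₁))
    {p : X → ZMod 2} {y : X → A} (hy : ∀ x, y x ∈ 𝒜 (p x)) :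
    ∑ i, ∑ j, inverseTensor 𝒜 M.form i j *
      vertexTensor M (g.trans (twistPerm (vertexRot V) (g z₀) (g z₁))) r
        (Function.update (Function.update y z₀ (homBasis 𝒜 i)) z₁ (homBasis 𝒜 j)) =
    -∑ i, ∑ j, inverseTensor 𝒜 M.form i j * vertexTensor M g r
        (Function.update (Function.update y z₀ (homBasis 𝒜 i)) z₁ (homBasis 𝒜 j)) := by
  obtain ⟨V', ρ, hρ, hρ₀, hρ₁⟩ := exists_normalization hz
  set e : (Fin 2 × Fin 3) ⊕ (Fin V' × Fin 3) ≃ X := (flagSumEquiv 2 V').trans (g.trans ρ).symm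
    with he
  have hρe : ∀ x, ρ (g (e x)) = flagSumEquiv 2 V' x := fun x => by simp [he]
  have he₀ : e (Sum.inl (0, 0)) = z₀ := by
    rw [he, Equiv.trans_apply, flagSumEquiv_inl, Equiv.symm_apply_eq]
    exact hρ₀.symm
  have he₁ : e (Sum.inl (1, 0)) = z₁ := by
    rw [he, Equiv.trans_apply, flagSumEquiv_inl, Equiv.symm_apply_eq]
    exact hρ₁.symm
  set s : (Fin 2 × Fin 3) ⊕ (Fin V' × Fin 3) → ℕ :=
    Sum.elim pairRank (fun f => 6 + flagRank f) with hs
  have hlt : ∀ (x : Fin 2 × Fin 3) (w : Fin V' × Fin 3), s (Sum.inl x) < s (Sum.inr w) := by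
    intro x w
    have : ∀ x, pairRank x < 6 := by decide
    exact (this x).trans_le (Nat.le_add_right _ _)
  have hsi : Function.Injective s := by
    rintro (x | x) (w | w) h
    · exact congrArg _ (pairRank_injective h)
    · exact absurd h (hlt _ _).ne
    · exact absurd h (hlt _ _).ne'
    · exact congrArg _ (flagRank_injective (Nat.add_left_cancel h))
  -- the letters and their parities
  set Y : HomIdx 𝒜 → HomIdx 𝒜 → X → A := fun i j =>
    Function.update (Function.update y z₀ (homBasis 𝒜 i)) z₁ (homBasis 𝒜 j) with hY
  set Q : HomIdx 𝒜 → HomIdx 𝒜 → X → ZMod 2 := fun i j =>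
    Function.update (Function.update p z₀ i.1) z₁ j.1 with hQ
  have hYQ : ∀ i j x, Y i j x ∈ 𝒜 (Q i j x) := fun i j =>
    update_mem (update_mem hy (homBasis_mem 𝒜 i)) (homBasis_mem 𝒜 j)
  have hYe : ∀ i j, (Y i j ∘ e) ∘ Sum.inl = Function.update (Function.update
      ((y ∘ e) ∘ Sum.inl) (0, 0) (homBasis 𝒜 i)) (1, 0) (homBasis 𝒜 j) := by
    intro i j
    rw [hY]
    dsimp only
    rw [← he₀, ← he₁, update_comp_equiv, update_comp_equiv]
    funext x
    simp [Function.update_apply]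
  have hYr : ∀ i j, (Y i j ∘ e) ∘ Sum.inr = (y ∘ e) ∘ Sum.inr := by
    intro i j
    rw [hY]
    dsimp only
    rw [← he₀, ← he₁, update_comp_equiv, update_comp_equiv]
    funext x
    simp [Function.update_apply]
  have hne : z₀ ≠ z₁ := fun h => hz (by rw [h])
  -- the sign of the change of the order is the same for all nonvanishing terms
  obtain ⟨κ, hκ⟩ : ∃ κ : k, ∀ i j : HomIdx 𝒜, i.1 ≠ j.1 →
      koszulSign k s (r ∘ e) (fun x => (Q i j ∘ e) x + 1) = κ := by
    -- The parities 0 and 1 serve as a sample: by `koszulSign_adjacent` every pair of opposite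
    -- parities gives the same sign, while terms with equal parities carry a zero entry of `β^∨`.
    refine ⟨koszulSign k s (r ∘ e) (fun x => (Function.update (Function.update p z₀ 0) z₁ 1) (e x) + 1),
      fun i j hij => koszulSign_adjacent hsi (hr.comp e.injective) (a := Sum.inl (0, 0))
        (b := Sum.inl (1, 0)) ?_ ?_ ?_ ?_ ?_ ?_ ?_⟩
    · simp [hs, pairRank]
    · simpa [he₀, he₁] using h01
    · rintro (x | x) h1 h2
      · have : ∀ x, x ≠ (0, 0) → x ≠ (1, 0) → (pairRank x < pairRank (0, 0) ↔
          pairRank x < pairRank (1, 0)) := by decide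
        exact this x (by simpa using h1) (by simpa using h2)
      · exact iff_of_false (hlt _ _).not_gt (hlt _ _).not_gt
    · intro z h1 h2
      have := hadj (e z) (by rw [← he₀]; exact e.injective.ne h1)
        (by rw [← he₁]; exact e.injective.ne h2)
      simpa [he₀, he₁] using this
    · intro z h1 h2
      have h3 : e z ≠ z₀ := by rw [← he₀]; exact e.injective.ne h1
      have h4 : e z ≠ z₁ := by rw [← he₁]; exact e.injective.ne h2
      simp [hQ, Function.update_of_ne h3, Function.update_of_ne h4]
    · have : ∀ a b : ZMod 2, a ≠ b → a + 1 + (b + 1) = 1 := by decide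
      simpa [hQ, he₀, he₁, Function.update_of_ne hne] using this _ _ hij
    · simp [he₀, he₁, Function.update_of_ne hne]
      decide
  -- The twist acts only on the first two vertices (`hT`) and fixes all other flags (`hT'`).
  have hT : ∀ x, twistPerm (vertexRot _) (flagSumEquiv 2 V' (Sum.inl (0, 0)))
      (flagSumEquiv 2 V' (Sum.inl (1, 0))) (flagSumEquiv 2 V' (Sum.inl x)) =
      flagSumEquiv 2 V' (Sum.inl (twistPerm (vertexRot 2) (0, 0) (1, 0) x)) := fun x =>
    (twistPerm_map (e := fun x => flagSumEquiv 2 V' (Sum.inl x))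
      ((flagSumEquiv 2 V').injective.comp Sum.inl_injective) flagSumEquiv_rot_inl _ _ x).symm
  have hT' : ∀ x, twistPerm (vertexRot _) (flagSumEquiv 2 V' (Sum.inl (0, 0)))
      (flagSumEquiv 2 V' (Sum.inl (1, 0))) (flagSumEquiv 2 V' (Sum.inr x)) =
      flagSumEquiv 2 V' (Sum.inr x) := by
    intro x
    have h1 : ∀ f, flagSumEquiv 2 V' (Sum.inr x) ≠ flagSumEquiv 2 V' (Sum.inl f) := by simp
    simp only [twistPerm, Equiv.Perm.mul_apply, ← flagSumEquiv_rot_inl]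
    rw [Equiv.swap_apply_of_ne_of_ne (h1 _) (h1 _), Equiv.swap_apply_of_ne_of_ne (h1 _) (h1 _),
      Equiv.swap_apply_of_ne_of_ne (h1 _) (h1 _)]
  have hg : ∀ x, e.trans (g.trans ρ) x = flagSumEquiv 2 V' x := hρe
  have hgT : ∀ x, e.trans ((g.trans (twistPerm (vertexRot V) (g z₀) (g z₁))).trans ρ) x =
      twistPerm (vertexRot _) (flagSumEquiv 2 V' (Sum.inl (0, 0)))
      (flagSumEquiv 2 V' (Sum.inl (1, 0))) (flagSumEquiv 2 V' x) := by
    intro x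
    have h1 := twistPerm_map ρ.injective hρ (g z₀) (g z₁) (g (e x))
    rw [hρe, ← he₀, hρe, ← he₁, hρe] at h1
    rw [← h1, he₀, he₁]
    rfl
  set W : k := vertexTensor M (Equiv.refl _) (s ∘ Sum.inr) ((y ∘ e) ∘ Sum.inr) with hW
  have e1 : ∀ i j, inverseTensor 𝒜 M.form i j * vertexTensor M g r (Y i j) =
      κ * W * (inverseTensor 𝒜 M.form i j * vertexTensor M (Equiv.refl _) pairRank
        (Function.update (Function.update ((y ∘ e) ∘ Sum.inl) (0, 0) (homBasis 𝒜 i)) (1, 0)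
          (homBasis 𝒜 j))) := by
    intro i j
    by_cases hij : i.1 = j.1
    · rw [inverseTensor_parity M.form_odd hij]; ring
    rw [vertexTensor_normalize M g ρ hρ e hr (hYQ i j) hsi, hκ i j hij,
      vertexTensor_sum M (Equiv.refl _) (Equiv.refl _) _ (fun x => by
        rw [hg, flagSumEquiv_inl]; rfl) (fun x => by rw [hg, flagSumEquiv_inr]; rfl) hlt
        (p := Q i j ∘ e) (y := Y i j ∘ e) (fun x => hYQ i j _), hYe, hYr]
    have : s ∘ Sum.inl = pairRank := rfl
    rw [this, ← hW]
    ring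
  have e2 : ∀ i j, inverseTensor 𝒜 M.form i j *
      vertexTensor M (g.trans (twistPerm (vertexRot V) (g z₀) (g z₁))) r (Y i j) =
      κ * W * (inverseTensor 𝒜 M.form i j *
        vertexTensor M (twistPerm (vertexRot 2) (0, 0) (1, 0)) pairRank
        (Function.update (Function.update ((y ∘ e) ∘ Sum.inl) (0, 0) (homBasis 𝒜 i)) (1, 0)
          (homBasis 𝒜 j))) := by
    intro i j
    by_cases hij : i.1 = j.1
    · rw [inverseTensor_parity M.form_odd hij]; ring
    rw [vertexTensor_normalize M _ ρ hρ e hr (hYQ i j) hsi, hκ i j hij,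
      vertexTensor_sum M (twistPerm (vertexRot 2) (0, 0) (1, 0)) (Equiv.refl _) _ (fun x => by
        rw [hgT, hT, flagSumEquiv_inl]) (fun x => by rw [hgT, hT', flagSumEquiv_inr]; rfl) hlt
        (p := Q i j ∘ e) (y := Y i j ∘ e) (fun x => hYQ i j _), hYe, hYr]
    have : s ∘ Sum.inl = pairRank := rfl
    rw [this, ← hW]
    ring
  rw [Finset.sum_congr rfl fun i _ => Finset.sum_congr rfl fun j _ => e1 i j,
    Finset.sum_congr rfl fun i _ => Finset.sum_congr rfl fun j _ => e2 i j]
  simp only [← Finset.mul_sum]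
  rw [sum_vertexTensor_pair_twist M (p := (p ∘ e) ∘ Sum.inl) (y := (y ∘ e) ∘ Sum.inl)
    (fun x => hy _), mul_neg]

end Twist

/-! ### The exchange of resolutions on ribbon graphs. -/

namespace RibbonGraph

variable {n : ℕ}

/-- Permuting the places to which the half-edges and legs are attached. -/
abbrev transport (Γ : RibbonGraph n) (T : Equiv.Perm Γ.Flag) : RibbonGraph n where
  numVert := Γ.numVert
  numEdge := Γ.numEdge
  flagEquiv := Γ.flagEquiv.trans T

theorem transport_inv (Γ : RibbonGraph n) (T : Equiv.Perm Γ.Flag) (f : Γ.Flag) :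
    (Γ.transport T).inv (T f) = T (Γ.inv f) := by
  simp [inv]

/-- The flag permutation that exchanges the two ways of resolving the edge between the vertices of
the first two legs. -/
def twistFlags (Γ : RibbonGraph (n + 2)) : Equiv.Perm Γ.Flag :=
  twistPerm Γ.rot (Γ.leg 0) (Γ.leg 1)

abbrev twist (Γ : RibbonGraph (n + 2)) : RibbonGraph (n + 2) := Γ.transport Γ.twistFlags

end RibbonGraph

/-! ### Values of the twisting permutation. -/

section Values

variable {V : ℕ} {f f' : Fin V × Fin 3}

theorem vertexRot_ne (f : Fin V × Fin 3) : vertexRot V f ≠ f := by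
  obtain ⟨v, i⟩ := f
  rw [vertexRot_apply, Ne, Prod.ext_iff]
  have : ∀ i : Fin 3, i + 1 ≠ i := by decide
  exact fun h => this i h.2

theorem vertexRot_three (f : Fin V × Fin 3) : vertexRot V (vertexRot V (vertexRot V f)) = f := by
  obtain ⟨v, i⟩ := f
  have : ∀ i : Fin 3, i + 1 + 1 + 1 = i := by decide
  rw [vertexRot_apply, vertexRot_apply, vertexRot_apply, this]

theorem vertexRot_fst (f : Fin V × Fin 3) : (vertexRot V f).1 = f.1 := by
  obtain ⟨v, i⟩ := f
  rw [vertexRot_apply]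

/-- The six flags at two distinct vertices are distinct. -/
theorem twistPerm_values (h : f.1 ≠ f'.1) :
    twistPerm (vertexRot V) f f' f = f ∧ twistPerm (vertexRot V) f f' f' = f' ∧
    twistPerm (vertexRot V) f f' (vertexRot V f) = vertexRot V (vertexRot V f') ∧
    twistPerm (vertexRot V) f f' (vertexRot V (vertexRot V f')) = vertexRot V f' ∧
    twistPerm (vertexRot V) f f' (vertexRot V f') = vertexRot V (vertexRot V f) ∧
    twistPerm (vertexRot V) f f' (vertexRot V (vertexRot V f)) = vertexRot V f := by
  have e1 : ∀ f : Fin V × Fin 3, f ≠ vertexRot V f := fun f => (vertexRot_ne f).symm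
  have e2 : ∀ f : Fin V × Fin 3, f ≠ vertexRot V (vertexRot V f) := fun f h => by
    have := vertexRot_three f
    rw [← h] at this
    exact vertexRot_ne f this
  have e3 : ∀ x y : Fin V × Fin 3, x.1 = f.1 → y.1 = f'.1 → x ≠ y := by
    rintro x y hx hy rfl
    exact h (hx.symm.trans hy)
  have a1 : (vertexRot V f).1 = f.1 := vertexRot_fst f
  have a2 : (vertexRot V (vertexRot V f)).1 = f.1 := by rw [vertexRot_fst, vertexRot_fst]
  have b1 : (vertexRot V f').1 = f'.1 := vertexRot_fst f'
  have b2 : (vertexRot V (vertexRot V f')).1 = f'.1 := by rw [vertexRot_fst, vertexRot_fst]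
  simp only [twistPerm, Equiv.Perm.mul_apply]
  have fa := e1 f
  have fb := e2 f
  have ab := e1 (vertexRot V f)
  have f'c := e1 f'
  have f'd := e2 f'
  have cd := e1 (vertexRot V f')
  have fc := e3 f _ rfl b1
  have fd := e3 f _ rfl b2
  have af' := e3 _ f' a1 rfl
  have ac := e3 _ _ a1 b1
  have ad := e3 _ _ a1 b2
  have bf' := e3 _ f' a2 rfl
  have bc := e3 _ _ a2 b1
  have bd := e3 _ _ a2 b2
  refine ⟨?_, ?_, ?_, ?_, ?_, ?_⟩
  · rw [Equiv.swap_apply_of_ne_of_ne fa fb, Equiv.swap_apply_of_ne_of_ne fb fc,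
      Equiv.swap_apply_of_ne_of_ne fc fd]
  · rw [Equiv.swap_apply_of_ne_of_ne af'.symm bf'.symm, Equiv.swap_apply_of_ne_of_ne bf'.symm f'c,
      Equiv.swap_apply_of_ne_of_ne f'c f'd]
  · rw [Equiv.swap_apply_left, Equiv.swap_apply_left, Equiv.swap_apply_left]
  · rw [Equiv.swap_apply_of_ne_of_ne ad.symm bd.symm, Equiv.swap_apply_of_ne_of_ne bd.symm cd.symm,
      Equiv.swap_apply_right]
  · rw [Equiv.swap_apply_of_ne_of_ne ac.symm bc.symm, Equiv.swap_apply_right,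
      Equiv.swap_apply_of_ne_of_ne bc bd]
  · rw [Equiv.swap_apply_right, Equiv.swap_apply_of_ne_of_ne ab ac,
      Equiv.swap_apply_of_ne_of_ne ac ad]

theorem twistPerm_of_ne {x : Fin V × Fin 3} (h : x.1 ≠ f.1) (h' : x.1 ≠ f'.1) :
    twistPerm (vertexRot V) f f' x = x := by
  have e1 : ∀ y : Fin V × Fin 3, y.1 = f.1 → x ≠ y := fun y hy hxy => h (by rw [hxy, hy])
  have e2 : ∀ y : Fin V × Fin 3, y.1 = f'.1 → x ≠ y := fun y hy hxy => h' (by rw [hxy, hy])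
  have a1 : (vertexRot V f).1 = f.1 := vertexRot_fst f
  have a2 : (vertexRot V (vertexRot V f)).1 = f.1 := by rw [vertexRot_fst, vertexRot_fst]
  have b1 : (vertexRot V f').1 = f'.1 := vertexRot_fst f'
  have b2 : (vertexRot V (vertexRot V f')).1 = f'.1 := by rw [vertexRot_fst, vertexRot_fst]
  simp only [twistPerm, Equiv.Perm.mul_apply]
  rw [Equiv.swap_apply_of_ne_of_ne (e1 _ a1) (e1 _ a2),
    Equiv.swap_apply_of_ne_of_ne (e1 _ a2) (e2 _ b1),
    Equiv.swap_apply_of_ne_of_ne (e2 _ b1) (e2 _ b2)]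

theorem eq_vertexRot_of_fst {x f : Fin V × Fin 3} (h : x.1 = f.1) :
    x = f ∨ x = vertexRot V f ∨ x = vertexRot V (vertexRot V f) := by
  obtain ⟨v, i⟩ := f
  obtain ⟨w, j⟩ := x
  dsimp only at h
  subst h
  simp only [vertexRot_apply, Prod.mk.injEq, true_and]
  revert i j
  decide

end Values

/-! ### Effect of the exchange on isomorphism classes, connectedness and boundary. -/

namespace RibbonGraph

variable {n : ℕ}

/-- The twisting permutation is built from `rot` and legs `0`, `1`, which the twist does not move;
an isomorphism of twisted graphs commutes with it and descends. Injectivity is all that is needed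
later: the twist has order four on the outer flags, twice being the exchange of the ends of the
edge. -/
theorem Iso.of_twist {Γ Γ' : RibbonGraph (n + 2)} (h : (Γ.leg 0).1 ≠ (Γ.leg 1).1)
    (h' : (Γ'.leg 0).1 ≠ (Γ'.leg 1).1) (hi : Γ.twist.Iso Γ'.twist) : Γ.Iso Γ' := by
  obtain ⟨τ, h1, h2, h3⟩ := hi
  have hv := twistPerm_values h
  have hv' := twistPerm_values h'
  have t0 : τ (Γ.leg 0) = Γ'.leg 0 :=
    (congrArg τ hv.1.symm).trans ((h3 0).trans hv'.1)
  have t1 : τ (Γ.leg 1) = Γ'.leg 1 :=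
    (congrArg τ hv.2.1.symm).trans ((h3 1).trans hv'.2.1)
  have hT : ∀ f, τ (Γ.twistFlags f) = Γ'.twistFlags (τ f) := fun f => by
    refine (twistPerm_map τ.injective (ρ := Γ.rot) (ρ' := Γ'.rot) h1 _ _ f).trans ?_
    rw [t0, t1]
    rfl
  refine ⟨τ, h1, fun f => ?_, fun l => ?_⟩
  · refine Γ'.twistFlags.injective ((hT _).symm.trans ?_)
    exact (congrArg τ (transport_inv Γ _ f).symm).trans ((h2 _).trans
      ((congrArg _ (hT f)).trans (transport_inv Γ' _ (τ f))))
  · exact Γ'.twistFlags.injective ((hT _).symm.trans (h3 l))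

/-- The new edge still joins the two vertices, so the six flags at them remain connected, and
nothing else is moved. -/
theorem twist_glue_connected (Γ : RibbonGraph (n + 2)) (h : (Γ.leg 0).1 ≠ (Γ.leg 1).1)
    (hc : Γ.glue.Connected) : Γ.twist.glue.Connected := by
  rw [connected_iff] at hc ⊢
  refine ⟨hc.1, ?_⟩
  obtain ⟨h1, h2, h3, h4, h5, h6⟩ := twistPerm_values h
  set T := Γ.twistFlags with hT
  set f := Γ.leg 0
  set f' := Γ.leg 1
  set ρ := vertexRot Γ.numVert
  set s : Setoid Γ.Flag := Γ.twist.glue.conn.comap T with hs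
  have hinv : ∀ x, s x (Γ.glue.inv x) := by
    intro x
    have h7 := Γ.twist.glue.conn_inv (T x)
    have h8 : Γ.twist.glue.inv (T x) = T (Γ.glue.inv x) := transport_inv Γ.glue T x
    rw [h8] at h7
    exact h7
  have hrot : ∀ x y, T y = ρ (T x) → s x y := by
    intro x y hxy
    have h7 := Γ.twist.glue.conn_rot (T x)
    change Γ.twist.glue.conn (T x) (ρ (T x)) at h7
    rw [← hxy] at h7
    exact h7
  have hff' : s f f' := by
    have := hinv f
    rwa [glue_inv_leg_zero] at this
  have T1 : T f = f := h1
  have T2 : T f' = f' := h2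
  have T3 : T (ρ f) = ρ (ρ f') := h3
  have T4 : T (ρ (ρ f')) = ρ f' := h4
  have T5 : T (ρ f') = ρ (ρ f) := h5
  have T6 : T (ρ (ρ f)) = ρ f := h6
  have sb : s f (ρ (ρ f)) := hrot _ _ (by rw [T6, T1])
  have sc : s f (ρ f') := s.trans sb (hrot _ _ (by rw [T6, T5]))
  have sd : s f (ρ (ρ f')) := s.trans hff' (hrot _ _ (by rw [T4, T2]))
  have sa : s f (ρ f) := s.trans sd (hrot _ _ (by rw [T4, T3]))
  have hle : Γ.glue.conn ≤ s := by
    refine conn_le _ (fun x => ?_) hinv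
    change s x (ρ x)
    by_cases hx : x.1 = f.1
    · rcases eq_vertexRot_of_fst hx with rfl | rfl | rfl
      · exact sa
      · exact s.trans (s.symm sa) sb
      · rw [vertexRot_three]; exact s.symm sb
    · by_cases hx' : x.1 = f'.1
      · rcases eq_vertexRot_of_fst hx' with rfl | rfl | rfl
        · exact s.trans (s.symm hff') sc
        · exact s.trans (s.symm sc) sd
        · rw [vertexRot_three]; exact s.trans (s.symm sd) hff'
      · refine hrot _ _ ?_
        have e1 : T x = x := twistPerm_of_ne hx hx'
        have e2 : T (ρ x) = ρ x := twistPerm_of_ne (by rwa [vertexRot_fst]) (by rwa [vertexRot_fst])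
        rw [e1, e2]
  intro x y
  obtain ⟨x, rfl⟩ := T.surjective x
  obtain ⟨y, rfl⟩ := T.surjective y
  exact hle (hc.2 x y)

/-- Around the shrunken edge the four outer flags keep their cyclic order. The boundary walks of the
two graphs differ only in the corners at which they pass along the edge, that is, through `f` or
`f'`, which are not legs. -/
theorem twist_glue_hasBoundary (Γ : RibbonGraph (n + 2)) (h : (Γ.leg 0).1 ≠ (Γ.leg 1).1)
    {σ : Equiv.Perm (Fin n)} (hb : Γ.glue.HasBoundary σ) : Γ.twist.glue.HasBoundary σ := by
  obtain ⟨h1, h2, h3, h4, h5, h6⟩ := twistPerm_values h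
  set T := Γ.twistFlags with hT
  set f := Γ.leg 0 with hf
  set f' := Γ.leg 1 with hf'
  set ρ := vertexRot Γ.numVert
  have hr3 : ∀ x, ρ (ρ (ρ x)) = x := vertexRot_three
  have T1 : T f = f := h1
  have T2 : T f' = f' := h2
  have T3 : T (ρ f) = ρ (ρ f') := h3
  have T4 : T (ρ (ρ f')) = ρ f' := h4
  have T5 : T (ρ f') = ρ (ρ f) := h5
  have T6 : T (ρ (ρ f)) = ρ f := h6
  have hff' : f ≠ f' := fun h' => h (by rw [h'])
  obtain ⟨c, t, hct⟩ := hb.exists_cert Γ.glue.leg_injective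
  have hlegf : ∀ l, f ≠ Γ.glue.leg l := fun l => Γ.leg_injective.ne (by simp [Fin.ext_iff])
  have hlegf' : ∀ l, f' ≠ Γ.glue.leg l := fun l => Γ.leg_injective.ne (by simp [Fin.ext_iff])
  have hφf : Γ.glue.face f = ρ f' := by rw [face_apply, glue_inv_leg_zero]; rfl
  have hφf' : Γ.glue.face f' = ρ f := by rw [face_apply, glue_inv_leg_one]; rfl
  -- The boundary permutation of the twisted graph, transported back by `T` to the flags of the
  -- original one.
  set φ : Equiv.Perm Γ.Flag := T⁻¹ * Γ.rot * T * Γ.glue.inv with hφ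
  have hφa : ∀ x y, T y = ρ (T (Γ.glue.inv x)) → φ x = y := by
    intro x y hxy
    rw [hφ, Equiv.Perm.mul_apply, Equiv.Perm.mul_apply, Equiv.Perm.mul_apply,
      Equiv.Perm.inv_eq_iff_eq]
    exact hxy.symm
  have e1 : φ f = ρ (ρ f') := hφa _ _ (by rw [glue_inv_leg_zero, T4, T2])
  have e2 : φ f' = ρ (ρ f) := hφa _ _ (by rw [glue_inv_leg_one, T6, T1])
  -- In the new walk `f` and `f'` immediately precede `ρ (ρ f')` and `ρ (ρ f)`, so they take over
  -- these colours. Doubling the heights leaves room for the inserted steps.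
  set c' : Γ.Flag → Fin n := fun x => if x = f' then c (ρ (ρ f)) else if x = f then c (ρ (ρ f'))
    else c x with hc'
  set t' : Γ.Flag → ℕ := fun x => if x = f' then 2 * t (ρ (ρ f)) + 1 else if x = f then
    2 * t (ρ (ρ f')) + 1 else 2 * t x with ht'
  have c'f' : c' f' = c (ρ (ρ f)) := by simp [hc']
  have t'f' : t' f' = 2 * t (ρ (ρ f)) + 1 := by simp [ht']
  have c'f : c' f = c (ρ (ρ f')) := by simp [hc', hff']
  have t'f : t' f = 2 * t (ρ (ρ f')) + 1 := by simp [ht', hff']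
  have c'x : ∀ x, x ≠ f → x ≠ f' → c' x = c x := fun x h1 h2 => by simp [hc', h1, h2]
  have t'x : ∀ x, x ≠ f → x ≠ f' → t' x = 2 * t x := fun x h1 h2 => by simp [ht', h1, h2]
  have vne : ∀ x, x.1 = f.1 → x ≠ f' := fun x hx hxf => h (by rw [← hx, hxf])
  have vne' : ∀ x, x.1 = f'.1 → x ≠ f := fun x hx hxf => h (by rw [← hx, hxf])
  have rne : ∀ x, ρ x ≠ x := vertexRot_ne
  have rrne : ∀ x, ρ (ρ x) ≠ x := fun x hx => rne x (by rw [← hx, hr3, hx])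
  have r1 : ∀ x, (ρ x).1 = x.1 := vertexRot_fst
  -- From any other flag the new walk goes where the old one does, except that it may omit a passage
  -- through `f` or `f'` or insert one.
  have claim : ∀ z, z ≠ f → z ≠ f' → c' (φ z) = c (Γ.glue.face z) ∧
      t' (φ z) ≤ 2 * t (Γ.glue.face z) + 1 := by
    intro z hz hz'
    have hface : Γ.glue.face z = ρ (Γ.glue.inv z) := rfl
    have hwf : Γ.glue.inv z ≠ f := fun hw => hz' (by
      rw [← Γ.glue.inv_inv z, hw, glue_inv_leg_zero])
    have hwf' : Γ.glue.inv z ≠ f' := fun hw => hz (by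
      rw [← Γ.glue.inv_inv z, hw, glue_inv_leg_one])
    generalize hw : Γ.glue.inv z = w at *
    by_cases hx : w.1 = f.1
    · rcases eq_vertexRot_of_fst hx with rfl | rfl | rfl
      · exact absurd rfl hwf
      · rw [hφa z f' (by rw [hw]; exact T2.trans (by rw [T3, hr3])), hface, c'f', t'f']
        exact ⟨rfl, le_rfl⟩
      · rw [hφa z (ρ f') (by rw [hw]; exact T5.trans (by rw [T6])), hface, hr3,
          c'x _ (vne' _ (r1 _)) (rne _), t'x _ (vne' _ (r1 _)) (rne _)]
        have h7 := hct.color f hlegf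
        have h8 := hct.lt f hlegf
        rw [hφf] at h7 h8
        exact ⟨h7, by omega⟩
    · by_cases hx' : w.1 = f'.1
      · rcases eq_vertexRot_of_fst hx' with rfl | rfl | rfl
        · exact absurd rfl hwf'
        · rw [hφa z f (by rw [hw]; exact T1.trans (by rw [T5, hr3])), hface, c'f, t'f]
          exact ⟨rfl, le_rfl⟩
        · rw [hφa z (ρ f) (by rw [hw]; exact T3.trans (by rw [T4])), hface, hr3,
            c'x _ (rne _) (vne _ (r1 _)), t'x _ (rne _) (vne _ (r1 _))]
          have h7 := hct.color f' hlegf'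
          have h8 := hct.lt f' hlegf'
          rw [hφf'] at h7 h8
          exact ⟨h7, by omega⟩
      · have a1 : T w = w := twistPerm_of_ne hx hx'
        have a2 : T (ρ w) = ρ w := twistPerm_of_ne (by rwa [r1]) (by rwa [r1])
        have a3 : ρ w ≠ f := fun h => hx (by rw [← h, r1])
        have a4 : ρ w ≠ f' := fun h => hx' (by rw [← h, r1])
        rw [hφa z (ρ w) (by rw [hw, a1, a2]), hface, c'x _ a3 a4, t'x _ a3 a4]
        exact ⟨rfl, by omega⟩
  have hB : IsBoundary φ Γ.glue.leg σ := by
    refine BoundaryCert.isBoundary (c := c') (t := t') ⟨fun l => ?_, fun z hz => ?_, fun z hz => ?_,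
      fun l => ?_⟩
    · rw [c'x _ (hlegf l).symm (hlegf' l).symm, hct.color_leg]
    · by_cases hzf : z = f
      · rw [hzf, e1, c'f, c'x _ (vne' _ (by rw [r1, r1])) (rrne _)]
      · by_cases hzf' : z = f'
        · rw [hzf', e2, c'f', c'x _ (rrne _) (vne _ (by rw [r1, r1]))]
        · rw [(claim z hzf hzf').1, hct.color z hz, c'x z hzf hzf']
    · by_cases hzf : z = f
      · rw [hzf, e1, t'f, t'x _ (vne' _ (by rw [r1, r1])) (rrne _)]
        omega
      · by_cases hzf' : z = f'
        · rw [hzf', e2, t'f', t'x _ (rrne _) (vne _ (by rw [r1, r1]))]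
          omega
        · have h7 := (claim z hzf hzf').2
          have h8 := hct.lt z hz
          rw [t'x z hzf hzf']
          omega
    · rw [(claim _ (hlegf l).symm (hlegf' l).symm).1, hct.next]
  have := hB.conj (φ' := Γ.twist.glue.face) (leg' := Γ.twist.glue.leg) 1 T ?_ (fun l => rfl)
  · rw [one_mul, inv_one, mul_one] at this
    exact this
  · intro x
    have h8 : Γ.twist.glue.inv (T x) = T (Γ.glue.inv x) := transport_inv Γ.glue T x
    rw [face_apply, h8]
    simp [hφ]
    rfl

/-- An edge joining neighbouring flags of one vertex creates a boundary component without legs. -/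
theorem leg_fst_ne_of_glue_hasBoundary (Γ : RibbonGraph (n + 2)) {σ : Equiv.Perm (Fin n)}
    (hb : Γ.glue.HasBoundary σ) : (Γ.leg 0).1 ≠ (Γ.leg 1).1 := by
  intro h
  have hne : Γ.leg 0 ≠ Γ.leg 1 := Γ.leg_injective.ne (by simp)
  have key : ∀ f, Γ.glue.face f = f → (∀ l, f ≠ Γ.glue.leg l) → False := by
    intro f hf hl
    obtain ⟨t, l, ht⟩ := hb.2 f
    have : ∀ t : ℕ, (Γ.glue.face ^ t) f = f := fun t => by
      induction t with
      | zero => rfl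
      | succ t ih => rw [pow_succ, Equiv.Perm.mul_apply, hf, ih]
    exact hl l ((this t).symm.trans ht)
  have hl0 : ∀ l, Γ.leg 0 ≠ Γ.glue.leg l := fun l => Γ.leg_injective.ne (by simp [Fin.ext_iff])
  have hl1 : ∀ l, Γ.leg 1 ≠ Γ.glue.leg l := fun l => Γ.leg_injective.ne (by simp [Fin.ext_iff])
  rcases eq_vertexRot_of_fst h with h1 | h1 | h1
  · exact hne h1
  · refine key (Γ.leg 0) ?_ hl0
    rw [face_apply, glue_inv_leg_zero]
    exact h1.symm
  · refine key (Γ.leg 1) ?_ hl1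
    rw [face_apply, glue_inv_leg_one, h1]
    exact vertexRot_three _

end RibbonGraph

/-! ### Contractions of a twisted graph. -/

section Twist

variable {k A : Type*} [Field k] [NonUnitalRing A] [Module k A]
  {𝒜 : ZMod 2 → Submodule k A} {M : CyclicDGAlgebra 𝒜}
  [IsScalarTower k A A] [SMulCommClass k A A] [DirectSum.Decomposition 𝒜] [FiniteDimensional k A]
  (h : Homotopy M) {n : ℕ}

theorem letters_cons {E : ℕ} (ψ : Fin E × Fin 2 → HomIdx 𝒜) (x : Fin n → A) (a b : A) :
    letters 𝒜 ψ (Fin.cons a (Fin.cons b x) : Fin (n + 2) → A) =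
      Function.update (Function.update (letters 𝒜 ψ (Fin.cons 0 (Fin.cons 0 x) : Fin (n + 2) → A))
        (Sum.inr 0) a) (Sum.inr 1) b := by
  funext z
  rcases z with z | l
  · rw [Function.update_of_ne (by simp), Function.update_of_ne (by simp)]
    rfl
  · refine Fin.cases ?_ (fun l => ?_) l
    · rw [Function.update_of_ne (by simp), Function.update_self]
      rfl
    · refine Fin.cases ?_ (fun l => ?_) l
      · have : (Fin.succ 0 : Fin (n + 2)) = 1 := rfl
        rw [this, Function.update_self]
        rfl
      · rw [Function.update_of_ne (by simp [Fin.ext_iff]), Function.update_of_ne (by simp)]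
        rfl

theorem gluedContraction_twist [CharZero k] (Γ : RibbonGraph (n + 2))
    (hv : (Γ.leg 0).1 ≠ (Γ.leg 1).1) {p : Fin n → ZMod 2} {x : Fin n → A}
    (hx : ∀ l, x l ∈ 𝒜 (p l)) :
    gluedContraction h (inverseTensor 𝒜 M.form) Γ.twist x =
      -gluedContraction h (inverseTensor 𝒜 M.form) Γ x := by
  have h1 : ∀ g : (Fin Γ.numEdge × Fin 2) ⊕ Fin (n + 2) ≃ Fin Γ.numVert × Fin 3,
      gluedContraction h (inverseTensor 𝒜 M.form) ⟨Γ.numVert, Γ.numEdge, g⟩ x =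
      ∑ ψ : Fin Γ.numEdge × Fin 2 → HomIdx 𝒜, (∏ e, propagator h (ψ (e, 0)) (ψ (e, 1))) *
        ∑ i, ∑ j, inverseTensor 𝒜 M.form i j * vertexTensor M g edgeLegRank
          (Function.update (Function.update
            (letters 𝒜 ψ (Fin.cons 0 (Fin.cons 0 x) : Fin (n + 2) → A))
            (Sum.inr 0) (homBasis 𝒜 i)) (Sum.inr 1) (homBasis 𝒜 j)) := by
    intro g
    simp only [gluedContraction, contraction_eq_graphTensor, graphTensor_apply, Finset.mul_sum]
    rw [Finset.sum_congr rfl fun i _ => Finset.sum_comm, Finset.sum_comm]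
    refine Finset.sum_congr rfl fun ψ _ => Finset.sum_congr rfl fun i _ =>
      Finset.sum_congr rfl fun j _ => by
        rw [letters_cons ψ x (homBasis 𝒜 i)]
        ring
  refine (h1 _).trans (Eq.trans ?_ (congrArg Neg.neg (h1 Γ.flagEquiv)).symm)
  rw [← Finset.sum_neg_distrib]
  refine Finset.sum_congr rfl fun ψ _ => ?_
  rw [← mul_neg]
  congr 1
  have hx' : ∀ l, (Fin.cons 0 (Fin.cons 0 x) : Fin (n + 2) → A) l ∈
      𝒜 ((Fin.cons 0 (Fin.cons 0 p) : Fin (n + 2) → ZMod 2) l) := by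
    intro l
    refine Fin.cases (Submodule.zero_mem _) (fun l => ?_) l
    refine Fin.cases (Submodule.zero_mem _) (fun l => hx l) l
  refine sum_vertexTensor_twist M Γ.flagEquiv hv edgeLegRank_injective ?_ ?_ (letters_mem ψ hx')
  · rw [edgeLegRank_inr, edgeLegRank_inr, Fin.val_zero, Fin.val_one]
    omega
  · rintro (z | l) h0 h1
    · exact iff_of_true (edgeLegRank_lt _ _) (edgeLegRank_lt _ _)
    · have : (l : ℕ) ≠ 0 := fun h => h0 (congrArg _ (Fin.ext h))
      rw [edgeLegRank_inr, edgeLegRank_inr, edgeLegRank_inr, Fin.val_zero, Fin.val_one]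
      omega

end Twist

/-! ### Disjoint unions of graphs. -/

/-- The edge-halves and legs of a disjoint union. -/
def unionIndexEquiv {E₁ E₂ n₁ n₂ n : ℕ} (j : Fin n₁ ⊕ Fin n₂ ≃ Fin n) :
    ((Fin E₁ × Fin 2) ⊕ Fin n₁) ⊕ ((Fin E₂ × Fin 2) ⊕ Fin n₂) ≃
      (Fin (E₁ + E₂) × Fin 2) ⊕ Fin n :=
  (Equiv.sumSumSumComm _ _ _ _).trans (Equiv.sumCongr ((Equiv.sumProdDistrib _ _ _).symm.trans
    (Equiv.prodCongr finSumFinEquiv (Equiv.refl _))) j)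

section UnionIndex

variable {E₁ E₂ n₁ n₂ n : ℕ} (j : Fin n₁ ⊕ Fin n₂ ≃ Fin n)

theorem unionIndexEquiv_inl_inl (e : Fin E₁) (s : Fin 2) :
    unionIndexEquiv (E₂ := E₂) j (Sum.inl (Sum.inl (e, s))) = Sum.inl (Fin.castAdd E₂ e, s) := by
  simp [unionIndexEquiv]

theorem unionIndexEquiv_inr_inl (e : Fin E₂) (s : Fin 2) :
    unionIndexEquiv (E₁ := E₁) j (Sum.inr (Sum.inl (e, s))) = Sum.inl (Fin.natAdd E₁ e, s) := by
  simp [unionIndexEquiv]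

theorem unionIndexEquiv_inl_inr (l : Fin n₁) :
    unionIndexEquiv (E₁ := E₁) (E₂ := E₂) j (Sum.inl (Sum.inr l)) = Sum.inr (j (Sum.inl l)) := by
  simp [unionIndexEquiv]

theorem unionIndexEquiv_inr_inr (l : Fin n₂) :
    unionIndexEquiv (E₁ := E₁) (E₂ := E₂) j (Sum.inr (Sum.inr l)) = Sum.inr (j (Sum.inr l)) := by
  simp [unionIndexEquiv]

end UnionIndex

namespace RibbonGraph

variable {n₁ n₂ n : ℕ}

/-- The disjoint union of two graphs. -/
abbrev union (Γ₁ : RibbonGraph n₁) (Γ₂ : RibbonGraph n₂) (j : Fin n₁ ⊕ Fin n₂ ≃ Fin n) :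
    RibbonGraph n where
  numVert := Γ₁.numVert + Γ₂.numVert
  numEdge := Γ₁.numEdge + Γ₂.numEdge
  flagEquiv := (unionIndexEquiv j).symm.trans
    ((Equiv.sumCongr Γ₁.flagEquiv Γ₂.flagEquiv).trans (flagSumEquiv _ _))

variable (Γ₁ : RibbonGraph n₁) (Γ₂ : RibbonGraph n₂) (j : Fin n₁ ⊕ Fin n₂ ≃ Fin n)

/-- The flags of a disjoint union. -/
abbrev unionFlags : Γ₁.Flag ⊕ Γ₂.Flag ≃ (Γ₁.union Γ₂ j).Flag := flagSumEquiv _ _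

theorem union_flagEquiv (z : ((Fin Γ₁.numEdge × Fin 2) ⊕ Fin n₁) ⊕
    ((Fin Γ₂.numEdge × Fin 2) ⊕ Fin n₂)) :
    (Γ₁.union Γ₂ j).flagEquiv (unionIndexEquiv j z) =
      unionFlags Γ₁ Γ₂ j (Sum.map Γ₁.flagEquiv Γ₂.flagEquiv z) := by
  simp [union]

theorem union_rot_inl (f : Γ₁.Flag) : (Γ₁.union Γ₂ j).rot (unionFlags Γ₁ Γ₂ j (Sum.inl f)) =
    unionFlags Γ₁ Γ₂ j (Sum.inl (Γ₁.rot f)) := (flagSumEquiv_rot_inl f).symm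

theorem union_rot_inr (f : Γ₂.Flag) : (Γ₁.union Γ₂ j).rot (unionFlags Γ₁ Γ₂ j (Sum.inr f)) =
    unionFlags Γ₁ Γ₂ j (Sum.inr (Γ₂.rot f)) := (flagSumEquiv_rot_inr f).symm

theorem union_leg_inl (l : Fin n₁) :
    (Γ₁.union Γ₂ j).leg (j (Sum.inl l)) = unionFlags Γ₁ Γ₂ j (Sum.inl (Γ₁.leg l)) := by
  rw [leg, ← unionIndexEquiv_inl_inr, union_flagEquiv]
  rfl

theorem union_leg_inr (l : Fin n₂) :
    (Γ₁.union Γ₂ j).leg (j (Sum.inr l)) = unionFlags Γ₁ Γ₂ j (Sum.inr (Γ₂.leg l)) := by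
  rw [leg, ← unionIndexEquiv_inr_inr, union_flagEquiv]
  rfl

theorem union_inv_inl (f : Γ₁.Flag) : (Γ₁.union Γ₂ j).inv (unionFlags Γ₁ Γ₂ j (Sum.inl f)) =
    unionFlags Γ₁ Γ₂ j (Sum.inl (Γ₁.inv f)) := by
  obtain ⟨⟨e, s⟩ | l, rfl⟩ := Γ₁.flagEquiv.surjective f
  · have h : ∀ s, unionFlags Γ₁ Γ₂ j (Sum.inl (Γ₁.flagEquiv (Sum.inl (e, s)))) =
        (Γ₁.union Γ₂ j).flagEquiv (Sum.inl (Fin.castAdd _ e, s)) := fun s => by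
      rw [← unionIndexEquiv_inl_inl j, union_flagEquiv]; rfl
    rw [inv_inl, h, h, inv_inl]
  · have h := union_leg_inl Γ₁ Γ₂ j l
    change (Γ₁.union Γ₂ j).inv (unionFlags Γ₁ Γ₂ j (Sum.inl (Γ₁.leg l))) =
      unionFlags Γ₁ Γ₂ j (Sum.inl (Γ₁.inv (Γ₁.leg l)))
    rw [inv_leg, ← h, inv_leg]

theorem union_inv_inr (f : Γ₂.Flag) : (Γ₁.union Γ₂ j).inv (unionFlags Γ₁ Γ₂ j (Sum.inr f)) =
    unionFlags Γ₁ Γ₂ j (Sum.inr (Γ₂.inv f)) := by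
  obtain ⟨⟨e, s⟩ | l, rfl⟩ := Γ₂.flagEquiv.surjective f
  · have h : ∀ s, unionFlags Γ₁ Γ₂ j (Sum.inr (Γ₂.flagEquiv (Sum.inl (e, s)))) =
        (Γ₁.union Γ₂ j).flagEquiv (Sum.inl (Fin.natAdd _ e, s)) := fun s => by
      rw [← unionIndexEquiv_inr_inl j, union_flagEquiv]; rfl
    rw [inv_inl, h, h, inv_inl]
  · have h := union_leg_inr Γ₁ Γ₂ j l
    change (Γ₁.union Γ₂ j).inv (unionFlags Γ₁ Γ₂ j (Sum.inr (Γ₂.leg l))) =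
      unionFlags Γ₁ Γ₂ j (Sum.inr (Γ₂.inv (Γ₂.leg l)))
    rw [inv_leg, ← h, inv_leg]

end RibbonGraph

/-! ### Koszul signs of disjoint unions. -/

section Sign

variable {E₁ E₂ n₁ n₂ n : ℕ} (j : Fin n₁ ⊕ Fin n₂ ≃ Fin n)

/-- The order by edges and legs of the first graph followed by those of the second graph. -/
def blockRank : ((Fin E₁ × Fin 2) ⊕ Fin n₁) ⊕ ((Fin E₂ × Fin 2) ⊕ Fin n₂) → ℕ :=
  Sum.elim edgeLegRank fun z => 2 * E₁ + n₁ + edgeLegRank z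

/-- The order by all edges followed by the legs of the first and of the second graph. -/
def edgesFirstRank : ((Fin E₁ × Fin 2) ⊕ Fin n₁) ⊕ ((Fin E₂ × Fin 2) ⊕ Fin n₂) → ℕ :=
  Sum.elim (Sum.elim (fun z => 2 * z.1 + z.2) fun l => 2 * (E₁ + E₂) + l)
    (Sum.elim (fun z => 2 * E₁ + (2 * z.1 + z.2)) fun l => 2 * (E₁ + E₂) + (n₁ + l))

theorem edgeLegRank_lt_total (z : (Fin E₁ × Fin 2) ⊕ Fin n₁) : edgeLegRank z < 2 * E₁ + n₁ := by
  rcases z with ⟨e, s⟩ | l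
  · rw [edgeLegRank_inl]; omega
  · rw [edgeLegRank_inr]; omega

theorem blockRank_injective :
    Function.Injective (blockRank (E₁ := E₁) (E₂ := E₂) (n₁ := n₁) (n₂ := n₂)) := by
  rintro (x | x) (y | y) h
  · exact congrArg _ (edgeLegRank_injective h)
  · exact absurd h ((edgeLegRank_lt_total x).trans_le (Nat.le_add_right _ _)).ne
  · exact absurd h ((edgeLegRank_lt_total y).trans_le (Nat.le_add_right _ _)).ne'
  · exact congrArg _ (edgeLegRank_injective (Nat.add_left_cancel h))

theorem edgesFirstRank_injective :
    Function.Injective (edgesFirstRank (E₁ := E₁) (E₂ := E₂) (n₁ := n₁) (n₂ := n₂)) := by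
  rintro ((⟨x, s⟩ | x) | (⟨x, s⟩ | x)) ((⟨y, t⟩ | y) | (⟨y, t⟩ | y)) h <;>
    simp only [edgesFirstRank, Sum.elim_inl, Sum.elim_inr] at h <;>
    first
      | (exfalso; omega)
      | (simp only [Sum.inl.injEq, Sum.inr.injEq, Prod.mk.injEq, Fin.ext_iff]; omega)

variable {k : Type*} [CommRing k]

/-- The edges of the second graph move past the legs of the first as even blocks. -/
theorem koszulSign_blockRank {q : ((Fin E₁ × Fin 2) ⊕ Fin n₁) ⊕ ((Fin E₂ × Fin 2) ⊕ Fin n₂) → ZMod 2}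
    (hq : ∀ e, q (Sum.inr (Sum.inl (e, 0))) + q (Sum.inr (Sum.inl (e, 1))) = 0) :
    koszulSign k blockRank edgesFirstRank q = 1 := by
  rw [koszulSign_block (ι := ((Fin E₁ × Fin 2) ⊕ Fin n₁) ⊕ (Fin E₂ ⊕ Fin n₂))
    (Sum.map id (Sum.map Prod.fst id))]
  · refine Finset.prod_eq_one fun z _ => if_neg ?_
    obtain ⟨x, y⟩ := z
    rcases x with (⟨x, s⟩ | x) | (⟨x, s⟩ | x) <;> rcases y with (⟨y, t⟩ | y) | (⟨y, t⟩ | y) <;>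
      simp [blockRank, edgesFirstRank, edgeLegRank_inl, edgeLegRank_inr] <;> omega
  · intro x y x' y' hne hx hy h1 h2
    rcases x with (⟨x, s⟩ | x) | (⟨x, s⟩ | x) <;> rcases y with (⟨y, t⟩ | y) | (⟨y, t⟩ | y) <;>
      simp only [blockRank, edgesFirstRank, edgeLegRank_inl, edgeLegRank_inr, Sum.elim_inl,
        Sum.elim_inr] at h1 h2 <;> try (exfalso; omega)
    rcases x' with (⟨x', s'⟩ | x') | (⟨x', s'⟩ | x') <;> simp at hx
    rcases y' with (⟨y', t'⟩ | y') | (⟨y', t'⟩ | y') <;> simp at hy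
    subst hx hy
    simp [blockRank, edgesFirstRank, edgeLegRank_inl, edgeLegRank_inr]
    omega
  · intro x y hne h1 h2
    right
    rcases x with (⟨x, s⟩ | x) | (⟨x, s⟩ | x) <;> rcases y with (⟨y, t⟩ | y) | (⟨y, t⟩ | y) <;>
      simp only [blockRank, edgesFirstRank, edgeLegRank_inl, edgeLegRank_inr, Sum.elim_inl,
        Sum.elim_inr] at h1 h2 <;> try (exfalso; omega)
    rw [Finset.sum_filter, Fintype.sum_sum_type, Fintype.sum_sum_type (α₁ := Fin E₂ × Fin 2),
      Fintype.sum_prod_type (α₁ := Fin E₂)]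
    simp only [Sum.map_inl, Sum.map_inr, Sum.inr.injEq, Sum.inl.injEq, reduceCtorEq, if_false,
      Finset.sum_const_zero, zero_add, add_zero, Fin.sum_univ_two]
    rw [Finset.sum_eq_single y]
    · simpa using hq y
    · intro y' _ hy'; simp [hy']
    · simp

/-- The edges already stand in their final order, so only the shuffle of the two sets of legs
remains. -/
theorem koszulSign_edgesFirstRank
    (q : ((Fin E₁ × Fin 2) ⊕ Fin n₁) ⊕ ((Fin E₂ × Fin 2) ⊕ Fin n₂) → ZMod 2) :
    koszulSign k edgesFirstRank (edgeLegRank ∘ unionIndexEquiv j) q =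
      koszulSign k (Sum.elim (fun a : Fin n₁ => (a : ℕ)) fun b : Fin n₂ => n₁ + b)
        (fun l => (j l : ℕ)) (Sum.elim (fun l => q (Sum.inl (Sum.inr l)))
          fun l => q (Sum.inr (Sum.inr l))) := by
  rw [← koszulSign_equiv (Equiv.sumSumSumComm (Fin E₁ × Fin 2) (Fin E₂ × Fin 2) (Fin n₁) (Fin n₂)),
    koszulSign_sum]
  · have h1 : (edgesFirstRank (E₁ := E₁) (E₂ := E₂) (n₁ := n₁) (n₂ := n₂) ∘
        Equiv.sumSumSumComm (Fin E₁ × Fin 2) (Fin E₂ × Fin 2) (Fin n₁) (Fin n₂)) ∘ Sum.inl =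
        ((edgeLegRank ∘ unionIndexEquiv j) ∘
          Equiv.sumSumSumComm (Fin E₁ × Fin 2) (Fin E₂ × Fin 2) (Fin n₁) (Fin n₂)) ∘ Sum.inl := by
      funext z
      rcases z with ⟨e, s⟩ | ⟨e, s⟩
      · simp [edgesFirstRank, unionIndexEquiv_inl_inl, edgeLegRank_inl]
      · simp [edgesFirstRank, unionIndexEquiv_inr_inl, edgeLegRank_inl]
        ring
    rw [h1, koszulSign_self, one_mul]
    refine koszulSign_congr (fun x y => ?_) (fun x y _ _ => ?_)
    · rcases x with x | x <;> rcases y with y | y <;>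
        simp [edgesFirstRank, unionIndexEquiv_inl_inr, unionIndexEquiv_inr_inr, edgeLegRank_inr]
    · rcases x with x | x <;> rcases y with y | y <;> rfl
  · rintro (⟨e, s⟩ | ⟨e, s⟩) (l | l) <;> simp [edgesFirstRank] <;> omega
  · rintro (⟨e, s⟩ | ⟨e, s⟩) (l | l) <;>
      simp [unionIndexEquiv_inl_inl, unionIndexEquiv_inl_inr, unionIndexEquiv_inr_inl,
        unionIndexEquiv_inr_inr, edgeLegRank_lt]

end Sign

/-! ### Contractions over disjoint unions. -/

section Union

variable {k A : Type*} [Field k] [NonUnitalRing A] [Module k A]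
  {𝒜 : ZMod 2 → Submodule k A} {M : CyclicDGAlgebra 𝒜}
  [IsScalarTower k A A] [SMulCommClass k A A] [DirectSum.Decomposition 𝒜] [FiniteDimensional k A]
  (h : Homotopy M) {n₁ n₂ n : ℕ}

/-- Contractions over disjoint unions are products. -/
theorem contraction_union [CharZero k] (Γ₁ : RibbonGraph n₁) (Γ₂ : RibbonGraph n₂)
    (j : Fin n₁ ⊕ Fin n₂ ≃ Fin n) {p : Fin n → ZMod 2} {x : Fin n → A}
    (hx : ∀ l, x l ∈ 𝒜 (p l)) :
    contraction h (Γ₁.union Γ₂ j) x =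
      koszulSign k (Sum.elim (fun a : Fin n₁ => (a : ℕ)) fun b : Fin n₂ => n₁ + b)
        (fun l => (j l : ℕ)) (fun l => p (j l) + 1) *
      (contraction h Γ₁ (fun l => x (j (Sum.inl l))) *
        contraction h Γ₂ (fun l => x (j (Sum.inr l)))) := by
  simp only [contraction_eq_graphTensor, graphTensor_apply]
  rw [Finset.sum_mul_sum, Finset.mul_sum]
  set η : (Fin Γ₁.numEdge × Fin 2) ⊕ (Fin Γ₂.numEdge × Fin 2) ≃
      Fin (Γ₁.numEdge + Γ₂.numEdge) × Fin 2 := (Equiv.sumProdDistrib _ _ _).symm.trans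
    (Equiv.prodCongr finSumFinEquiv (Equiv.refl _)) with hη
  have hη₁ : ∀ e s, η (Sum.inl (e, s)) = (Fin.castAdd _ e, s) := fun e s => by simp [hη]
  have hη₂ : ∀ e s, η (Sum.inr (e, s)) = (Fin.natAdd _ e, s) := fun e s => by simp [hη]
  rw [← Equiv.sum_comp ((Equiv.sumArrowEquivProdArrow _ _ _).symm.trans
    (Equiv.arrowCongr η (Equiv.refl _))), Fintype.sum_prod_type]
  refine Finset.sum_congr rfl fun ψ₁ _ => ?_
  rw [Finset.mul_sum]
  refine Finset.sum_congr rfl fun ψ₂ _ => ?_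
  set ψ := ((Equiv.sumArrowEquivProdArrow _ _ _).symm.trans
    (Equiv.arrowCongr η (Equiv.refl (HomIdx 𝒜)))) (ψ₁, ψ₂) with hψ
  have hψη : ∀ z, ψ (η z) = Sum.elim ψ₁ ψ₂ z := fun z => by
    simp [hψ, Equiv.arrowCongr, Equiv.sumArrowEquivProdArrow]
  have hψ₁ : ∀ e s, ψ (Fin.castAdd _ e, s) = ψ₁ (e, s) := fun e s => by rw [← hη₁, hψη]; rfl
  have hψ₂ : ∀ e s, ψ (Fin.natAdd _ e, s) = ψ₂ (e, s) := fun e s => by rw [← hη₂, hψη]; rfl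
  rw [Fin.prod_univ_add]
  simp only [hψ₁, hψ₂]
  -- A vanishing product makes both sides zero; otherwise every edge of the second graph has even
  -- total parity, as `koszulSign_blockRank` requires.
  by_cases h0 : ∏ e, propagator h (ψ₂ (e, 0)) (ψ₂ (e, 1)) = 0
  · rw [h0]; ring
  have hlet : letters 𝒜 ψ x ∘ unionIndexEquiv j = Sum.elim
      (letters 𝒜 ψ₁ fun l => x (j (Sum.inl l))) (letters 𝒜 ψ₂ fun l => x (j (Sum.inr l))) := by
    funext z
    rcases z with (⟨e, s⟩ | l) | (⟨e, s⟩ | l)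
    · simp [unionIndexEquiv_inl_inl, letters, hψ₁]
    · simp [unionIndexEquiv_inl_inr, letters]
    · simp [unionIndexEquiv_inr_inl, letters, hψ₂]
    · simp [unionIndexEquiv_inr_inr, letters]
  set q : ((Fin Γ₁.numEdge × Fin 2) ⊕ Fin n₁) ⊕ ((Fin Γ₂.numEdge × Fin 2) ⊕ Fin n₂) → ZMod 2 :=
    Sum.elim (letterParity 𝒜 ψ₁ fun l => p (j (Sum.inl l)))
      (letterParity 𝒜 ψ₂ fun l => p (j (Sum.inr l))) with hq
  have hy : ∀ z, (Sum.elim (letters 𝒜 ψ₁ fun l => x (j (Sum.inl l)))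
      (letters 𝒜 ψ₂ fun l => x (j (Sum.inr l)))) z ∈ 𝒜 (q z) := by
    rintro (z | z)
    · exact letters_mem ψ₁ (fun l => hx _) z
    · exact letters_mem ψ₂ (fun l => hx _) z
  have hT : vertexTensor M (Γ₁.union Γ₂ j).flagEquiv edgeLegRank (letters 𝒜 ψ x) =
      koszulSign k (Sum.elim (fun a : Fin n₁ => (a : ℕ)) fun b : Fin n₂ => n₁ + b)
        (fun l => (j l : ℕ)) (fun l => p (j l) + 1) *
      (vertexTensor M Γ₁.flagEquiv edgeLegRank (letters 𝒜 ψ₁ fun l => x (j (Sum.inl l))) *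
        vertexTensor M Γ₂.flagEquiv edgeLegRank (letters 𝒜 ψ₂ fun l => x (j (Sum.inr l)))) := by
    rw [← vertexTensor_reindex M _ (unionIndexEquiv j) edgeLegRank (letters_mem ψ hx), hlet,
      vertexTensor_rank M _ blockRank_injective
        (edgeLegRank_injective.comp (unionIndexEquiv j).injective) hy,
      vertexTensor_sum M Γ₁.flagEquiv Γ₂.flagEquiv _ ?_ ?_ ?_ hy]
    · have h1 : vertexTensor M Γ₂.flagEquiv (blockRank (E₁ := Γ₁.numEdge) (n₁ := n₁) ∘ Sum.inr)
          (letters 𝒜 ψ₂ fun l => x (j (Sum.inr l))) = vertexTensor M Γ₂.flagEquiv edgeLegRank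
          (letters 𝒜 ψ₂ fun l => x (j (Sum.inr l))) := by
        rw [vertexTensor_rank M _ edgeLegRank_injective (blockRank_injective.comp Sum.inr_injective)
          (letters_mem ψ₂ fun l => hx _)]
        have : koszulSign k edgeLegRank (blockRank (E₁ := Γ₁.numEdge) (n₁ := n₁) ∘ Sum.inr)
            (fun z => letterParity 𝒜 ψ₂ (fun l => p (j (Sum.inr l))) z + 1) =
            koszulSign k edgeLegRank edgeLegRank
            (fun z => letterParity 𝒜 ψ₂ (fun l => p (j (Sum.inr l))) z + 1) :=
          koszulSign_congr (fun a b => by simp [blockRank]) fun _ _ _ _ => rfl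
        rw [this, koszulSign_self, one_mul]
      have h2 : koszulSign k blockRank (edgeLegRank ∘ unionIndexEquiv j) (fun z => q z + 1) =
          koszulSign k (Sum.elim (fun a : Fin n₁ => (a : ℕ)) fun b : Fin n₂ => n₁ + b)
            (fun l => (j l : ℕ)) (fun l => p (j l) + 1) := by
        rw [← koszulSign_trans blockRank_injective edgesFirstRank_injective
          (edgeLegRank_injective.comp (unionIndexEquiv j).injective), koszulSign_blockRank,
          one_mul, koszulSign_edgesFirstRank]
        · congr 1
          funext l
          rcases l with l | l <;> rfl
        · intro e
          exact (isEdgeTensor_propagator h).parity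
            (Finset.prod_ne_zero_iff.1 h0 e (Finset.mem_univ e))
      rw [h2]
      congr 1
      exact congrArg _ h1
    · intro z
      rw [Equiv.trans_apply, RibbonGraph.union_flagEquiv]
      exact flagSumEquiv_inl _
    · intro z
      rw [Equiv.trans_apply, RibbonGraph.union_flagEquiv]
      exact flagSumEquiv_inr _
    · intro z w
      exact (edgeLegRank_lt_total z).trans_le (Nat.le_add_right _ _)
  rw [hT]
  ring

end Union

/-! ### Isomorphism classes and admissible graphs. -/

namespace RibbonGraph

variable {n : ℕ}

theorem Iso.connected {Γ Γ' : RibbonGraph n} (h : Γ.Iso Γ') (hc : Γ.Connected) : Γ'.Connected := by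
  obtain ⟨τ, h1, h2, -⟩ := h
  rw [connected_iff] at hc ⊢
  refine ⟨hc.1.map τ, fun f g => ?_⟩
  have hle : Γ.conn ≤ Setoid.comap τ Γ'.conn :=
    conn_le _ (fun f => by rw [Setoid.comap_rel, h1]; exact Γ'.conn_rot _)
      (fun f => by rw [Setoid.comap_rel, h2]; exact Γ'.conn_inv _)
  have := hle (hc.2 (τ.symm f) (τ.symm g))
  rwa [Setoid.comap_rel, Equiv.apply_symm_apply, Equiv.apply_symm_apply] at this

theorem Iso.hasBoundary {Γ Γ' : RibbonGraph n} (h : Γ.Iso Γ') {σ : Equiv.Perm (Fin n)}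
    (hb : Γ.HasBoundary σ) : Γ'.HasBoundary σ := by
  obtain ⟨τ, h1, h2, h3⟩ := h
  have := IsBoundary.conj hb (φ' := Γ'.face) (leg' := Γ'.leg) 1 τ
    (fun f => by rw [face_apply, face_apply, h1, h2]) h3
  rwa [one_mul, inv_one, mul_one] at this

theorem Iso.symm {Γ Γ' : RibbonGraph n} (h : Γ.Iso Γ') : Γ'.Iso Γ := (isoSetoid n).symm' h

theorem Iso.trans {Γ Γ' Γ'' : RibbonGraph n} (h : Γ.Iso Γ') (h' : Γ'.Iso Γ'') : Γ.Iso Γ'' :=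
  (isoSetoid n).trans' h h'

/-- A count of flags. Together with the Euler characteristic it determines the numbers of vertices
and edges. -/
theorem three_mul_numVert (Γ : RibbonGraph n) : 3 * Γ.numVert = 2 * Γ.numEdge + n := by
  have := Fintype.card_congr Γ.flagEquiv
  simp only [Fintype.card_sum, Fintype.card_prod, Fintype.card_fin] at this
  omega

theorem Iso.numVert_eq {Γ Γ' : RibbonGraph n} (h : Γ.Iso Γ') : Γ.numVert = Γ'.numVert := by
  obtain ⟨τ, -⟩ := h
  have := Fintype.card_congr τ
  simp only [Fintype.card_prod, Fintype.card_fin] at this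
  omega

theorem Iso.chi_eq {Γ Γ' : RibbonGraph n} (h : Γ.Iso Γ') : Γ.chi = Γ'.chi := by
  have h1 := h.numVert_eq
  have h2 := Γ.three_mul_numVert
  have h3 := Γ'.three_mul_numVert
  unfold chi
  omega

theorem out_iso (Γ : RibbonGraph n) : Γ.Iso (Quotient.mk (isoSetoid n) Γ).out :=
  (Quotient.mk_out (s := isoSetoid n) Γ).symm

theorem class_eq {Γ : RibbonGraph n} {c : RibbonClass n} (h : Γ.Iso c.out) :
    Quotient.mk (isoSetoid n) Γ = c := by
  rw [← Quotient.out_eq c]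
  exact Quotient.sound h

/-- From `3V = 2E + n` and `V - E = 1 - b` one gets `V = 2(b - 1) + n` and `E = 3(b - 1) + n`, and
there are finitely many ways to attach flags to vertices of a fixed number. -/
theorem finite_class (b : ℤ) : {c : RibbonClass n | 1 - c.out.chi = b}.Finite := by
  have h1 : {c : RibbonClass n | 1 - c.out.chi = b} ⊆ Set.range
      (fun g : (Fin (3 * (b - 1) + n).toNat × Fin 2) ⊕ Fin n ≃
        Fin (2 * (b - 1) + n).toNat × Fin 3 =>
        Quotient.mk (isoSetoid n) ⟨(2 * (b - 1) + n).toNat, (3 * (b - 1) + n).toNat, g⟩) := by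
    intro c hc
    have h2 := c.out.three_mul_numVert
    have h3 : (c.out.numVert : ℤ) - c.out.numEdge = 1 - b := by
      change 1 - c.out.chi = b at hc
      unfold chi at hc
      omega
    have hV : (2 * (b - 1) + n).toNat = c.out.numVert := by omega
    have hE : (3 * (b - 1) + n).toNat = c.out.numEdge := by omega
    rw [hV, hE]
    exact ⟨c.out.flagEquiv, Quotient.out_eq c⟩
  exact (Set.finite_range _).subset h1

/-- The isomorphism classes of graphs with a given property and with `1 - χ = b`. -/
def classes (Q : RibbonGraph n → Prop) (b : ℤ) : Finset (RibbonClass n) :=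
  ((finite_class (n := n) b).subset (t := {c | Q c.out ∧ 1 - c.out.chi = b})
    fun _ hc => hc.2).toFinset

theorem mem_classes {Q : RibbonGraph n → Prop} {b : ℤ} {c : RibbonClass n} :
    c ∈ classes Q b ↔ Q c.out ∧ 1 - c.out.chi = b := by
  simp [classes]

theorem mk_mem_classes {Q : RibbonGraph n → Prop} (hQ : ∀ Γ Γ', Γ.Iso Γ' → Q Γ → Q Γ') {b : ℤ}
    {Γ : RibbonGraph n} (h : Q Γ) (hb : 1 - Γ.chi = b) :
    (Quotient.mk (isoSetoid n) Γ : RibbonClass n) ∈ classes Q b := by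
  rw [mem_classes]
  exact ⟨hQ _ _ Γ.out_iso h, by rw [← Γ.out_iso.chi_eq, hb]⟩

/-- Relabelling the legs. -/
abbrev relabel (Γ : RibbonGraph n) (π : Equiv.Perm (Fin n)) : RibbonGraph n where
  numVert := Γ.numVert
  numEdge := Γ.numEdge
  flagEquiv := (Equiv.sumCongr (Equiv.refl _) π.symm).trans Γ.flagEquiv

theorem relabel_leg (Γ : RibbonGraph n) (π : Equiv.Perm (Fin n)) (l : Fin n) :
    (Γ.relabel π).leg (π l) = Γ.leg l := by
  simp [leg]

theorem relabel_inv (Γ : RibbonGraph n) (π : Equiv.Perm (Fin n)) :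
    (Γ.relabel π).inv = Γ.inv := by
  refine Equiv.ext fun f => ?_
  obtain ⟨x, rfl⟩ := Γ.flagEquiv.surjective f
  rcases x with ⟨e, s⟩ | l <;> simp [inv]

theorem Iso.relabel {Γ Γ' : RibbonGraph n} (h : Γ.Iso Γ') (π : Equiv.Perm (Fin n)) :
    (Γ.relabel π).Iso (Γ'.relabel π) := by
  obtain ⟨τ, h1, h2, h3⟩ := h
  refine ⟨τ, h1, fun f => ?_, fun l => ?_⟩
  · rw [relabel_inv, relabel_inv]; exact h2 f
  · obtain ⟨l, rfl⟩ := π.surjective l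
    rw [relabel_leg, relabel_leg]; exact h3 l

theorem relabel_connected (Γ : RibbonGraph n) (π : Equiv.Perm (Fin n)) :
    (Γ.relabel π).Connected ↔ Γ.Connected := by
  unfold Connected
  rw [relabel_inv]
  rfl

theorem relabel_hasBoundary (Γ : RibbonGraph n) (π : Equiv.Perm (Fin n)) {σ : Equiv.Perm (Fin n)}
    (h : Γ.HasBoundary σ) : (Γ.relabel π).HasBoundary (π * σ * π⁻¹) :=
  IsBoundary.conj h (φ' := (Γ.relabel π).face) π (Equiv.refl _)
    (fun f => by rw [face_apply, face_apply, relabel_inv]; rfl) fun l => (relabel_leg Γ π l).symm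

theorem relabel_symm (Γ : RibbonGraph n) (π : Equiv.Perm (Fin n)) :
    (Γ.relabel π).relabel π⁻¹ = Γ := by
  obtain ⟨V, E, g⟩ := Γ
  simp only [relabel, RibbonGraph.mk.injEq, heq_eq_eq, true_and]
  refine Equiv.ext fun x => ?_
  rcases x with x | x
  · simp
  · exact congrArg (fun y => g (Sum.inr y)) (π.symm_apply_apply x)

/-- The graphs contributing to the sum over ribbon graphs. -/
def IsAdmissible (σ : Equiv.Perm (Fin n)) (Γ : RibbonGraph n) : Prop :=
  Γ.Connected ∧ Γ.HasBoundary σ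

theorem Iso.isAdmissible {σ : Equiv.Perm (Fin n)} (Γ Γ' : RibbonGraph n) (h : Γ.Iso Γ')
    (ha : Γ.IsAdmissible σ) : Γ'.IsAdmissible σ :=
  ⟨h.connected ha.1, h.hasBoundary ha.2⟩

theorem IsAdmissible.pos {σ : Equiv.Perm (Fin n)} {Γ : RibbonGraph n} (h : Γ.IsAdmissible σ) :
    0 < n := by
  obtain ⟨⟨f⟩, -⟩ := h.1
  obtain ⟨t, l, -⟩ := h.2.2 f
  exact l.pos

theorem IsAdmissible.genus {σ : Equiv.Perm (Fin n)} {Γ : RibbonGraph n} (h : Γ.IsAdmissible σ) :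
    ∃ g : ℕ, (1 - Γ.chi) + 1 = 2 * g + numCycles σ := by
  obtain ⟨g, hg⟩ := Γ.genus_formula h.1
  refine ⟨g, ?_⟩
  rw [IsBoundary.numCycles_eq Γ.leg_injective h.2, chi]
  omega

theorem numCycles_pos (hn : 0 < n) (σ : Equiv.Perm (Fin n)) : 0 < numCycles σ := by
  have : Nonempty (Quotient (Equiv.Perm.SameCycle.setoid σ)) := ⟨Quotient.mk _ ⟨0, hn⟩⟩
  exact Nat.card_pos

/-- No negative powers of ħ occur. This makes the term of ħΔ at ħ⁰ empty and bounds the exponents of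
the two components of a split graph. -/
theorem IsAdmissible.chi_le {σ : Equiv.Perm (Fin n)} {Γ : RibbonGraph n} (h : Γ.IsAdmissible σ) :
    0 ≤ 1 - Γ.chi := by
  obtain ⟨g, hg⟩ := h.genus
  have := numCycles_pos h.pos σ
  omega

end RibbonGraph

open RibbonGraph

/-! ### The sum over ribbon graphs and its symmetries. -/

section Sums

variable {k A : Type*} [Field k] [NonUnitalRing A] [Module k A]
  {𝒜 : ZMod 2 → Submodule k A} {M : CyclicDGAlgebra 𝒜}
  [IsScalarTower k A A] [SMulCommClass k A A] [DirectSum.Decomposition 𝒜] [FiniteDimensional k A]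
  (h : Homotopy M) {n : ℕ}

theorem contraction_congr [CharZero k] {Γ Γ' : RibbonGraph n} (hi : Γ.Iso Γ') :
    contraction h Γ = contraction h Γ' := by
  obtain ⟨τ, h1, h2, h3⟩ := hi
  refine Module.Basis.ext_multilinear (fun _ => homBasis 𝒜) fun v => ?_
  have := contraction_of_iso h τ 1 h1 h2 h3 (x := fun l => homBasis 𝒜 (v l))
    (p := fun l => (v l).1) (fun l => homBasis_mem 𝒜 _)
  rw [show (fun l => ((1 : Equiv.Perm (Fin n)) l : ℕ)) = fun l : Fin n => (l : ℕ) from rfl,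
    koszulSign_self, one_mul] at this
  exact this.symm

/-- The index set is finite, so the `finsum` is a genuine sum and not its default value. -/
theorem ribbonSum_eq (σ : Equiv.Perm (Fin n)) (b : ℕ) :
    ribbonSum h n σ b = ∑ c ∈ classes (IsAdmissible σ) b, contraction h c.out := by
  have hS : ∀ c : RibbonClass n, (c.out.Connected ∧ c.out.HasBoundary σ ∧ 1 - c.out.chi = b) ↔
      c ∈ classes (IsAdmissible σ) b := fun c => by rw [mem_classes, IsAdmissible, and_assoc]
  unfold ribbonSum
  simp only [hS]
  exact finsum_mem_coe_finset (fun c : RibbonClass n => contraction h c.out) _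

theorem ribbonSum_apply (σ : Equiv.Perm (Fin n)) (b : ℕ) (x : Fin n → A) :
    ribbonSum h n σ b x = ∑ c ∈ classes (IsAdmissible σ) b, contraction h c.out x := by
  rw [ribbonSum_eq, sum_apply]

theorem ribbonSum_symmetric [CharZero k] (σ τ : Equiv.Perm (Fin n)) (b : ℕ) {p : Fin n → ZMod 2}
    {x : Fin n → A} (hx : ∀ l, x l ∈ 𝒜 (p l)) :
    ribbonSum h n (τ * σ * τ⁻¹) b (x ∘ ⇑τ⁻¹) =
      koszulSign k (fun i : Fin n => (i : ℕ)) (fun i => (τ i : ℕ)) (fun i => p i + 1) *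
        ribbonSum h n σ b x := by
  rw [ribbonSum_apply, ribbonSum_apply, Finset.mul_sum]
  symm
  have hmem : ∀ (σ τ : Equiv.Perm (Fin n)), ∀ c ∈ classes (IsAdmissible σ) (b : ℤ),
      (Quotient.mk (isoSetoid n) (c.out.relabel τ) : RibbonClass n) ∈
        classes (IsAdmissible (τ * σ * τ⁻¹)) (b : ℤ) := by
    intro σ τ c hc
    rw [mem_classes] at hc
    exact mk_mem_classes Iso.isAdmissible
      ⟨(relabel_connected _ _).2 hc.1.1, relabel_hasBoundary _ _ hc.1.2⟩ hc.2
  -- Relabelling the legs by `τ` permutes the isomorphism classes, with inverse the relabelling by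
  -- `τ⁻¹`.
  refine Finset.sum_nbij' (fun c => Quotient.mk (isoSetoid n) (c.out.relabel τ))
    (fun c => Quotient.mk (isoSetoid n) (c.out.relabel τ⁻¹)) (hmem σ τ) (fun c hc => ?_)
    (fun c hc => ?_) (fun c hc => ?_) (fun c hc => ?_)
  · have := hmem _ τ⁻¹ c hc
    simpa [mul_assoc] using this
  · refine class_eq ?_
    have := (Iso.relabel (out_iso (c.out.relabel τ)) τ⁻¹).symm
    rwa [relabel_symm] at this
  · refine class_eq ?_
    have := (Iso.relabel (out_iso (c.out.relabel τ⁻¹)) τ).symm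
    have h2 := relabel_symm c.out τ⁻¹
    rw [_root_.inv_inv] at h2
    rwa [h2] at this
  · rw [← contraction_congr h (out_iso (c.out.relabel τ))]
    exact (contraction_of_iso h (Γ := c.out) (Γ' := c.out.relabel τ) (Equiv.refl _) τ
      (fun _ => rfl) (fun f => by rw [relabel_inv]; rfl) (fun l => (relabel_leg _ _ _).symm)
      hx).symm

theorem ribbonSum_even [CharZero k] (σ : Equiv.Perm (Fin n)) (b : ℕ) {p : Fin n → ZMod 2}
    {x : Fin n → A} (hx : ∀ l, x l ∈ 𝒜 (p l)) (h0 : ∑ l, (p l + 1) ≠ 0) :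
    ribbonSum h n σ b x = 0 := by
  rw [ribbonSum_apply]
  exact Finset.sum_eq_zero fun c _ => contraction_eq_zero h _ hx h0

theorem ribbonSum_genus (σ : Equiv.Perm (Fin n)) (b : ℕ) (h0 : ribbonSum h n σ b ≠ 0) :
    0 < n ∧ ∃ g : ℕ, b + 1 = 2 * g + numCycles σ := by
  rw [ribbonSum_eq] at h0
  obtain ⟨c, hc, -⟩ := Finset.exists_ne_zero_of_sum_ne_zero h0
  rw [mem_classes] at hc
  refine ⟨hc.1.pos, ?_⟩
  obtain ⟨g, hg⟩ := hc.1.genus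
  exact ⟨g, by rw [hc.2] at hg; exact_mod_cast hg⟩

end Sums

/-! ### Isomorphisms of glued graphs and rigidity. -/

namespace RibbonGraph

variable {n : ℕ}

theorem map_glue_inv {Γ Γ' : RibbonGraph (n + 2)} (τ : Γ.Flag ≃ Γ'.Flag)
    (h2 : ∀ f, τ (Γ.inv f) = Γ'.inv (τ f)) (h3 : ∀ l, τ (Γ.leg l) = Γ'.leg l) (f : Γ.Flag) :
    τ (Γ.glue.inv f) = Γ'.glue.inv (τ f) := by
  rw [glue_inv, glue_inv, Equiv.Perm.mul_apply, Equiv.Perm.mul_apply, ← h3 0, ← h3 1, h2,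
    τ.injective.swap_apply]

theorem Iso.glue {Γ Γ' : RibbonGraph (n + 2)} (h : Γ.Iso Γ') : Γ.glue.Iso Γ'.glue := by
  obtain ⟨τ, h1, h2, h3⟩ := h
  exact ⟨τ, h1, map_glue_inv τ h2 h3, fun l => h3 l.succ.succ⟩

/-- It suffices to control leg `0`: leg `1` is its partner under the glued involution. Cut graphs
are thus classified by the chosen half-edge. -/
theorem iso_of_glue {Γ Γ' : RibbonGraph (n + 2)} (τ : Γ.glue.Flag ≃ Γ'.glue.Flag)
    (h1 : ∀ f, τ (Γ.glue.rot f) = Γ'.glue.rot (τ f))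
    (h2 : ∀ f, τ (Γ.glue.inv f) = Γ'.glue.inv (τ f))
    (h3 : ∀ l, τ (Γ.glue.leg l) = Γ'.glue.leg l) (h0 : τ (Γ.leg 0) = Γ'.leg 0) : Γ.Iso Γ' := by
  have h4 : τ (Γ.leg 1) = Γ'.leg 1 := by
    rw [← Γ.glue_inv_leg_zero, h2, h0, Γ'.glue_inv_leg_zero]
  have h5 : ∀ l, τ (Γ.leg l) = Γ'.leg l := by
    intro l
    induction l using Fin.cases with
    | zero => exact h0
    | succ l =>
      induction l using Fin.cases with
      | zero => exact h4
      | succ l => exact h3 l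
  refine ⟨τ, h1, fun f => ?_, h5⟩
  by_cases hf : ∃ l, f = Γ.leg l
  · obtain ⟨l, rfl⟩ := hf
    rw [inv_leg]
    exact (h5 l).trans ((Γ'.inv_leg l).symm.trans (congrArg _ (h5 l).symm))
  · have hne : ∀ l, f ≠ Γ.leg l := fun l hl => hf ⟨l, hl⟩
    have hne' : ∀ l, τ f ≠ Γ'.leg l := fun l hl => hne l (τ.injective (hl.trans (h5 l).symm))
    exact (congrArg τ (glue_inv_of_ne Γ f (hne 0) (hne 1))).symm.trans
      ((h2 f).trans (glue_inv_of_ne Γ' (τ f) (hne' 0) (hne' 1)))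

/-- Automorphisms of connected graphs that fix a leg are trivial. -/
theorem Connected.rigid {Γ : RibbonGraph n} (hc : Γ.Connected) (τ : Γ.Flag ≃ Γ.Flag)
    (h1 : ∀ f, τ (Γ.rot f) = Γ.rot (τ f)) (h2 : ∀ f, τ (Γ.inv f) = Γ.inv (τ f)) {f : Γ.Flag}
    (hf : τ f = f) (g : Γ.Flag) : τ g = g := by
  have hle : Γ.conn ≤ Setoid.ker fun f => τ f = f :=
    conn_le _ (fun f => by simp [Setoid.ker_def, h1]) (fun f => by
      simp only [Setoid.ker_def, h2, (Γ.inv.injective).eq_iff])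
  have := hle (((connected_iff Γ).1 hc).2 f g)
  rw [Setoid.ker_def] at this
  exact this.mp hf

theorem glue_chi (Γ : RibbonGraph (n + 2)) : Γ.glue.chi = Γ.chi - 1 := by
  simp only [chi]; push_cast; ring

end RibbonGraph

open RibbonGraph

/-! ### Cutting edges, and cancellation of the terms with the full inverse tensor. -/

section Cut

variable {k A : Type*} [Field k] [NonUnitalRing A] [Module k A]
  {𝒜 : ZMod 2 → Submodule k A} {M : CyclicDGAlgebra 𝒜}
  [IsScalarTower k A A] [SMulCommClass k A A] [DirectSum.Decomposition 𝒜] [FiniteDimensional k A]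
  (h : Homotopy M) {n : ℕ}

theorem gluedContraction_congr [CharZero k] (t : Matrix (HomIdx 𝒜) (HomIdx 𝒜) k)
    {Γ Γ' : RibbonGraph (n + 2)} (hi : Γ.Iso Γ') (x : Fin n → A) :
    gluedContraction h t Γ x = gluedContraction h t Γ' x := by
  simp only [gluedContraction, contraction_congr h hi]

/-- The graphs that become admissible when the first two legs are joined. -/
def GluesAdmissible (σ : Equiv.Perm (Fin n)) (Γ : RibbonGraph (n + 2)) : Prop :=
  Γ.glue.IsAdmissible σ

theorem GluesAdmissible.of_iso {σ : Equiv.Perm (Fin n)} (Γ Γ' : RibbonGraph (n + 2))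
    (hi : Γ.Iso Γ') (hΓ : GluesAdmissible σ Γ) : GluesAdmissible σ Γ' :=
  Iso.isAdmissible _ _ hi.glue hΓ

/-- The sum over the edges of all admissible graphs is half of the sum over all graphs with a pair
of legs that becomes an edge. -/
theorem sum_graphTensor_update [CharZero k] {o : ZMod 2} {t : Matrix (HomIdx 𝒜) (HomIdx 𝒜) k}
    (ht : IsEdgeTensor o t) (σ : Equiv.Perm (Fin n)) (b : ℤ)
    {p : Fin n → ZMod 2} {x : Fin n → A} (hx : ∀ l, x l ∈ 𝒜 (p l)) :
    2 * ∑ c ∈ classes (IsAdmissible σ) b, ∑ e, graphTensor M c.out.flagEquiv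
        (Function.update (fun _ => propagator h) e t) x =
      ∑ c ∈ classes (GluesAdmissible σ) (b - 1), gluedContraction h t c.out x := by
  -- The factor 2 turns the sum over edges into one over half-edges; a half-edge tells which end of
  -- the cut edge becomes leg `0`.
  have h1 : 2 * ∑ c ∈ classes (IsAdmissible σ) b, ∑ e, graphTensor M c.out.flagEquiv
        (Function.update (fun _ => propagator h) e t) x =
      ∑ c ∈ classes (IsAdmissible σ) b, ∑ z : Fin c.out.numEdge × Fin 2,
        graphTensor M c.out.flagEquiv (Function.update (fun _ => propagator h) z.1 t) x := by
    rw [Finset.mul_sum]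
    refine Finset.sum_congr rfl fun c _ => ?_
    rw [Fintype.sum_prod_type, Finset.mul_sum]
    refine Finset.sum_congr rfl fun e _ => ?_
    rw [Fin.sum_univ_two, two_mul]
  rw [h1, Finset.sum_sigma']
  choose cut τ hrot hinv hleg hτ using
    fun (c : RibbonClass n) (z : Fin c.out.numEdge × Fin 2) => c.out.exists_cut z.1 z.2
  have hcut : ∀ c z, (cut c z).glue.Iso c.out := fun c z => ⟨τ c z, hrot c z, hinv c z, hleg c z⟩
  refine Finset.sum_bij (fun s _ => Quotient.mk (isoSetoid (n + 2)) (cut s.1 s.2)) ?_ ?_ ?_ ?_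
  · rintro ⟨c, z⟩ hc
    have hc' := mem_classes.1 (Finset.mem_sigma.1 hc).1
    refine mk_mem_classes GluesAdmissible.of_iso (Iso.isAdmissible _ _ (hcut c z).symm hc'.1) ?_
    have h2 := (hcut c z).chi_eq
    rw [glue_chi] at h2
    have := hc'.2
    dsimp only
    linarith
  · rintro ⟨c, z⟩ hc ⟨c₂, z₂⟩ hc₂ heq
    have hc' := mem_classes.1 (Finset.mem_sigma.1 hc).1
    have hi : (cut c z).Iso (cut c₂ z₂) := Quotient.exact heq
    obtain rfl : c = c₂ := by
      rw [← class_eq (hcut c z), ← class_eq (hcut c₂ z₂)]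
      exact Quotient.sound hi.glue
    obtain ⟨ρ, r1, r2, r3⟩ := hi
    have r2' := map_glue_inv ρ r2 r3
    have hl := hc'.1.pos
    -- An isomorphism of two cuts of one graph induces an automorphism of that graph fixing its
    -- legs. There is at least one leg, so the automorphism is trivial and the two half-edges
    -- coincide.
    set T : c.out.Flag ≃ c.out.Flag := ((τ c z).symm.trans ρ).trans (τ c z₂) with hT
    have hT' : ∀ f, T (τ c z f) = τ c z₂ (ρ f) := fun f => by
      rw [hT, Equiv.trans_apply, Equiv.trans_apply, Equiv.symm_apply_apply]
    have hrig := hc'.1.1.rigid T (fun f => ?_) (fun f => ?_) (f := c.out.leg ⟨0, hl⟩) ?_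
    · have h3 := hT' ((cut c z).leg 0)
      rw [hrig, hτ, r3, hτ] at h3
      have h4 := Sum.inl_injective (c.out.flagEquiv.injective h3)
      have h5 : z = z₂ := h4
      rw [h5]
    · obtain ⟨f, rfl⟩ := (τ c z).surjective f
      rw [← hrot, hT', hT', ← hrot]
      exact congrArg _ (r1 f)
    · obtain ⟨f, rfl⟩ := (τ c z).surjective f
      rw [← hinv, hT', hT', ← hinv]
      exact congrArg _ (r2' f)
    · rw [← hleg c z, hT', hleg c z, ← hleg c z₂]
      exact congrArg _ (r3 _)
  · intro c' hc'
    have hc := mem_classes.1 hc'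
    have hi := c'.out.glue.out_iso
    set c := (Quotient.mk (isoSetoid n) c'.out.glue : RibbonClass n) with hcdef
    obtain ⟨ρ, r1, r2, r3⟩ := hi
    -- In the representative of the glued class, the image of leg `0` is a half-edge, as the
    -- labelled legs are images of the others; cutting there recovers `c'`.
    obtain ⟨z | l, hz⟩ := c.out.flagEquiv.surjective (ρ (c'.out.leg 0))
    · refine ⟨⟨c, z⟩, ?_, ?_⟩
      · rw [Finset.mem_sigma]
        refine ⟨mk_mem_classes Iso.isAdmissible hc.1 ?_, Finset.mem_univ _⟩
        rw [glue_chi]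
        linarith [hc.2]
      · refine class_eq (iso_of_glue ((τ c z).trans ρ.symm) (fun f => ?_) (fun f => ?_)
          (fun l => ?_) ?_)
        · rw [Equiv.trans_apply, hrot, Equiv.symm_apply_eq, r1, Equiv.trans_apply,
            Equiv.apply_symm_apply]
        · rw [Equiv.trans_apply, hinv, Equiv.symm_apply_eq, r2, Equiv.trans_apply,
            Equiv.apply_symm_apply]
        · rw [Equiv.trans_apply, hleg, Equiv.symm_apply_eq, r3]
        · rw [Equiv.trans_apply, hτ, Equiv.symm_apply_eq, ← hz]
    · exfalso
      have h2 : ρ (c'.out.glue.leg l) = ρ (c'.out.leg 0) := (r3 l).trans hz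
      have h3 := c'.out.leg_injective (ρ.injective h2)
      exact Fin.succ_ne_zero _ h3
  · rintro ⟨c, z⟩ hc
    rw [graphTensor_update_eq h ht (τ c z) (hrot c z) (hinv c z) (hleg c z) (hτ c z) hx]
    exact gluedContraction_congr h t (out_iso _) x

/-- The graphs in which the joined edge carries the full inverse tensor cancel in pairs. -/
theorem sum_gluedContraction_inverseTensor [CharZero k] (σ : Equiv.Perm (Fin n)) (b : ℤ)
    {p : Fin n → ZMod 2} {x : Fin n → A} (hx : ∀ l, x l ∈ 𝒜 (p l)) :
    ∑ c ∈ classes (GluesAdmissible σ) b,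
      gluedContraction h (inverseTensor 𝒜 M.form) c.out x = 0 := by
  classical
  have hne : ∀ Γ : RibbonGraph (n + 2), GluesAdmissible σ Γ → (Γ.leg 0).1 ≠ (Γ.leg 1).1 :=
    fun Γ hΓ => leg_fst_ne_of_glue_hasBoundary Γ hΓ.2
  set tw : RibbonClass (n + 2) → RibbonClass (n + 2) :=
    fun c => Quotient.mk (isoSetoid (n + 2)) c.out.twist with htw
  have hmem : ∀ c ∈ classes (GluesAdmissible σ) b, tw c ∈ classes (GluesAdmissible σ) b := by
    intro c hc
    rw [mem_classes] at hc
    exact mk_mem_classes GluesAdmissible.of_iso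
      ⟨twist_glue_connected _ (hne _ hc.1) hc.1.1, twist_glue_hasBoundary _ (hne _ hc.1) hc.1.2⟩
      hc.2
  have hinj : Set.InjOn tw (classes (GluesAdmissible σ) b : Set (RibbonClass (n + 2))) := by
    intro c hc c' hc' heq
    have h1 := mem_classes.1 hc
    have h2 := mem_classes.1 hc'
    have := Iso.of_twist (hne _ h1.1) (hne _ h2.1) (Quotient.exact heq)
    rw [← Quotient.out_eq c, ← Quotient.out_eq c']
    exact Quotient.sound this
  -- An injective map of a finite set to itself is onto, so the sum may be reindexed by the twist.
  have himg : (classes (GluesAdmissible σ) b).image tw = classes (GluesAdmissible σ) b :=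
    Finset.eq_of_subset_of_card_le (Finset.image_subset_iff.2 hmem)
      (Finset.card_image_of_injOn hinj).ge
  have h2 : ∑ c ∈ classes (GluesAdmissible σ) b,
      gluedContraction h (inverseTensor 𝒜 M.form) c.out x =
      -∑ c ∈ classes (GluesAdmissible σ) b,
      gluedContraction h (inverseTensor 𝒜 M.form) c.out x := by
    conv_lhs => rw [← himg]
    rw [Finset.sum_image hinj, ← Finset.sum_neg_distrib]
    refine Finset.sum_congr rfl fun c hc => ?_
    rw [← gluedContraction_twist h c.out (hne _ (mem_classes.1 hc).1) hx]
    exact (gluedContraction_congr h _ (out_iso _) x).symm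
  exact self_eq_neg.1 h2

end Cut

theorem restrictPerm_apply {N : ℕ} (σ : Equiv.Perm (Fin N)) (I : Finset (Fin N))
    (hI : ∀ a, σ a ∈ I ↔ a ∈ I) (a : Fin I.card) :
    I.orderEmbOfFin rfl (restrictPerm σ I hI a) = σ (I.orderEmbOfFin rfl a) := by
  rw [← Finset.coe_orderIsoOfFin_apply, restrictPerm, Equiv.permCongr_apply]
  change ((I.orderIsoOfFin rfl) ((I.orderIsoOfFin rfl).symm _) : Fin N) = _
  rw [OrderIso.apply_symm_apply]
  rfl

/-! ### Connected components and split graphs. -/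

namespace RibbonGraph

section Component

variable {n₁ n₂ n : ℕ} (Γ₁ : RibbonGraph n₁) (Γ₂ : RibbonGraph n₂) (j : Fin n₁ ⊕ Fin n₂ ≃ Fin n)

theorem union_conn_iff (x y : Γ₁.Flag ⊕ Γ₂.Flag) :
    (Γ₁.union Γ₂ j).conn (unionFlags Γ₁ Γ₂ j x) (unionFlags Γ₁ Γ₂ j y) ↔
      Sum.LiftRel Γ₁.conn Γ₂.conn x y := by
  constructor
  · intro hxy
    have hle : (Γ₁.union Γ₂ j).conn ≤ Setoid.ker fun f =>
        Sum.map (Quotient.mk Γ₁.conn) (Quotient.mk Γ₂.conn) ((unionFlags Γ₁ Γ₂ j).symm f) := by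
      refine conn_le _ (fun f => ?_) fun f => ?_
      · obtain ⟨f | f, rfl⟩ := (unionFlags Γ₁ Γ₂ j).surjective f
        · rw [union_rot_inl, Setoid.ker_def, Equiv.symm_apply_apply, Equiv.symm_apply_apply]
          exact congrArg Sum.inl (Quotient.sound (Γ₁.conn_rot f))
        · rw [union_rot_inr, Setoid.ker_def, Equiv.symm_apply_apply, Equiv.symm_apply_apply]
          exact congrArg Sum.inr (Quotient.sound (Γ₂.conn_rot f))
      · obtain ⟨f | f, rfl⟩ := (unionFlags Γ₁ Γ₂ j).surjective f
        · rw [union_inv_inl, Setoid.ker_def, Equiv.symm_apply_apply, Equiv.symm_apply_apply]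
          exact congrArg Sum.inl (Quotient.sound (Γ₁.conn_inv f))
        · rw [union_inv_inr, Setoid.ker_def, Equiv.symm_apply_apply, Equiv.symm_apply_apply]
          exact congrArg Sum.inr (Quotient.sound (Γ₂.conn_inv f))
    have := hle hxy
    rw [Setoid.ker_def, Equiv.symm_apply_apply, Equiv.symm_apply_apply] at this
    rcases x with x | x <;> rcases y with y | y
    · exact Sum.LiftRel.inl (Quotient.exact (Sum.inl_injective this))
    · exact absurd this Sum.inl_ne_inr
    · exact absurd this Sum.inr_ne_inl
    · exact Sum.LiftRel.inr (Quotient.exact (Sum.inr_injective this))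
  · rintro (⟨hxy⟩ | ⟨hxy⟩)
    · have hle : Γ₁.conn ≤ Setoid.comap (fun f => unionFlags Γ₁ Γ₂ j (Sum.inl f))
          (Γ₁.union Γ₂ j).conn := conn_le _
        (fun f => by rw [Setoid.comap_rel, ← union_rot_inl]; exact conn_rot _ _)
        (fun f => by rw [Setoid.comap_rel, ← union_inv_inl]; exact conn_inv _ _)
      exact hle hxy
    · have hle : Γ₂.conn ≤ Setoid.comap (fun f => unionFlags Γ₁ Γ₂ j (Sum.inr f))
          (Γ₁.union Γ₂ j).conn := conn_le _
        (fun f => by rw [Setoid.comap_rel, ← union_rot_inr]; exact conn_rot _ _)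
        (fun f => by rw [Setoid.comap_rel, ← union_inv_inr]; exact conn_inv _ _)
      exact hle hxy

theorem union_face_inl (f : Γ₁.Flag) : (Γ₁.union Γ₂ j).face (unionFlags Γ₁ Γ₂ j (Sum.inl f)) =
    unionFlags Γ₁ Γ₂ j (Sum.inl (Γ₁.face f)) := by
  rw [face_apply, union_inv_inl, union_rot_inl, face_apply]

theorem union_face_inr (f : Γ₂.Flag) : (Γ₁.union Γ₂ j).face (unionFlags Γ₁ Γ₂ j (Sum.inr f)) =
    unionFlags Γ₁ Γ₂ j (Sum.inr (Γ₂.face f)) := by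
  rw [face_apply, union_inv_inr, union_rot_inr, face_apply]

theorem union_chi : (Γ₁.union Γ₂ j).chi = Γ₁.chi + Γ₂.chi := by
  simp only [chi]; push_cast; ring

theorem Iso.union {Γ₁ Γ₁' : RibbonGraph n₁} {Γ₂ Γ₂' : RibbonGraph n₂} (h₁ : Γ₁.Iso Γ₁')
    (h₂ : Γ₂.Iso Γ₂') (j : Fin n₁ ⊕ Fin n₂ ≃ Fin n) :
    (Γ₁.union Γ₂ j).Iso (Γ₁'.union Γ₂' j) := by
  obtain ⟨τ₁, a1, a2, a3⟩ := h₁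
  obtain ⟨τ₂, b1, b2, b3⟩ := h₂
  set T : (Γ₁.union Γ₂ j).Flag ≃ (Γ₁'.union Γ₂' j).Flag :=
    ((unionFlags Γ₁ Γ₂ j).symm.trans (Equiv.sumCongr τ₁ τ₂)).trans (unionFlags Γ₁' Γ₂' j) with hT
  have hT₁ : ∀ f, T (unionFlags Γ₁ Γ₂ j (Sum.inl f)) = unionFlags Γ₁' Γ₂' j (Sum.inl (τ₁ f)) :=
    fun f => by rw [hT, Equiv.trans_apply, Equiv.trans_apply, Equiv.symm_apply_apply]; rfl
  have hT₂ : ∀ f, T (unionFlags Γ₁ Γ₂ j (Sum.inr f)) = unionFlags Γ₁' Γ₂' j (Sum.inr (τ₂ f)) :=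
    fun f => by rw [hT, Equiv.trans_apply, Equiv.trans_apply, Equiv.symm_apply_apply]; rfl
  refine ⟨T, fun f => ?_, fun f => ?_, fun l => ?_⟩
  · obtain ⟨f | f, rfl⟩ := (unionFlags Γ₁ Γ₂ j).surjective f
    · rw [union_rot_inl, hT₁, hT₁, union_rot_inl, a1]
    · rw [union_rot_inr, hT₂, hT₂, union_rot_inr, b1]
  · obtain ⟨f | f, rfl⟩ := (unionFlags Γ₁ Γ₂ j).surjective f
    · rw [union_inv_inl, hT₁, hT₁, union_inv_inl, a2]
    · rw [union_inv_inr, hT₂, hT₂, union_inv_inr, b2]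
  · obtain ⟨l | l, rfl⟩ := j.surjective l
    · rw [union_leg_inl, hT₁, union_leg_inl, a3]
    · rw [union_leg_inr, hT₂, union_leg_inr, b3]

/-- A connected component of a graph. -/
theorem exists_component (Γ : RibbonGraph n) (C : Γ.Flag → Prop) (hrot : ∀ f, C (Γ.rot f) ↔ C f)
    (hinv : ∀ f, C (Γ.inv f) ↔ C f) (I : Finset (Fin n)) (hI : ∀ l, l ∈ I ↔ C (Γ.leg l)) :
    ∃ (Γ' : RibbonGraph I.card) (τ : Γ'.Flag ≃ {f // C f}),
      (∀ f, (τ (Γ'.rot f) : Γ.Flag) = Γ.rot (τ f)) ∧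
      (∀ f, (τ (Γ'.inv f) : Γ.Flag) = Γ.inv (τ f)) ∧
      ∀ l, (τ (Γ'.leg l) : Γ.Flag) = Γ.leg (I.orderEmbOfFin rfl l) := by
  classical
  -- A property invariant under `rot` and `inv` selects whole vertices (`hC`) and whole edges
  -- (`hE`), which are then renumbered to form a graph.
  have hC : ∀ v i, C (v, i) ↔ C (v, 0) := by
    intro v i
    have h1 := hrot (v, 0)
    have h2 := hrot (v, 1)
    rw [rot_apply] at h1 h2
    have h3 : ∀ i : Fin 3, i = 0 ∨ i = 0 + 1 ∨ i = 1 + 1 := by decide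
    rcases h3 i with rfl | rfl | rfl
    · rfl
    · exact h1
    · exact h2.trans h1
  have hE : ∀ e s, C (Γ.flagEquiv (Sum.inl (e, s))) ↔ C (Γ.flagEquiv (Sum.inl (e, 0))) := by
    intro e s
    have h1 := hinv (Γ.flagEquiv (Sum.inl (e, 0)))
    rw [inv_inl, Equiv.swap_apply_left] at h1
    have h3 : ∀ s : Fin 2, s = 0 ∨ s = 1 := by decide
    rcases h3 s with rfl | rfl
    · rfl
    · exact h1
  set εV := Fintype.equivFin {v // C (v, 0)}
  set εE := Fintype.equivFin {e // C (Γ.flagEquiv (Sum.inl (e, 0)))}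
  set V := Fintype.card {v // C (v, 0)}
  set E := Fintype.card {e // C (Γ.flagEquiv (Sum.inl (e, 0)))}
  set τ : Fin V × Fin 3 ≃ {f // C f} := Equiv.ofBijective
    (fun f => ⟨((εV.symm f.1).1, f.2), (hC _ _).2 (εV.symm f.1).2⟩) (by
      constructor
      · rintro ⟨v, i⟩ ⟨w, j⟩ hvw
        simp only [Subtype.mk.injEq, Prod.mk.injEq] at hvw
        rw [Prod.mk.injEq]
        exact ⟨εV.symm.injective (Subtype.ext hvw.1), hvw.2⟩
      · rintro ⟨⟨v, i⟩, hv⟩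
        exact ⟨(εV ⟨v, (hC v i).1 hv⟩, i), by simp⟩) with hτ
  set m : (Fin E × Fin 2) ⊕ Fin I.card → (Fin Γ.numEdge × Fin 2) ⊕ Fin n :=
    Sum.map (fun z => ((εE.symm z.1).1, z.2)) (I.orderEmbOfFin rfl) with hm
  have hmC : ∀ z, C (Γ.flagEquiv (m z)) := by
    rintro (⟨e, s⟩ | l)
    · exact (hE _ _).2 (εE.symm e).2
    · exact (hI _).1 (I.orderEmbOfFin_mem rfl l)
  set κ : (Fin E × Fin 2) ⊕ Fin I.card ≃ {f // C f} := Equiv.ofBijective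
    (fun z => ⟨Γ.flagEquiv (m z), hmC z⟩) (by
      constructor
      · intro z w hzw
        have h1 := Γ.flagEquiv.injective (congrArg Subtype.val hzw)
        refine Sum.map_injective.2 ⟨?_, (I.orderEmbOfFin rfl).injective⟩ h1
        rintro ⟨e, s⟩ ⟨e', s'⟩ h2
        simp only [Prod.mk.injEq] at h2
        rw [Prod.mk.injEq]
        exact ⟨εE.symm.injective (Subtype.ext h2.1), h2.2⟩
      · rintro ⟨f, hf⟩
        obtain ⟨⟨e, s⟩ | l, rfl⟩ := Γ.flagEquiv.surjective f
        · exact ⟨Sum.inl (εE ⟨e, (hE e s).1 hf⟩, s), by simp [hm]⟩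
        · have h1 : l ∈ Set.range (I.orderEmbOfFin rfl) := by
            rw [Finset.range_orderEmbOfFin]; exact (hI l).2 hf
          obtain ⟨a, rfl⟩ := h1
          exact ⟨Sum.inr a, by simp [hm]⟩) with hκ
  refine ⟨⟨V, E, κ.trans τ.symm⟩, τ, fun f => ?_, fun f => ?_, fun l => ?_⟩
  · obtain ⟨v, i⟩ := f
    rw [rot_apply]
    exact (Γ.rot_apply _ _).symm
  · obtain ⟨z, rfl⟩ := (κ.trans τ.symm).surjective f
    have key : ∀ z, τ ((κ.trans τ.symm) z) = κ z := fun z => by simp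
    rcases z with ⟨e, s⟩ | l
    · have h1 := inv_inl (⟨V, E, κ.trans τ.symm⟩ : RibbonGraph I.card) e s
      have h2 := congrArg (fun f => (τ f : Γ.Flag)) h1
      refine h2.trans ?_
      simp only [key]
      exact (inv_inl Γ _ _).symm
    · have h1 := inv_leg (⟨V, E, κ.trans τ.symm⟩ : RibbonGraph I.card) l
      have h2 := congrArg (fun f => (τ f : Γ.Flag)) h1
      refine h2.trans ?_
      simp only [key, leg]
      exact (inv_leg Γ _).symm
  · simp only [leg, Equiv.trans_apply, Equiv.apply_symm_apply]
    rfl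

end Component

section Split

variable {n : ℕ}

/-- The numbering of a set of legs and of its complement. -/
abbrev splitEquiv (I : Finset (Fin n)) : Fin I.card ⊕ Fin Iᶜ.card ≃ Fin n :=
  finSumEquivOfFinset rfl rfl

theorem splitEquiv_inl_mem (I : Finset (Fin n)) (a : Fin I.card) :
    splitEquiv I (Sum.inl a) ∈ I := I.orderEmbOfFin_mem rfl a

theorem splitEquiv_inr_mem (I : Finset (Fin n)) (a : Fin Iᶜ.card) :
    splitEquiv I (Sum.inr a) ∉ I := Finset.mem_compl.1 (Iᶜ.orderEmbOfFin_mem rfl a)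

/-- The graph has two components, with the legs in `I` and in its complement. -/
def IsSplit (I : Finset (Fin n)) (Γ : RibbonGraph n) : Prop :=
  ∃ (Γ₁ : RibbonGraph I.card) (Γ₂ : RibbonGraph Iᶜ.card), Γ₁.Connected ∧ Γ₂.Connected ∧
    Γ.Iso (Γ₁.union Γ₂ (splitEquiv I))

theorem exists_union (Γ : RibbonGraph n) (C : Γ.Flag → Prop) (hrot : ∀ f, C (Γ.rot f) ↔ C f)
    (hinv : ∀ f, C (Γ.inv f) ↔ C f) (I : Finset (Fin n)) (hI : ∀ l, l ∈ I ↔ C (Γ.leg l)) :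
    ∃ (Γ₁ : RibbonGraph I.card) (Γ₂ : RibbonGraph Iᶜ.card)
      (ρ : (Γ₁.union Γ₂ (splitEquiv I)).Flag ≃ Γ.Flag),
      (∀ f, ρ ((Γ₁.union Γ₂ (splitEquiv I)).rot f) = Γ.rot (ρ f)) ∧
      (∀ f, ρ ((Γ₁.union Γ₂ (splitEquiv I)).inv f) = Γ.inv (ρ f)) ∧
      (∀ l, ρ ((Γ₁.union Γ₂ (splitEquiv I)).leg l) = Γ.leg l) ∧
      (∀ f, C (ρ (unionFlags Γ₁ Γ₂ (splitEquiv I) (Sum.inl f)))) ∧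
      (∀ f, ¬ C (ρ (unionFlags Γ₁ Γ₂ (splitEquiv I) (Sum.inr f)))) ∧
      Nonempty (Γ₁.Flag ≃ {f // C f}) ∧ Nonempty (Γ₂.Flag ≃ {f // ¬ C f}) := by
  classical
  obtain ⟨Γ₁, τ₁, a1, a2, a3⟩ := Γ.exists_component C hrot hinv I hI
  obtain ⟨Γ₂, τ₂, b1, b2, b3⟩ := Γ.exists_component (fun f => ¬ C f)
    (fun f => not_congr (hrot f)) (fun f => not_congr (hinv f)) Iᶜ
    (fun l => by rw [Finset.mem_compl, hI])
  set ρ : (Γ₁.union Γ₂ (splitEquiv I)).Flag ≃ Γ.Flag :=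
    (unionFlags Γ₁ Γ₂ (splitEquiv I)).symm.trans ((Equiv.sumCongr τ₁ τ₂).trans (Equiv.sumCompl C))
    with hρ
  have h1 : ∀ f, ρ (unionFlags Γ₁ Γ₂ (splitEquiv I) (Sum.inl f)) = τ₁ f := fun f => by
    rw [hρ, Equiv.trans_apply, Equiv.symm_apply_apply]; simp
  have h2 : ∀ f, ρ (unionFlags Γ₁ Γ₂ (splitEquiv I) (Sum.inr f)) = τ₂ f := fun f => by
    rw [hρ, Equiv.trans_apply, Equiv.symm_apply_apply]; simp
  refine ⟨Γ₁, Γ₂, ρ, fun f => ?_, fun f => ?_, fun l => ?_, fun f => ?_, fun f => ?_, ⟨τ₁⟩, ⟨τ₂⟩⟩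
  · obtain ⟨f | f, rfl⟩ := (unionFlags Γ₁ Γ₂ (splitEquiv I)).surjective f
    · rw [union_rot_inl, h1, h1, a1]
    · rw [union_rot_inr, h2, h2, b1]
  · obtain ⟨f | f, rfl⟩ := (unionFlags Γ₁ Γ₂ (splitEquiv I)).surjective f
    · rw [union_inv_inl, h1, h1, a2]
    · rw [union_inv_inr, h2, h2, b2]
  · obtain ⟨l | l, rfl⟩ := (splitEquiv I).surjective l
    · rw [union_leg_inl, h1, a3]; rfl
    · rw [union_leg_inr, h2, b3]; rfl
  · rw [h1]; exact (τ₁ f).2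
  · rw [h2]; exact (τ₂ f).2

theorem conn_map {Γ Γ' : RibbonGraph n} (τ : Γ.Flag ≃ Γ'.Flag)
    (h1 : ∀ f, τ (Γ.rot f) = Γ'.rot (τ f)) (h2 : ∀ f, τ (Γ.inv f) = Γ'.inv (τ f)) {f g : Γ.Flag}
    (hfg : Γ.conn f g) : Γ'.conn (τ f) (τ g) := by
  have hle : Γ.conn ≤ Setoid.comap τ Γ'.conn :=
    conn_le _ (fun f => by rw [Setoid.comap_rel, h1]; exact Γ'.conn_rot _)
      (fun f => by rw [Setoid.comap_rel, h2]; exact Γ'.conn_inv _)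
  exact hle hfg

/-- The set `I` can be read off from the graph as the component of any of its legs; a split graph is
counted for one `I` only. -/
theorem IsSplit.conn_leg_iff {I : Finset (Fin n)} {Γ : RibbonGraph n} (h : IsSplit I Γ)
    (l m : Fin n) : Γ.conn (Γ.leg l) (Γ.leg m) ↔ (l ∈ I ↔ m ∈ I) := by
  obtain ⟨Γ₁, Γ₂, h1, h2, ρ, r1, r2, r3⟩ := h
  have h3 : Γ.conn (Γ.leg l) (Γ.leg m) ↔ (Γ₁.union Γ₂ (splitEquiv I)).conn
      ((Γ₁.union Γ₂ (splitEquiv I)).leg l) ((Γ₁.union Γ₂ (splitEquiv I)).leg m) := by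
    rw [← r3, ← r3]
    refine ⟨conn_map ρ r1 r2, fun hc => ?_⟩
    have := conn_map ρ.symm (fun f => by rw [Equiv.symm_apply_eq, r1, Equiv.apply_symm_apply])
      (fun f => by rw [Equiv.symm_apply_eq, r2, Equiv.apply_symm_apply]) hc
    rwa [Equiv.symm_apply_apply, Equiv.symm_apply_apply] at this
  rw [h3]
  obtain ⟨l, rfl⟩ := (splitEquiv I).surjective l
  obtain ⟨m, rfl⟩ := (splitEquiv I).surjective m
  rw [connected_iff] at h1 h2
  rcases l with l | l <;> rcases m with m | m
  · rw [union_leg_inl, union_leg_inl, union_conn_iff, Sum.liftRel_inl_inl]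
    exact iff_of_true (h1.2 _ _)
      (iff_of_true (splitEquiv_inl_mem I l) (splitEquiv_inl_mem I m))
  · rw [union_leg_inl, union_leg_inr, union_conn_iff]
    exact iff_of_false Sum.not_liftRel_inl_inr
      fun h => splitEquiv_inr_mem I m (h.1 (splitEquiv_inl_mem I l))
  · rw [union_leg_inl, union_leg_inr, union_conn_iff]
    exact iff_of_false Sum.not_liftRel_inr_inl
      fun h => splitEquiv_inr_mem I l (h.2 (splitEquiv_inl_mem I m))
  · rw [union_leg_inr, union_leg_inr, union_conn_iff, Sum.liftRel_inr_inr]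
    exact iff_of_true (h2.2 _ _)
      (iff_of_false (splitEquiv_inr_mem I l) (splitEquiv_inr_mem I m))

theorem IsSplit.of_iso {I : Finset (Fin n)} {Γ Γ' : RibbonGraph n} (hi : Γ.Iso Γ')
    (h : IsSplit I Γ) : IsSplit I Γ' := by
  obtain ⟨Γ₁, Γ₂, h1, h2, h3⟩ := h
  exact ⟨Γ₁, Γ₂, h1, h2, hi.symm.trans h3⟩

/-- The components of a split graph are determined by the graph. -/
theorem iso_of_union {n₁ n₂ : ℕ} {j : Fin n₁ ⊕ Fin n₂ ≃ Fin n} {Γ₁ Γ₁' : RibbonGraph n₁}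
    {Γ₂ Γ₂' : RibbonGraph n₂} (hn₁ : 0 < n₁) (hn₂ : 0 < n₂)
    (h₁ : Γ₁.Connected) (h₂ : Γ₂.Connected) (h₁' : Γ₁'.Connected) (h₂' : Γ₂'.Connected)
    (h : (Γ₁.union Γ₂ j).Iso (Γ₁'.union Γ₂' j)) : Γ₁.Iso Γ₁' ∧ Γ₂.Iso Γ₂' := by
  obtain ⟨ρ, r1, r2, r3⟩ := h
  rw [connected_iff] at h₁ h₂ h₁' h₂'
  -- Each component contains a leg, and the isomorphism preserves leg labels; this is what keeps the
  -- two components from being interchanged.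
  have l1 : ∀ f, ∃ g, ρ (unionFlags Γ₁ Γ₂ j (Sum.inl f)) = unionFlags Γ₁' Γ₂' j (Sum.inl g) := by
    intro f
    have h3 := conn_map ρ r1 r2 ((union_conn_iff Γ₁ Γ₂ j (Sum.inl (Γ₁.leg ⟨0, hn₁⟩)) (Sum.inl f)).2
      (Sum.LiftRel.inl (h₁.2 _ _)))
    rw [← union_leg_inl, r3, union_leg_inl] at h3
    obtain ⟨g | g, hg⟩ := (unionFlags Γ₁' Γ₂' j).surjective (ρ (unionFlags Γ₁ Γ₂ j (Sum.inl f)))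
    · exact ⟨g, hg.symm⟩
    · rw [← hg, union_conn_iff] at h3
      exact absurd h3 Sum.not_liftRel_inl_inr
  have l2 : ∀ f, ∃ g, ρ (unionFlags Γ₁ Γ₂ j (Sum.inr f)) = unionFlags Γ₁' Γ₂' j (Sum.inr g) := by
    intro f
    have h3 := conn_map ρ r1 r2 ((union_conn_iff Γ₁ Γ₂ j (Sum.inr (Γ₂.leg ⟨0, hn₂⟩)) (Sum.inr f)).2
      (Sum.LiftRel.inr (h₂.2 _ _)))
    rw [← union_leg_inr, r3, union_leg_inr] at h3
    obtain ⟨g | g, hg⟩ := (unionFlags Γ₁' Γ₂' j).surjective (ρ (unionFlags Γ₁ Γ₂ j (Sum.inr f)))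
    · rw [← hg, union_conn_iff] at h3
      exact absurd h3 Sum.not_liftRel_inr_inl
    · exact ⟨g, hg.symm⟩
  choose t1 ht1 using l1
  choose t2 ht2 using l2
  have s1 : Function.Surjective t1 := by
    intro g
    obtain ⟨f, hf⟩ := ρ.surjective (unionFlags Γ₁' Γ₂' j (Sum.inl g))
    obtain ⟨f | f, rfl⟩ := (unionFlags Γ₁ Γ₂ j).surjective f
    · rw [ht1] at hf
      exact ⟨f, Sum.inl_injective ((unionFlags Γ₁' Γ₂' j).injective hf)⟩
    · rw [ht2] at hf
      exact absurd ((unionFlags Γ₁' Γ₂' j).injective hf) Sum.inr_ne_inl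
  have s2 : Function.Surjective t2 := by
    intro g
    obtain ⟨f, hf⟩ := ρ.surjective (unionFlags Γ₁' Γ₂' j (Sum.inr g))
    obtain ⟨f | f, rfl⟩ := (unionFlags Γ₁ Γ₂ j).surjective f
    · rw [ht1] at hf
      exact absurd ((unionFlags Γ₁' Γ₂' j).injective hf) Sum.inl_ne_inr
    · rw [ht2] at hf
      exact ⟨f, Sum.inr_injective ((unionFlags Γ₁' Γ₂' j).injective hf)⟩
  have i1 : Function.Injective t1 := fun f g hfg => by
    have := (ht1 f).trans ((congrArg _ (congrArg Sum.inl hfg)).trans (ht1 g).symm)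
    exact Sum.inl_injective ((unionFlags Γ₁ Γ₂ j).injective (ρ.injective this))
  have i2 : Function.Injective t2 := fun f g hfg => by
    have := (ht2 f).trans ((congrArg _ (congrArg Sum.inr hfg)).trans (ht2 g).symm)
    exact Sum.inr_injective ((unionFlags Γ₁ Γ₂ j).injective (ρ.injective this))
  have u1 := fun {f g} (h : unionFlags Γ₁' Γ₂' j (Sum.inl f) = unionFlags Γ₁' Γ₂' j (Sum.inl g)) =>
    Sum.inl_injective ((unionFlags Γ₁' Γ₂' j).injective h)
  have u2 := fun {f g} (h : unionFlags Γ₁' Γ₂' j (Sum.inr f) = unionFlags Γ₁' Γ₂' j (Sum.inr g)) =>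
    Sum.inr_injective ((unionFlags Γ₁' Γ₂' j).injective h)
  have b1 : Function.Bijective t1 := ⟨i1, s1⟩
  have b2 : Function.Bijective t2 := ⟨i2, s2⟩
  refine ⟨⟨Equiv.ofBijective t1 b1, fun f => u1 ?_, fun f => u1 ?_, fun l => u1 ?_⟩,
    ⟨Equiv.ofBijective t2 b2, fun f => u2 ?_, fun f => u2 ?_, fun l => u2 ?_⟩⟩
  · rw [Equiv.ofBijective_apply, Equiv.ofBijective_apply, ← ht1, ← union_rot_inl, r1, ht1,
      union_rot_inl]
  · rw [Equiv.ofBijective_apply, Equiv.ofBijective_apply, ← ht1, ← union_inv_inl, r2, ht1,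
      union_inv_inl]
  · rw [Equiv.ofBijective_apply, ← ht1, ← union_leg_inl, r3, union_leg_inl]
  · rw [Equiv.ofBijective_apply, Equiv.ofBijective_apply, ← ht2, ← union_rot_inr, r1, ht2,
      union_rot_inr]
  · rw [Equiv.ofBijective_apply, Equiv.ofBijective_apply, ← ht2, ← union_inv_inr, r2, ht2,
      union_inv_inr]
  · rw [Equiv.ofBijective_apply, ← ht2, ← union_leg_inr, r3, union_leg_inr]

end Split

end RibbonGraph

/-! ### Boundaries of split graphs and the passage to pairs of connected graphs. -/

namespace RibbonGraph

variable {n : ℕ}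

theorem union_hasBoundary {I : Finset (Fin n)} {Γ₁ : RibbonGraph I.card} {Γ₂ : RibbonGraph Iᶜ.card}
    {σ : Equiv.Perm (Fin n)} (hI : ∀ a, σ a ∈ I ↔ a ∈ I) (hI' : ∀ a, σ a ∈ Iᶜ ↔ a ∈ Iᶜ)
    (h₁ : Γ₁.HasBoundary (restrictPerm σ I hI)) (h₂ : Γ₂.HasBoundary (restrictPerm σ Iᶜ hI')) :
    (Γ₁.union Γ₂ (splitEquiv I)).HasBoundary σ :=
  IsBoundary.union h₁ h₂ (unionFlags Γ₁ Γ₂ (splitEquiv I))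
    (fun f => (union_face_inl _ _ _ f).symm) (fun f => (union_face_inr _ _ _ f).symm) (splitEquiv I)
    (fun l => (union_leg_inl _ _ _ l).symm) (fun l => (union_leg_inr _ _ _ l).symm)
    (fun l => restrictPerm_apply σ I hI l) (fun l => restrictPerm_apply σ Iᶜ hI' l)

theorem hasBoundary_of_union {I : Finset (Fin n)} {Γ₁ : RibbonGraph I.card}
    {Γ₂ : RibbonGraph Iᶜ.card} {σ : Equiv.Perm (Fin n)} (hI : ∀ a, σ a ∈ I ↔ a ∈ I)
    (hI' : ∀ a, σ a ∈ Iᶜ ↔ a ∈ Iᶜ) (h : (Γ₁.union Γ₂ (splitEquiv I)).HasBoundary σ) :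
    Γ₁.HasBoundary (restrictPerm σ I hI) ∧ Γ₂.HasBoundary (restrictPerm σ Iᶜ hI') := by
  constructor
  · refine IsBoundary.restrict h (fun f => unionFlags Γ₁ Γ₂ (splitEquiv I) (Sum.inl f))
      ((unionFlags Γ₁ Γ₂ (splitEquiv I)).injective.comp Sum.inl_injective)
      (fun f => (union_face_inl _ _ _ f).symm) (fun a => splitEquiv I (Sum.inl a))
      (fun l => (union_leg_inl _ _ _ l).symm) (fun l => restrictPerm_apply σ I hI l)
      fun l f hl => ?_
    obtain ⟨l | l, rfl⟩ := (splitEquiv I).surjective l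
    · exact ⟨l, rfl⟩
    · rw [union_leg_inr] at hl
      exact absurd ((unionFlags Γ₁ Γ₂ (splitEquiv I)).injective hl) Sum.inr_ne_inl
  · refine IsBoundary.restrict h (fun f => unionFlags Γ₁ Γ₂ (splitEquiv I) (Sum.inr f))
      ((unionFlags Γ₁ Γ₂ (splitEquiv I)).injective.comp Sum.inr_injective)
      (fun f => (union_face_inr _ _ _ f).symm) (fun a => splitEquiv I (Sum.inr a))
      (fun l => (union_leg_inr _ _ _ l).symm) (fun l => restrictPerm_apply σ Iᶜ hI' l)
      fun l f hl => ?_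
    obtain ⟨l | l, rfl⟩ := (splitEquiv I).surjective l
    · rw [union_leg_inl] at hl
      exact absurd ((unionFlags Γ₁ Γ₂ (splitEquiv I)).injective hl) Sum.inl_ne_inr
    · exact ⟨l, rfl⟩

/-- A boundary walk never leaves its component, so each circle of `σ` lies in `I` or in its
complement. -/
theorem IsSplit.stable {I : Finset (Fin n)} {Γ : RibbonGraph n} (h : IsSplit I Γ)
    {σ : Equiv.Perm (Fin n)} (hb : Γ.HasBoundary σ) (a : Fin n) : σ a ∈ I ↔ a ∈ I := by
  obtain ⟨t, ht, -⟩ := hb.1 a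
  refine ((h.conn_leg_iff a (σ a)).1 (sameCycle_face_le Γ ⟨(t + 1 : ℕ), ?_⟩)).symm
  rw [zpow_natCast, ht]

/-- Joining legs `0` and `1` merges only their two components. If the result is connected and the
graph was not, these two are all the components. -/
theorem exists_isSplit {Γ : RibbonGraph (n + 2)} (hΓ : ¬ Γ.Connected) (hg : Γ.glue.Connected) :
    ∃ I, IsSplit I Γ ∧ 0 ∈ I ∧ 1 ∉ I := by
  classical
  rw [connected_iff] at hg hΓ
  obtain ⟨hne, hg⟩ := hg
  rw [glue_conn] at hg
  have h01 : ¬ Γ.conn (Γ.leg 0) (Γ.leg 1) := fun h01 => by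
    rw [joinSetoid_eq_self h01] at hg
    exact hΓ ⟨hne, hg⟩
  have hcov : ∀ f, Γ.conn (Γ.leg 0) f ∨ Γ.conn (Γ.leg 1) f := by
    have hle : joinSetoid Γ.conn (Γ.leg 0) (Γ.leg 1) ≤
        Setoid.ker fun f => (Γ.conn (Γ.leg 0) f ∨ Γ.conn (Γ.leg 1) f) := by
      refine joinSetoid_le (fun f g hfg => ?_) ?_
      · rw [Setoid.ker_def, eq_iff_iff]
        exact ⟨Or.imp (fun h => Setoid.trans' _ h hfg) (fun h => Setoid.trans' _ h hfg),
          Or.imp (fun h => Setoid.trans' _ h (Setoid.symm' _ hfg))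
            (fun h => Setoid.trans' _ h (Setoid.symm' _ hfg))⟩
      · rw [Setoid.ker_def, eq_iff_iff]
        exact iff_of_true (Or.inl (Setoid.refl' _ _)) (Or.inr (Setoid.refl' _ _))
    intro f
    have := hle (hg (Γ.leg 0) f)
    rw [Setoid.ker_def, eq_iff_iff] at this
    exact this.1 (Or.inl (Setoid.refl' _ _))
  obtain ⟨Γ₁, Γ₂, ρ, r1, r2, r3, c1, c2, ⟨τ₁⟩, ⟨τ₂⟩⟩ := Γ.exists_union
    (fun f => Γ.conn (Γ.leg 0) f)
    (fun f => ⟨fun h => Setoid.trans' _ h (Setoid.symm' _ (Γ.conn_rot f)),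
      fun h => Setoid.trans' _ h (Γ.conn_rot f)⟩)
    (fun f => ⟨fun h => Setoid.trans' _ h (Setoid.symm' _ (Γ.conn_inv f)),
      fun h => Setoid.trans' _ h (Γ.conn_inv f)⟩)
    (Finset.univ.filter fun l => Γ.conn (Γ.leg 0) (Γ.leg l)) (fun l => by simp)
  have key : ∀ x y, Γ.conn (ρ (unionFlags Γ₁ Γ₂ (splitEquiv _) x))
      (ρ (unionFlags Γ₁ Γ₂ (splitEquiv _) y)) → Sum.LiftRel Γ₁.conn Γ₂.conn x y := by
    intro x y hxy
    have := conn_map ρ.symm (fun f => by rw [Equiv.symm_apply_eq, r1, Equiv.apply_symm_apply])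
      (fun f => by rw [Equiv.symm_apply_eq, r2, Equiv.apply_symm_apply]) hxy
    rwa [Equiv.symm_apply_apply, Equiv.symm_apply_apply, union_conn_iff] at this
  refine ⟨_, ⟨Γ₁, Γ₂, ?_, ?_, Iso.symm ⟨ρ, r1, r2, r3⟩⟩, ?_, ?_⟩
  · rw [connected_iff]
    refine ⟨⟨τ₁.symm ⟨Γ.leg 0, Setoid.refl' _ _⟩⟩, fun f g => ?_⟩
    exact Sum.liftRel_inl_inl.1 (key _ _ (Setoid.trans' _ (Setoid.symm' _ (c1 f)) (c1 g)))
  · rw [connected_iff]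
    refine ⟨⟨τ₂.symm ⟨Γ.leg 1, h01⟩⟩, fun f g => ?_⟩
    have e1 := (hcov _).resolve_left (c2 f)
    have e2 := (hcov _).resolve_left (c2 g)
    exact Sum.liftRel_inr_inr.1 (key _ _ (Setoid.trans' _ (Setoid.symm' _ e1) e2))
  · simpa using Setoid.refl' _ _
  · simpa using h01

theorem IsSplit.not_connected {I : Finset (Fin n)} {Γ : RibbonGraph n} (h : IsSplit I Γ)
    {l m : Fin n} (hl : l ∈ I) (hm : m ∉ I) : ¬ Γ.Connected := fun hc =>
  hm (((h.conn_leg_iff l m).1 (((connected_iff Γ).1 hc).2 _ _)).1 hl)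

theorem IsSplit.glue_connected {I : Finset (Fin (n + 2))} {Γ : RibbonGraph (n + 2)}
    (h : IsSplit I Γ) (h0 : 0 ∈ I) (h1 : 1 ∉ I) : Γ.glue.Connected := by
  obtain ⟨Γ₁, Γ₂, c1, c2, hi⟩ := h
  have hc : (Γ₁.union Γ₂ (splitEquiv I)).glue.Connected := by
    rw [connected_iff] at c1 c2 ⊢
    refine ⟨⟨(Γ₁.union Γ₂ (splitEquiv I)).leg 0⟩, ?_⟩
    rw [glue_conn]
    set U := Γ₁.union Γ₂ (splitEquiv I) with hU
    have key : ∀ f, joinSetoid U.conn (U.leg 0) (U.leg 1) (U.leg 0) f := by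
      intro f
      obtain ⟨f | f, rfl⟩ := (unionFlags Γ₁ Γ₂ (splitEquiv I)).surjective f
      · obtain ⟨a | a, ha⟩ := (splitEquiv I).surjective 0
        · refine le_joinSetoid _ _ _ ?_
          rw [← ha, show U.leg (splitEquiv I (Sum.inl a)) = _ from union_leg_inl _ _ _ a]
          exact (union_conn_iff _ _ _ _ _).2 (Sum.LiftRel.inl (c1.2 _ _))
        · exact absurd h0 (ha ▸ splitEquiv_inr_mem I a)
      · refine Setoid.trans' _ (joinSetoid_rel _ _ _) ?_
        obtain ⟨a | a, ha⟩ := (splitEquiv I).surjective 1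
        · exact absurd (ha ▸ splitEquiv_inl_mem I a) h1
        · refine le_joinSetoid _ _ _ ?_
          rw [← ha, show U.leg (splitEquiv I (Sum.inr a)) = _ from union_leg_inr _ _ _ a]
          exact (union_conn_iff _ _ _ _ _).2 (Sum.LiftRel.inr (c2.2 _ _))
    exact fun f g => Setoid.trans' _ (Setoid.symm' _ (key f)) (key g)
  exact hi.symm.glue.connected hc

theorem Connected.glue {Γ : RibbonGraph (n + 2)} (h : Γ.Connected) : Γ.glue.Connected := by
  rw [connected_iff] at h ⊢
  rw [glue_conn]
  exact ⟨h.1, fun f g => le_joinSetoid _ _ _ (h.2 f g)⟩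

theorem glue_hasBoundary_iff (Γ : RibbonGraph (n + 2)) (σ : Equiv.Perm (Fin n)) :
    Γ.glue.HasBoundary σ ↔ ∃ σ', Γ.HasBoundary σ' ∧ Glues σ' σ := by
  rw [HasBoundary, glue_face]
  exact isBoundary_mul_swap_iff Γ.leg_injective σ

/-- The sum over the split graphs is a sum over pairs of connected graphs. -/
theorem sum_isSplit {k : Type*} [CommRing k] (f : RibbonGraph n → k)
    (hf : ∀ Γ Γ', Γ.Iso Γ' → f Γ = f Γ') {σ : Equiv.Perm (Fin n)} {I : Finset (Fin n)}
    (hI : ∀ a, σ a ∈ I ↔ a ∈ I) (hI' : ∀ a, σ a ∈ Iᶜ ↔ a ∈ Iᶜ) (b : ℕ) :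
    ∑ c ∈ classes (fun Γ => IsSplit I Γ ∧ Γ.HasBoundary σ) ((b : ℤ) - 1), f c.out =
      ∑ b₁ ∈ Finset.range (b + 1), ∑ c₁ ∈ classes (IsAdmissible (restrictPerm σ I hI)) (b₁ : ℤ),
        ∑ c₂ ∈ classes (IsAdmissible (restrictPerm σ Iᶜ hI')) ((b - b₁ : ℕ) : ℤ),
          f (c₁.out.union c₂.out (splitEquiv I)) := by
  classical
  have hsum : ∀ b₁ : ℕ, ∑ c₁ ∈ classes (IsAdmissible (restrictPerm σ I hI)) (b₁ : ℤ),
        ∑ c₂ ∈ classes (IsAdmissible (restrictPerm σ Iᶜ hI')) ((b - b₁ : ℕ) : ℤ),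
          f (c₁.out.union c₂.out (splitEquiv I)) =
      ∑ z ∈ classes (IsAdmissible (restrictPerm σ I hI)) (b₁ : ℤ) ×ˢ
        classes (IsAdmissible (restrictPerm σ Iᶜ hI')) ((b - b₁ : ℕ) : ℤ),
          f (z.1.out.union z.2.out (splitEquiv I)) := fun b₁ => by rw [Finset.sum_product]
  simp only [hsum]
  rw [Finset.sum_sigma']
  symm
  -- Euler characteristics add under disjoint union, so exponents `b₁` and `b - b₁` of the
  -- components give the union `1 - χ = b - 1`.
  refine Finset.sum_bij (fun z _ => Quotient.mk (isoSetoid n)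
    (z.2.1.out.union z.2.2.out (splitEquiv I))) ?_ ?_ ?_ ?_
  · rintro ⟨b₁, c₁, c₂⟩ hz
    simp only [Finset.mem_sigma, Finset.mem_range, Finset.mem_product, mem_classes] at hz
    obtain ⟨hb, ⟨a1, e1⟩, a2, e2⟩ := hz
    refine mk_mem_classes (fun Γ Γ' hi h => ⟨h.1.of_iso hi, hi.hasBoundary h.2⟩)
      ⟨⟨_, _, a1.1, a2.1, (isoSetoid n).refl' _⟩, union_hasBoundary hI hI' a1.2 a2.2⟩ ?_
    rw [union_chi]
    dsimp only
    omega
  · rintro ⟨b₁, c₁, c₂⟩ hz ⟨b₁', c₁', c₂'⟩ hz' heq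
    simp only [Finset.mem_sigma, Finset.mem_range, Finset.mem_product, mem_classes] at hz hz'
    obtain ⟨hb, ⟨a1, e1⟩, a2, e2⟩ := hz
    obtain ⟨hb', ⟨a1', e1'⟩, a2', e2'⟩ := hz'
    obtain ⟨i1, i2⟩ := iso_of_union a1.pos a2.pos a1.1 a2.1 a1'.1 a2'.1 (Quotient.exact heq)
    have h1 : c₁ = c₁' := by
      rw [← class_eq i1]; exact (Quotient.out_eq c₁).symm
    have h2 : c₂ = c₂' := by
      rw [← class_eq i2]; exact (Quotient.out_eq c₂).symm
    subst h1 h2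
    have h3 : b₁ = b₁' := by omega
    rw [h3]
  · intro c hc
    rw [mem_classes] at hc
    obtain ⟨⟨hs, hb⟩, hχ⟩ := hc
    obtain ⟨Γ₁, Γ₂, c1, c2, hi⟩ := hs
    obtain ⟨b1, b2⟩ := hasBoundary_of_union hI hI' (hi.hasBoundary hb)
    have a1 : IsAdmissible _ Γ₁ := ⟨c1, b1⟩
    have a2 : IsAdmissible _ Γ₂ := ⟨c2, b2⟩
    -- The exponents of both components are nonnegative, which places that of the first in the range
    -- from 0 to `b`.
    have n1 := a1.chi_le
    have n2 := a2.chi_le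
    rw [hi.chi_eq, union_chi] at hχ
    refine ⟨⟨(1 - Γ₁.chi).toNat, Quotient.mk _ Γ₁, Quotient.mk _ Γ₂⟩, ?_, ?_⟩
    · rw [Finset.mem_sigma, Finset.mem_product, Finset.mem_range]
      exact ⟨by dsimp only; omega, mk_mem_classes Iso.isAdmissible a1 (by dsimp only; omega),
        mk_mem_classes Iso.isAdmissible a2 (by dsimp only; omega)⟩
    · exact class_eq ((Iso.union Γ₁.out_iso.symm Γ₂.out_iso.symm _).trans hi.symm)
  · rintro ⟨b₁, c₁, c₂⟩ _
    exact hf _ _ (out_iso _)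

end RibbonGraph

open RibbonGraph

/-! ### Decomposition of a cut graph: connected or split. -/

open Classical in
/-- A graph that becomes admissible when its first two legs are joined is either connected or
split. -/
theorem sum_gluesAdmissible {k : Type*} [CommRing k] {n : ℕ} (f : RibbonClass (n + 2) → k)
    (σ : Equiv.Perm (Fin n)) (b : ℤ) :
    ∑ c ∈ classes (GluesAdmissible σ) b, f c =
      ∑ σ' : Equiv.Perm (Fin (n + 2)), if Glues σ' σ then
        (∑ c ∈ classes (IsAdmissible σ') b, f c +
          ∑ I : Finset (Fin (n + 2)),
            if (∀ a, σ' a ∈ I ↔ a ∈ I) ∧ (∀ a, σ' a ∈ Iᶜ ↔ a ∈ Iᶜ) ∧ 0 ∈ I ∧ 1 ∉ I then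
              ∑ c ∈ classes (fun Γ => IsSplit I Γ ∧ Γ.HasBoundary σ') b, f c
            else 0)
      else 0 := by
  -- All families become indicator sums over one finite set of classes, so the identity can be
  -- checked for each class separately.
  have hQ : ∀ Q : RibbonGraph (n + 2) → Prop, ∑ c ∈ classes Q b, f c =
      ∑ c ∈ classes (fun _ => True) b, if Q c.out then f c else 0 := by
    intro Q
    rw [← Finset.sum_filter]
    refine Finset.sum_congr (Finset.ext fun c => ?_) fun _ _ => rfl
    rw [Finset.mem_filter, mem_classes, mem_classes, true_and, and_comm]
  simp only [hQ (GluesAdmissible σ), hQ (IsAdmissible _), hQ (fun Γ => IsSplit _ Γ ∧ _)]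
  have h1 : ∀ (P : Prop) [Decidable P] (g : RibbonClass (n + 2) → k),
      (if P then ∑ c ∈ classes (fun _ => True) b, g c else 0) =
        ∑ c ∈ classes (fun _ => True) b, if P then g c else 0 := by
    intro P _ g
    split_ifs
    · rfl
    · simp
  simp only [h1]
  have h2 : ∀ g : Finset (Fin (n + 2)) → RibbonClass (n + 2) → k,
      ∑ I, ∑ c ∈ classes (fun _ => True) b, g I c =
        ∑ c ∈ classes (fun _ => True) b, ∑ I, g I c := fun g => Finset.sum_comm
  simp only [h2, ← Finset.sum_add_distrib, h1]
  rw [Finset.sum_comm]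
  refine Finset.sum_congr rfl fun c _ => ?_
  set Γ := c.out
  by_cases hg : GluesAdmissible σ Γ
  · rw [if_pos hg]
    -- The boundary permutation `σ'` of the cut graph is unique. For it the class is counted once:
    -- in the connected sum, or for the single `I` given by the component of leg `0`.
    obtain ⟨σ', hb, hσ'⟩ := (glue_hasBoundary_iff Γ σ).1 hg.2
    rw [Finset.sum_eq_single σ', if_pos hσ']
    · by_cases hc : Γ.Connected
      · rw [if_pos ⟨hc, hb⟩, Finset.sum_eq_zero, add_zero]
        intro I _
        split_ifs with hI hs
        · exact absurd hc (hs.1.not_connected hI.2.2.1 hI.2.2.2)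
        · rfl
        · rfl
      · rw [if_neg fun h => hc h.1, zero_add]
        obtain ⟨I, hI, h0, h1⟩ := exists_isSplit hc hg.1
        rw [Finset.sum_eq_single I]
        · rw [if_pos, if_pos ⟨hI, hb⟩]
          exact ⟨hI.stable hb, fun a => by
            rw [Finset.mem_compl, Finset.mem_compl, hI.stable hb], h0, h1⟩
        · intro J _ hJI
          split_ifs with hJ hs
          · refine absurd (Finset.ext fun a => ?_) hJI
            have e1 := (hs.1.conn_leg_iff 0 a).symm.trans (hI.conn_leg_iff 0 a)
            tauto
          · rfl
          · rfl
        · exact fun h => absurd (Finset.mem_univ _) h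
    · intro σ'' _ hne
      have hnb : ¬ Γ.HasBoundary σ'' := fun hb' => hne (IsBoundary.unique Γ.leg_injective hb' hb)
      split_ifs with h1 h2
      · exact absurd h2.2 hnb
      · rw [zero_add]
        refine Finset.sum_eq_zero fun I _ => ?_
        split_ifs with h3 h4
        · exact absurd h4.2 hnb
        · rfl
        · rfl
      · rfl
    · exact fun h => absurd (Finset.mem_univ _) h
  · rw [if_neg hg]
    symm
    refine Finset.sum_eq_zero fun σ' _ => ?_
    split_ifs with h1 h2
    · exact absurd ⟨h2.1.glue, (glue_hasBoundary_iff Γ σ).2 ⟨σ', h2.2, h1⟩⟩ hg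
    · rw [zero_add]
      refine Finset.sum_eq_zero fun I _ => ?_
      split_ifs with h3 h4
      · exact absurd ⟨h4.1.glue_connected h3.2.2.1 h3.2.2.2,
          (glue_hasBoundary_iff Γ σ).2 ⟨σ', h4.2, h1⟩⟩ hg
      · rfl
      · rfl
    · rfl

open RibbonGraph

/-! ### The terms with the image tensor: Laplacian and bracket of the ribbon sum. -/

section Image

variable {k A B : Type*} [Field k] [NonUnitalRing A] [Module k A]
  [AddCommGroup B] [Module k B]
  {𝒜 : ZMod 2 → Submodule k A} {ℬ : ZMod 2 → Submodule k B} {M : CyclicDGAlgebra 𝒜}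
  [IsScalarTower k A A] [SMulCommClass k A A] [DirectSum.Decomposition 𝒜] [FiniteDimensional k A]
  [DirectSum.Decomposition ℬ] [FiniteDimensional k B]
  (h : Homotopy M) {n : ℕ}

theorem update_update_cons {X : Type*} (x : Fin n → X) (a b u v : X) :
    Function.update (Function.update (Fin.cons a (Fin.cons b x) : Fin (n + 2) → X) 0 u) 1 v =
      Fin.cons u (Fin.cons v x) := by
  rw [Fin.update_cons_zero, ← Fin.succ_zero_eq_one, ← Fin.cons_update, Fin.update_cons_zero]

theorem gluedContraction_imageTensor {R : CyclicAInfinity ℬ} {incl : B →ₗ[k] A}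
    (hm : IsTreeModel R h incl) (Γ : RibbonGraph (n + 2)) (x : Fin n → A) :
    gluedContraction h (imageTensor h) Γ x = ∑ i, ∑ j, inverseTensor ℬ R.form i j *
      contraction h Γ (Fin.cons (incl (homBasis ℬ i)) (Fin.cons (incl (homBasis ℬ j)) x)) := by
  have h01 : (0 : Fin (n + 2)) ≠ 1 := by simp
  have := sum_imageTensor_eq h hm
    (bilinearAt (contraction h Γ) (Fin.cons 0 (Fin.cons 0 x)) h01)
  simpa only [gluedContraction, bilinearAt_apply, update_update_cons] using this

theorem isEdgeTensor_sub {o : ZMod 2} {t t' : Matrix (HomIdx 𝒜) (HomIdx 𝒜) k}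
    (ht : IsEdgeTensor o t) (ht' : IsEdgeTensor o t') : IsEdgeTensor o (t - t') where
  parity {i j} hij := by
    by_cases h1 : t i j = 0
    · refine ht'.parity fun h2 => hij ?_
      rw [Matrix.sub_apply, h1, h2, sub_zero]
    · exact ht.parity h1
  symm i j := by
    rw [Matrix.sub_apply, Matrix.sub_apply, ht.symm i j, ht'.symm i j, mul_sub]

/-- The functional given by the sum over all ribbon graphs. -/
def ribbonSeries (incl : B →ₗ[k] A) : Series k B := fun n σ b =>
  (ribbonSum h n σ b).compLinearMap fun _ => incl

theorem ribbonSeries_apply (incl : B →ₗ[k] A) (σ : Equiv.Perm (Fin n)) (b : ℕ) (x : Fin n → B) :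
    ribbonSeries h incl n σ b x =
      ∑ c ∈ classes (IsAdmissible σ) b, contraction h c.out fun l => incl (x l) :=
  ribbonSum_apply h σ b _

theorem cons_cons_parity {i j : HomIdx ℬ} {p : Fin n → ZMod 2} {x : Fin n → B}
    (hx : ∀ l, x l ∈ ℬ (p l)) (a : Fin (n + 2)) :
    (Fin.cons (homBasis ℬ i) (Fin.cons (homBasis ℬ j) x) : Fin (n + 2) → B) a ∈
      ℬ ((Fin.cons i.1 (Fin.cons j.1 p) : Fin (n + 2) → ZMod 2) a) := by
  refine Fin.cases ?_ (fun a => Fin.cases ?_ (fun a => ?_) a) a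
  · exact homBasis_mem ℬ i
  · exact homBasis_mem ℬ j
  · exact hx a

/-- The shuffle sign from numbering the two sets of legs separately is the sign, used in
`bvBracket`, of moving the letters of `I` to the front. -/
theorem contraction_split [CharZero k] {incl : B →ₗ[k] A}
    (hincl : ∀ i x, x ∈ ℬ i → incl x ∈ 𝒜 i) (I : Finset (Fin n)) (Γ₁ : RibbonGraph I.card)
    (Γ₂ : RibbonGraph Iᶜ.card) {q : Fin n → ZMod 2} {y : Fin n → B} (hy : ∀ l, y l ∈ ℬ (q l)) :
    contraction h (Γ₁.union Γ₂ (splitEquiv I)) (fun l => incl (y l)) =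
      koszulSign k (fun a : Fin n => (a : ℕ)) (fun a => if a ∈ I then (a : ℕ) else a + n)
          (fun a => q a + 1) *
        (contraction h Γ₁ (fun a => incl (restrictWord y I a)) *
          contraction h Γ₂ (fun a => incl (restrictWord y Iᶜ a))) := by
  rw [contraction_union h Γ₁ Γ₂ (splitEquiv I) (fun l => hincl _ _ (hy l))]
  congr 1
  have hr : Function.Injective fun a : Fin n => if a ∈ I then (a : ℕ) else a + n := by
    intro a b hab
    have := a.2
    have := b.2
    dsimp only at hab
    apply Fin.ext
    split_ifs at hab <;> omega
  rw [koszulSign_comm Fin.val_injective hr, ← koszulSign_equiv (splitEquiv I)]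
  refine koszulSign_congr (fun a b => and_congr_left fun _ => ?_) fun _ _ _ _ => rfl
  have hj₁ := splitEquiv_inl_mem I
  have hj₂ := splitEquiv_inr_mem I
  rcases a with a | a <;> rcases b with b | b <;>
    simp only [Sum.elim_inl, Sum.elim_inr, Function.comp_apply, hj₁, hj₂, if_true, if_false]
  · rw [Fin.val_fin_lt, Fin.val_fin_lt]
    exact (I.orderEmbOfFin rfl).lt_iff_lt.symm
  · exact iff_of_true (by have := a.2; omega) (by have := (splitEquiv I (Sum.inl a)).2; omega)
  · exact iff_of_false (by have := b.2; omega) (by have := (splitEquiv I (Sum.inl b)).2; omega)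
  · rw [Nat.add_lt_add_iff_left, Nat.add_lt_add_iff_right, Fin.val_fin_lt, Fin.val_fin_lt]
    exact (Iᶜ.orderEmbOfFin rfl).lt_iff_lt.symm

/-- The graphs in which the joined edge carries the inverse tensor of `B`. -/
theorem sum_gluedContraction_imageTensor [CharZero k] {R : CyclicAInfinity ℬ} {incl : B →ₗ[k] A}
    (hm : IsTreeModel R h incl) (σ : Equiv.Perm (Fin n)) (b : ℕ) {p : Fin n → ZMod 2}
    {x : Fin n → B} (hx : ∀ l, x l ∈ ℬ (p l)) :
    ∑ c ∈ classes (GluesAdmissible σ) ((b : ℤ) - 1),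
        gluedContraction h (imageTensor h) c.out (fun l => incl (x l)) =
      2 * hbarMul (bvLaplacian ℬ R.form (ribbonSeries h incl)) n σ b x +
        bvBracket ℬ R.form (ribbonSeries h incl) (ribbonSeries h incl) n σ b p x := by
  classical
  set y : HomIdx ℬ → HomIdx ℬ → Fin (n + 2) → B :=
    fun i j => Fin.cons (homBasis ℬ i) (Fin.cons (homBasis ℬ j) x) with hy
  have hincl : ∀ i j, (Fin.cons (incl (homBasis ℬ i)) (Fin.cons (incl (homBasis ℬ j))
      fun l => incl (x l)) : Fin (n + 2) → A) = fun l => incl (y i j l) := by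
    intro i j
    funext l
    refine Fin.cases rfl (fun l => Fin.cases rfl (fun l => rfl) l) l
  -- The 2 cancels the 1/2 in the definition of the Laplacian. At `b = 0` both sides vanish because
  -- no admissible graph has `1 - χ = -1`.
  have hL : 2 * hbarMul (bvLaplacian ℬ R.form (ribbonSeries h incl)) n σ b x =
      ∑ i, ∑ j, inverseTensor ℬ R.form i j * ∑ σ' : Equiv.Perm (Fin (n + 2)),
        if Glues σ' σ then ∑ c ∈ classes (IsAdmissible σ') ((b : ℤ) - 1),
          contraction h c.out (fun l => incl (y i j l)) else 0 := by
    cases b with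
    | zero =>
      have h0 : ∀ σ' : Equiv.Perm (Fin (n + 2)),
          classes (IsAdmissible σ') (((0 : ℕ) : ℤ) - 1) = ∅ := fun σ' =>
        Finset.eq_empty_of_forall_notMem fun c hc => by
          rw [mem_classes] at hc
          have := hc.1.chi_le
          omega
      simp only [h0, Finset.sum_empty, ite_self, Finset.sum_const_zero, mul_zero]
      exact mul_zero _
    | succ b =>
      have e1 : (((b + 1 : ℕ) : ℤ) - 1) = b := by push_cast; ring
      simp only [hbarMul, bvLaplacian, e1]
      rw [smul_apply, smul_eq_mul, ← mul_assoc, mul_one_div_cancel two_ne_zero,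
        one_mul, sum_apply]
      refine Finset.sum_congr rfl fun i _ => ?_
      rw [sum_apply]
      refine Finset.sum_congr rfl fun j _ => ?_
      rw [smul_apply, smul_eq_mul, sum_apply]
      congr 1
      refine Finset.sum_congr rfl fun σ' _ => ?_
      split_ifs
      · rw [MultilinearMap.curryLeft_apply, MultilinearMap.curryLeft_apply, ribbonSeries_apply]
      · rfl
  rw [hL, bvBracket, ← Finset.sum_add_distrib]
  simp only [gluedContraction_imageTensor h hm, hincl]
  rw [Finset.sum_comm]
  refine Finset.sum_congr rfl fun i _ => ?_
  rw [Finset.sum_comm, ← Finset.sum_add_distrib]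
  refine Finset.sum_congr rfl fun j _ => ?_
  rw [← Finset.mul_sum, ← mul_add, sum_gluesAdmissible, ← Finset.sum_add_distrib]
  congr 1
  refine Finset.sum_congr rfl fun σ' _ => ?_
  by_cases hσ : Glues σ' σ
  swap
  · simp only [if_neg hσ, add_zero]
  simp only [if_pos hσ]
  congr 1
  refine Finset.sum_congr rfl fun I _ => ?_
  by_cases hI : (∀ a, σ' a ∈ I ↔ a ∈ I) ∧ (∀ a, σ' a ∈ Iᶜ ↔ a ∈ Iᶜ) ∧ 0 ∈ I ∧ 1 ∉ I
  swap
  · rw [if_neg hI, dif_neg hI]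
  -- The product over the two components, summed over the distribution of the exponent, is the
  -- corresponding term of the bracket.
  rw [if_pos hI, dif_pos hI, sum_isSplit (fun Γ => contraction h Γ fun l => incl (y i j l))
    (fun Γ Γ' hi => by rw [contraction_congr h hi]) hI.1 hI.2.1, Finset.mul_sum]
  refine Finset.sum_congr rfl fun c _ => ?_
  rw [ribbonSeries_apply, ribbonSeries_apply, Finset.sum_mul_sum, Finset.mul_sum]
  refine Finset.sum_congr rfl fun c₁ _ => ?_
  rw [Finset.mul_sum]
  refine Finset.sum_congr rfl fun c₂ _ => ?_
  rw [contraction_split h hm.incl_mem I _ _ (cons_cons_parity hx)]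
  congr 2
  funext a
  refine Fin.cases rfl (fun a => Fin.cases rfl (fun a => rfl) a) a

/-- The differential of the sum over all ribbon graphs. -/
theorem ribbonSeries_equation [CharZero k] {R : CyclicAInfinity ℬ} {incl : B →ₗ[k] A}
    (hm : IsTreeModel R h incl) (σ : Equiv.Perm (Fin n)) (b : ℕ) {p : Fin n → ZMod 2}
    {x : Fin n → B} (hx : ∀ l, x l ∈ ℬ (p l)) :
    2 * hbarMul (bvLaplacian ℬ R.form (ribbonSeries h incl)) n σ b x +
      bvBracket ℬ R.form (ribbonSeries h incl) (ribbonSeries h incl) n σ b p x =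
    -(2 * ∑ l, sgn k (∑ m with m < l, (p m + 1)) *
      ribbonSeries h incl n σ b (Function.update x l (R.op 1 fun _ => x l))) := by
  have hx' : ∀ l, incl (x l) ∈ 𝒜 (p l) := fun l => hm.incl_mem _ _ (hx l)
  have h1 : ∑ l, sgn k (∑ m with m < l, (p m + 1)) *
      ribbonSeries h incl n σ b (Function.update x l (R.op 1 fun _ => x l)) =
      ∑ c ∈ classes (IsAdmissible σ) (b : ℤ), ∑ e, graphTensor M c.out.flagEquiv
        (Function.update (fun _ => propagator h) e (inverseTensor 𝒜 M.form - imageTensor h))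
        fun l => incl (x l) := by
    simp only [← sum_contraction_d h _ hx', ribbonSeries_apply, Finset.mul_sum]
    rw [Finset.sum_comm]
    refine Finset.sum_congr rfl fun c _ => Finset.sum_congr rfl fun l _ => ?_
    congr 2
    funext m
    by_cases hml : m = l
    · subst hml
      rw [Function.update_self, Function.update_self, hm.op_one]
    · rw [Function.update_of_ne hml, Function.update_of_ne hml]
  -- The tensor at the distinguished edge is split as a difference: the part with `β^∨` cancels in
  -- pairs, and the image part yields the Laplacian and the bracket.
  rw [h1, sum_graphTensor_update h (isEdgeTensor_sub (isEdgeTensor_inverseTensor M.form_odd)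
    (isEdgeTensor_imageTensor h hm)) σ b hx']
  simp only [gluedContraction_sub, Finset.sum_sub_distrib]
  rw [sum_gluedContraction_inverseTensor h σ _ hx', sum_gluedContraction_imageTensor h hm σ b hx,
    zero_sub, neg_neg]

end Image

/-! ### The quadratic term of the differential. -/

section Quadratic

variable {k A B : Type*} [Field k] [NonUnitalRing A] [Module k A]
  [AddCommGroup B] [Module k B]
  {𝒜 : ZMod 2 → Submodule k A} {ℬ : ZMod 2 → Submodule k B} {M : CyclicDGAlgebra 𝒜}
  [DirectSum.Decomposition 𝒜] [FiniteDimensional k A]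
  [DirectSum.Decomposition ℬ] [FiniteDimensional k B]
  {h : Homotopy M} {R : CyclicAInfinity ℬ} {incl : B →ₗ[k] A}

/-- The differential of a cyclic `A∞`-algebra. -/
def CyclicAInfinity.diff (R : CyclicAInfinity ℬ) : B →ₗ[k] B :=
  (MultilinearMap.ofSubsingleton k B B (0 : Fin 1)).symm (R.op 1)

theorem CyclicAInfinity.op_one_eq (R : CyclicAInfinity ℬ) (x : Fin 1 → B) :
    R.op 1 x = R.diff (x 0) := by
  change R.op 1 x = R.op 1 fun _ => x 0
  congr 1
  funext i
  rw [Subsingleton.elim i 0]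

theorem CyclicAInfinity.diff_mem (R : CyclicAInfinity ℬ) {p : ZMod 2} {a : B} (ha : a ∈ ℬ p) :
    R.diff a ∈ ℬ (p + 1) := by
  have h1 : ∑ _i : Fin 1, (p + 1) = p + 1 := by simp
  exact h1 ▸ R.op_mem 1 (fun _ => p) (fun _ => a) fun _ => ha

/-- Inherited from the square-zero differential of `A` through the injective inclusion. -/
theorem IsTreeModel.diff_diff (hm : IsTreeModel R h incl) (a : B) : R.diff (R.diff a) = 0 := by
  apply hm.incl_injective
  have h1 : ∀ b, incl (R.diff b) = M.d (incl b) := fun b => hm.op_one fun _ => b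
  rw [h1, h1, M.d_sq, map_zero]

theorem IsTreeModel.form_diff (hm : IsTreeModel R h incl) {p : ZMod 2} {a : B} (ha : a ∈ ℬ p)
    (b : B) : R.form (R.diff a) b = -(sgn k p * R.form a (R.diff b)) := by
  have h1 : ∀ b, incl (R.diff b) = M.d (incl b) := fun b => hm.op_one fun _ => b
  rw [hm.form_incl, hm.form_incl, h1, h1, eq_neg_iff_add_eq_zero]
  exact M.form_d _ _ _ (hm.incl_mem _ _ ha)

theorem finRotate_two_eq : finRotate 2 = Equiv.swap 0 1 := by decide

/-- The sign in the cyclic tensor depends on the parity of the second letter. The parity operator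
makes it linear, so the formula holds for all vectors. -/
theorem quadraticTerm_two (R : CyclicAInfinity ℬ) (x : Fin 2 → B) :
    quadraticTerm R 2 (finRotate 2) 0 x = -R.form (R.diff (x 0)) (parityOp ℬ (x 1)) := by
  have h1 : quadraticTerm R 2 (finRotate 2) 0 = ∑ i : HomIdx ℬ, ∑ j : HomIdx ℬ,
        cyclicTensor R.form (R.op 1) ![i.1, j.1] ![homBasis ℬ i, homBasis ℬ j] •
          (MultilinearMap.mkPiAlgebra k (Fin 2) k).compLinearMap
            ![(homBasis ℬ).coord i, (homBasis ℬ).coord j] := by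
    simp only [quadraticTerm, if_true]
  rw [h1]
  have h2 : ∀ i j : HomIdx ℬ,
      cyclicTensor R.form (R.op 1) ![i.1, j.1] ![homBasis ℬ i, homBasis ℬ j] =
        -R.form (R.diff (homBasis ℬ i)) (parityOp ℬ (homBasis ℬ j)) := by
    intro i j
    rw [cyclicTensor, R.op_one_eq, parityOp_basis]
    change sgn k (j.1 + 1) * R.form (R.diff (homBasis ℬ i)) (homBasis ℬ j) = _
    rw [sgn_add_one, map_smul, smul_eq_mul, neg_mul]
  rw [sum_apply]
  simp only [sum_apply, smul_apply, h2,
    MultilinearMap.compLinearMap_apply, MultilinearMap.mkPiAlgebra_apply, Fin.prod_univ_two]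
  conv_rhs => rw [← (homBasis ℬ).sum_repr (x 0), ← (homBasis ℬ).sum_repr (x 1)]
  simp only [map_sum, map_smul, LinearMap.sum_apply, LinearMap.smul_apply, smul_eq_mul,
    Finset.mul_sum, ← Finset.sum_neg_distrib]
  rw [Finset.sum_comm]
  refine Finset.sum_congr rfl fun i _ => Finset.sum_congr rfl fun j _ => ?_
  simp only [Matrix.cons_val_zero, Matrix.cons_val_one, Module.Basis.coord_apply]
  ring

theorem quadraticTerm_two_of_mem (R : CyclicAInfinity ℬ) {a b : B} {p : ZMod 2} (hb : b ∈ ℬ p)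
    {x : Fin 2 → B} (h0 : x 0 = a) (h1 : x 1 = b) :
    quadraticTerm R 2 (finRotate 2) 0 x = sgn k (p + 1) * R.form (R.diff a) b := by
  rw [quadraticTerm_two, h0, h1, parityOp_of_mem hb, map_smul, smul_eq_mul, sgn_add_one, neg_mul]

theorem quadraticTerm_eq_cyclicTensor (R : CyclicAInfinity ℬ) {q : Fin 2 → ZMod 2} {y : Fin 2 → B}
    (hy : ∀ i, y i ∈ ℬ (q i)) :
    quadraticTerm R 2 (finRotate 2) 0 y = cyclicTensor R.form (R.op 1) q y := by
  rw [quadraticTerm_two_of_mem R (hy 1) rfl rfl, cyclicTensor, R.op_one_eq]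
  rfl

/-- The support is described by the absence of fixed points, a condition invariant under conjugation
and relabelling; on two letters it singles out `finRotate 2`. -/
theorem quadraticTerm_eq_zero (R : CyclicAInfinity ℬ) {n : ℕ} {σ : Equiv.Perm (Fin n)} {b : ℕ}
    (hne : ¬ (n = 2 ∧ b = 0 ∧ ∀ a, σ a ≠ a)) : quadraticTerm R n σ b = 0 := by
  unfold quadraticTerm
  split
  · refine if_neg fun hσ => hne ⟨rfl, rfl, ?_⟩
    rw [hσ]
    decide
  · rfl

theorem eq_finRotate_two {σ : Equiv.Perm (Fin 2)} (hσ : ∀ a, σ a ≠ a) : σ = finRotate 2 := by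
  revert σ
  decide

theorem quadraticTerm_symmetric (R : CyclicAInfinity ℬ) : IsSymmetric ℬ (quadraticTerm R) := by
  intro n σ τ b p x hx
  by_cases hc : n = 2 ∧ b = 0 ∧ ∀ a, σ a ≠ a
  · obtain ⟨rfl, rfl, hσ⟩ := hc
    obtain rfl := eq_finRotate_two hσ
    have hτ : τ = 1 ∨ τ = Equiv.swap 0 1 := by revert τ; decide
    rcases hτ with rfl | rfl
    · rw [show (fun i => ((1 : Equiv.Perm (Fin 2)) i : ℕ)) = fun i : Fin 2 => (i : ℕ) from rfl,
        koszulSign_self, one_mul]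
      simp
    · have h1 : Equiv.swap 0 1 * finRotate 2 * (Equiv.swap 0 1)⁻¹ = finRotate 2 := by decide
      have hcyc := R.cyclic 1 p x hx
      have h3 : (finRotate (1 + 1)).symm = Equiv.swap 0 1 := by decide
      rw [h3] at hcyc
      rw [h1, quadraticTerm_eq_cyclicTensor R (q := p ∘ Equiv.swap 0 1)
          (y := x ∘ ⇑(Equiv.swap 0 1)⁻¹) (fun i => hx _), quadraticTerm_eq_cyclicTensor R hx, hcyc,
        ← mul_assoc]
      have h4 : koszulSign k (fun i : Fin 2 => (i : ℕ)) (fun i => ((Equiv.swap 0 1 : Equiv.Perm (Fin 2)) i : ℕ))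
          (fun i => p i + 1) = sgn k ((p 1 + 1) * (p 0 + 1)) := by
        unfold koszulSign
        rw [Fintype.prod_prod_type]
        simp [Fin.prod_univ_two, mul_comm]
      rw [h4]
      have h5 : (p (Fin.last 1) + 1) * ∑ i : Fin 1, (p i.castSucc + 1) =
          (p 1 + 1) * (p 0 + 1) := by simp
      rw [h5, sgn_mul_self, one_mul]
      rfl
  · have hc' : ¬ (n = 2 ∧ b = 0 ∧ ∀ a, (τ * σ * τ⁻¹) a ≠ a) := by
      rintro ⟨h1, h2, h3⟩
      refine hc ⟨h1, h2, fun a ha => h3 (τ a) ?_⟩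
      simp [ha]
    rw [quadraticTerm_eq_zero R hc, quadraticTerm_eq_zero R hc']
    simp

theorem quadraticTerm_even (R : CyclicAInfinity ℬ) : IsEven ℬ (quadraticTerm R) := by
  intro n σ b p x hx h0
  by_cases hc : n = 2 ∧ b = 0 ∧ ∀ a, σ a ≠ a
  · obtain ⟨rfl, rfl, hσ⟩ := hc
    obtain rfl := eq_finRotate_two hσ
    rw [Fin.sum_univ_two] at h0
    have h1 : ∀ a b : ZMod 2, a + 1 + (b + 1) ≠ 0 → a + 1 = b := by decide
    have h2 := R.diff_mem (hx 0)
    rw [h1 _ _ h0] at h2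
    rw [quadraticTerm_two_of_mem R (hx 1) rfl rfl, R.form_odd.odd _ _ _ h2 (hx 1), mul_zero]
  · rw [quadraticTerm_eq_zero R hc]; rfl

theorem quadraticTerm_genus (R : CyclicAInfinity ℬ) : HasGenusExpansion (quadraticTerm R) := by
  intro n σ b h0
  by_cases hc : n = 2 ∧ b = 0 ∧ ∀ a, σ a ≠ a
  · obtain ⟨rfl, rfl, hσ⟩ := hc
    refine ⟨two_pos, 0, ?_⟩
    have : numCycles σ = 1 := by
      rw [numCycles, Nat.card_eq_one_iff_exists]
      refine ⟨Quotient.mk _ 0, fun q => ?_⟩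
      induction q using Quotient.inductionOn with | _ a => ?_
      refine Quotient.sound ?_
      have h1 : ∀ a : Fin 2, a = 0 ∨ a = 1 := by decide
      rcases h1 a with rfl | rfl
      · exact Equiv.Perm.SameCycle.refl _ _
      · refine ⟨1, ?_⟩
        rw [zpow_one]
        exact (h1 (σ 1)).resolve_right (hσ 1)
    rw [this]
  · exact absurd (quadraticTerm_eq_zero R hc) h0

/-- Contracting both letters of a two-letter word leaves none, whereas `Glues` requires a remaining
letter on every circle. -/
theorem bvLaplacian_quadraticTerm (R : CyclicAInfinity ℬ) (n : ℕ) (σ : Equiv.Perm (Fin n)) (b : ℕ) :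
    bvLaplacian ℬ R.form (quadraticTerm R) n σ b = 0 := by
  rw [bvLaplacian, Finset.sum_eq_zero, smul_zero]
  intro i _
  refine Finset.sum_eq_zero fun j _ => ?_
  rw [Finset.sum_eq_zero, smul_zero]
  intro σ' _
  split_ifs with hg
  · have hn : 0 < n := by
      obtain ⟨t, l, -⟩ := hg.2 0
      exact l.pos
    rw [quadraticTerm_eq_zero R (by omega)]
    ext
    simp
  · rfl

end Quadratic

/-! ### Relabelling invariance and restriction to subwords. -/

section Signs

variable {k : Type*} [Field k]

theorem koszulSign_eq_prod {F : Type*} [Fintype F] (r s : F → ℕ) (q : F → ZMod 2) :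
    koszulSign k r s q = ∏ x, sgn k (q x * ∑ y with r x < r y ∧ s y < s x, q y) := by
  unfold koszulSign
  rw [Fintype.prod_prod_type]
  refine Finset.prod_congr rfl fun x _ => ?_
  rw [Finset.mul_sum, sgn_sum, Finset.prod_filter]

theorem koszulSign_eq_prod' {F : Type*} [Fintype F] (r s : F → ℕ) (q : F → ZMod 2) :
    koszulSign k r s q = ∏ y, sgn k (q y * ∑ x with r x < r y ∧ s y < s x, q x) := by
  unfold koszulSign
  rw [Fintype.prod_prod_type, Finset.prod_comm]
  refine Finset.prod_congr rfl fun y _ => ?_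
  rw [Finset.mul_sum, sgn_sum, Finset.prod_filter]
  refine Finset.prod_congr rfl fun x _ => ?_
  simp only [mul_comm]

variable {B : Type*} [AddCommGroup B] [Module k B] {ℬ : ZMod 2 → Submodule k B}

theorem IsSymmetric.equiv {T : Series k B} (hT : IsSymmetric ℬ T) {n m : ℕ} (e : Fin n ≃ Fin m)
    (σ : Equiv.Perm (Fin n)) (b : ℕ) {p : Fin n → ZMod 2} {x : Fin n → B}
    (hx : ∀ l, x l ∈ ℬ (p l)) : T m (e.permCongr σ) b (x ∘ e.symm) =
      koszulSign k (fun i : Fin n => (i : ℕ)) (fun i => (e i : ℕ)) (fun i => p i + 1) *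
        T n σ b x := by
  obtain rfl : n = m := by simpa using Fintype.card_congr e
  exact hT n σ e b p x hx

/-- Evaluation on the words with letters in a given set. -/
theorem IsSymmetric.restrict {T : Series k B} (hT : IsSymmetric ℬ T) {n N : ℕ} {κ : Fin n → Fin N}
    (hκ : Function.Injective κ) {J : Finset (Fin N)} (hJ : ∀ a, a ∈ J ↔ ∃ m, κ m = a)
    {σ' : Equiv.Perm (Fin N)} (hs : ∀ a, σ' a ∈ J ↔ a ∈ J) {σ : Equiv.Perm (Fin n)}
    (hσ : ∀ m, σ' (κ m) = κ (σ m)) (b : ℕ) {q : Fin N → ZMod 2} {y : Fin N → B}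
    (hy : ∀ a, y a ∈ ℬ (q a)) : T J.card (restrictPerm σ' J hs) b (restrictWord y J) =
      koszulSign k (fun m : Fin n => (m : ℕ)) (fun m => (κ m : ℕ)) (fun m => q (κ m) + 1) *
        T n σ b (fun m => y (κ m)) := by
  have h1 : ∀ m, ∃ a, J.orderEmbOfFin rfl a = κ m := fun m => by
    have : κ m ∈ Set.range (J.orderEmbOfFin rfl) := by
      rw [Finset.range_orderEmbOfFin]
      exact (hJ _).2 ⟨m, rfl⟩
    exact this
  choose e he using h1
  have hb : Function.Bijective e := by
    constructor
    · intro m m' hm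
      exact hκ (by rw [← he, ← he, hm])
    · intro a
      obtain ⟨m, hm⟩ := (hJ _).1 (J.orderEmbOfFin_mem rfl a)
      exact ⟨m, (J.orderEmbOfFin rfl).injective (by rw [he, hm])⟩
  set e' := Equiv.ofBijective e hb
  have he' : ∀ m, J.orderEmbOfFin rfl (e' m) = κ m := he
  have h2 : restrictPerm σ' J hs = e'.permCongr σ := by
    refine Equiv.ext fun a => (J.orderEmbOfFin rfl).injective ?_
    obtain ⟨m, rfl⟩ := e'.surjective a
    rw [restrictPerm_apply, he', hσ, Equiv.permCongr_apply, Equiv.symm_apply_apply, he']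
  have h3 : restrictWord y J = (fun m => y (κ m)) ∘ e'.symm := by
    funext a
    obtain ⟨m, rfl⟩ := e'.surjective a
    rw [Function.comp_apply, Equiv.symm_apply_apply, restrictWord, he']
  rw [h2, h3, hT.equiv e' σ b (fun m => hy _)]
  congr 1
  refine koszulSign_congr (fun x y => and_congr_right fun _ => ?_) fun _ _ _ _ => rfl
  rw [← he', ← he', Fin.val_fin_lt, Fin.val_fin_lt]
  exact (J.orderEmbOfFin rfl).lt_iff_lt.symm

end Signs

/-! ### Gluing a word of two letters. -/

section CutPerm

variable {n : ℕ}

/-- The two letters to be contracted, followed by the other letters. -/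
def consEquiv (n : ℕ) : Fin 2 ⊕ Fin n ≃ Fin (n + 2) :=
  finSumFinEquiv.trans (finCongr (Nat.add_comm 2 n))

theorem consEquiv_inl_zero : consEquiv n (Sum.inl 0) = 0 := rfl

theorem consEquiv_inl_one : consEquiv n (Sum.inl 1) = 1 := rfl

theorem consEquiv_inr (m : Fin n) : consEquiv n (Sum.inr m) = m.succ.succ := by
  apply Fin.ext
  simp [consEquiv]

/-- The letter `l` and the letter it is multiplied with, followed by the other letters, where the
letter `l` is replaced by the other contracted letter. -/
def pairEquiv (ε : Equiv.Perm (Fin (n + 2))) (l : Fin n) : Fin 2 ⊕ Fin n ≃ Fin (n + 2) :=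
  ((consEquiv n).trans (Equiv.swap 1 l.succ.succ)).trans ε

variable {ε : Equiv.Perm (Fin (n + 2))}

theorem apply_succ_succ (hε : ε = 1 ∨ ε = Equiv.swap 0 1) (m : Fin n) :
    ε m.succ.succ = m.succ.succ := by
  rcases hε with rfl | rfl
  · rfl
  · exact Equiv.swap_apply_of_ne_of_ne (Fin.succ_ne_zero _)
      fun h => Fin.succ_ne_zero m (Fin.succ_injective _ (h.trans Fin.succ_zero_eq_one.symm))

theorem succ_succ_ne_one (m : Fin n) : m.succ.succ ≠ 1 :=
  fun h => Fin.succ_ne_zero m (Fin.succ_injective _ (h.trans Fin.succ_zero_eq_one.symm))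

theorem pairEquiv_inl_zero (ε : Equiv.Perm (Fin (n + 2))) (l : Fin n) :
    pairEquiv ε l (Sum.inl 0) = ε 0 := by
  rw [pairEquiv, Equiv.trans_apply, Equiv.trans_apply, consEquiv_inl_zero,
    Equiv.swap_apply_of_ne_of_ne (by simp) (Fin.succ_ne_zero _).symm]

theorem pairEquiv_inl_one (hε : ε = 1 ∨ ε = Equiv.swap 0 1) (l : Fin n) :
    pairEquiv ε l (Sum.inl 1) = l.succ.succ := by
  rw [pairEquiv, Equiv.trans_apply, Equiv.trans_apply, consEquiv_inl_one, Equiv.swap_apply_left,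
    apply_succ_succ hε]

theorem pairEquiv_inr_self (ε : Equiv.Perm (Fin (n + 2))) (l : Fin n) :
    pairEquiv ε l (Sum.inr l) = ε 1 := by
  rw [pairEquiv, Equiv.trans_apply, Equiv.trans_apply, consEquiv_inr, Equiv.swap_apply_right]

theorem pairEquiv_inr_of_ne (hε : ε = 1 ∨ ε = Equiv.swap 0 1) {l m : Fin n} (hm : m ≠ l) :
    pairEquiv ε l (Sum.inr m) = m.succ.succ := by
  rw [pairEquiv, Equiv.trans_apply, Equiv.trans_apply, consEquiv_inr,
    Equiv.swap_apply_of_ne_of_ne (succ_succ_ne_one m) fun h =>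
      hm (Fin.succ_injective _ (Fin.succ_injective _ h)), apply_succ_succ hε]

/-- The circle with the letter `l` and a contracted letter, together with circles as in `σ` where
the letter `l` is replaced by the other contracted letter. -/
def pairPerm (ε : Equiv.Perm (Fin (n + 2))) (l : Fin n) (σ : Equiv.Perm (Fin n)) :
    Equiv.Perm (Fin (n + 2)) :=
  (pairEquiv ε l).permCongr (Equiv.sumCongr (Equiv.swap 0 1) σ)

theorem pairPerm_inl (ε : Equiv.Perm (Fin (n + 2))) (l : Fin n) (σ : Equiv.Perm (Fin n))
    (z : Fin 2) : pairPerm ε l σ (pairEquiv ε l (Sum.inl z)) =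
      pairEquiv ε l (Sum.inl (Equiv.swap 0 1 z)) := by
  rw [pairPerm, Equiv.permCongr_apply, Equiv.symm_apply_apply]; rfl

theorem pairPerm_inr (ε : Equiv.Perm (Fin (n + 2))) (l : Fin n) (σ : Equiv.Perm (Fin n))
    (m : Fin n) : pairPerm ε l σ (pairEquiv ε l (Sum.inr m)) =
      pairEquiv ε l (Sum.inr (σ m)) := by
  rw [pairPerm, Equiv.permCongr_apply, Equiv.symm_apply_apply]; rfl

theorem glues_pairPerm_one (l : Fin n) (σ : Equiv.Perm (Fin n)) : Glues (pairPerm 1 l σ) σ := by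
  have hε : (1 : Equiv.Perm (Fin (n + 2))) = 1 ∨ (1 : Equiv.Perm (Fin (n + 2))) = Equiv.swap 0 1 :=
    Or.inl rfl
  -- After gluing, `1` leads to the letter `l`, and `0` leads to the successor of `l`. That
  -- successor is `1` itself if `σ` fixes `l`, hence the heights 2 for `0` and 1 for `1`.
  set c : Fin (n + 2) → Fin n := Fin.cons (σ l) (Fin.cons l id) with hc
  set t : Fin (n + 2) → ℕ := Fin.cons 2 (Fin.cons 1 fun _ => 0) with ht
  have c0 : c 0 = σ l := rfl
  have c1 : c 1 = l := rfl
  have c2 : ∀ m : Fin n, c m.succ.succ = m := fun m => rfl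
  have t0 : t 0 = 2 := rfl
  have t1 : t 1 = 1 := rfl
  have t2 : ∀ m : Fin n, t m.succ.succ = 0 := fun m => rfl
  have hcκ : ∀ m, c (pairEquiv 1 l (Sum.inr m)) = m := by
    intro m
    by_cases hm : m = l
    · rw [hm, pairEquiv_inr_self]; rfl
    · rw [pairEquiv_inr_of_ne hε hm]; rfl
  have htκ : ∀ m, t (pairEquiv 1 l (Sum.inr m)) ≤ 1 := by
    intro m
    by_cases hm : m = l
    · rw [hm, pairEquiv_inr_self]; exact t1.le
    · rw [pairEquiv_inr_of_ne hε hm, t2]; exact zero_le_one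
  have e0 : (pairPerm 1 l σ * Equiv.swap 0 1 : Equiv.Perm (Fin (n + 2))) 0 = pairEquiv 1 l (Sum.inr (σ l)) := by
    rw [Equiv.Perm.mul_apply, Equiv.swap_apply_left, ← pairPerm_inr, pairEquiv_inr_self]; rfl
  have e1 : (pairPerm 1 l σ * Equiv.swap 0 1 : Equiv.Perm (Fin (n + 2))) 1 = l.succ.succ := by
    rw [Equiv.Perm.mul_apply, Equiv.swap_apply_right, ← pairEquiv_inl_one hε l]
    exact (congrArg _ (pairEquiv_inl_zero 1 l).symm).trans (pairPerm_inl 1 l σ 0)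
  have e2 : ∀ m : Fin n, (pairPerm 1 l σ * Equiv.swap 0 1 : Equiv.Perm (Fin (n + 2))) m.succ.succ =
      pairPerm 1 l σ m.succ.succ := fun m => by
    rw [Equiv.Perm.mul_apply, Equiv.swap_apply_of_ne_of_ne (Fin.succ_ne_zero _)
      (succ_succ_ne_one m)]
  refine BoundaryCert.isBoundary (c := c) (t := t) ⟨c2, fun f hf => ?_, fun f hf => ?_, fun m => ?_⟩
  · revert hf
    refine Fin.cases (fun _ => ?_) (fun f => Fin.cases (fun _ => ?_) (fun m hm => ?_) f) f
    · rw [e0, hcκ, c0]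
    · rw [Fin.succ_zero_eq_one, e1, c1, c2]
    · exact absurd rfl (hm m)
  · revert hf
    refine Fin.cases (fun _ => ?_) (fun f => Fin.cases (fun _ => ?_) (fun m hm => ?_) f) f
    · rw [e0, t0]; exact (htκ _).trans_lt one_lt_two
    · rw [Fin.succ_zero_eq_one, e1, t1, t2]; exact zero_lt_one
    · exact absurd rfl (hm m)
  · rw [e2]
    by_cases hm : m = l
    · rw [hm, ← pairEquiv_inl_one hε l, pairPerm_inl, Equiv.swap_apply_right, pairEquiv_inl_zero]
      rfl
    · rw [← pairEquiv_inr_of_ne hε hm, pairPerm_inr, hcκ]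

theorem glues_swap {σ' : Equiv.Perm (Fin (n + 2))} {σ : Equiv.Perm (Fin n)} (h : Glues σ' σ) :
    Glues (Equiv.swap 0 1 * σ' * (Equiv.swap 0 1)⁻¹) σ := by
  have := IsBoundary.conj h (φ' := Equiv.swap 0 1 * σ' * (Equiv.swap 0 1)⁻¹ * Equiv.swap 0 1)
    (leg' := fun l : Fin n => l.succ.succ) 1 (Equiv.swap 0 1)
    (fun f => by simp [Equiv.Perm.mul_apply]) fun m => apply_succ_succ (Or.inr rfl) m
  rwa [one_mul, inv_one, mul_one] at this

theorem pairPerm_eq_conj (ε : Equiv.Perm (Fin (n + 2))) (l : Fin n) (σ : Equiv.Perm (Fin n)) :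
    pairPerm ε l σ = ε * pairPerm 1 l σ * ε⁻¹ := by
  refine Equiv.ext fun a => ?_
  obtain ⟨a, rfl⟩ := ε.surjective a
  obtain ⟨z, rfl⟩ := (pairEquiv 1 l).surjective a
  have h1 : ∀ z, ε (pairEquiv 1 l z) = pairEquiv ε l z := fun z => rfl
  rw [Equiv.Perm.mul_apply, Equiv.Perm.mul_apply, show ε⁻¹ (ε (pairEquiv 1 l z)) = pairEquiv 1 l z from
    ε.symm_apply_apply _, h1]
  simp only [pairPerm, Equiv.permCongr_apply, Equiv.symm_apply_apply, h1]

theorem glues_pairPerm (hε : ε = 1 ∨ ε = Equiv.swap 0 1) (l : Fin n) (σ : Equiv.Perm (Fin n)) :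
    Glues (pairPerm ε l σ) σ := by
  rcases hε with rfl | rfl
  · exact glues_pairPerm_one l σ
  · rw [pairPerm_eq_conj]
    exact glues_swap (glues_pairPerm_one l σ)

/-- The circle through `ε 0` and the letter `l` is stable, so `σ'` splits into it and some
permutation of the other letters. Gluing has a unique result, and that permutation must be `σ`. -/
theorem eq_pairPerm (hε : ε = 1 ∨ ε = Equiv.swap 0 1) {σ' : Equiv.Perm (Fin (n + 2))}
    {σ : Equiv.Perm (Fin n)} (h : Glues σ' σ) {l : Fin n} (h0 : σ' (ε 0) = l.succ.succ)
    (h1 : σ' l.succ.succ = ε 0) : σ' = pairPerm ε l σ := by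
  have hmem := Equiv.Perm.mem_sumCongrHom_range_of_perm_mapsTo_inl
    (σ := (pairEquiv ε l).symm.permCongr σ') ?_
  · obtain ⟨⟨a, σ₂⟩, ha⟩ := hmem
    have ha' : Equiv.sumCongr a σ₂ = (pairEquiv ε l).symm.permCongr σ' := ha
    have hs : σ' = (pairEquiv ε l).permCongr (Equiv.sumCongr a σ₂) := by
      rw [ha']; ext; simp
    have ha0 : a 0 = 1 := by
      have h2 := congrArg (fun τ => τ (pairEquiv ε l (Sum.inl 0))) hs
      simp only [Equiv.permCongr_apply, Equiv.symm_apply_apply] at h2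
      rw [pairEquiv_inl_zero, h0, ← pairEquiv_inl_one hε l] at h2
      exact (Sum.inl_injective ((pairEquiv ε l).injective h2)).symm
    obtain rfl : a = Equiv.swap 0 1 := by
      revert ha0; clear * -; revert a; decide
    have h3 : Glues σ' σ₂ := by
      rw [hs]; exact glues_pairPerm hε l σ₂
    have hinj : Function.Injective fun l : Fin n => l.succ.succ :=
      (Fin.succ_injective _).comp (Fin.succ_injective _)
    rw [IsBoundary.unique hinj h h3]
    exact hs
  · rintro _ ⟨z, rfl⟩
    have hz : ∀ z : Fin 2, z = 0 ∨ z = 1 := by decide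
    rcases hz z with rfl | rfl
    · refine ⟨1, ?_⟩
      rw [Equiv.permCongr_apply, Equiv.symm_symm, pairEquiv_inl_zero, h0,
        ← pairEquiv_inl_one hε l, Equiv.symm_apply_apply]
    · refine ⟨0, ?_⟩
      rw [Equiv.permCongr_apply, Equiv.symm_symm, pairEquiv_inl_one hε, h1,
        ← pairEquiv_inl_zero ε l, Equiv.symm_apply_apply]

/-- Finds every term of a bracket in which the quadratic factor can be nonzero: its letters are the
contracted letter `ε 0` and one letter `l`. The identity serves for the quadratic term as first
argument of the bracket, the swap for it as second. -/
theorem exists_eq_pairPerm (hε : ε = 1 ∨ ε = Equiv.swap 0 1) {σ' : Equiv.Perm (Fin (n + 2))}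
    {σ : Equiv.Perm (Fin n)} (h : Glues σ' σ) {J : Finset (Fin (n + 2))}
    (hJ : ∀ a, σ' a ∈ J ↔ a ∈ J) (h0 : ε 0 ∈ J) (h1 : ε 1 ∉ J) (h2 : J.card = 2)
    (hne : ∀ a, restrictPerm σ' J hJ a ≠ a) :
    ∃ l : Fin n, (pairPerm ε l σ, ({ε 0, l.succ.succ} : Finset (Fin (n + 2)))) = (σ', J) := by
  have hfix : ∀ a ∈ J, σ' a ≠ a := by
    intro a ha hfa
    have hr : a ∈ Set.range (J.orderEmbOfFin rfl) := by
      rw [Finset.range_orderEmbOfFin]; exact ha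
    obtain ⟨a, rfl⟩ := hr
    rw [← restrictPerm_apply σ' J hJ] at hfa
    exact hne a ((J.orderEmbOfFin rfl).injective hfa)
  have hJ2 : J = {ε 0, σ' (ε 0)} := by
    symm
    refine Finset.eq_of_subset_of_card_le ?_ ?_
    · intro a ha
      rw [Finset.mem_insert, Finset.mem_singleton] at ha
      rcases ha with rfl | rfl
      · exact h0
      · exact (hJ _).2 h0
    · rw [h2, Finset.card_pair (hfix _ h0).symm]
  have hl : ∃ l : Fin n, σ' (ε 0) = l.succ.succ := by
    have e0 : σ' (ε 0) ≠ ε 0 := hfix _ h0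
    have e1 : σ' (ε 0) ≠ ε 1 := fun he => h1 (he ▸ (hJ _).2 h0)
    obtain ⟨l | l, hz⟩ := ((consEquiv n).trans ε).surjective (σ' (ε 0))
    · have hz2 : ∀ z : Fin 2, z = 0 ∨ z = 1 := by decide
      rcases hz2 l with rfl | rfl
      · exact absurd hz.symm e0
      · exact absurd hz.symm e1
    · refine ⟨l, ?_⟩
      rw [← hz, Equiv.trans_apply, consEquiv_inr, apply_succ_succ hε]
  obtain ⟨l, hl⟩ := hl
  rw [hl] at hJ2
  have hl1 : σ' l.succ.succ = ε 0 := by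
    have hlJ : l.succ.succ ∈ J := by rw [hJ2]; simp
    have h3 := (hJ _).2 hlJ
    rw [hJ2, Finset.mem_insert, Finset.mem_singleton] at h3
    exact h3.resolve_right (hfix _ hlJ)
  exact ⟨l, Prod.ext (eq_pairPerm hε h hl hl1).symm hJ2.symm⟩

theorem mem_pair_iff (hε : ε = 1 ∨ ε = Equiv.swap 0 1) (l : Fin n) (a : Fin (n + 2)) :
    a ∈ ({ε 0, l.succ.succ} : Finset (Fin (n + 2))) ↔ ∃ z, pairEquiv ε l (Sum.inl z) = a := by
  rw [Finset.mem_insert, Finset.mem_singleton, Fin.exists_fin_two, pairEquiv_inl_zero,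
    pairEquiv_inl_one hε]
  exact or_congr eq_comm eq_comm

theorem notMem_pair_iff (hε : ε = 1 ∨ ε = Equiv.swap 0 1) (l : Fin n) (a : Fin (n + 2)) :
    a ∉ ({ε 0, l.succ.succ} : Finset (Fin (n + 2))) ↔ ∃ m, pairEquiv ε l (Sum.inr m) = a := by
  rw [mem_pair_iff hε]
  obtain ⟨z | m, rfl⟩ := (pairEquiv ε l).surjective a
  · exact iff_of_false (fun h => h ⟨z, rfl⟩)
      fun ⟨m, hm⟩ => Sum.inr_ne_inl ((pairEquiv ε l).injective hm)
  · exact iff_of_true (fun ⟨z, hz⟩ => Sum.inl_ne_inr ((pairEquiv ε l).injective hz)) ⟨m, rfl⟩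

theorem pairPerm_mem_iff (hε : ε = 1 ∨ ε = Equiv.swap 0 1) (l : Fin n) (σ : Equiv.Perm (Fin n))
    (a : Fin (n + 2)) : pairPerm ε l σ a ∈ ({ε 0, l.succ.succ} : Finset (Fin (n + 2))) ↔
      a ∈ ({ε 0, l.succ.succ} : Finset (Fin (n + 2))) := by
  obtain ⟨z | m, rfl⟩ := (pairEquiv ε l).surjective a
  · rw [pairPerm_inl, mem_pair_iff hε, mem_pair_iff hε]
    exact iff_of_true ⟨_, rfl⟩ ⟨_, rfl⟩
  · rw [pairPerm_inr]
    exact iff_of_false ((notMem_pair_iff hε _ _).2 ⟨_, rfl⟩) ((notMem_pair_iff hε _ _).2 ⟨_, rfl⟩)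

theorem pair_injective (hε : ε = 1 ∨ ε = Equiv.swap 0 1) {l m : Fin n}
    (h : ({ε 0, l.succ.succ} : Finset (Fin (n + 2))) = {ε 0, m.succ.succ}) : l = m := by
  have h1 : l.succ.succ ∈ ({ε 0, m.succ.succ} : Finset (Fin (n + 2))) := by rw [← h]; simp
  rw [Finset.mem_insert, Finset.mem_singleton] at h1
  refine Fin.succ_injective _ (Fin.succ_injective _ (h1.resolve_left fun h2 => ?_))
  rw [← apply_succ_succ hε] at h2
  exact Fin.succ_ne_zero _ (ε.injective h2)

end CutPerm

/-! ### Koszul signs for the brackets with the quadratic term. -/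

section PairSigns

variable {k : Type*} [Field k] {n : ℕ} {ε : Equiv.Perm (Fin (n + 2))}

theorem sum_filter_succ_succ {N : Type*} [AddCommMonoid N] (P : Fin (n + 2) → Prop)
    [DecidablePred P] (f : Fin (n + 2) → N) :
    ∑ a with P a, f a = (if P 0 then f 0 else 0) + ((if P 1 then f 1 else 0) +
      ∑ m : Fin n with P m.succ.succ, f m.succ.succ) := by
  rw [Finset.sum_filter, Fin.sum_univ_succ, Fin.sum_univ_succ, Finset.sum_filter,
    Fin.succ_zero_eq_one]

theorem apply_one_lt (hε : ε = 1 ∨ ε = Equiv.swap 0 1) (m : Fin n) : ε 1 < m.succ.succ := by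
  rcases hε with rfl | rfl
  · rw [Fin.lt_def]; simp
  · rw [Equiv.swap_apply_right]; exact Fin.succ_pos _

theorem koszulSign_pairEquiv_inl (hε : ε = 1 ∨ ε = Equiv.swap 0 1) (l : Fin n)
    (q : Fin 2 → ZMod 2) : koszulSign k (fun z : Fin 2 => (z : ℕ))
      (fun z => (pairEquiv ε l (Sum.inl z) : ℕ)) q = 1 := by
  refine koszulSign_eq_one fun x y hxy h => ?_
  have h2 : ∀ x y : Fin 2, (x : ℕ) < y → x = 0 ∧ y = 1 := by decide
  obtain ⟨rfl, rfl⟩ := h2 x y hxy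
  rw [pairEquiv_inl_zero, pairEquiv_inl_one hε] at h
  have h3 : ε 0 < l.succ.succ := by
    rcases hε with rfl | rfl
    · exact Fin.succ_pos _
    · rw [Equiv.swap_apply_left, Fin.lt_def]; simp
  exact absurd h (Fin.lt_def.1 h3).not_gt

/-- The only displaced letter is the contracted letter `ε 1`, which stands in front and is brought
to place `l`. -/
theorem koszulSign_pairEquiv_inr (hε : ε = 1 ∨ ε = Equiv.swap 0 1) (l : Fin n)
    (q : Fin n → ZMod 2) : koszulSign k (fun m : Fin n => (m : ℕ))
      (fun m => (pairEquiv ε l (Sum.inr m) : ℕ)) q = sgn k (q l * ∑ m with m < l, q m) := by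
  have hlt : ∀ x y : Fin n, ((x : ℕ) < y ∧ (pairEquiv ε l (Sum.inr y) : ℕ) <
      pairEquiv ε l (Sum.inr x)) ↔ (y = l ∧ x < l) := by
    intro x y
    by_cases hy : y = l
    · subst hy
      rw [pairEquiv_inr_self]
      constructor
      · exact fun h => ⟨rfl, h.1⟩
      · rintro ⟨-, h⟩
        rw [pairEquiv_inr_of_ne hε h.ne]
        exact ⟨h, apply_one_lt hε x⟩
    · refine iff_of_false (fun h => ?_) fun h => hy h.1
      rw [pairEquiv_inr_of_ne hε hy] at h
      by_cases hx : x = l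
      · rw [hx, pairEquiv_inr_self] at h
        exact absurd h.2 (apply_one_lt hε y).le.not_gt
      · rw [pairEquiv_inr_of_ne hε hx] at h
        simp only [Fin.val_succ] at h
        omega
  rw [koszulSign_eq_prod']
  simp only [hlt]
  rw [Finset.prod_eq_single l]
  · simp
  · intro y _ hy
    simp [hy, sgn_zero]
  · exact fun h => absurd (Finset.mem_univ _) h

/-- To reach the front behind `0`, the letter `l` passes the contracted letter `1` and all letters
before it. -/
theorem koszulSign_front_zero (l : Fin n) (q : Fin (n + 2) → ZMod 2) :
    koszulSign k (fun a : Fin (n + 2) => (a : ℕ))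
      (fun a => if a ∈ ({0, l.succ.succ} : Finset (Fin (n + 2))) then (a : ℕ) else a + (n + 2)) q =
      sgn k (q l.succ.succ * (q 1 + ∑ m with m < l, q m.succ.succ)) := by
  have hlt : ∀ x y : Fin (n + 2), ((x : ℕ) < y ∧
      (if y ∈ ({0, l.succ.succ} : Finset (Fin (n + 2))) then (y : ℕ) else y + (n + 2)) <
      if x ∈ ({0, l.succ.succ} : Finset (Fin (n + 2))) then (x : ℕ) else x + (n + 2)) ↔
      (y = l.succ.succ ∧ x ≠ 0 ∧ x < l.succ.succ) := by
    intro x y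
    have hx := x.2
    have hy := y.2
    simp only [Finset.mem_insert, Finset.mem_singleton, Fin.ext_iff, Fin.lt_def, Fin.val_succ,
      Fin.val_zero, Ne]
    split_ifs <;> omega
  rw [koszulSign_eq_prod']
  simp only [hlt]
  rw [Finset.prod_eq_single l.succ.succ]
  · congr 2
    simp only [true_and]
    rw [sum_filter_succ_succ, if_neg (by simp), if_pos ⟨by simp, by simp [Fin.lt_def]⟩, zero_add]
    congr 1
    refine Finset.sum_congr (Finset.ext fun m => ?_) fun _ _ => rfl
    simp
  · intro y _ hy
    simp [hy, sgn_zero]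
  · exact fun h => absurd (Finset.mem_univ _) h

/-- The pair moves to the back: `1` passes all letters other than `l`, and `l` passes the letters
after it. -/
theorem koszulSign_front_one (l : Fin n) (q : Fin (n + 2) → ZMod 2) :
    koszulSign k (fun a : Fin (n + 2) => (a : ℕ))
      (fun a => if a ∈ ({1, l.succ.succ} : Finset (Fin (n + 2)))ᶜ then (a : ℕ) else a + (n + 2)) q =
      sgn k (q 1 * ∑ m with m ≠ l, q m.succ.succ) *
        sgn k (q l.succ.succ * ∑ m with l < m, q m.succ.succ) := by
  have hlt : ∀ x y : Fin (n + 2), ((x : ℕ) < y ∧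
      (if y ∈ ({1, l.succ.succ} : Finset (Fin (n + 2)))ᶜ then (y : ℕ) else y + (n + 2)) <
      if x ∈ ({1, l.succ.succ} : Finset (Fin (n + 2)))ᶜ then (x : ℕ) else x + (n + 2)) ↔
      (x = 1 ∧ 1 < y ∧ y ≠ l.succ.succ) ∨ (x = l.succ.succ ∧ l.succ.succ < y) := by
    intro x y
    have hx := x.2
    have hy := y.2
    simp only [Finset.mem_compl, Finset.mem_insert, Finset.mem_singleton, Fin.ext_iff, Fin.lt_def,
      Fin.val_succ, Fin.val_one, Ne]
    split_ifs <;> omega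
  rw [koszulSign_eq_prod]
  simp only [hlt]
  have hne : (1 : Fin (n + 2)) ≠ l.succ.succ := (succ_succ_ne_one l).symm
  rw [Fintype.prod_eq_mul 1 l.succ.succ hne]
  · congr 3
    · simp only [true_and, hne, false_and, or_false]
      rw [sum_filter_succ_succ, if_neg (by simp), if_neg (by simp), zero_add, zero_add]
      refine Finset.sum_congr (Finset.ext fun m => ?_) fun _ _ => rfl
      simp [Fin.lt_def]
    · simp only [true_and, hne.symm, false_and, false_or]
      rw [sum_filter_succ_succ, if_neg (by simp), if_neg (by simp [Fin.lt_def]), zero_add, zero_add]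
      refine Finset.sum_congr (Finset.ext fun m => ?_) fun _ _ => rfl
      simp
  · rintro x ⟨h1, h2⟩
    simp [h1, h2, sgn_zero]

end PairSigns

/-! ### Evaluation of the factors of a bracket with the quadratic term. -/

section Bracket

variable {k A B : Type*} [Field k] [NonUnitalRing A] [Module k A]
  [AddCommGroup B] [Module k B]
  {𝒜 : ZMod 2 → Submodule k A} {ℬ : ZMod 2 → Submodule k B} {M : CyclicDGAlgebra 𝒜}
  [DirectSum.Decomposition 𝒜] [FiniteDimensional k A]
  [DirectSum.Decomposition ℬ] [FiniteDimensional k B]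
  {h : Homotopy M} {R : CyclicAInfinity ℬ} {incl : B →ₗ[k] A} {n : ℕ}
  {ε : Equiv.Perm (Fin (n + 2))}

theorem quadraticTerm_restrict (hε : ε = 1 ∨ ε = Equiv.swap 0 1) (l : Fin n)
    (σ : Equiv.Perm (Fin n)) {J : Finset (Fin (n + 2))} (hJ : J = {ε 0, l.succ.succ})
    (hs : ∀ a, pairPerm ε l σ a ∈ J ↔ a ∈ J) {q : Fin (n + 2) → ZMod 2} {y : Fin (n + 2) → B}
    (hy : ∀ a, y a ∈ ℬ (q a)) :
    quadraticTerm R J.card (restrictPerm (pairPerm ε l σ) J hs) 0 (restrictWord y J) =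
      sgn k (q l.succ.succ + 1) * R.form (R.diff (y (ε 0))) (y l.succ.succ) := by
  rw [(quadraticTerm_symmetric R).restrict
    (κ := fun z => pairEquiv ε l (Sum.inl z)) ((pairEquiv ε l).injective.comp Sum.inl_injective)
    (fun a => by rw [hJ, mem_pair_iff hε]) hs (σ := finRotate 2)
    (fun m => by rw [pairPerm_inl, finRotate_two_eq]) 0 hy, koszulSign_pairEquiv_inl hε, one_mul]
  exact quadraticTerm_two_of_mem R (hy _) (by rw [pairEquiv_inl_zero])
    (by rw [pairEquiv_inl_one hε])

theorem restrict_complement {T : Series k B} (hT : IsSymmetric ℬ T)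
    (hε : ε = 1 ∨ ε = Equiv.swap 0 1) (l : Fin n)
    (σ : Equiv.Perm (Fin n)) {J : Finset (Fin (n + 2))}
    (hJ : ∀ a, a ∈ J ↔ a ∉ ({ε 0, l.succ.succ} : Finset (Fin (n + 2))))
    (hs : ∀ a, pairPerm ε l σ a ∈ J ↔ a ∈ J) (b : ℕ) {u : B} {r : ZMod 2} (hu : u ∈ ℬ r)
    {p : Fin n → ZMod 2} {x : Fin n → B} (hx : ∀ m, x m ∈ ℬ (p m)) {y : Fin (n + 2) → B}
    {q : Fin (n + 2) → ZMod 2} (hy : ∀ a, y a ∈ ℬ (q a))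
    (hyu : y (ε 1) = u) (hqu : q (ε 1) = r) (hyx : ∀ m : Fin n, y m.succ.succ = x m)
    (hqp : ∀ m : Fin n, q m.succ.succ = p m) :
    T J.card (restrictPerm (pairPerm ε l σ) J hs) b (restrictWord y J) =
      sgn k ((r + 1) * ∑ m with m < l, (p m + 1)) * T n σ b (Function.update x l u) := by
  rw [hT.restrict (κ := fun z => pairEquiv ε l (Sum.inr z))
    ((pairEquiv ε l).injective.comp Sum.inr_injective)
    (fun a => by rw [hJ, notMem_pair_iff hε]) hs (σ := σ)
    (fun m => by rw [pairPerm_inr]) b hy, koszulSign_pairEquiv_inr hε]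
  congr 2
  · rw [pairEquiv_inr_self, hqu]
    congr 1
    refine Finset.sum_congr rfl fun m hm => ?_
    rw [pairEquiv_inr_of_ne hε (Finset.mem_filter.1 hm).2.ne, hqp]
  · congr 1
    funext m
    by_cases hm : m = l
    · subst hm
      rw [pairEquiv_inr_self, Function.update_self, hyu]
    · rw [pairEquiv_inr_of_ne hε hm, Function.update_of_ne hm, hyx]

end Bracket

/-! ### Brackets with the quadratic term as the action of the differential. -/

section Bracket

variable {k A B : Type*} [Field k] [NonUnitalRing A] [Module k A]
  [AddCommGroup B] [Module k B]
  {𝒜 : ZMod 2 → Submodule k A} {ℬ : ZMod 2 → Submodule k B} {M : CyclicDGAlgebra 𝒜}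
  [DirectSum.Decomposition 𝒜] [FiniteDimensional k A]
  [DirectSum.Decomposition ℬ] [FiniteDimensional k B]
  {h : Homotopy M} {R : CyclicAInfinity ℬ} {incl : B →ₗ[k] A} {n : ℕ}

theorem sum_inverseTensor_update {T : Series k B} (σ : Equiv.Perm (Fin n)) (b : ℕ) (x : Fin n → B)
    (l : Fin n) (a : B) :
    ∑ i, ∑ j, inverseTensor ℬ R.form i j * (R.form (homBasis ℬ i) a *
        T n σ b (Function.update x l (homBasis ℬ j))) = T n σ b (Function.update x l a) := by
  have := inverseTensor_expand R.form_odd ((T n σ b).toLinearMap x l) a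
  simpa only [smul_eq_mul, MultilinearMap.toLinearMap_apply, mul_assoc] using this

theorem form_eq_zero (R : CyclicAInfinity ℬ) {p q : ZMod 2} {a b : B} (ha : a ∈ ℬ p) (hb : b ∈ ℬ q)
    (hpq : p = q) : R.form a b = 0 := R.form_odd.odd p a b ha (hpq ▸ hb)

/-- The nonzero terms correspond to the letters `l`. In each of them the contraction with `β^∨` is
the expansion of the differential of `x l`, which takes the place of `x l` in `T`. -/
theorem bvBracket_quadraticTerm_left [CharZero k] (hm : IsTreeModel R h incl) {T : Series k B}
    (hT : IsSymmetric ℬ T) (σ : Equiv.Perm (Fin n)) (b : ℕ) {p : Fin n → ZMod 2} {x : Fin n → B}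
    (hx : ∀ l, x l ∈ ℬ (p l)) :
    bvBracket ℬ R.form (quadraticTerm R) T n σ b p x =
      ∑ l, sgn k (∑ m with m < l, (p m + 1)) *
        T n σ b (Function.update x l (R.diff (x l))) := by
  classical
  have hε : (1 : Equiv.Perm (Fin (n + 2))) = 1 ∨ (1 : Equiv.Perm (Fin (n + 2))) = Equiv.swap 0 1 :=
    Or.inl rfl
  simp only [← sum_inverseTensor_update (R := R) (T := T) σ b x _ (R.diff _), Finset.mul_sum]
  rw [Finset.sum_comm]
  unfold bvBracket
  refine Finset.sum_congr rfl fun i _ => ?_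
  rw [Finset.sum_comm]
  refine Finset.sum_congr rfl fun j _ => ?_
  by_cases hij : inverseTensor ℬ R.form i j = 0
  · simp [hij]
  have hij' : i.1 ≠ j.1 := fun he => hij (inverseTensor_parity R.form_odd he)
  simp only [mul_left_comm _ (inverseTensor ℬ R.form i j)]
  rw [← Finset.mul_sum]
  congr 1
  set y : Fin (n + 2) → B := Fin.cons (homBasis ℬ i) (Fin.cons (homBasis ℬ j) x) with hy
  set q : Fin (n + 2) → ZMod 2 := Fin.cons i.1 (Fin.cons j.1 p) with hq
  have hyq : ∀ a, y a ∈ ℬ (q a) := cons_cons_parity hx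
  have hyx : ∀ m : Fin n, y m.succ.succ = x m := fun m => rfl
  have hqp : ∀ m : Fin n, q m.succ.succ = p m := fun m => rfl
  have hsign : (Fin.cons (i.1 + 1) (Fin.cons (j.1 + 1) fun l => p l + 1) : Fin (n + 2) → ZMod 2) =
      fun a => q a + 1 := by
    funext a
    refine Fin.cases rfl (fun a => Fin.cases rfl (fun a => rfl) a) a
  simp only [hsign]
  -- The double sum is rewritten as one sum over pairs `(σ', I)`, into which the letters `l` embed;
  -- outside their image the quadratic factor vanishes.
  set F : Equiv.Perm (Fin (n + 2)) × Finset (Fin (n + 2)) → k := fun z =>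
    if Glues z.1 σ then
      if hI : (∀ a, z.1 a ∈ z.2 ↔ a ∈ z.2) ∧ (∀ a, z.1 a ∈ z.2ᶜ ↔ a ∈ z.2ᶜ) ∧ 0 ∈ z.2 ∧ 1 ∉ z.2 then
        koszulSign k (fun a : Fin (n + 2) => (a : ℕ))
          (fun a => if a ∈ z.2 then (a : ℕ) else a + (n + 2)) (fun a => q a + 1) *
        ∑ c ∈ Finset.range (b + 1),
          quadraticTerm R _ (restrictPerm z.1 z.2 hI.1) c (restrictWord y z.2) *
          T _ (restrictPerm z.1 z.2ᶜ hI.2.1) (b - c) (restrictWord y z.2ᶜ)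
      else 0
    else 0 with hF
  have hsum : (∑ σ' : Equiv.Perm (Fin (n + 2)), if Glues σ' σ then
      ∑ I : Finset (Fin (n + 2)),
        if hI : (∀ a, σ' a ∈ I ↔ a ∈ I) ∧ (∀ a, σ' a ∈ Iᶜ ↔ a ∈ Iᶜ) ∧ 0 ∈ I ∧ 1 ∉ I then
          koszulSign k (fun a : Fin (n + 2) => (a : ℕ))
            (fun a => if a ∈ I then (a : ℕ) else a + (n + 2)) (fun a => q a + 1) *
          ∑ c ∈ Finset.range (b + 1),
            quadraticTerm R _ (restrictPerm σ' I hI.1) c (restrictWord y I) *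
            T _ (restrictPerm σ' Iᶜ hI.2.1) (b - c) (restrictWord y Iᶜ)
        else 0
      else 0) = ∑ z, F z := by
    rw [Fintype.sum_prod_type]
    refine Finset.sum_congr rfl fun σ' _ => ?_
    simp only [hF]
    split_ifs
    · rfl
    · rw [Finset.sum_const_zero]
  rw [hsum]
  symm
  refine Fintype.sum_of_injective (fun l : Fin n => (pairPerm 1 l σ,
    ({(1 : Equiv.Perm (Fin (n + 2))) 0, l.succ.succ} : Finset (Fin (n + 2)))))
    (fun l m hlm => pair_injective hε (Prod.ext_iff.1 hlm).2) _ _ ?_ ?_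
  · rintro ⟨σ', I⟩ hz
    simp only [hF]
    split_ifs with hg hI
    · rw [Finset.sum_eq_zero, mul_zero]
      intro c _
      rw [quadraticTerm_eq_zero R, zero_apply, zero_mul]
      rintro ⟨h2, -, hne⟩
      exact hz (exists_eq_pairPerm hε hg hI.1 hI.2.2.1 hI.2.2.2 h2 hne)
    · rfl
    · rfl
  · intro l
    have hst := pairPerm_mem_iff hε l σ
    have he0 : (1 : Equiv.Perm (Fin (n + 2))) 0 = 0 := rfl
    have h0 : (0 : Fin (n + 2)) ∈
        ({(1 : Equiv.Perm (Fin (n + 2))) 0, l.succ.succ} : Finset (Fin (n + 2))) := by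
      rw [he0]; exact Finset.mem_insert_self _ _
    have h1 : (1 : Fin (n + 2)) ∉
        ({(1 : Equiv.Perm (Fin (n + 2))) 0, l.succ.succ} : Finset (Fin (n + 2))) := by
      rw [he0]; simp [(succ_succ_ne_one l).symm]
    simp only [hF]
    rw [if_pos (glues_pairPerm hε l σ), dif_pos ⟨hst, fun a => by
      rw [Finset.mem_compl, Finset.mem_compl, hst], h0, h1⟩]
    rw [Finset.sum_eq_single (0 : ℕ), Nat.sub_zero, quadraticTerm_restrict hε l σ rfl _ hyq,
      restrict_complement hT hε l σ (fun a => Finset.mem_compl) _ b (homBasis_mem ℬ j) hx hyq rfl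
        rfl hyx hqp]
    · have hs := koszulSign_front_zero (k := k) l fun a => q a + 1
      rw [show (1 : Equiv.Perm (Fin (n + 2))) 0 = 0 from rfl, hs]
      simp only [hqp, hyx]
      rw [show y 0 = homBasis ℬ i from rfl, show q 1 = j.1 from rfl,
        hm.form_diff (homBasis_mem ℬ i)]
      -- If the parities do not match, the form vanishes. If they do, all signs reduce to that of
      -- applying an odd operator at place `l`.
      by_cases hp : i.1 = p l
      · have hj : j.1 + 1 = p l := by
          have : ∀ a b : ZMod 2, a ≠ b → b + 1 = a := by decide
          rw [← hp, this _ _ hij']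
        rw [hj, hp]
        set a := ∑ m with m < l, (p m + 1)
        have h1 : sgn k ((p l + 1) * (p l + a)) * sgn k (p l * a) * sgn k (p l + 1) * -sgn k (p l) =
            sgn k a := by
          have : ∀ p a : ZMod 2, (p + 1) * (p + a) + p * a + (p + 1) + (p + 1) = a := by decide
          rw [← sgn_add_one, ← sgn_add, ← sgn_add, ← sgn_add, this]
        rw [← h1]
        ring
      · rw [form_eq_zero R (homBasis_mem ℬ i) (R.diff_mem (hx l))]
        · ring
        · have : ∀ a b : ZMod 2, a ≠ b → a = b + 1 := by decide
          exact this _ _ hp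
    · intro c _ hc
      rw [quadraticTerm_eq_zero R fun hh => hc hh.2.1, zero_apply, zero_mul]
    · intro h0
      exact absurd (Finset.mem_range.2 (Nat.succ_pos b)) h0

/-- The mirror image, with letter `1` in the quadratic factor. Moving the pair behind all letters of
`T` produces a sign that the evenness of `T` converts into the one of the other bracket. -/
theorem bvBracket_quadraticTerm_right [CharZero k] (hm : IsTreeModel R h incl) {T : Series k B}
    (hT : IsSymmetric ℬ T) (hT' : IsEven ℬ T) (σ : Equiv.Perm (Fin n)) (b : ℕ) {p : Fin n → ZMod 2}
    {x : Fin n → B} (hx : ∀ l, x l ∈ ℬ (p l)) :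
    bvBracket ℬ R.form T (quadraticTerm R) n σ b p x =
      ∑ l, sgn k (∑ m with m < l, (p m + 1)) *
        T n σ b (Function.update x l (R.diff (x l))) := by
  classical
  have hε : (Equiv.swap 0 1 : Equiv.Perm (Fin (n + 2))) = 1 ∨
    (Equiv.swap 0 1 : Equiv.Perm (Fin (n + 2))) = Equiv.swap 0 1 := Or.inr rfl
  have hε0 : (Equiv.swap 0 1 : Equiv.Perm (Fin (n + 2))) 0 = 1 := Equiv.swap_apply_left _ _
  have hε1 : (Equiv.swap 0 1 : Equiv.Perm (Fin (n + 2))) 1 = 0 := Equiv.swap_apply_right _ _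
  simp only [← sum_inverseTensor_update (R := R) (T := T) σ b x _ (R.diff _), Finset.mul_sum]
  rw [Finset.sum_comm]
  unfold bvBracket
  -- The roles of `i` and `j` are exchanged, since the quadratic factor now receives the second
  -- contracted letter; the inverse tensor is symmetric.
  rw [Finset.sum_comm]
  refine Finset.sum_congr rfl fun j _ => ?_
  rw [Finset.sum_comm]
  refine Finset.sum_congr rfl fun i _ => ?_
  rw [inverseTensor_symm R.form_odd i j]
  by_cases hij : inverseTensor ℬ R.form j i = 0
  · simp [hij]
  have hij' : j.1 ≠ i.1 := fun he => hij (inverseTensor_parity R.form_odd he)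
  simp only [mul_left_comm _ (inverseTensor ℬ R.form j i)]
  rw [← Finset.mul_sum]
  congr 1
  set y : Fin (n + 2) → B := Fin.cons (homBasis ℬ i) (Fin.cons (homBasis ℬ j) x) with hy
  set q : Fin (n + 2) → ZMod 2 := Fin.cons i.1 (Fin.cons j.1 p) with hq
  have hyq : ∀ a, y a ∈ ℬ (q a) := cons_cons_parity hx
  have hyx : ∀ m : Fin n, y m.succ.succ = x m := fun m => rfl
  have hqp : ∀ m : Fin n, q m.succ.succ = p m := fun m => rfl
  have hsign : (Fin.cons (i.1 + 1) (Fin.cons (j.1 + 1) fun l => p l + 1) : Fin (n + 2) → ZMod 2) =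
      fun a => q a + 1 := by
    funext a
    refine Fin.cases rfl (fun a => Fin.cases rfl (fun a => rfl) a) a
  simp only [hsign]
  set F : Equiv.Perm (Fin (n + 2)) × Finset (Fin (n + 2)) → k := fun z =>
    if Glues z.1 σ then
      if hI : (∀ a, z.1 a ∈ z.2 ↔ a ∈ z.2) ∧ (∀ a, z.1 a ∈ z.2ᶜ ↔ a ∈ z.2ᶜ) ∧ 0 ∈ z.2 ∧ 1 ∉ z.2 then
        koszulSign k (fun a : Fin (n + 2) => (a : ℕ))
          (fun a => if a ∈ z.2 then (a : ℕ) else a + (n + 2)) (fun a => q a + 1) *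
        ∑ c ∈ Finset.range (b + 1),
          T _ (restrictPerm z.1 z.2 hI.1) c (restrictWord y z.2) *
          quadraticTerm R _ (restrictPerm z.1 z.2ᶜ hI.2.1) (b - c) (restrictWord y z.2ᶜ)
      else 0
    else 0 with hF
  have hsum : (∑ σ' : Equiv.Perm (Fin (n + 2)), if Glues σ' σ then
      ∑ I : Finset (Fin (n + 2)),
        if hI : (∀ a, σ' a ∈ I ↔ a ∈ I) ∧ (∀ a, σ' a ∈ Iᶜ ↔ a ∈ Iᶜ) ∧ 0 ∈ I ∧ 1 ∉ I then
          koszulSign k (fun a : Fin (n + 2) => (a : ℕ))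
            (fun a => if a ∈ I then (a : ℕ) else a + (n + 2)) (fun a => q a + 1) *
          ∑ c ∈ Finset.range (b + 1),
            T _ (restrictPerm σ' I hI.1) c (restrictWord y I) *
            quadraticTerm R _ (restrictPerm σ' Iᶜ hI.2.1) (b - c) (restrictWord y Iᶜ)
        else 0
      else 0) = ∑ z, F z := by
    rw [Fintype.sum_prod_type]
    refine Finset.sum_congr rfl fun σ' _ => ?_
    simp only [hF]
    split_ifs
    · rfl
    · rw [Finset.sum_const_zero]
  rw [hsum]
  symm
  refine Fintype.sum_of_injective (fun l : Fin n => (pairPerm (Equiv.swap 0 1) l σ,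
    ({(Equiv.swap 0 1 : Equiv.Perm (Fin (n + 2))) 0, l.succ.succ} : Finset (Fin (n + 2)))ᶜ))
    (fun l m hlm => pair_injective hε (compl_injective (Prod.ext_iff.1 hlm).2)) _ _ ?_ ?_
  · rintro ⟨σ', I⟩ hz
    simp only [hF]
    split_ifs with hg hI
    · rw [Finset.sum_eq_zero, mul_zero]
      intro c _
      rw [quadraticTerm_eq_zero R (n := Iᶜ.card), zero_apply, mul_zero]
      rintro ⟨h2, -, hne⟩
      obtain ⟨l, hl⟩ := exists_eq_pairPerm hε hg hI.2.1
        (by rw [hε0, Finset.mem_compl]; exact hI.2.2.2)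
        (by rw [hε1, Finset.mem_compl]; exact fun h => h hI.2.2.1) h2 hne
      refine hz ⟨l, Prod.ext (Prod.ext_iff.1 hl).1 ?_⟩
      exact (congrArg _ (Prod.ext_iff.1 hl).2).trans (compl_compl I)
    · rfl
    · rfl
  · intro l
    have hst := pairPerm_mem_iff hε l σ
    simp only [hF]
    rw [if_pos (glues_pairPerm hε l σ), dif_pos ⟨fun a => by
      rw [Finset.mem_compl, Finset.mem_compl, hst], fun a => by
      rw [compl_compl, hst], by simp [hε0, (Fin.succ_ne_zero _).symm],
      by simp [hε0]⟩]
    rw [Finset.sum_eq_single (b : ℕ), Nat.sub_self, quadraticTerm_restrict hε l σ (compl_compl _) _ hyq,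
      restrict_complement hT hε l σ (fun a => Finset.mem_compl) _ b (homBasis_mem ℬ i) hx hyq
        (by rw [hε1]; rfl) (by rw [hε1]; rfl) hyx hqp]
    · have hs := koszulSign_front_one (k := k) l fun a => q a + 1
      rw [hε0, hs]
      simp only [hqp, hyx]
      rw [show y 1 = homBasis ℬ j from rfl, show q 1 = j.1 from rfl,
        hm.form_diff (homBasis_mem ℬ j)]
      by_cases hp : j.1 = p l
      · have hi : i.1 + 1 = p l := by
          have : ∀ a b : ZMod 2, a ≠ b → b + 1 = a := by decide
          rw [← hp, this _ _ hij']
        rw [hi, hp]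
        by_cases hTz : T n σ b (Function.update x l (homBasis ℬ i)) = 0
        · rw [hTz]; ring
        -- A nonzero value of `T` forces even total parity, which relates the parities before and
        -- after `l`.
        have hpar : ∑ m, (Function.update p l i.1 m + 1) = 0 := by
          by_contra hne
          refine hTz (hT' n σ b (Function.update p l i.1) _ (fun m => ?_) hne)
          by_cases hml : m = l
          · subst hml; simpa using homBasis_mem ℬ i
          · simpa [hml] using hx m
        rw [← Finset.sum_filter_add_sum_filter_not _ (fun m => m ≠ l)] at hpar
        have hP1 : ∑ m with m ≠ l, (Function.update p l i.1 m + 1) = ∑ m with m ≠ l, (p m + 1) :=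
          Finset.sum_congr rfl fun m hml => by
            rw [Function.update_of_ne (Finset.mem_filter.1 hml).2]
        have hP2 : ∑ m with ¬ m ≠ l, (Function.update p l i.1 m + 1) = i.1 + 1 := by
          simp [Finset.sum_filter]
        rw [hP1, hP2, hi] at hpar
        have hsplit : ∑ m with m ≠ l, (p m + 1) =
            ∑ m with m < l, (p m + 1) + ∑ m with l < m, (p m + 1) := by
          rw [← Finset.sum_union]
          · refine Finset.sum_congr (Finset.ext fun m => ?_) fun _ _ => rfl
            simp [lt_or_lt_iff_ne]
          · rw [Finset.disjoint_filter]
            exact fun m _ h1 h2 => absurd h2 h1.not_gt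
        rw [hsplit] at hpar ⊢
        set a := ∑ m with m < l, (p m + 1)
        set c := ∑ m with l < m, (p m + 1)
        have h1 : sgn k ((p l + 1) * (a + c)) * sgn k ((p l + 1) * c) * sgn k (p l * a) *
            sgn k (p l + 1) * -sgn k (p l) = sgn k a := by
          have : ∀ p a c : ZMod 2, a + c + p = 0 →
              (p + 1) * (a + c) + (p + 1) * c + p * a + (p + 1) + (p + 1) = a := by decide
          rw [← sgn_add_one, ← sgn_add, ← sgn_add, ← sgn_add, ← sgn_add, this _ _ _ hpar]
        rw [← h1]
        ring
      · rw [form_eq_zero R (homBasis_mem ℬ j) (R.diff_mem (hx l))]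
        · ring
        · have : ∀ a b : ZMod 2, a ≠ b → a = b + 1 := by decide
          exact this _ _ hp
    · intro c hc hcb
      have h1 := Finset.mem_range.1 hc
      rw [quadraticTerm_eq_zero R fun hh => hcb (by have := hh.2.1; omega),
        zero_apply, mul_zero]
    · intro h0
      exact absurd (Finset.mem_range.2 (Nat.lt_succ_self b)) h0

theorem bvBracket_quadraticTerm_self [CharZero k] (hm : IsTreeModel R h incl)
    (σ : Equiv.Perm (Fin n)) (b : ℕ) {p : Fin n → ZMod 2} {x : Fin n → B}
    (hx : ∀ l, x l ∈ ℬ (p l)) :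
    bvBracket ℬ R.form (quadraticTerm R) (quadraticTerm R) n σ b p x = 0 := by
  rw [bvBracket_quadraticTerm_left hm (quadraticTerm_symmetric R) σ b hx]
  refine Finset.sum_eq_zero fun l _ => ?_
  -- Only two-letter words can contribute, and there the differential is applied twice to one
  -- letter, directly or after moving it across the form.
  by_cases hc : n = 2 ∧ b = 0 ∧ ∀ a, σ a ≠ a
  · obtain ⟨rfl, rfl, hσ⟩ := hc
    obtain rfl := eq_finRotate_two hσ
    have hl : ∀ l : Fin 2, l = 0 ∨ l = 1 := by decide
    rcases hl l with rfl | rfl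
    · rw [quadraticTerm_two, Function.update_self, hm.diff_diff, map_zero, LinearMap.zero_apply,
        neg_zero, mul_zero]
    · rw [quadraticTerm_two_of_mem R (R.diff_mem (hx 1)) (Function.update_of_ne (by simp) _ _)
        (Function.update_self _ _ _), hm.form_diff (hx 0), hm.diff_diff, map_zero]
      simp
  · rw [quadraticTerm_eq_zero R hc, zero_apply, mul_zero]

end Bracket

open RibbonGraph

/-! ### Additivity of the operators. -/

section Additivity

variable {k B : Type*} [Field k] [AddCommGroup B] [Module k B]
  {ℬ : ZMod 2 → Submodule k B} [DirectSum.Decomposition ℬ] [FiniteDimensional k B]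
  {β : LinearMap.BilinForm k B} {n : ℕ}

theorem bvBracket_add_left (T₁ T₂ T : Series k B) (σ : Equiv.Perm (Fin n)) (b : ℕ)
    (p : Fin n → ZMod 2) (x : Fin n → B) :
    bvBracket ℬ β (T₁ + T₂) T n σ b p x =
      bvBracket ℬ β T₁ T n σ b p x + bvBracket ℬ β T₂ T n σ b p x := by
  unfold bvBracket
  simp only [← Finset.sum_add_distrib, ← mul_add]
  refine Finset.sum_congr rfl fun i _ => Finset.sum_congr rfl fun j _ => ?_
  congr 1
  refine Finset.sum_congr rfl fun σ' _ => ?_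
  split_ifs
  · rw [← Finset.sum_add_distrib]
    refine Finset.sum_congr rfl fun I _ => ?_
    split_ifs
    · rw [← mul_add, ← Finset.sum_add_distrib]
      congr 1
      refine Finset.sum_congr rfl fun c _ => ?_
      rw [← add_mul]
      rfl
    · rw [add_zero]
  · rw [add_zero]

theorem bvBracket_add_right (T T₁ T₂ : Series k B) (σ : Equiv.Perm (Fin n)) (b : ℕ)
    (p : Fin n → ZMod 2) (x : Fin n → B) :
    bvBracket ℬ β T (T₁ + T₂) n σ b p x =
      bvBracket ℬ β T T₁ n σ b p x + bvBracket ℬ β T T₂ n σ b p x := by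
  unfold bvBracket
  simp only [← Finset.sum_add_distrib, ← mul_add]
  refine Finset.sum_congr rfl fun i _ => Finset.sum_congr rfl fun j _ => ?_
  congr 1
  refine Finset.sum_congr rfl fun σ' _ => ?_
  split_ifs
  · rw [← Finset.sum_add_distrib]
    refine Finset.sum_congr rfl fun I _ => ?_
    split_ifs
    · rw [← mul_add, ← Finset.sum_add_distrib]
      congr 1
      refine Finset.sum_congr rfl fun c _ => ?_
      rw [← mul_add]
      rfl
    · rw [add_zero]
  · rw [add_zero]

theorem bvLaplacian_add (T₁ T₂ : Series k B) (σ : Equiv.Perm (Fin n)) (b : ℕ) :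
    bvLaplacian ℬ β (T₁ + T₂) n σ b = bvLaplacian ℬ β T₁ n σ b + bvLaplacian ℬ β T₂ n σ b := by
  have hc : ∀ (S S' : MultilinearMap k (fun _ : Fin (n + 2) => B) k) (x y : B),
      ((S + S').curryLeft x).curryLeft y =
        (S.curryLeft x).curryLeft y + (S'.curryLeft x).curryLeft y :=
    fun S S' x y => MultilinearMap.ext fun z => add_apply S S' _
  have ha : ∀ σ', (T₁ + T₂) (n + 2) σ' b = T₁ (n + 2) σ' b + T₂ (n + 2) σ' b := fun _ => rfl
  unfold bvLaplacian
  simp only [ha, hc, ← Finset.sum_add_distrib, ← smul_add]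
  refine congrArg _ (Finset.sum_congr rfl fun i _ => Finset.sum_congr rfl fun j _ =>
    congrArg _ (Finset.sum_congr rfl fun σ' _ => ?_))
  split_ifs
  · rfl
  · rw [add_zero]

end Additivity

/-! ### The master equation and the component `S_{1,0}`. -/

section Solution

variable {k A B : Type*} [Field k] [CharZero k] [NonUnitalRing A] [Module k A]
  [IsScalarTower k A A] [SMulCommClass k A A]
  [AddCommGroup B] [Module k B]
  {𝒜 : ZMod 2 → Submodule k A} {ℬ : ZMod 2 → Submodule k B} {M : CyclicDGAlgebra 𝒜}
  [DirectSum.Decomposition 𝒜] [FiniteDimensional k A]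
  [DirectSum.Decomposition ℬ] [FiniteDimensional k B]
  {h : Homotopy M} {R : CyclicAInfinity ℬ} {incl : B →ₗ[k] A} {n : ℕ}

theorem ribbonAction_eq (R : CyclicAInfinity ℬ) (h : Homotopy M) (incl : B →ₗ[k] A) :
    ribbonAction R h incl = quadraticTerm R + ribbonSeries h incl := rfl

theorem ribbonSeries_symmetric (hm : IsTreeModel R h incl) : IsSymmetric ℬ (ribbonSeries h incl) :=
  fun _ σ τ b _ _ hx => ribbonSum_symmetric h σ τ b fun l => hm.incl_mem _ _ (hx l)

theorem ribbonSeries_even (hm : IsTreeModel R h incl) : IsEven ℬ (ribbonSeries h incl) :=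
  fun _ σ b _ _ hx h0 => ribbonSum_even h σ b (fun l => hm.incl_mem _ _ (hx l)) h0

theorem ribbonSeries_genus (h : Homotopy M) (incl : B →ₗ[k] A) :
    HasGenusExpansion (ribbonSeries h incl) := by
  refine fun n σ b h0 => ribbonSum_genus h σ b fun hz => h0 ?_
  rw [ribbonSeries, hz]
  rfl

theorem IsTreeModel.isBVSolution (hm : IsTreeModel R h incl) :
    IsBVSolution ℬ R.form (ribbonAction R h incl) where
  symmetric n σ τ b p x hx := by
    rw [ribbonAction_eq]
    change quadraticTerm R n _ b _ + ribbonSeries h incl n _ b _ =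
      _ * (quadraticTerm R n σ b x + ribbonSeries h incl n σ b x)
    rw [quadraticTerm_symmetric R n σ τ b p x hx, ribbonSeries_symmetric hm n σ τ b p x hx, mul_add]
  even n σ b p x hx h0 := by
    rw [ribbonAction_eq]
    change quadraticTerm R n _ b _ + ribbonSeries h incl n _ b _ = 0
    rw [quadraticTerm_even R n σ b p x hx h0, ribbonSeries_even hm n σ b p x hx h0, add_zero]
  genus n σ b h0 := by
    by_cases h1 : quadraticTerm R n σ b = 0
    · refine ribbonSeries_genus h incl n σ b fun h2 => h0 ?_
      change quadraticTerm R n σ b + ribbonSeries h incl n σ b = 0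
      rw [h1, h2, add_zero]
    · exact quadraticTerm_genus R n σ b h1
  equation n σ b p x hx := by
    have h1 := ribbonSeries_equation h hm σ b hx
    have h2 : hbarMul (bvLaplacian ℬ R.form (quadraticTerm R + ribbonSeries h incl)) n σ b =
        hbarMul (bvLaplacian ℬ R.form (ribbonSeries h incl)) n σ b := by
      cases b with
      | zero => rfl
      | succ b =>
        change bvLaplacian ℬ R.form _ n σ b = bvLaplacian ℬ R.form _ n σ b
        rw [bvLaplacian_add, bvLaplacian_quadraticTerm, zero_add]
    simp only [R.op_one_eq] at h1
    rw [ribbonAction_eq, h2, bvBracket_add_left, bvBracket_add_right, bvBracket_add_right,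
      bvBracket_quadraticTerm_self hm σ b hx,
      bvBracket_quadraticTerm_left hm (ribbonSeries_symmetric hm) σ b hx,
      bvBracket_quadraticTerm_right hm (ribbonSeries_symmetric hm) (ribbonSeries_even hm) σ b hx]
    -- The two cross brackets are equal, so half of them together is one copy of the differential of
    -- the ribbon sum, as in half of `ribbonSeries_equation`.
    linear_combination (1 / 2 : k) * h1

/-- For a connected graph, `1 - χ = 0` is the definition of a tree. -/
theorem ribbonSum_zero_eq_treeSum (h : Homotopy M) (σ : Equiv.Perm (Fin n)) :
    ribbonSum h n σ 0 = treeSum h n σ := by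
  unfold ribbonSum treeSum
  refine finsum_congr fun c => finsum_congr_Prop (propext ?_) fun _ => rfl
  unfold IsTree chi
  constructor
  · rintro ⟨h1, h2, h3⟩
    exact ⟨⟨h1, by push_cast at h3; omega⟩, h2⟩
  · rintro ⟨⟨h1, h3⟩, h2⟩
    exact ⟨h1, h2, by push_cast; omega⟩

/-- When `1 - χ = 0`, counting flags gives `n = E + 3`, so with at most two legs there is nothing to
sum. -/
theorem ribbonSum_zero_eq_zero (h : Homotopy M) (hn : n ≤ 2) (σ : Equiv.Perm (Fin n)) :
    ribbonSum h n σ 0 = 0 := by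
  rw [ribbonSum_eq]
  refine Finset.sum_eq_zero fun c hc => ?_
  have h1 := (mem_classes.1 hc).2
  have h2 := c.out.three_mul_numVert
  unfold chi at h1
  push_cast at h1
  omega

theorem IsTreeModel.extends (hm : IsTreeModel R h incl) : Extends (ribbonAction R h incl) R := by
  intro n p x hx
  change quadraticTerm R (n + 1) _ 0 x + ribbonSum h (n + 1) _ 0 (fun i => incl (x i)) = _
  by_cases hn : 2 ≤ n
  · rw [quadraticTerm_eq_zero R (by omega), ribbonSum_zero_eq_treeSum,
      hm.op_eq_treeSum n hn p x hx, zero_apply, zero_add]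
  -- There remain `b_0 = 0`, where the quadratic term vanishes too, and `b_1`, which the quadratic
  -- term represents.
  · rw [ribbonSum_zero_eq_zero h (by omega), zero_apply, add_zero]
    have hn' : n = 0 ∨ n = 1 := by omega
    rcases hn' with rfl | rfl
    · rw [quadraticTerm_eq_zero R (by omega), cyclicTensor, R.op_zero]
      simp
    · exact quadraticTerm_eq_cyclicTensor R hx

end Solution

end NCBV

end

theorem mainTheorem7 {k A B : Type*} [Field k] [CharZero k]
    [NonUnitalRing A] [Module k A] [IsScalarTower k A A] [SMulCommClass k A A]
    [FiniteDimensional k A] [AddCommGroup B] [Module k B] [FiniteDimensional k B]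
    (𝒜 : ZMod 2 → Submodule k A) [DirectSum.Decomposition 𝒜]
    (ℬ : ZMod 2 → Submodule k B) [DirectSum.Decomposition ℬ]
    (R : NCBV.CyclicAInfinity ℬ) (M : NCBV.CyclicDGAlgebra 𝒜) (h : NCBV.Homotopy M)
    (incl : B →ₗ[k] A) (hmodel : NCBV.IsTreeModel R h incl) :
    NCBV.IsBVSolution ℬ R.form (NCBV.ribbonAction R h incl) ∧
      NCBV.Extends (NCBV.ribbonAction R h incl) R := by
  exact ⟨hmodel.isBVSolution, hmodel.extends⟩
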